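/- **Dendritic face complexes.** A *many-to-one poset* $C$ is a finite set of cells with a dimension $\dim:C\to\mathbb Z_{\ge -1}$ and, for each cell $x$, sets $\delta(x)$ (sources) and $\gamma(x)$ (targets) of cells of dimension $\dim x-1$. Write $y\prec^-x$ if $y\in\delta(x)\setminus\gamma(x)$, $y\prec^+x$ if $y\in\gamma(x)\setminus\delta(x)$, $y\prec^{\o}x$ ("$x$ is a loop on $y$") if $y\in\delta(x)\cap\gamma(x)$, and $y\prec x$ if $y\in\delta(x)\cup\gamma(x)$; $\le$ is the order generated by $\prec$; $C_k$ is the set of cells of dimension $k$; $\Lambda$ is the set of cells $x$ for which no $w$ satisfies $x\prec^+w$, and $\Lambda_k=\Lambda\cap C_k$; $N=\{x:\delta(x)=\emptyset\}$. It is required that $\gamma(x)$ is a singleton if $\dim x\ge 0$ (its element is also written $\gamma(x)$); that $\delta(x)=\gamma(x)$ if $\delta(x)\cap\gamma(x)\ne\emptyset$; that there is exactly one cell $s$ of dimension $-1$, and $\gamma(x)\setminus\delta(x)=\{s\}$ for $x\in C_0$; and, for $x\in\Lambda$ and each cell $z$, a strict total order (*local order*) on $\{y: z\prec^{\o}y\prec^-x\}$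 is given. A *morphism* is a map that preserves dimension, maps $\delta(x)$ bijectively onto $\delta(f(x))$ and $\gamma(x)$ onto $\gamma(f(x))$ for $\dim x\ge0$, and preserves the local orders at those $x\in\Lambda$ with $f(x)\in\Lambda$. A *dendritic face complex* (DFC) is a many-to-one poset such that: there is a greatest element $\omega$, of dimension $n\ge0$ (the dimension of $C$); for every loop $y$ there is $x$ with $y\prec^+x$; (oriented thinness) for $z\prec^\beta y\prec^\alpha x$ with $\alpha,\beta\in\{+,-\}$ there is exactly one $y'\ne y$ with $z\prec^{\beta'}y'\prec^{\alpha'}x$ for some $\alpha',\beta'\in\{+,-\}$, and it satisfies $\alpha\beta=-\alpha'\beta'$; moreover for $z\prec^{\o}y\prec^-x$ there is $y'\neq y$ with $z\prec^{\beta}y'\prec^{\alpha}x$ and $(\alpha,\beta)\ne(-,\o)$; (acyclicity) for $\dim x\ge1$ the relation on $\{y:y\prec^-x\}$ given by $\exists z,\ z\prec^+y$ and $z\prec^-y'$, has no cycle. $\mathbf{DFC}^{\mathsf{core}}$ is the groupoid of DFCs and isomorphisms (bijective morphisms whose inverse is a morphism). **Opetopes.** A *rooted tree* $T$ has finite sets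 $T^\bullet$ of nodes and $T^{E}$ of edges; each node has a unique target edge; each edge is the target of at most one node (its source node) and is a source of at most one node (its target node); there is a root edge, without target node, to which a descending path (edge, its target node, its target edge, …) leads from every edge. Leaves are edges without source node; nulldots are nodes without source edge. A *subdivision* of $T$ is, for each edge $b$, a finite totally ordered set $W(b)$ of white dots put on $b$ in this order from the root side upwards (the sets $W(b)$ being pairwise disjoint); the nodes of $T$ are called black dots. An *exact constellation* $T\to U$ is a subdivision of $T$ such that the black dots are the leaves of $U$, the white dots are the nulldots of $U$, and (kernel rule) for each node $x$ of $U$ the dots from which a descending path in $U$ leads to $x$ form a connected part of the subdivided tree. For $n\in\mathbb N$ an *$n$-opetope* is a sequence of exact constellations $T_0\to\cdots\to T_n$ with $T_0$ and (if $n\ge1$) $T_1$ having one node and one leaf, and (if $n\ge2$) $T_2$ linear (each node has exactly one source). $\mathbf{KJBM}$ is the groupoid of opetopes; an isomorphism between two opetopes of the same dimension is a sequence of isomorphisms of subdivided trees that are compatible with the identifications of black dots of $T_k$ with leaves of $T_{k+1}$ and of white dots of $T_k$ with nulldots of $T_{k+1}$. **The functor $Z$.** Let $C$ be a DFC of dimension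 $n$. $Z(C)=(T_0\to\cdots\to T_n)$, where for $k\ge2$ the nodes of $T_k$ are $\Lambda_{k-1}$, its edges are $C_{k-2}$, $y$ is the target (a source) of $x$ when $y\prec^+x$ ($y\prec^-x$), and the root is the element of $C_{k-2}$ among $\omega,\gamma(\omega),\gamma(\gamma(\omega)),\dots$; $T_1$ has the node $\Lambda_0$, the root $s$ and one new leaf, which is also the only node of $T_0$; $T_0$ has a new root and a new leaf. For $2\le k<n$ the white dots on an edge $y$ of $T_k$ are the $w\in\Lambda_k\cap N$ with $\gamma(\gamma(w))=y$, and $w$ lies below $w'$ iff $\gamma(w)\blacktriangleleft\gamma(w')$, where the relation $\blacktriangleleft$ between loops on a cell $c$ is defined as follows. For loops $b,b'$ on $c$, $b'\subset b$ means $b'\prec^-a$ and $b\prec^+a$ for some $a\in\Lambda$; $\subseteq$ is the reflexive transitive closure of $\subset$. For $a,a'\in\Lambda$ say that $a$ immediately precedes $a'$ if some $b$ satisfies either $c\prec^-b$, $b\prec^+a$, $b\prec^-a'$, or $c\prec^+b$, $b\prec^-a$, $b\prec^+a'$; "precedes" is the transitive closure. Then $b_1\blacktriangleleft^1b_1'$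 iff there are loops $b\supseteq b_1$, $b'\supseteq b_1'$ on $c$ and $a,a'$ with $b\prec^-a$, $b'\prec^-a'$ and $a$ preceding $a'$; $b_1\blacktriangleleft^2b_1'$ iff $b_1\ne b_1'$, neither $b_1\blacktriangleleft^1b_1'$ nor $b_1'\blacktriangleleft^1b_1$, and there are $a\in\Lambda$ and loops $b\supseteq b_1$, $b'\supseteq b_1'$ on $c$, $b\ne b'$, $b,b'\prec^-a$, with $b$ below $b'$ in the local order; $\blacktriangleleft$ is the union of $\blacktriangleleft^1$ and $\blacktriangleleft^2$. On isomorphisms, $Z(f)$ acts on nodes and edges as $f$ (and trivially on the new elements). **The functor $P$.** Let $Y=(S_0\to\cdots\to S_n)$ be an opetope. Extend it by the tree $S_{n+1}$ with a single node $\top$, whose source edges are the nodes of $S_n$, and a new root edge, and by the tree $S_{n+2}$ with the single edge $\top$ and no node; the subdivisions of $S_n$ and $S_{n+1}$ are empty, except that if $S_n$ has no node, then $\top$ is a white dot on the only edge of $S_n$. $P(Y)$ has $P(Y)_{k}$ equal to the set of edges of $S_{k+2}$ for $0\le k\le n$, and $P(Y)_{-1}=\{\text{root edge of }S_1\}$.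 For $x\in P(Y)_k$, $k\ge 0$, let $S_{k+1,x}$ be the subtree of $S_{k+1}$ spanned by the dots from which a descending path in $S_{k+2}$ leads to the edge $x$ (its edges are those adjacent to one of these black dots or carrying one of these white dots). Then $\gamma(x)$ is the root edge of $S_{k+1,x}$, and $\delta(x)$ is the set of its leaves if $k\ge1$, and $\emptyset$ if $k=0$. If $z\prec^{\o}y\prec^-x\in\Lambda$ and $z\prec^{\o}y'\prec^-x$, then $y$ is below $y'$ in the local order iff every white dot of $S_{\dim z+2,y}$ lies below every white dot of $S_{\dim z+2,y'}$ on the edge $z$. On isomorphisms, $P(f)$ is the action of $f$ on edges, extended by $\top\mapsto\top$ and the new root to the new root. **Theorem.** $Z(C)$ is an opetope for every DFC $C$, $P(Y)$ is a DFC for every opetope $Y$, and $Z:\mathbf{DFC}^{\mathsf{core}}\to\mathbf{KJBM}$ and $P:\mathbf{KJBM}\to\mathbf{DFC}^{\mathsf{core}}$ form an equivalence of categories. More precisely, there are natural isomorphisms $\theta_C:C\cong P(Z(C))$ and $\tau_Y:Y\cong Z(P(Y))$, where $\theta_C$ sends the greatest element $\omega$ to $\top$, $\gamma(\omega)$ to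 the root edge of $S_{n+1}$, and every other cell $x$ to the edge $x$; and $\tau_Y$ is, in each degree $k\ge2$, the identity on the names of nodes and edges: it sends a node $a$ of $S_k$ to the cell of dimension $k-1$ given by the edge $a$ of $S_{k+1}$, and an edge $b$ of $S_k$ to the cell of dimension $k-2$ given by $b$ (in degrees $0$ and $1$ it is the only possible isomorphism). -/

import Mathlib

open CategoryTheory

universe u

/-! ## Many-to-one posets and dendritic face complexes -/

/-- The data of a many-to-one poset: cells, gradation, sources `δ`, targets `γ`, and the
local orders, where `localLT x z` is an order on the loops on `z` that are sources of `x`. -/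
structure PreMOP where
  Cell : Type u
  dim : Cell → ℤ
  δ : Cell → Set Cell
  γ : Cell → Set Cell
  localLT : Cell → Cell → Cell → Cell → Prop

namespace PreMOP

/-- `y ≺⁻ x`: `y` is a source of `x`, but not its target. -/
def Neg (C : PreMOP.{u}) (y x : C.Cell) : Prop := y ∈ C.δ x \ C.γ x

/-- `y ≺⁺ x`: `y` is the target of `x`, but not a source. -/
def Pos (C : PreMOP.{u}) (y x : C.Cell) : Prop := y ∈ C.γ x \ C.δ x

/-- `y ≺° x`: `y` is a source and the target of `x`, that is, `x` is a loop on `y`. -/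
def Loop (C : PreMOP.{u}) (y x : C.Cell) : Prop := y ∈ C.δ x ∩ C.γ x

/-- `y ≺ x`. -/
def Facet (C : PreMOP.{u}) (y x : C.Cell) : Prop := y ∈ C.δ x ∪ C.γ x

/-- `y ≺^α x`, where the signs `+`, `-`, `°` are `1`, `-1`, `0`. -/
def Rel (C : PreMOP.{u}) : SignType → C.Cell → C.Cell → Prop
  | .pos => C.Pos
  | .neg => C.Neg
  | .zero => C.Loop

/-- The partial order generated by `≺`. -/
def Le (C : PreMOP.{u}) : C.Cell → C.Cell → Prop := Relation.ReflTransGen C.Facet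

/-- `ω` is the greatest element. -/
def IsTop (C : PreMOP.{u}) (ω : C.Cell) : Prop := ∀ x, C.Le x ω

/-- `Λ`, the cells that are not the target of a non-loop. -/
def Lam (C : PreMOP.{u}) : Set C.Cell := {x | ¬ ∃ w, C.Pos x w}

/-- `N`, the cells without source. -/
def Null (C : PreMOP.{u}) : Set C.Cell := {x | C.δ x = ∅}

/-- The axioms of a many-to-one poset. -/
structure IsMOP (C : PreMOP.{u}) : Prop where
  finite : Finite C.Cell
  dim_ge : ∀ x, -1 ≤ C.dim x
  dim_facet : ∀ x y, C.Facet y x → C.dim x = C.dim y + 1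
  target : ∀ x, 0 ≤ C.dim x → ∃ y, C.γ x = {y}
  loop : ∀ x, (C.δ x ∩ C.γ x).Nonempty → C.δ x = C.γ x
  bottom : ∃ s, (∀ x, C.dim x = -1 ↔ x = s) ∧ ∀ x, C.dim x = 0 → C.γ x \ C.δ x = {s}
  local_order : ∀ x ∈ C.Lam, ∀ z,
    IsStrictTotalOrder {y // C.Loop z y ∧ C.Neg y x} fun y y' => C.localLT x z y y'

/-- The axioms of a dendritic face complex. In `thin`, a completion of a chain is made of two
relations that are not loops, and it is the unique such completion. -/
structure IsDFC (C : PreMOP.{u}) : Prop extends IsMOP C where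
  greatest : ∃ ω, 0 ≤ C.dim ω ∧ C.IsTop ω
  loops : ∀ z y, C.Loop z y → ∃ x, C.Pos y x
  thin : ∀ (x y z : C.Cell) (α β : SignType), α ≠ 0 → β ≠ 0 → C.Rel β z y → C.Rel α y x →
    ∃ y', y' ≠ y ∧
      (∃ α' β' : SignType, α' ≠ 0 ∧ β' ≠ 0 ∧ C.Rel β' z y' ∧ C.Rel α' y' x ∧
        α * β = -(α' * β')) ∧
      ∀ y'', y'' ≠ y →
        (∃ α' β' : SignType, α' ≠ 0 ∧ β' ≠ 0 ∧ C.Rel β' z y'' ∧ C.Rel α' y'' x) → y'' = y'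
  thin_loop : ∀ x y z, C.Loop z y → C.Neg y x →
    ∃ y', y' ≠ y ∧ ∃ α β : SignType, (α, β) ≠ (-1, 0) ∧ C.Rel β z y' ∧ C.Rel α y' x
  acyclic : ∀ x, 1 ≤ C.dim x → ∀ y,
    ¬ Relation.TransGen
      (fun y y' => C.Neg y x ∧ C.Neg y' x ∧ ∃ z, C.Pos z y ∧ C.Neg z y') y y

/-- Morphisms of many-to-one posets. -/
structure IsMorphism (C D : PreMOP.{u}) (f : C.Cell → D.Cell) : Prop where
  dim : ∀ x, D.dim (f x) = C.dim x
  source : ∀ x, 0 ≤ C.dim x → Set.BijOn f (C.δ x) (D.δ (f x))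
  target : ∀ x, 0 ≤ C.dim x → f '' C.γ x = D.γ (f x)
  local_order : ∀ x ∈ C.Lam, f x ∈ D.Lam → ∀ z y y', C.Loop z y → C.Neg y x →
    C.Loop z y' → C.Neg y' x → C.localLT x z y y' → D.localLT (f x) (f z) (f y) (f y')

end PreMOP

/-- Dendritic face complexes, as the objects of the groupoid `DFC^core`. -/
structure DFCcore where
  toPreMOP : PreMOP.{u}
  isDFC : toPreMOP.IsDFC

/-- An isomorphism of dendritic face complexes: a morphism with an inverse morphism. -/
@[ext]
structure DFCIso (C D : PreMOP.{u}) where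
  toEquiv : C.Cell ≃ D.Cell
  hom : C.IsMorphism D toEquiv
  inv : D.IsMorphism C toEquiv.symm

/-! ## Rooted trees, constellations, opetopes -/

/-- The data of a rooted tree. `out a b` says that `b` is the target edge of the node `a`, and
`inp a b` that the edge `b` is a source of `a`, i.e. that `a` is the target node of `b`.
The root edge is given by the set of which it is the only element. -/
structure PreTree (N E : Type u) where
  nodes : Set N
  edges : Set E
  out : N → E → Prop
  inp : N → E → Prop
  root : Set E

namespace PreTree

variable {N E V : Type u}

/-- One step of a descending path, from an edge to its target node or from a node to its
target edge. -/
inductive Step (T : PreTree N E) : N ⊕ E → N ⊕ E → Prop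
  | edge (a : N) (b : E) (ha : a ∈ T.nodes) (hb : b ∈ T.edges) (h : T.inp a b) :
      Step T (.inr b) (.inl a)
  | node (a : N) (b : E) (ha : a ∈ T.nodes) (hb : b ∈ T.edges) (h : T.out a b) :
      Step T (.inl a) (.inr b)

/-- There is a descending path from the first to the second element. -/
def Desc (T : PreTree N E) : N ⊕ E → N ⊕ E → Prop := Relation.ReflTransGen T.Step

/-- Edges without source node. -/
def leaves (T : PreTree N E) : Set E := {b | b ∈ T.edges ∧ ∀ a, ¬ T.out a b}

/-- Nodes without source edge. -/
def nulldots (T : PreTree N E) : Set N := {a | a ∈ T.nodes ∧ ∀ b, ¬ T.inp a b}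

structure IsRootedTree (T : PreTree N E) : Prop where
  nodes_finite : T.nodes.Finite
  edges_finite : T.edges.Finite
  out_mem : ∀ a b, T.out a b → a ∈ T.nodes ∧ b ∈ T.edges
  inp_mem : ∀ a b, T.inp a b → a ∈ T.nodes ∧ b ∈ T.edges
  target_edge : ∀ a ∈ T.nodes, ∃! b, T.out a b
  source_node : ∀ a a' b, T.out a b → T.out a' b → a = a'
  target_node : ∀ a a' b, T.inp a b → T.inp a' b → a = a'
  root : ∃ r ∈ T.edges, T.root = {r} ∧ (∀ a, ¬ T.inp a r) ∧
    ∀ b ∈ T.edges, T.Desc (.inr b) (.inr r)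

/-- One root, one leaf and one node. -/
def IsElementary (T : PreTree N E) : Prop := (∃ a, T.nodes = {a}) ∧ ∃ l, T.leaves = {l}

/-- Every node has exactly one source. -/
def IsLinear (T : PreTree N E) : Prop := ∀ a ∈ T.nodes, ∃! b, T.inp a b

/-- The subdivided tree: `W b` is the set of white dots on the edge `b`, ordered by `lt b` from
the root side upwards. The nodes are the black dots (`Sum.inl`) and the white dots (`Sum.inr`);
an edge `b` is cut into the segments `(b, none)`, the lowest one, and `(b, some w)`, the one
just above the white dot `w`. -/
def subdivide (T : PreTree N E) (W : E → Set V) (lt : E → V → V → Prop) :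
    PreTree (N ⊕ V) (E × Option V) where
  nodes := {d | (∃ a ∈ T.nodes, d = .inl a) ∨ ∃ b ∈ T.edges, ∃ w ∈ W b, d = .inr w}
  edges := {e | e.1 ∈ T.edges ∧ ∀ w, e.2 = some w → w ∈ W e.1}
  out
    | .inl a, (b, none) => T.out a b ∧ W b = ∅
    | .inl a, (b, some w) => T.out a b ∧ w ∈ W b ∧ ∀ v ∈ W b, ¬ lt b w v
    | .inr w, (b, none) => w ∈ W b ∧ ∀ v ∈ W b, ¬ lt b v w
    | .inr w, (b, some w') => w ∈ W b ∧ w' ∈ W b ∧ lt b w' w ∧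
        ∀ v ∈ W b, ¬ (lt b w' v ∧ lt b v w)
  inp
    | .inl a, (b, s) => T.inp a b ∧ s = none
    | .inr w, (b, s) => w ∈ W b ∧ s = some w
  root := {e | e.1 ∈ T.root ∧ e.2 = none}

/-- The graph of the nodes of a tree: two nodes are adjacent when an edge joins them. -/
def graph (T : PreTree N E) : SimpleGraph N :=
  SimpleGraph.fromRel fun a a' => ∃ e ∈ T.edges, T.inp a e ∧ T.out a' e

variable {A : Type u}

/-- The dots of the subdivided tree `(T, W)` from which a descending path of `U` leads to `x`,
where a black dot of `T` is a leaf of `U` and a white dot is a sourceless node of `U`. -/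
def dotsAbove (T : PreTree A A) (W : A → Set A) (U : PreTree A A) (x : A ⊕ A) : Set (A ⊕ A) :=
  {d | ((∃ a ∈ T.nodes, d = .inl a) ∨ ∃ b ∈ T.edges, ∃ w ∈ W b, d = .inr w) ∧ U.Desc d.swap x}

/-- An exact constellation `T → U`: a subdivision of `T` whose black dots are the leaves of `U`,
whose white dots are the sourceless nodes of `U`, and which satisfies the kernel rule. -/
structure IsExactConstellation (T : PreTree A A) (W : A → Set A) (lt : A → A → A → Prop)
    (U : PreTree A A) : Prop where
  white_edge : ∀ b w, w ∈ W b → b ∈ T.edges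
  white_finite : ∀ b, (W b).Finite
  white_order : ∀ b, IsStrictTotalOrder (W b) fun w w' => lt b w w'
  white_disjoint : ∀ b b' w, w ∈ W b → w ∈ W b' → b = b'
  black : T.nodes = U.leaves
  white : {w | ∃ b, w ∈ W b} = U.nulldots
  kernel : ∀ x ∈ U.nodes,
    ((T.subdivide W lt).graph.induce (T.dotsAbove W U (.inl x))).Connected

/-- The edges of the subtree of `T` spanned by the dots `dotsAbove T W U x`. -/
def nestEdges (T : PreTree A A) (W : A → Set A) (U : PreTree A A) (x : A ⊕ A) : Set A :=
  {b | b ∈ T.edges ∧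
    ((∃ a, .inl a ∈ T.dotsAbove W U x ∧ (T.out a b ∨ T.inp a b)) ∨
      ∃ w ∈ W b, .inr w ∈ T.dotsAbove W U x)}

/-- The root edge of that subtree. -/
def nestRoot (T : PreTree A A) (W : A → Set A) (U : PreTree A A) (x : A ⊕ A) : Set A :=
  {b | b ∈ T.nestEdges W U x ∧ ¬ ∃ a, .inl a ∈ T.dotsAbove W U x ∧ T.inp a b}

/-- The leaves of that subtree. -/
def nestLeaves (T : PreTree A A) (W : A → Set A) (U : PreTree A A) (x : A ⊕ A) : Set A :=
  {b | b ∈ T.nestEdges W U x ∧ ¬ ∃ a, .inl a ∈ T.dotsAbove W U x ∧ T.out a b}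

end PreTree

/-- The data of a zoom complex `T_0 → ⋯ → T_n` whose structural maps are identities: all nodes
and edges are elements of one ambient type `Elem`, and `white k b` is the set of white dots
on the edge `b` of `T_k`. -/
structure PreZoom where
  dim : ℕ
  Elem : Type u
  tree : ℕ → PreTree Elem Elem
  white : ℕ → Elem → Set Elem
  whiteLT : ℕ → Elem → Elem → Elem → Prop

/-- `Y` is an opetope of dimension `Y.dim`; there are no data in degrees above `Y.dim`. -/
structure PreZoom.IsOpetope (Y : PreZoom.{u}) : Prop where
  tree : ∀ k ≤ Y.dim, (Y.tree k).IsRootedTree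
  constellation : ∀ k < Y.dim,
    (Y.tree k).IsExactConstellation (Y.white k) (Y.whiteLT k) (Y.tree (k + 1))
  void : ∀ k, Y.dim < k → (Y.tree k).nodes = ∅ ∧ (Y.tree k).edges = ∅
  zero : (Y.tree 0).IsElementary
  one : 1 ≤ Y.dim → (Y.tree 1).IsElementary
  two : 2 ≤ Y.dim → (Y.tree 2).IsLinear

/-- Isomorphisms of zoom complexes with identities as structural maps: tree isomorphisms in each
degree that preserve the subdivisions. Compatibility with the structural maps says that a node of
`T_k` and the corresponding leaf of `T_{k+1}` have the same image (`black`), and that white dots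
of `T_k` are sent where the corresponding nodes of `T_{k+1}` are sent (`white`, `whiteLT`). -/
@[ext]
structure ZoomIso (Y Y' : PreZoom.{u}) where
  dim_eq : Y.dim = Y'.dim
  node : ∀ k, (Y.tree k).nodes ≃ (Y'.tree k).nodes
  edge : ∀ k, (Y.tree k).edges ≃ (Y'.tree k).edges
  out : ∀ k (a : (Y.tree k).nodes) (b : (Y.tree k).edges), (Y.tree k).out a b ↔
    (Y'.tree k).out (node k a) (edge k b)
  inp : ∀ k (a : (Y.tree k).nodes) (b : (Y.tree k).edges), (Y.tree k).inp a b ↔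
    (Y'.tree k).inp (node k a) (edge k b)
  root : ∀ k b, b.1 ∈ (Y.tree k).root ↔ (edge k b).1 ∈ (Y'.tree k).root
  black : ∀ k (a : (Y.tree k).nodes) (b : (Y.tree (k + 1)).edges),
    a.1 = b.1 ↔ (node k a).1 = (edge (k + 1) b).1
  white : ∀ k (b : (Y.tree k).edges) (w : (Y.tree (k + 1)).nodes),
    w.1 ∈ Y.white k b ↔ (node (k + 1) w).1 ∈ Y'.white k (edge k b)
  whiteLT : ∀ k (b : (Y.tree k).edges) (w w' : (Y.tree (k + 1)).nodes),
    w.1 ∈ Y.white k b → w'.1 ∈ Y.white k b →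
      (Y.whiteLT k b w w' ↔
        Y'.whiteLT k (edge k b) (node (k + 1) w) (node (k + 1) w'))

/-- Opetopes, as the objects of the groupoid `KJBM`. -/
structure KJBM where
  toPreZoom : PreZoom.{u}
  isOpetope : toPreZoom.IsOpetope

/-! ## The two groupoids -/

namespace DFCIso

variable {C D E : PreMOP.{u}}

theorem mem_δ (f : DFCIso C D) (hC : C.IsMOP) (hD : D.IsMOP) (x y : C.Cell) :
    y ∈ C.δ x ↔ f.toEquiv y ∈ D.δ (f.toEquiv x) := by
  by_cases h : 0 ≤ C.dim x
  · have := (f.hom.source x h).image_eq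
    rw [← this]
    exact (f.toEquiv.injective.mem_set_image).symm
  · have h1 := hC.dim_ge y
    have h2 := hD.dim_ge (f.toEquiv y)
    have h3 := f.hom.dim x
    constructor
    · intro hy
      have := hC.dim_facet x y (Or.inl hy)
      omega
    · intro hy
      have := hD.dim_facet _ _ (Or.inl hy)
      omega

theorem mem_γ (f : DFCIso C D) (hC : C.IsMOP) (hD : D.IsMOP) (x y : C.Cell) :
    y ∈ C.γ x ↔ f.toEquiv y ∈ D.γ (f.toEquiv x) := by
  by_cases h : 0 ≤ C.dim x
  · have := f.hom.target x h
    rw [← this]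
    exact (f.toEquiv.injective.mem_set_image).symm
  · have h1 := hC.dim_ge y
    have h2 := hD.dim_ge (f.toEquiv y)
    have h3 := f.hom.dim x
    constructor
    · intro hy
      have := hC.dim_facet x y (Or.inr hy)
      omega
    · intro hy
      have := hD.dim_facet _ _ (Or.inr hy)
      omega

theorem neg_iff (f : DFCIso C D) (hC : C.IsMOP) (hD : D.IsMOP) (y x : C.Cell) :
    C.Neg y x ↔ D.Neg (f.toEquiv y) (f.toEquiv x) :=
  and_congr (f.mem_δ hC hD x y) (not_congr (f.mem_γ hC hD x y))

theorem pos_iff (f : DFCIso C D) (hC : C.IsMOP) (hD : D.IsMOP) (y x : C.Cell) :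
    C.Pos y x ↔ D.Pos (f.toEquiv y) (f.toEquiv x) :=
  and_congr (f.mem_γ hC hD x y) (not_congr (f.mem_δ hC hD x y))

theorem loop_iff (f : DFCIso C D) (hC : C.IsMOP) (hD : D.IsMOP) (y x : C.Cell) :
    C.Loop y x ↔ D.Loop (f.toEquiv y) (f.toEquiv x) :=
  and_congr (f.mem_δ hC hD x y) (f.mem_γ hC hD x y)

theorem facet_iff (f : DFCIso C D) (hC : C.IsMOP) (hD : D.IsMOP) (y x : C.Cell) :
    C.Facet y x ↔ D.Facet (f.toEquiv y) (f.toEquiv x) :=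
  or_congr (f.mem_δ hC hD x y) (f.mem_γ hC hD x y)

theorem lam_iff (f : DFCIso C D) (hC : C.IsMOP) (hD : D.IsMOP) (x : C.Cell) :
    x ∈ C.Lam ↔ f.toEquiv x ∈ D.Lam := by
  refine not_congr ?_
  rw [f.toEquiv.surjective.exists]
  exact exists_congr fun w => f.pos_iff hC hD x w

theorem null_iff (f : DFCIso C D) (hC : C.IsMOP) (hD : D.IsMOP) (x : C.Cell) :
    x ∈ C.Null ↔ f.toEquiv x ∈ D.Null := by
  show C.δ x = ∅ ↔ D.δ (f.toEquiv x) = ∅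
  simp only [Set.eq_empty_iff_forall_notMem]
  rw [f.toEquiv.surjective.forall]
  exact forall_congr' fun y => not_congr (f.mem_δ hC hD x y)

/-- The inverse isomorphism. -/
def symm (f : DFCIso C D) : DFCIso D C := ⟨f.toEquiv.symm, f.inv, f.hom⟩

/-- The identity isomorphism. -/
def refl (C : PreMOP.{u}) : DFCIso C C := by
  have h : C.IsMorphism C (Equiv.refl C.Cell) :=
    ⟨fun _ => rfl, fun _ _ => Set.bijOn_id _, fun _ _ => Set.image_id _,
      fun _ _ _ _ _ _ _ _ _ _ h => h⟩
  exact ⟨Equiv.refl _, h, h⟩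

theorem comp_isMorphism (f : DFCIso C D) (g : DFCIso D E) (hC : C.IsMOP) (hD : D.IsMOP) :
    C.IsMorphism E (f.toEquiv.trans g.toEquiv) := by
  refine ⟨fun x => ?_, fun x hx => ?_, fun x hx => ?_, ?_⟩
  · exact (g.hom.dim _).trans (f.hom.dim _)
  · have hx' : 0 ≤ D.dim (f.toEquiv x) := by rw [f.hom.dim]; exact hx
    exact (g.hom.source _ hx').comp (f.hom.source x hx)
  · have hx' : 0 ≤ D.dim (f.toEquiv x) := by rw [f.hom.dim]; exact hx
    show (g.toEquiv ∘ f.toEquiv) '' _ = _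
    rw [Set.image_comp, f.hom.target x hx, g.hom.target _ hx']
    rfl
  · intro x hx hx' z y y' h1 h2 h3 h4 h5
    have hfx := (f.lam_iff hC hD x).1 hx
    exact g.hom.local_order _ hfx hx' _ _ _ ((f.loop_iff hC hD _ _).1 h1)
      ((f.neg_iff hC hD _ _).1 h2) ((f.loop_iff hC hD _ _).1 h3) ((f.neg_iff hC hD _ _).1 h4)
      (f.hom.local_order x hx hfx z y y' h1 h2 h3 h4 h5)

/-- Composition of isomorphisms. -/
def trans (f : DFCIso C D) (g : DFCIso D E) (hC : C.IsMOP) (hD : D.IsMOP) (hE : E.IsMOP) :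
    DFCIso C E :=
  ⟨f.toEquiv.trans g.toEquiv, comp_isMorphism f g hC hD,
    comp_isMorphism g.symm f.symm hE hD⟩

end DFCIso

/-- The groupoid of dendritic face complexes and their isomorphisms. -/
instance : Category DFCcore.{u} where
  Hom C D := DFCIso C.toPreMOP D.toPreMOP
  id C := DFCIso.refl C.toPreMOP
  comp {C D E} f g := f.trans g C.isDFC.toIsMOP D.isDFC.toIsMOP E.isDFC.toIsMOP

namespace ZoomIso

variable {Y Y' Y'' : PreZoom.{u}}

/-- The identity isomorphism. -/
def refl (Y : PreZoom.{u}) : ZoomIso Y Y where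
  dim_eq := rfl
  node _ := Equiv.refl _
  edge _ := Equiv.refl _
  out _ _ _ := Iff.rfl
  inp _ _ _ := Iff.rfl
  root _ _ := Iff.rfl
  black _ _ _ := Iff.rfl
  white _ _ _ := Iff.rfl
  whiteLT _ _ _ _ _ _ := Iff.rfl

/-- The inverse isomorphism. -/
def symm (f : ZoomIso Y Y') : ZoomIso Y' Y where
  dim_eq := f.dim_eq.symm
  node k := (f.node k).symm
  edge k := (f.edge k).symm
  out k a b := by simpa using (f.out k ((f.node k).symm a) ((f.edge k).symm b)).symm
  inp k a b := by simpa using (f.inp k ((f.node k).symm a) ((f.edge k).symm b)).symm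
  root k b := by simpa using (f.root k ((f.edge k).symm b)).symm
  black k a b := by
    simpa using (f.black k ((f.node k).symm a) ((f.edge (k + 1)).symm b)).symm
  white k b w := by
    simpa using (f.white k ((f.edge k).symm b) ((f.node (k + 1)).symm w)).symm
  whiteLT k b w w' h h' := by
    have e1 := f.white k ((f.edge k).symm b) ((f.node (k + 1)).symm w)
    have e2 := f.white k ((f.edge k).symm b) ((f.node (k + 1)).symm w')
    simp only [Equiv.apply_symm_apply] at e1 e2
    simpa using (f.whiteLT k ((f.edge k).symm b) ((f.node (k + 1)).symm w)
      ((f.node (k + 1)).symm w') (e1.2 h) (e2.2 h')).symm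

/-- Composition of isomorphisms. -/
def trans (f : ZoomIso Y Y') (g : ZoomIso Y' Y'') : ZoomIso Y Y'' where
  dim_eq := f.dim_eq.trans g.dim_eq
  node k := (f.node k).trans (g.node k)
  edge k := (f.edge k).trans (g.edge k)
  out k a b := (f.out k a b).trans (g.out k _ _)
  inp k a b := (f.inp k a b).trans (g.inp k _ _)
  root k b := (f.root k b).trans (g.root k _)
  black k a b := (f.black k a b).trans (g.black k _ _)
  white k b w := (f.white k b w).trans (g.white k _ _)
  whiteLT k b w w' h h' := (f.whiteLT k b w w' h h').trans
    (g.whiteLT k _ _ _ ((f.white k b w).1 h) ((f.white k b w').1 h'))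

end ZoomIso

/-- The groupoid of opetopes and their isomorphisms. -/
instance : Category KJBM.{u} where
  Hom Y Y' := ZoomIso Y.toPreZoom Y'.toPreZoom
  id Y := ZoomIso.refl Y.toPreZoom
  comp f g := f.trans g
  id_comp _ := rfl
  comp_id _ := rfl
  assoc _ _ _ := rfl

/-! ## From dendritic face complexes to opetopes -/

namespace PreMOP

/-- `a` immediately precedes `a'` in the zig-zag of all chains `c ≺^β b ≺^α a` with `a ∈ Λ` and
signs `α, β ≠ °`. -/
def ZigStep (C : PreMOP.{u}) (c a a' : C.Cell) : Prop :=
  a ∈ C.Lam ∧ a' ∈ C.Lam ∧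
    ∃ b, (C.Neg c b ∧ C.Pos b a ∧ C.Neg b a') ∨ (C.Pos c b ∧ C.Neg b a ∧ C.Pos b a')

/-- `a` precedes `a'` in that zig-zag. -/
def Before (C : PreMOP.{u}) (c : C.Cell) : C.Cell → C.Cell → Prop :=
  Relation.TransGen (C.ZigStep c)

/-- `b' ⊂ b`, for loops on `c`. -/
def Incl (C : PreMOP.{u}) (c b' b : C.Cell) : Prop :=
  ∃ a ∈ C.Lam, C.Loop c b ∧ C.Pos b a ∧ C.Loop c b' ∧ C.Neg b' a

/-- `b' ⊆ b`, for loops on `c`. -/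
def InclEq (C : PreMOP.{u}) (c : C.Cell) : C.Cell → C.Cell → Prop :=
  Relation.ReflTransGen (C.Incl c)

/-- Comparison of loops on `c` by the position in the zig-zag of the cells that contain them. -/
def LoopLT₁ (C : PreMOP.{u}) (c b₁ b₁' : C.Cell) : Prop :=
  ∃ b b' a a', C.Loop c b ∧ C.Neg b a ∧ C.Loop c b' ∧ C.Neg b' a' ∧ C.Before c a a' ∧
    C.InclEq c b₁ b ∧ C.InclEq c b₁' b'

/-- Comparison of loops on `c` by the local orders. -/
def LoopLT₂ (C : PreMOP.{u}) (c b b' : C.Cell) : Prop :=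
  b ≠ b' ∧ ¬ C.LoopLT₁ c b b' ∧ ¬ C.LoopLT₁ c b' b ∧
    ∃ a ∈ C.Lam, ∃ y y', C.Loop c y ∧ C.Neg y a ∧ C.Loop c y' ∧ C.Neg y' a ∧ y ≠ y' ∧
      C.InclEq c b y ∧ C.InclEq c b' y' ∧ C.localLT a c y y'

/-- The total order of the minimal loops on `c`. -/
def LoopLT (C : PreMOP.{u}) (c b b' : C.Cell) : Prop := C.LoopLT₁ c b b' ∨ C.LoopLT₂ c b b'

/-- The white dots on the edge `y`: the `w ∈ Λ ∩ N` with `γ (γ w) = y`. -/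
def whites (C : PreMOP.{u}) (y : C.Cell) : Set C.Cell :=
  {w | w ∈ C.Lam ∧ w ∈ C.Null ∧ ∃ t ∈ C.γ w, y ∈ C.γ t}

/-- The order of the white dots on the edge `y`. -/
def WhiteLT (C : PreMOP.{u}) (y w w' : C.Cell) : Prop :=
  ∃ t ∈ C.γ w, ∃ t' ∈ C.γ w', C.LoopLT y t t'

/-- `y` is an iterated target of the greatest element. -/
def IterTarget (C : PreMOP.{u}) (y : C.Cell) : Prop :=
  ∃ ω, C.IsTop ω ∧ Relation.ReflTransGen (fun x t => t ∈ C.γ x) ω y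

/-- The dimension of the whole complex. -/
noncomputable def topDim (C : PreMOP.{u}) : ℕ := (sSup (Set.range C.dim)).toNat

end PreMOP

/-- Names for the elements of the trees `T_0` and `T_1` that are not cells: the node of `T_0`
(which is also the leaf of `T_1`), the root of `T_0`, and the leaf of `T_0`. -/
inductive AugElem
  | node
  | root
  | leaf

/-- The tree without nodes and edges, used in the degrees above the dimension. -/
def PreTree.void (N E : Type u) : PreTree N E := ⟨∅, ∅, fun _ _ => False, fun _ _ => False, ∅⟩

namespace PreMOP

/-- The tree `T_0`, with one node, one leaf and one root. -/
def tree₀ (C : PreMOP.{u}) : PreTree (C.Cell ⊕ AugElem) (C.Cell ⊕ AugElem) where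
  nodes := {.inr .node}
  edges := {.inr .root, .inr .leaf}
  out a b := a = .inr .node ∧ b = .inr .root
  inp a b := a = .inr .node ∧ b = .inr .leaf
  root := {.inr .root}

/-- The tree `T_1`: its node is the element of `Λ_0`, its root the bottom cell. -/
def tree₁ (C : PreMOP.{u}) : PreTree (C.Cell ⊕ AugElem) (C.Cell ⊕ AugElem) where
  nodes := {a | ∃ x ∈ C.Lam, C.dim x = 0 ∧ a = .inl x}
  edges := {b | (∃ y, C.dim y = -1 ∧ b = .inl y) ∨ b = .inr .node}
  out a b := (∃ x ∈ C.Lam, C.dim x = 0 ∧ a = .inl x) ∧ ∃ y, C.dim y = -1 ∧ b = .inl y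
  inp a b := (∃ x ∈ C.Lam, C.dim x = 0 ∧ a = .inl x) ∧ b = .inr .node
  root := {b | ∃ y, C.dim y = -1 ∧ b = .inl y}

/-- The tree `T_{k+2}`: the nodes are `Λ_{k+1}`, the edges are `C_k`. -/
def treeSucc (C : PreMOP.{u}) (k : ℕ) : PreTree (C.Cell ⊕ AugElem) (C.Cell ⊕ AugElem) where
  nodes := {a | ∃ x ∈ C.Lam, C.dim x = k + 1 ∧ a = .inl x}
  edges := {b | ∃ y, C.dim y = k ∧ b = .inl y}
  out a b := ∃ x y, x ∈ C.Lam ∧ C.dim x = k + 1 ∧ C.dim y = k ∧ C.Pos y x ∧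
    a = .inl x ∧ b = .inl y
  inp a b := ∃ x y, x ∈ C.Lam ∧ C.dim x = k + 1 ∧ C.dim y = k ∧ C.Neg y x ∧
    a = .inl x ∧ b = .inl y
  root := {b | ∃ y, C.dim y = k ∧ C.IterTarget y ∧ b = .inl y}

/-- The trees `T_k`, for all `k`. -/
def trees (C : PreMOP.{u}) : ℕ → PreTree (C.Cell ⊕ AugElem) (C.Cell ⊕ AugElem)
  | 0 => C.tree₀
  | 1 => C.tree₁
  | k + 2 => C.treeSucc k

/-- The zoom complex `T_0 → ⋯ → T_n` of a complex of dimension `n`. -/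
noncomputable def zoom (C : PreMOP.{u}) : PreZoom.{u} where
  dim := C.topDim
  Elem := C.Cell ⊕ AugElem
  tree k := if k ≤ C.topDim then C.trees k else PreTree.void _ _
  white k b := {w | k < C.topDim ∧ 2 ≤ k ∧
    ∃ y v, C.dim y = (k : ℤ) - 2 ∧ v ∈ C.whites y ∧ b = .inl y ∧ w = .inl v}
  whiteLT _ b w w' := ∃ y v v', C.WhiteLT y v v' ∧ b = .inl y ∧ w = .inl v ∧ w' = .inl v'

end PreMOP

/-! ## From opetopes to dendritic face complexes -/

/-- The new elements of the extension of a zoom complex. -/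
inductive NewElem
  | top
  | root

namespace PreZoom

/-- The tree `S_{n+1}`: the corolla with node `⊤`, whose leaves are the nodes of `S_n`. -/
def corolla (Y : PreZoom.{u}) : PreTree (Y.Elem ⊕ NewElem) (Y.Elem ⊕ NewElem) where
  nodes := {.inr .top}
  edges := {b | (∃ a ∈ (Y.tree Y.dim).nodes, b = .inl a) ∨ b = .inr .root}
  out a b := a = .inr .top ∧ b = .inr .root
  inp a b := a = .inr .top ∧ ∃ x ∈ (Y.tree Y.dim).nodes, b = .inl x
  root := {.inr .root}

/-- The tree `S_{n+2}`: the unit tree with root edge `⊤`. -/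
def unit (Y : PreZoom.{u}) : PreTree (Y.Elem ⊕ NewElem) (Y.Elem ⊕ NewElem) where
  nodes := ∅
  edges := {.inr .top}
  out _ _ := False
  inp _ _ := False
  root := {.inr .top}

/-- A tree of the complex, with its elements seen in the larger ambient type. -/
def oldTree (Y : PreZoom.{u}) (k : ℕ) : PreTree (Y.Elem ⊕ NewElem) (Y.Elem ⊕ NewElem) where
  nodes := {a | ∃ x ∈ (Y.tree k).nodes, a = .inl x}
  edges := {b | ∃ y ∈ (Y.tree k).edges, b = .inl y}
  out a b := ∃ x y, (Y.tree k).out x y ∧ a = .inl x ∧ b = .inl y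
  inp a b := ∃ x y, (Y.tree k).inp x y ∧ a = .inl x ∧ b = .inl y
  root := {b | ∃ y ∈ (Y.tree k).root, b = .inl y}

/-- The trees `S_k` of the extension `S_0 → ⋯ → S_n → S_{n+1} → S_{n+2}`. -/
def extTree (Y : PreZoom.{u}) (k : ℕ) : PreTree (Y.Elem ⊕ NewElem) (Y.Elem ⊕ NewElem) :=
  if k ≤ Y.dim then Y.oldTree k else if k = Y.dim + 1 then Y.corolla
    else if k = Y.dim + 2 then Y.unit else PreTree.void _ _

/-- The subdivisions of the extension. The subdivision of `S_n` is empty, except when `S_n` has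
no node: then `⊤` is a sourceless node of `S_{n+1}`, hence a white dot on the only edge of `S_n`.
The subdivision of `S_{n+1}` is empty. -/
def extWhite (Y : PreZoom.{u}) (k : ℕ) (b : Y.Elem ⊕ NewElem) : Set (Y.Elem ⊕ NewElem) :=
  {w | (k < Y.dim ∧ ∃ y v, v ∈ Y.white k y ∧ b = .inl y ∧ w = .inl v) ∨
    (k = Y.dim ∧ (Y.tree k).nodes = ∅ ∧ (∃ y ∈ (Y.tree k).edges, b = .inl y) ∧ w = .inr .top)}

/-- The orders of the subdivisions of the extension. -/
def extWhiteLT (Y : PreZoom.{u}) (k : ℕ) (b w w' : Y.Elem ⊕ NewElem) : Prop :=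
  k < Y.dim ∧ ∃ y v v', Y.whiteLT k y v v' ∧ b = .inl y ∧ w = .inl v ∧ w' = .inl v'

/-- The extension `S_0 → ⋯ → S_n → S_{n+1} → S_{n+2}` of a zoom complex of dimension `n`. -/
def extend (Y : PreZoom.{u}) : PreZoom.{u} where
  dim := Y.dim + 2
  Elem := Y.Elem ⊕ NewElem
  tree := Y.extTree
  white := Y.extWhite
  whiteLT := Y.extWhiteLT

/-- The dots of `S_k` (black: `Sum.inl`, white: `Sum.inr`) above the edge `x` of `S_{k+1}`, in
the extended complex. -/
def dots (Y : PreZoom.{u}) (k : ℕ) (x : Y.extend.Elem) : Set (Y.extend.Elem ⊕ Y.extend.Elem) :=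
  (Y.extend.tree k).dotsAbove (Y.extend.white k) (Y.extend.tree (k + 1)) (.inr x)

/-- The face complex of an opetope. A cell of dimension `k - 2` is a pair `(k, x)`, where `x` is
an edge of `S_k`, and the root edge if `k = 1`. -/
def faces (Y : PreZoom.{u}) : PreMOP.{u} where
  Cell := {p : ℕ × Y.extend.Elem // 1 ≤ p.1 ∧ p.1 ≤ Y.dim + 2 ∧
    p.2 ∈ (Y.extend.tree p.1).edges ∧ (p.1 = 1 → p.2 ∈ (Y.extend.tree 1).root)}
  dim p := (p.1.1 : ℤ) - 2
  δ p := {q | p.1.1 = q.1.1 + 1 ∧ 3 ≤ p.1.1 ∧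
    q.1.2 ∈ (Y.extend.tree q.1.1).nestLeaves (Y.extend.white q.1.1)
      (Y.extend.tree (q.1.1 + 1)) (.inr p.1.2)}
  γ p := {q | p.1.1 = q.1.1 + 1 ∧
    q.1.2 ∈ (Y.extend.tree q.1.1).nestRoot (Y.extend.white q.1.1)
      (Y.extend.tree (q.1.1 + 1)) (.inr p.1.2)}
  localLT _ z y y' := ∀ w w', .inr w ∈ Y.dots z.1.1 y.1.2 → .inr w' ∈ Y.dots z.1.1 y'.1.2 →
    w ∈ Y.extend.white z.1.1 z.1.2 ∧ w' ∈ Y.extend.white z.1.1 z.1.2 ∧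
      Y.extend.whiteLT z.1.1 z.1.2 w w'

end PreZoom

/-! ## The functors on isomorphisms -/

namespace DFCIso

variable {C D : PreMOP.{u}}

theorem le_imp (f : DFCIso C D) (hC : C.IsMOP) (hD : D.IsMOP) {x y : C.Cell} (h : C.Le x y) :
    D.Le (f.toEquiv x) (f.toEquiv y) :=
  Relation.ReflTransGen.lift f.toEquiv (fun _ _ => (f.facet_iff hC hD _ _).1) _ _ h

theorem isTop_imp (f : DFCIso C D) (hC : C.IsMOP) (hD : D.IsMOP) {x : C.Cell} (h : C.IsTop x) :
    D.IsTop (f.toEquiv x) := fun y => by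
  simpa using f.le_imp hC hD (h (f.toEquiv.symm y))

theorem iterTarget_imp (f : DFCIso C D) (hC : C.IsMOP) (hD : D.IsMOP) {x : C.Cell}
    (h : C.IterTarget x) : D.IterTarget (f.toEquiv x) := by
  obtain ⟨ω, h1, h2⟩ := h
  exact ⟨_, f.isTop_imp hC hD h1,
    Relation.ReflTransGen.lift f.toEquiv (fun _ _ => (f.mem_γ hC hD _ _).1) _ _ h2⟩

theorem before_imp (f : DFCIso C D) (hC : C.IsMOP) (hD : D.IsMOP) {c x y : C.Cell}
    (h : C.Before c x y) : D.Before (f.toEquiv c) (f.toEquiv x) (f.toEquiv y) := by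
  refine Relation.TransGen.lift f.toEquiv ?_ _ _ h
  rintro a a' ⟨h1, h2, b, h3⟩
  refine ⟨(f.lam_iff hC hD _).1 h1, (f.lam_iff hC hD _).1 h2, f.toEquiv b, ?_⟩
  simpa only [← f.neg_iff hC hD, ← f.pos_iff hC hD] using h3

theorem inclEq_imp (f : DFCIso C D) (hC : C.IsMOP) (hD : D.IsMOP) {c x y : C.Cell}
    (h : C.InclEq c x y) : D.InclEq (f.toEquiv c) (f.toEquiv x) (f.toEquiv y) := by
  refine Relation.ReflTransGen.lift f.toEquiv ?_ _ _ h
  rintro b b' ⟨a, h1, h3⟩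
  refine ⟨f.toEquiv a, (f.lam_iff hC hD _).1 h1, ?_⟩
  simpa only [← f.neg_iff hC hD, ← f.pos_iff hC hD, ← f.loop_iff hC hD] using h3

theorem loopLT₁_imp (f : DFCIso C D) (hC : C.IsMOP) (hD : D.IsMOP) {c x y : C.Cell}
    (h : C.LoopLT₁ c x y) : D.LoopLT₁ (f.toEquiv c) (f.toEquiv x) (f.toEquiv y) := by
  obtain ⟨b, b', a, a', h1, h2, h3, h4, h5, h6, h7⟩ := h
  exact ⟨_, _, _, _, (f.loop_iff hC hD _ _).1 h1, (f.neg_iff hC hD _ _).1 h2,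
    (f.loop_iff hC hD _ _).1 h3, (f.neg_iff hC hD _ _).1 h4, f.before_imp hC hD h5,
    f.inclEq_imp hC hD h6, f.inclEq_imp hC hD h7⟩

theorem loopLT₁_iff (f : DFCIso C D) (hC : C.IsMOP) (hD : D.IsMOP) (c x y : C.Cell) :
    C.LoopLT₁ c x y ↔ D.LoopLT₁ (f.toEquiv c) (f.toEquiv x) (f.toEquiv y) :=
  ⟨f.loopLT₁_imp hC hD, fun h => by simpa [symm] using f.symm.loopLT₁_imp hD hC h⟩

theorem loopLT_imp (f : DFCIso C D) (hC : C.IsMOP) (hD : D.IsMOP) {c x y : C.Cell}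
    (h : C.LoopLT c x y) : D.LoopLT (f.toEquiv c) (f.toEquiv x) (f.toEquiv y) := by
  rcases h with h | ⟨h1, h2, h3, a, h4, y, y', h5, h6, h7, h8, h9, h10, h11, h12⟩
  · exact Or.inl (f.loopLT₁_imp hC hD h)
  · refine Or.inr ⟨f.toEquiv.injective.ne h1, fun h => h2 ((f.loopLT₁_iff hC hD _ _ _).2 h),
      fun h => h3 ((f.loopLT₁_iff hC hD _ _ _).2 h), f.toEquiv a, (f.lam_iff hC hD _).1 h4,
      f.toEquiv y, f.toEquiv y', (f.loop_iff hC hD _ _).1 h5, (f.neg_iff hC hD _ _).1 h6,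
      (f.loop_iff hC hD _ _).1 h7, (f.neg_iff hC hD _ _).1 h8, f.toEquiv.injective.ne h9,
      f.inclEq_imp hC hD h10, f.inclEq_imp hC hD h11,
      f.hom.local_order a h4 ((f.lam_iff hC hD _).1 h4) _ _ _ h5 h6 h7 h8 h12⟩

theorem whiteLT_imp (f : DFCIso C D) (hC : C.IsMOP) (hD : D.IsMOP) {c x y : C.Cell}
    (h : C.WhiteLT c x y) : D.WhiteLT (f.toEquiv c) (f.toEquiv x) (f.toEquiv y) := by
  obtain ⟨t, h1, t', h2, h3⟩ := h
  exact ⟨_, (f.mem_γ hC hD _ _).1 h1, _, (f.mem_γ hC hD _ _).1 h2, f.loopLT_imp hC hD h3⟩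

theorem whites_imp (f : DFCIso C D) (hC : C.IsMOP) (hD : D.IsMOP) {y w : C.Cell}
    (h : w ∈ C.whites y) : f.toEquiv w ∈ D.whites (f.toEquiv y) := by
  obtain ⟨h1, h2, t, h3, h4⟩ := h
  exact ⟨(f.lam_iff hC hD _).1 h1, (f.null_iff hC hD _).1 h2, _, (f.mem_γ hC hD _ _).1 h3,
    (f.mem_γ hC hD _ _).1 h4⟩

theorem topDim_eq (f : DFCIso C D) : C.topDim = D.topDim := by
  unfold PreMOP.topDim
  congr 2
  ext d
  constructor
  · rintro ⟨x, rfl⟩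
    exact ⟨f.toEquiv x, f.hom.dim x⟩
  · rintro ⟨x, rfl⟩
    exact ⟨f.toEquiv.symm x, f.inv.dim x⟩

/-- The action of an isomorphism on the elements of the trees: the map itself on cells. -/
noncomputable def elem (f : DFCIso C D) : C.zoom.Elem ≃ D.zoom.Elem :=
  Equiv.sumCongr f.toEquiv (Equiv.refl _)

theorem elem_symm (f : DFCIso C D) : f.symm.elem = f.elem.symm := rfl

theorem zoom_imp (f : DFCIso C D) (hC : C.IsMOP) (hD : D.IsMOP) (k : ℕ) :
    (∀ a ∈ (C.zoom.tree k).nodes, f.elem a ∈ (D.zoom.tree k).nodes) ∧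
    (∀ b ∈ (C.zoom.tree k).edges, f.elem b ∈ (D.zoom.tree k).edges) ∧
    (∀ a b, (C.zoom.tree k).out a b → (D.zoom.tree k).out (f.elem a) (f.elem b)) ∧
    (∀ a b, (C.zoom.tree k).inp a b → (D.zoom.tree k).inp (f.elem a) (f.elem b)) ∧
    (∀ b ∈ (C.zoom.tree k).root, f.elem b ∈ (D.zoom.tree k).root) ∧
    (∀ b, ∀ w ∈ C.zoom.white k b, f.elem w ∈ D.zoom.white k (f.elem b)) ∧
    (∀ b w w', C.zoom.whiteLT k b w w' →
      D.zoom.whiteLT k (f.elem b) (f.elem w) (f.elem w')) := by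
  have hdim := f.topDim_eq
  have hd : ∀ x, D.dim (f.toEquiv x) = C.dim x := f.hom.dim
  have hl : ∀ x, f.toEquiv x ∈ D.Lam ↔ x ∈ C.Lam := fun x => (f.lam_iff hC hD x).symm
  have hp : ∀ y x, D.Pos (f.toEquiv y) (f.toEquiv x) ↔ C.Pos y x :=
    fun y x => (f.pos_iff hC hD y x).symm
  have hn : ∀ y x, D.Neg (f.toEquiv y) (f.toEquiv x) ↔ C.Neg y x :=
    fun y x => (f.neg_iff hC hD y x).symm
  have hwhite : ∀ b, ∀ w ∈ C.zoom.white k b, f.elem w ∈ D.zoom.white k (f.elem b) := by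
    rintro b w ⟨h1, h2, y, v, h3, h4, rfl, rfl⟩
    exact ⟨hdim ▸ h1, h2, _, _, (hd y).trans h3, f.whites_imp hC hD h4, rfl, rfl⟩
  have hwlt : ∀ b w w', C.zoom.whiteLT k b w w' →
      D.zoom.whiteLT k (f.elem b) (f.elem w) (f.elem w') := by
    rintro b w w' ⟨y, v, v', h, rfl, rfl, rfl⟩
    exact ⟨_, _, _, f.whiteLT_imp hC hD h, rfl, rfl, rfl⟩
  suffices h : _ ∧ _ ∧ _ ∧ _ ∧ _ from
    ⟨h.1, h.2.1, h.2.2.1, h.2.2.2.1, h.2.2.2.2, hwhite, hwlt⟩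
  simp only [PreMOP.zoom, ← hdim]
  by_cases hk : k ≤ C.topDim
  · simp only [hk, if_true]
    match k with
    | 0 =>
      refine ⟨?_, ?_, ?_, ?_, ?_⟩
      · rintro _ rfl
        exact rfl
      · rintro _ (rfl | rfl)
        · exact Or.inl rfl
        · exact Or.inr rfl
      · rintro _ _ ⟨rfl, rfl⟩
        exact ⟨rfl, rfl⟩
      · rintro _ _ ⟨rfl, rfl⟩
        exact ⟨rfl, rfl⟩
      · rintro _ rfl
        exact rfl
    | 1 =>
      refine ⟨?_, ?_, ?_, ?_, ?_⟩
      · rintro _ ⟨x, h1, h2, rfl⟩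
        exact ⟨_, (hl x).2 h1, (hd x).trans h2, rfl⟩
      · rintro _ (⟨y, h2, rfl⟩ | rfl)
        · exact Or.inl ⟨_, (hd y).trans h2, rfl⟩
        · exact Or.inr rfl
      · rintro _ _ ⟨⟨x, h1, h2, rfl⟩, y, h3, rfl⟩
        exact ⟨⟨_, (hl x).2 h1, (hd x).trans h2, rfl⟩, _, (hd y).trans h3, rfl⟩
      · rintro _ _ ⟨⟨x, h1, h2, rfl⟩, rfl⟩
        exact ⟨⟨_, (hl x).2 h1, (hd x).trans h2, rfl⟩, rfl⟩
      · rintro _ ⟨y, h3, rfl⟩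
        exact ⟨_, (hd y).trans h3, rfl⟩
    | k + 2 =>
      refine ⟨?_, ?_, ?_, ?_, ?_⟩
      · rintro _ ⟨x, h1, h2, rfl⟩
        exact ⟨_, (hl x).2 h1, (hd x).trans h2, rfl⟩
      · rintro _ ⟨y, h2, rfl⟩
        exact ⟨_, (hd y).trans h2, rfl⟩
      · rintro _ _ ⟨x, y, h1, h2, h3, h4, rfl, rfl⟩
        exact ⟨_, _, (hl x).2 h1, (hd x).trans h2, (hd y).trans h3, (hp y x).2 h4, rfl, rfl⟩
      · rintro _ _ ⟨x, y, h1, h2, h3, h4, rfl, rfl⟩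
        exact ⟨_, _, (hl x).2 h1, (hd x).trans h2, (hd y).trans h3, (hn y x).2 h4, rfl, rfl⟩
      · rintro _ ⟨y, h3, h4, rfl⟩
        exact ⟨_, (hd y).trans h3, f.iterTarget_imp hC hD h4, rfl⟩
  · simp only [hk, if_false]
    exact ⟨fun _ h => h.elim, fun _ h => h.elim, fun _ _ h => h.elim, fun _ _ h => h.elim,
      fun _ h => h.elim⟩

/-- The isomorphism of zoom complexes induced by an isomorphism of dendritic face complexes: it
acts on nodes and edges as the given map. -/
noncomputable def zoom (f : DFCIso C D) (hC : C.IsMOP) (hD : D.IsMOP) :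
    ZoomIso C.zoom D.zoom := by
  have F := f.zoom_imp hC hD
  have G := f.symm.zoom_imp hD hC
  simp only [elem_symm] at G
  exact
  { dim_eq := f.topDim_eq
    node := fun k => f.elem.subtypeEquiv fun a =>
      ⟨(F k).1 a, fun h => by simpa using (G k).1 _ h⟩
    edge := fun k => f.elem.subtypeEquiv fun a =>
      ⟨(F k).2.1 a, fun h => by simpa using (G k).2.1 _ h⟩
    out := fun k a b => ⟨(F k).2.2.1 _ _, fun h => by simpa using (G k).2.2.1 _ _ h⟩
    inp := fun k a b => ⟨(F k).2.2.2.1 _ _, fun h => by simpa using (G k).2.2.2.1 _ _ h⟩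
    root := fun k b => ⟨(F k).2.2.2.2.1 _, fun h => by simpa using (G k).2.2.2.2.1 _ h⟩
    black := fun k a b => f.elem.injective.eq_iff.symm
    white := fun k b w => ⟨(F k).2.2.2.2.2.1 _ _, fun h => by
      simpa using (G k).2.2.2.2.2.1 _ _ h⟩
    whiteLT := fun k b w w' _ _ => ⟨(F k).2.2.2.2.2.2 _ _ _, fun h => by
      simpa using (G k).2.2.2.2.2.2 _ _ _ h⟩ }

end DFCIso

/-- The functor `Z`, once its values are known to be opetopes. -/
noncomputable def Zfunctor (hZ : ∀ C : DFCcore.{u}, C.toPreMOP.zoom.IsOpetope) :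
    DFCcore.{u} ⥤ KJBM.{u} where
  obj C := ⟨C.toPreMOP.zoom, hZ C⟩
  map {C D} f := DFCIso.zoom f C.isDFC.toIsMOP D.isDFC.toIsMOP
  map_id C := by
    refine ZoomIso.ext ?_ ?_
    · funext k
      ext ⟨a | a, ha⟩ <;> rfl
    · funext k
      ext ⟨a | a, ha⟩ <;> rfl
  map_comp f g := by
    refine ZoomIso.ext ?_ ?_
    · funext k
      ext ⟨a | a, ha⟩ <;> rfl
    · funext k
      ext ⟨a | a, ha⟩ <;> rfl

namespace PreZoom

variable (Y : PreZoom.{u})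

theorem mem_extend_nodes (k : ℕ) (a : Y.Elem ⊕ NewElem) : a ∈ (Y.extTree k).nodes ↔
    (k ≤ Y.dim ∧ ∃ x ∈ (Y.tree k).nodes, a = .inl x) ∨ (k = Y.dim + 1 ∧ a = .inr .top) := by
  simp only [extTree]
  split_ifs with h1 h2 h3
  · have : k ≠ Y.dim + 1 := by omega
    simp [oldTree, h1, this]
  · simp [corolla, h2]
  · simp [unit, h3]
  · simp [PreTree.void, h1, h2]

theorem mem_extend_edges (k : ℕ) (b : Y.Elem ⊕ NewElem) : b ∈ (Y.extTree k).edges ↔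
    (k ≤ Y.dim ∧ ∃ y ∈ (Y.tree k).edges, b = .inl y) ∨
    (k = Y.dim + 1 ∧ ((∃ x ∈ (Y.tree (k - 1)).nodes, b = .inl x) ∨ b = .inr .root)) ∨
    (k = Y.dim + 2 ∧ b = .inr .top) := by
  simp only [extTree]
  split_ifs with h1 h2 h3
  · have : k ≠ Y.dim + 1 := by omega
    have : k ≠ Y.dim + 2 := by omega
    simp [oldTree, *]
  · simp [corolla, h2]
  · simp [unit, h3]
  · simp [PreTree.void, h1, h2, h3]

theorem extend_out (k : ℕ) (a b : Y.Elem ⊕ NewElem) : (Y.extTree k).out a b ↔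
    (k ≤ Y.dim ∧ ∃ x y, (Y.tree k).out x y ∧ a = .inl x ∧ b = .inl y) ∨
    (k = Y.dim + 1 ∧ a = .inr .top ∧ b = .inr .root) := by
  simp only [extTree]
  split_ifs with h1 h2 h3
  · have : k ≠ Y.dim + 1 := by omega
    simp [oldTree, h1, this]
  · simp [corolla, h2]
  · simp [unit, h3]
  · simp [PreTree.void, h1, h2]

theorem extend_inp (k : ℕ) (a b : Y.Elem ⊕ NewElem) : (Y.extTree k).inp a b ↔
    (k ≤ Y.dim ∧ ∃ x y, (Y.tree k).inp x y ∧ a = .inl x ∧ b = .inl y) ∨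
    (k = Y.dim + 1 ∧ a = .inr .top ∧ ∃ x ∈ (Y.tree (k - 1)).nodes, b = .inl x) := by
  simp only [extTree]
  split_ifs with h1 h2 h3
  · have : k ≠ Y.dim + 1 := by omega
    simp [oldTree, h1, this]
  · simp [corolla, h2]
  · simp [unit, h3]
  · simp [PreTree.void, h1, h2]

theorem mem_extend_root (k : ℕ) (b : Y.Elem ⊕ NewElem) : b ∈ (Y.extTree k).root ↔
    (k ≤ Y.dim ∧ ∃ y ∈ (Y.tree k).root, b = .inl y) ∨
    (k = Y.dim + 1 ∧ b = .inr .root) ∨ (k = Y.dim + 2 ∧ b = .inr .top) := by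
  simp only [extTree]
  split_ifs with h1 h2 h3
  · have : k ≠ Y.dim + 1 := by omega
    have : k ≠ Y.dim + 2 := by omega
    simp [oldTree, *]
  · simp [corolla, h2]
  · simp [unit, h3]
  · simp [PreTree.void, h1, h2, h3]

end PreZoom

namespace ZoomIso

variable {Y Y' Y'' : PreZoom.{u}}

/-- The extended isomorphism on nodes. -/
def extNode (f : ZoomIso Y Y') (k : ℕ) : (Y.extTree k).nodes → (Y'.extTree k).nodes
  | ⟨.inl x, h⟩ =>
    have h' : k ≤ Y.dim ∧ x ∈ (Y.tree k).nodes := by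
      simpa using (Y.mem_extend_nodes k _).1 h
    ⟨.inl (f.node k ⟨x, h'.2⟩), (Y'.mem_extend_nodes k _).2
      (Or.inl ⟨f.dim_eq ▸ h'.1, _, (f.node k _).2, rfl⟩)⟩
  | ⟨.inr e, h⟩ => ⟨.inr e, by
      have := f.dim_eq
      simpa [PreZoom.mem_extend_nodes, this] using h⟩

/-- The extended isomorphism on edges. -/
def extEdge (f : ZoomIso Y Y') (k : ℕ) : (Y.extTree k).edges → (Y'.extTree k).edges
  | ⟨.inl x, h⟩ =>
    if hk : k ≤ Y.dim then
      have h' : x ∈ (Y.tree k).edges := by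
        have h1 : k ≠ Y.dim + 1 := by omega
        simpa [hk, h1] using (Y.mem_extend_edges k _).1 h
      ⟨.inl (f.edge k ⟨x, h'⟩), (Y'.mem_extend_edges k _).2
        (Or.inl ⟨f.dim_eq ▸ hk, _, (f.edge k _).2, rfl⟩)⟩
    else
      have h' : k = Y.dim + 1 ∧ x ∈ (Y.tree (k - 1)).nodes := by
        simpa [hk] using (Y.mem_extend_edges k _).1 h
      ⟨.inl (f.node (k - 1) ⟨x, h'.2⟩), (Y'.mem_extend_edges k _).2
        (Or.inr (Or.inl ⟨f.dim_eq ▸ h'.1, Or.inl ⟨_, (f.node _ _).2, rfl⟩⟩))⟩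
  | ⟨.inr e, h⟩ => ⟨.inr e, by
      have := f.dim_eq
      simpa [PreZoom.mem_extend_edges, this] using h⟩

theorem extNode_symm (f : ZoomIso Y Y') (k : ℕ) (a : (Y.extTree k).nodes) :
    f.symm.extNode k (f.extNode k a) = a := by
  obtain ⟨x | e, h⟩ := a
  · simp [extNode, symm]
  · rfl

theorem extEdge_symm (f : ZoomIso Y Y') (k : ℕ) (a : (Y.extTree k).edges) :
    f.symm.extEdge k (f.extEdge k a) = a := by
  have := f.dim_eq
  obtain ⟨x | e, h⟩ := a
  · by_cases hk : k ≤ Y.dim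
    · have hk' : k ≤ Y'.dim := this ▸ hk
      simp [extEdge, symm, hk, hk']
    · have hk' : ¬ k ≤ Y'.dim := this ▸ hk
      simp [extEdge, symm, hk, hk']
  · rfl

theorem extend_out_imp (f : ZoomIso Y Y') (k : ℕ) (a : (Y.extTree k).nodes)
    (b : (Y.extTree k).edges) (h : (Y.extTree k).out a b) :
    (Y'.extTree k).out (f.extNode k a) (f.extEdge k b) := by
  have hd := f.dim_eq
  obtain ⟨a, ha⟩ := a
  obtain ⟨b, hb⟩ := b
  rw [PreZoom.extend_out] at h ⊢
  rcases h with ⟨hk, x, y, h1, rfl, rfl⟩ | ⟨hk, rfl, rfl⟩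
  · refine Or.inl ⟨hd ▸ hk, _, _, ?_, rfl, by simp only [extEdge, hk, dif_pos]; rfl⟩
    exact (f.out k ⟨x, _⟩ ⟨y, _⟩).1 h1
  · exact Or.inr ⟨hd ▸ hk, rfl, rfl⟩

theorem extend_inp_imp (f : ZoomIso Y Y') (k : ℕ) (a : (Y.extTree k).nodes)
    (b : (Y.extTree k).edges) (h : (Y.extTree k).inp a b) :
    (Y'.extTree k).inp (f.extNode k a) (f.extEdge k b) := by
  have hd := f.dim_eq
  obtain ⟨a, ha⟩ := a
  obtain ⟨b, hb⟩ := b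
  rw [PreZoom.extend_inp] at h ⊢
  rcases h with ⟨hk, x, y, h1, rfl, rfl⟩ | ⟨hk, rfl, x, hx, rfl⟩
  · refine Or.inl ⟨hd ▸ hk, _, _, ?_, rfl, by simp only [extEdge, hk, dif_pos]; rfl⟩
    exact (f.inp k ⟨x, _⟩ ⟨y, _⟩).1 h1
  · refine Or.inr ⟨hd ▸ hk, rfl, (f.node (k - 1) ⟨x, hx⟩).1, (f.node _ _).2, ?_⟩
    have hk' : ¬ k ≤ Y.dim := by omega
    simp [extEdge, hk']

theorem extend_root_imp (f : ZoomIso Y Y') (k : ℕ) (b : (Y.extTree k).edges)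
    (h : b.1 ∈ (Y.extTree k).root) : (f.extEdge k b).1 ∈ (Y'.extTree k).root := by
  have hd := f.dim_eq
  obtain ⟨b, hb⟩ := b
  rw [PreZoom.mem_extend_root] at h ⊢
  rcases h with ⟨hk, y, h1, rfl⟩ | ⟨hk, rfl⟩ | ⟨hk, rfl⟩
  · refine Or.inl ⟨hd ▸ hk, _, ?_, by simp only [extEdge, hk, dif_pos]; rfl⟩
    exact (f.root k ⟨y, _⟩).1 h1
  · exact Or.inr (Or.inl ⟨hd ▸ hk, rfl⟩)
  · exact Or.inr (Or.inr ⟨hd ▸ hk, rfl⟩)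

theorem extend_black_imp (f : ZoomIso Y Y') (k : ℕ) (a : (Y.extTree k).nodes)
    (b : (Y.extTree (k + 1)).edges) (h : a.1 = b.1) :
    (f.extNode k a).1 = (f.extEdge (k + 1) b).1 := by
  obtain ⟨a, ha⟩ := a
  obtain ⟨b, hb⟩ := b
  obtain rfl : a = b := h
  rcases a with x | e
  · have ha' : k ≤ Y.dim ∧ x ∈ (Y.tree k).nodes := by
      simpa using (Y.mem_extend_nodes k _).1 ha
    by_cases hk : k + 1 ≤ Y.dim
    · have hb' : x ∈ (Y.tree (k + 1)).edges := by
        have h1 : k ≠ Y.dim := by omega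
        simpa [hk, h1] using (Y.mem_extend_edges (k + 1) _).1 hb
      simp only [extNode, extEdge, hk, dif_pos]
      exact congrArg _ ((f.black k ⟨x, ha'.2⟩ ⟨x, hb'⟩).1 rfl)
    · simp only [extNode, extEdge, hk, dif_neg, not_false_eq_true]
      rfl
  · rfl

theorem extend_white_imp (f : ZoomIso Y Y') (k : ℕ) (b : (Y.extTree k).edges)
    (w : (Y.extTree (k + 1)).nodes) (h : w.1 ∈ Y.extWhite k b) :
    (f.extNode (k + 1) w).1 ∈ Y'.extWhite k (f.extEdge k b) := by
  have hd := f.dim_eq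
  obtain ⟨w, hw⟩ := w
  obtain ⟨b, hb⟩ := b
  rcases h with ⟨hk, y, v, h1, h2, h3⟩ | ⟨hk, h1, ⟨y, h2, h3⟩, h4⟩
  · dsimp only at h2 h3
    subst h2 h3
    have hk' : k ≤ Y.dim := by omega
    refine Or.inl ⟨hd ▸ hk, _, _, ?_, by simp only [extEdge, hk', dif_pos]; rfl, rfl⟩
    exact (f.white k ⟨y, _⟩ ⟨v, _⟩).1 h1
  · dsimp only at h3 h4
    subst h3 h4
    have hk' : k ≤ Y.dim := by omega
    refine Or.inr ⟨hd ▸ hk, ?_, ⟨(f.edge k ⟨y, h2⟩).1, (f.edge k _).2, ?_⟩, rfl⟩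
    · by_contra hne
      obtain ⟨a, ha⟩ := Set.nonempty_iff_ne_empty.2 hne
      have := ((f.node k).symm ⟨a, ha⟩).2
      exact (Set.eq_empty_iff_forall_notMem.1 h1) _ this
    · simp only [extEdge, hk', dif_pos]

theorem extend_whiteLT_imp (f : ZoomIso Y Y') (k : ℕ) (b : (Y.extTree k).edges)
    (w w' : (Y.extTree (k + 1)).nodes) (hw : w.1 ∈ Y.extWhite k b)
    (hw' : w'.1 ∈ Y.extWhite k b) (h : Y.extWhiteLT k b w w') :
    Y'.extWhiteLT k (f.extEdge k b) (f.extNode (k + 1) w) (f.extNode (k + 1) w') := by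
  have hd := f.dim_eq
  obtain ⟨w, hwm⟩ := w
  obtain ⟨w', hwm'⟩ := w'
  obtain ⟨b, hb⟩ := b
  obtain ⟨hk, y, v, v', h1, h2, h3, h4⟩ := h
  dsimp only at h2 h3 h4
  subst h2 h3 h4
  have hk' : k ≤ Y.dim := by omega
  have hk1 : k ≠ Y.dim := by omega
  refine ⟨hd ▸ hk, _, _, _, ?_, by simp only [extEdge, hk', dif_pos]; rfl, rfl, rfl⟩
  refine (f.whiteLT k ⟨y, _⟩ ⟨v, _⟩ ⟨v', _⟩ ?_ ?_).1 h1
  · simpa [PreZoom.extWhite, hk, hk1] using hw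
  · simpa [PreZoom.extWhite, hk, hk1] using hw'

theorem extend_out_iff (f : ZoomIso Y Y') (k : ℕ) (a : (Y.extTree k).nodes)
    (b : (Y.extTree k).edges) : (Y.extTree k).out a b ↔
    (Y'.extTree k).out (f.extNode k a) (f.extEdge k b) :=
  ⟨f.extend_out_imp k a b, fun h => by
    have := f.symm.extend_out_imp k (f.extNode k a) (f.extEdge k b) h
    rwa [f.extNode_symm, f.extEdge_symm] at this⟩

theorem extend_inp_iff (f : ZoomIso Y Y') (k : ℕ) (a : (Y.extTree k).nodes)
    (b : (Y.extTree k).edges) : (Y.extTree k).inp a b ↔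
    (Y'.extTree k).inp (f.extNode k a) (f.extEdge k b) :=
  ⟨f.extend_inp_imp k a b, fun h => by
    have := f.symm.extend_inp_imp k (f.extNode k a) (f.extEdge k b) h
    rwa [f.extNode_symm, f.extEdge_symm] at this⟩

theorem extend_root_iff (f : ZoomIso Y Y') (k : ℕ) (b : (Y.extTree k).edges) :
    b.1 ∈ (Y.extTree k).root ↔ (f.extEdge k b).1 ∈ (Y'.extTree k).root :=
  ⟨f.extend_root_imp k b, fun h => by
    have := f.symm.extend_root_imp k (f.extEdge k b) h
    rwa [f.extEdge_symm] at this⟩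

theorem extend_black_iff (f : ZoomIso Y Y') (k : ℕ) (a : (Y.extTree k).nodes)
    (b : (Y.extTree (k + 1)).edges) :
    a.1 = b.1 ↔ (f.extNode k a).1 = (f.extEdge (k + 1) b).1 :=
  ⟨f.extend_black_imp k a b, fun h => by
    have := f.symm.extend_black_imp k (f.extNode k a) (f.extEdge (k + 1) b) h
    rwa [f.extNode_symm, f.extEdge_symm] at this⟩

theorem extend_white_iff (f : ZoomIso Y Y') (k : ℕ) (b : (Y.extTree k).edges)
    (w : (Y.extTree (k + 1)).nodes) : w.1 ∈ Y.extWhite k b ↔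
    (f.extNode (k + 1) w).1 ∈ Y'.extWhite k (f.extEdge k b) :=
  ⟨f.extend_white_imp k b w, fun h => by
    have := f.symm.extend_white_imp k (f.extEdge k b) (f.extNode (k + 1) w) h
    rwa [f.extNode_symm, f.extEdge_symm] at this⟩

theorem extend_whiteLT_iff (f : ZoomIso Y Y') (k : ℕ) (b : (Y.extTree k).edges)
    (w w' : (Y.extTree (k + 1)).nodes) (hw : w.1 ∈ Y.extWhite k b)
    (hw' : w'.1 ∈ Y.extWhite k b) : Y.extWhiteLT k b w w' ↔
    Y'.extWhiteLT k (f.extEdge k b) (f.extNode (k + 1) w) (f.extNode (k + 1) w') :=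
  ⟨f.extend_whiteLT_imp k b w w' hw hw', fun h => by
    have := f.symm.extend_whiteLT_imp k (f.extEdge k b) (f.extNode (k + 1) w)
      (f.extNode (k + 1) w') (f.extend_white_imp k b w hw) (f.extend_white_imp k b w' hw') h
    rwa [f.extNode_symm, f.extNode_symm, f.extEdge_symm] at this⟩

/-- The isomorphism between the extensions. -/
def extend (f : ZoomIso Y Y') : ZoomIso Y.extend Y'.extend where
  dim_eq := congrArg (· + 2) f.dim_eq
  node k := ⟨f.extNode k, f.symm.extNode k, f.extNode_symm k, f.symm.extNode_symm k⟩
  edge k := ⟨f.extEdge k, f.symm.extEdge k, f.extEdge_symm k, f.symm.extEdge_symm k⟩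
  out := f.extend_out_iff
  inp := f.extend_inp_iff
  root := f.extend_root_iff
  black := f.extend_black_iff
  white := f.extend_white_iff
  whiteLT := f.extend_whiteLT_iff

/-! ### Invariance of the nests -/

theorem desc_imp (f : ZoomIso Y Y') (k : ℕ) {s t : Y.Elem ⊕ Y.Elem}
    (h : (Y.tree k).Desc s t) (x : (Y.tree k).edges) (ht : t = .inr x.1) :
    (∀ b (_ : s = .inr b), ∃ hb : b ∈ (Y.tree k).edges,
      (Y'.tree k).Desc (.inr (f.edge k ⟨b, hb⟩)) (.inr (f.edge k x))) ∧
    (∀ a (_ : s = .inl a), ∃ ha : a ∈ (Y.tree k).nodes,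
      (Y'.tree k).Desc (.inl (f.node k ⟨a, ha⟩)) (.inr (f.edge k x))) := by
  induction h using Relation.ReflTransGen.head_induction_on with
  | refl =>
    subst ht
    refine ⟨fun b hs => ?_, fun a hs => by simp at hs⟩
    obtain rfl : x.1 = b := by simpa using hs
    exact ⟨x.2, Relation.ReflTransGen.refl⟩
  | head hst _ ih =>
    cases hst with
    | edge a b ha hb h =>
      refine ⟨fun b' hs => ?_, fun a hs => by simp at hs⟩
      obtain rfl : b = b' := by simpa using hs
      obtain ⟨_, h2⟩ := ih.2 a rfl
      exact ⟨hb, Relation.ReflTransGen.head (.edge _ _ (f.node k _).2 (f.edge k _).2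
        ((f.inp k ⟨a, ha⟩ ⟨b, hb⟩).1 h)) h2⟩
    | node a b ha hb h =>
      refine ⟨fun b hs => by simp at hs, fun a' hs => ?_⟩
      obtain rfl : a = a' := by simpa using hs
      obtain ⟨_, h2⟩ := ih.1 b rfl
      exact ⟨ha, Relation.ReflTransGen.head (.node _ _ (f.node k _).2 (f.edge k _).2
        ((f.out k ⟨a, ha⟩ ⟨b, hb⟩).1 h)) h2⟩

theorem black_imp (f : ZoomIso Y Y') (k : ℕ) (x : (Y.tree (k + 1)).edges) {a : Y.Elem}
    (h : .inl a ∈ (Y.tree k).dotsAbove (Y.white k) (Y.tree (k + 1)) (.inr x.1)) :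
    ∃ ha : a ∈ (Y.tree k).nodes, .inl (f.node k ⟨a, ha⟩).1 ∈
      (Y'.tree k).dotsAbove (Y'.white k) (Y'.tree (k + 1)) (.inr (f.edge (k + 1) x).1) := by
  obtain ⟨h1, h2⟩ := h
  have ha : a ∈ (Y.tree k).nodes := by simpa using h1
  obtain ⟨hb, h3⟩ := (f.desc_imp (k + 1) h2 x rfl).1 a rfl
  refine ⟨ha, Or.inl ⟨_, (f.node k _).2, rfl⟩, ?_⟩
  have := (f.black k ⟨a, ha⟩ ⟨a, hb⟩).1 rfl
  simpa [this] using h3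

theorem white_imp (f : ZoomIso Y Y') (k : ℕ) (x : (Y.tree (k + 1)).edges) {w : Y.Elem}
    (h : .inr w ∈ (Y.tree k).dotsAbove (Y.white k) (Y.tree (k + 1)) (.inr x.1)) :
    ∃ hw : w ∈ (Y.tree (k + 1)).nodes, .inr (f.node (k + 1) ⟨w, hw⟩).1 ∈
      (Y'.tree k).dotsAbove (Y'.white k) (Y'.tree (k + 1)) (.inr (f.edge (k + 1) x).1) := by
  obtain ⟨h1, h2⟩ := h
  obtain ⟨hw, h3⟩ := (f.desc_imp (k + 1) h2 x rfl).2 w rfl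
  obtain ⟨b, hb, h4⟩ : ∃ b ∈ (Y.tree k).edges, w ∈ Y.white k b := by simpa using h1
  exact ⟨hw, Or.inr ⟨_, (f.edge k ⟨b, hb⟩).2, _, (f.white k ⟨b, hb⟩ ⟨w, hw⟩).1 h4, rfl⟩, h3⟩

theorem nestEdges_imp (f : ZoomIso Y Y') (k : ℕ) (x : (Y.tree (k + 1)).edges)
    (b : (Y.tree k).edges)
    (h : b.1 ∈ (Y.tree k).nestEdges (Y.white k) (Y.tree (k + 1)) (.inr x.1)) :
    (f.edge k b).1 ∈
      (Y'.tree k).nestEdges (Y'.white k) (Y'.tree (k + 1)) (.inr (f.edge (k + 1) x).1) := by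
  obtain ⟨_, ⟨a, h1, h2⟩ | ⟨w, h1, h2⟩⟩ := h
  · obtain ⟨ha, h3⟩ := f.black_imp k x h1
    exact ⟨(f.edge k b).2, Or.inl ⟨_, h3, h2.imp (f.out k ⟨a, ha⟩ b).1 (f.inp k ⟨a, ha⟩ b).1⟩⟩
  · obtain ⟨hw, h3⟩ := f.white_imp k x h2
    exact ⟨(f.edge k b).2, Or.inr ⟨_, (f.white k b ⟨w, hw⟩).1 h1, h3⟩⟩

theorem nestRoot_imp (f : ZoomIso Y Y') (k : ℕ) (x : (Y.tree (k + 1)).edges)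
    (b : (Y.tree k).edges)
    (h : b.1 ∈ (Y.tree k).nestRoot (Y.white k) (Y.tree (k + 1)) (.inr x.1)) :
    (f.edge k b).1 ∈
      (Y'.tree k).nestRoot (Y'.white k) (Y'.tree (k + 1)) (.inr (f.edge (k + 1) x).1) := by
  refine ⟨f.nestEdges_imp k x b h.1, ?_⟩
  rintro ⟨a, h1, h2⟩
  obtain ⟨ha, h3⟩ := f.symm.black_imp k (f.edge (k + 1) x) h1
  refine h.2 ⟨_, by simpa [symm] using h3, (f.inp k _ b).2 ?_⟩
  simpa using h2

theorem nestLeaves_imp (f : ZoomIso Y Y') (k : ℕ) (x : (Y.tree (k + 1)).edges)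
    (b : (Y.tree k).edges)
    (h : b.1 ∈ (Y.tree k).nestLeaves (Y.white k) (Y.tree (k + 1)) (.inr x.1)) :
    (f.edge k b).1 ∈
      (Y'.tree k).nestLeaves (Y'.white k) (Y'.tree (k + 1)) (.inr (f.edge (k + 1) x).1) := by
  refine ⟨f.nestEdges_imp k x b h.1, ?_⟩
  rintro ⟨a, h1, h2⟩
  obtain ⟨ha, h3⟩ := f.symm.black_imp k (f.edge (k + 1) x) h1
  refine h.2 ⟨_, by simpa [symm] using h3, (f.out k _ b).2 ?_⟩
  simpa using h2

/-- The action of an isomorphism of opetopes on cells. -/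
def faceFun (f : ZoomIso Y Y') (p : Y.faces.Cell) : Y'.faces.Cell :=
  ⟨(p.1.1, (f.extend.edge p.1.1 ⟨p.1.2, p.2.2.2.1⟩).1), p.2.1, f.dim_eq ▸ p.2.2.1,
    (f.extend.edge p.1.1 ⟨p.1.2, p.2.2.2.1⟩).2, by
      obtain ⟨⟨j, x⟩, h1, h2, h3, h4⟩ := p
      rintro rfl
      exact (f.extend.root 1 ⟨x, h3⟩).1 (h4 rfl)⟩

theorem faceFun_symm (f : ZoomIso Y Y') (p : Y.faces.Cell) :
    f.symm.faceFun (f.faceFun p) = p := by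
  obtain ⟨⟨j, x⟩, h1, h2, h3, h4⟩ := p
  refine Subtype.ext (Prod.ext rfl ?_)
  exact congrArg Subtype.val (f.extEdge_symm j ⟨x, h3⟩)

theorem face_δ (f : ZoomIso Y Y') (p q : Y.faces.Cell) (h : q ∈ Y.faces.δ p) :
    f.faceFun q ∈ Y'.faces.δ (f.faceFun p) := by
  obtain ⟨⟨j, x⟩, h1, h2, h3, h4⟩ := p
  obtain ⟨⟨i, y⟩, g1, g2, g3, g4⟩ := q
  obtain ⟨e1, e2, e3⟩ := h
  dsimp only at e1 e2 e3
  subst e1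
  exact ⟨rfl, e2, f.extend.nestLeaves_imp i ⟨x, h3⟩ ⟨y, g3⟩ e3⟩

theorem face_γ (f : ZoomIso Y Y') (p q : Y.faces.Cell) (h : q ∈ Y.faces.γ p) :
    f.faceFun q ∈ Y'.faces.γ (f.faceFun p) := by
  obtain ⟨⟨j, x⟩, h1, h2, h3, h4⟩ := p
  obtain ⟨⟨i, y⟩, g1, g2, g3, g4⟩ := q
  obtain ⟨e1, e3⟩ := h
  dsimp only at e1 e3
  subst e1
  exact ⟨rfl, f.extend.nestRoot_imp i ⟨x, h3⟩ ⟨y, g3⟩ e3⟩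

theorem face_localLT (f : ZoomIso Y Y') (p z y y' : Y.faces.Cell) (hy : Y.faces.Loop z y)
    (hy' : Y.faces.Loop z y') (h : Y.faces.localLT p z y y') :
    Y'.faces.localLT (f.faceFun p) (f.faceFun z) (f.faceFun y) (f.faceFun y') := by
  obtain ⟨⟨i, x⟩, h1, h2, h3, h4⟩ := z
  obtain ⟨⟨j, b⟩, g1, g2, g3, g4⟩ := y
  obtain ⟨⟨j', b'⟩, k1, k2, k3, k4⟩ := y'
  have e := hy.1.1
  have e' := hy'.1.1
  dsimp only at e e'
  subst e e'
  intro w w' hw hw'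
  obtain ⟨m, hm⟩ := f.extend.symm.white_imp i (f.extend.edge (i + 1) ⟨b, g3⟩) hw
  obtain ⟨m', hm'⟩ := f.extend.symm.white_imp i (f.extend.edge (i + 1) ⟨b', k3⟩) hw'
  have a1 : (f.extend.symm.edge (i + 1) (f.extend.edge (i + 1) ⟨b, g3⟩)) = ⟨b, g3⟩ :=
    Equiv.symm_apply_apply _ _
  have a2 : (f.extend.symm.edge (i + 1) (f.extend.edge (i + 1) ⟨b', k3⟩)) = ⟨b', k3⟩ :=
    Equiv.symm_apply_apply _ _
  rw [a1] at hm
  rw [a2] at hm'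
  obtain ⟨c1, c2, c3⟩ := h _ _ hm hm'
  have d1 := (f.extend.white i ⟨x, h3⟩ (f.extend.symm.node (i + 1) ⟨w, m⟩)).1 c1
  have d2 := (f.extend.white i ⟨x, h3⟩ (f.extend.symm.node (i + 1) ⟨w', m'⟩)).1 c2
  have d3 := (f.extend.whiteLT i ⟨x, h3⟩ (f.extend.symm.node (i + 1) ⟨w, m⟩)
    (f.extend.symm.node (i + 1) ⟨w', m'⟩) c1 c2).1 c3
  have b1 : f.extend.node (i + 1) (f.extend.symm.node (i + 1) ⟨w, m⟩) = ⟨w, m⟩ :=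
    Equiv.apply_symm_apply _ _
  have b2 : f.extend.node (i + 1) (f.extend.symm.node (i + 1) ⟨w', m'⟩) = ⟨w', m'⟩ :=
    Equiv.apply_symm_apply _ _
  rw [b1] at d1 d3
  rw [b2] at d2 d3
  exact ⟨d1, d2, d3⟩

theorem faceFun_isMorphism (f : ZoomIso Y Y') : Y.faces.IsMorphism Y'.faces f.faceFun := by
  have hinj : Function.Injective f.faceFun := Function.LeftInverse.injective f.faceFun_symm
  refine ⟨fun x => rfl, fun x _ => ⟨fun y hy => f.face_δ x y hy, hinj.injOn, fun y hy => ?_⟩,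
    fun x _ => Set.Subset.antisymm ?_ fun y hy => ?_, ?_⟩
  · refine ⟨f.symm.faceFun y, ?_, f.symm.faceFun_symm y⟩
    have := f.symm.face_δ _ _ hy
    rwa [f.faceFun_symm] at this
  · rintro _ ⟨y, hy, rfl⟩
    exact f.face_γ x y hy
  · refine ⟨f.symm.faceFun y, ?_, f.symm.faceFun_symm y⟩
    have := f.symm.face_γ _ _ hy
    rwa [f.faceFun_symm] at this
  · intro x _ _ z y y' h1 _ h2 _ h
    exact f.face_localLT x z y y' h1 h2 h

/-- The isomorphism of face complexes induced by an isomorphism of opetopes: it acts on cells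
as the given map on edges. -/
def faces (f : ZoomIso Y Y') : DFCIso Y.faces Y'.faces where
  toEquiv := ⟨f.faceFun, f.symm.faceFun, f.faceFun_symm, f.symm.faceFun_symm⟩
  hom := f.faceFun_isMorphism
  inv := f.symm.faceFun_isMorphism

theorem extEdge_refl (Y : PreZoom.{u}) (k : ℕ) (b : (Y.extTree k).edges) :
    (refl Y).extEdge k b = b := by
  obtain ⟨x | e, h⟩ := b
  · simp only [extEdge, refl]
    split_ifs <;> rfl
  · rfl

theorem extEdge_trans (f : ZoomIso Y Y') (g : ZoomIso Y' Y'') (k : ℕ)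
    (b : (Y.extTree k).edges) : (f.trans g).extEdge k b = g.extEdge k (f.extEdge k b) := by
  have := f.dim_eq
  obtain ⟨x | e, h⟩ := b
  · by_cases hk : k ≤ Y.dim
    · have hk' : k ≤ Y'.dim := this ▸ hk
      simp [extEdge, trans, hk, hk']
    · have hk' : ¬ k ≤ Y'.dim := this ▸ hk
      simp [extEdge, trans, hk, hk']
  · rfl

end ZoomIso

/-- The functor `P`, once its values are known to be dendritic face complexes. -/
def Pfunctor (hP : ∀ Y : KJBM.{u}, Y.toPreZoom.faces.IsDFC) : KJBM.{u} ⥤ DFCcore.{u} where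
  obj Y := ⟨Y.toPreZoom.faces, hP Y⟩
  map f := ZoomIso.faces f
  map_id Y := by
    refine DFCIso.ext (Equiv.ext fun p => Subtype.ext (Prod.ext rfl ?_))
    exact congrArg Subtype.val (ZoomIso.extEdge_refl Y.toPreZoom p.1.1 ⟨p.1.2, p.2.2.2.1⟩)
  map_comp {Y Y' Y''} f g := by
    refine DFCIso.ext (Equiv.ext fun p => Subtype.ext (Prod.ext rfl ?_))
    exact congrArg Subtype.val
      (ZoomIso.extEdge_trans (Y := Y.toPreZoom) (Y' := Y'.toPreZoom) (Y'' := Y''.toPreZoom)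
        f g p.1.1 ⟨p.1.2, p.2.2.2.1⟩)

open Classical in
/-- The map `θ` on cells: the greatest cell is sent to `⊤`, its target to the root edge of
`S_{n+1}`, and every other cell `x` to the edge `x`. -/
noncomputable def thetaFun (C : PreMOP.{u}) (x : C.Cell) : ℕ × C.zoom.extend.Elem :=
  ((C.dim x + 2).toNat,
    if C.IsTop x then .inr .top
    else if ∃ ω, C.IsTop ω ∧ x ∈ C.γ ω then .inr .root
    else .inl (.inl x))

open Relation

/-! ## Finite sums of signs -/

/-! Everything is governed by signs. For cells `z`, `x` let `ε(z, x)` be `1`, `-1` or `0` according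
as `z ≺⁺ x`, `z ≺⁻ x` or neither (`eps`). If `t ≺⁺ x`, oriented thinness says that `ε(z, t)` is the
sum of the `ε(z, y)` over the sources `y` of `x`, where each nonzero sign occurs at most once
(`eps_target_eq_sum`, `thin_unique`). A function on the edges of a rooted tree that is additive at
the nodes is determined by its values on the leaves (`eq_leafSum`). These two facts carry both
directions.

From a complex `C` to an opetope: the graph `cellTree k` with nodes `Λ_{k+1}` and edges `C_k` is a
rooted tree with leaves `Λ_k`. This is proved by descending induction on `k` (`TreeHyp.pred`). If
`r` is the iterated target of `ω` in dimension `k + 1`, then the sign formula for `r` over the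
leaves `Λ_{k+1}` shows that every `z ≠ γ(r)` of dimension `k` is a source of a node and that `γ(r)`
is not; acyclicity makes the descending paths end. Loops are invisible to signs and are controlled
by `loop_of_loop_target`: if the target of a non-loop is a loop on `z`, then so are all its sources.

The kernel rule is handled through a local description of connected sets of dots, `IsNest`, proved
equivalent to connectedness in `connected_iff`. It amounts to closure under passing to lower dots
until a root edge is reached, and convexity on that edge. For white dots `w`, `w'` on `z`, the
descending paths in the tree above meet at a node `x` with branches `y ≠ y'`, and `z` must be a
facet of both branches (`facet_of_siblings`). Hence `w` and `w'` can be compared by the signs of `z`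
in `y` and `y'`, or by the local order at `x` if both are loops (`MeetLT`). This is visibly a strict
total order. It is contained in the order `◂` defined by zig-zags, and `◂` is asymmetric, so the two
agree (`whiteLT_iff_meetLT`). With this description the dots above a cell `y` form a nest whose root
edge is `γ(y)` and whose leaves are `δ(y)` (`cell_isNest`, `cell_nestRoot`, `cell_nestLeaves`).

From an opetope to a complex: the extension of an opetope is again an opetope. The sign of an edge
`z` in the nest of `y` is the sum of its signs at the black dots of the nest, so it is additive over
nests in the next degree (`finsum_nestSign`), and thinness can be read off from this additivity
(`thin_of_sum`). Acyclicity holds because targets move strictly towards the root.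

For `θ`, the extended trees of `Z(C)` are the images of the cell trees under one injective renaming,
so roots, leaves and white dots of nests are transported. For `τ`, the cells in `Λ` are leaves,
hence nodes one degree below, and their nests are single black dots; the order of white dots is
recovered from `TreeHyp.whiteLT_iff`. -/

open Classical in
theorem finsum_mem_sign {α : Type*} {S : Set α} (hS : S.Finite) (f : α → ℤ)
    (hf : ∀ y ∈ S, f y = 1 ∨ f y = -1 ∨ f y = 0)
    (hp : ∀ y ∈ S, ∀ y' ∈ S, f y = 1 → f y' = 1 → y = y')
    (hn : ∀ y ∈ S, ∀ y' ∈ S, f y = -1 → f y' = -1 → y = y') :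
    ∑ᶠ y ∈ S, f y =
      (if ∃ y ∈ S, f y = 1 then 1 else 0) - (if ∃ y ∈ S, f y = -1 then 1 else 0) := by
  -- At most one element has the value `v`, so the indicator of that value sums to `0` or `1`. The
  -- function is the indicator of `1` minus the indicator of `-1`.
  have key : ∀ v : ℤ, (∀ y ∈ S, ∀ y' ∈ S, f y = v → f y' = v → y = y') →
      ∑ y ∈ hS.toFinset, (if f y = v then (1 : ℤ) else 0) = if ∃ y ∈ S, f y = v then 1 else 0 := by
    intro v hv
    split_ifs with h
    · obtain ⟨y, hy, hyv⟩ := h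
      rw [Finset.sum_eq_single y]
      · simp [hyv]
      · intro y' hy' hne
        rw [if_neg]
        intro h'
        exact hne (hv y' (by simpa using hy') y hy h' hyv)
      · intro h'
        exact absurd (by simpa using hy) h'
    · refine Finset.sum_eq_zero fun y hy => if_neg fun h' => h ⟨y, by simpa using hy, h'⟩
  rw [finsum_mem_eq_finite_toFinset_sum f hS, ← key 1 hp, ← key (-1) hn,
    ← Finset.sum_sub_distrib]
  refine Finset.sum_congr rfl fun y hy => ?_
  rcases hf y (by simpa using hy) with h | h | h <;> rw [h] <;> norm_num

theorem exists_pos_of_finsum_mem_pos {α : Type*} {S : Set α} (f : α → ℤ)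
    (h : 0 < ∑ᶠ y ∈ S, f y) : ∃ y ∈ S, 0 < f y := by
  by_contra hc
  push Not at hc
  exact h.not_ge (finsum_mem_induction (· ≤ 0) le_rfl (fun _ _ => add_nonpos) hc)

theorem exists_neg_of_finsum_mem_neg {α : Type*} {S : Set α} (f : α → ℤ)
    (h : ∑ᶠ y ∈ S, f y < 0) : ∃ y ∈ S, f y < 0 := by
  by_contra hc
  push Not at hc
  exact h.not_ge (finsum_mem_induction (0 ≤ ·) le_rfl (fun _ _ => add_nonneg) hc)

/-! ## Rooted trees -/

namespace PreTree

variable {N E : Type u}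

/-- The number of elements on the descending path from `s`. -/
noncomputable def depth (T : PreTree N E) (s : N ⊕ E) : ℕ := {t | T.Desc s t}.ncard

/-- The number of elements from which a descending path leads to `s`. -/
noncomputable def height (T : PreTree N E) (s : N ⊕ E) : ℕ := {t | T.Desc t s}.ncard

/-- The leaves above an edge. -/
def leavesAbove (T : PreTree N E) (b : E) : Set E := {l | l ∈ T.leaves ∧ T.Desc (.inr l) (.inr b)}

namespace IsRootedTree

variable {T : PreTree N E} {a a' : N} {b b' : E} {s s' t t' : N ⊕ E}

theorem step_inp (hT : T.IsRootedTree) (h : T.inp a b) : T.Step (.inr b) (.inl a) :=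
  .edge a b (hT.inp_mem a b h).1 (hT.inp_mem a b h).2 h

theorem step_out (hT : T.IsRootedTree) (h : T.out a b) : T.Step (.inl a) (.inr b) :=
  .node a b (hT.out_mem a b h).1 (hT.out_mem a b h).2 h

theorem desc_inp (hT : T.IsRootedTree) (h : T.inp a b) : T.Desc (.inr b) (.inl a) :=
  .single (hT.step_inp h)

theorem desc_out (hT : T.IsRootedTree) (h : T.out a b) : T.Desc (.inl a) (.inr b) :=
  .single (hT.step_out h)

theorem desc_inp_out (hT : T.IsRootedTree) (h : T.inp a b) (h' : T.out a b') :
    T.Desc (.inr b) (.inr b') := (hT.desc_inp h).trans (hT.desc_out h')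

theorem out_unique (hT : T.IsRootedTree) (h : T.out a b) (h' : T.out a b') : b = b' :=
  (hT.target_edge a (hT.out_mem a b h).1).unique h h'

theorem exists_out (hT : T.IsRootedTree) (h : a ∈ T.nodes) : ∃ b, T.out a b :=
  (hT.target_edge a h).exists

theorem step_unique (hT : T.IsRootedTree) (h : T.Step s t) (h' : T.Step s t') : t = t' := by
  cases h with
  | edge a b ha hb h =>
    cases h' with
    | edge a' _ _ _ h' => rw [hT.target_node a a' b h h']
  | node a b ha hb h =>
    cases h' with
    | node _ b' _ _ h' => rw [hT.out_unique h h']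

theorem total (hT : T.IsRootedTree) (h : T.Desc s t) (h' : T.Desc s t') :
    T.Desc t t' ∨ T.Desc t' t :=
  ReflTransGen.total_of_right_unique (fun _ _ _ => hT.step_unique) h h'

theorem exists_root (hT : T.IsRootedTree) : ∃ r ∈ T.edges, T.root = {r} ∧ (∀ a, ¬ T.inp a r) ∧
    ∀ s t, T.Step s t → T.Desc s (.inr r) := by
  obtain ⟨r, hr, h1, h2, h3⟩ := hT.root
  refine ⟨r, hr, h1, h2, fun s t h => ?_⟩
  cases h with
  | edge a b ha hb h => exact h3 b hb
  | node a b ha hb h => exact ReflTransGen.head (hT.step_out h) (h3 b hb)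

/-- Steps are deterministic and none starts at the root. A cycle through `s` can be rotated along
the descending path from `s` until it passes through the root. -/
theorem acyclic (hT : T.IsRootedTree) : ¬ TransGen T.Step s s := by
  obtain ⟨r, hr, h1, h2, h3⟩ := hT.exists_root
  intro h
  obtain ⟨u, hu, -⟩ := TransGen.head'_iff.1 h
  have hs := h3 s u hu
  clear hu
  revert h
  induction hs using ReflTransGen.head_induction_on with
  | refl =>
    intro h
    obtain ⟨u, hu, -⟩ := TransGen.head'_iff.1 h
    cases hu with
    | edge a _ _ _ h => exact h2 a h
  | head hst _ ih =>
    intro h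
    obtain ⟨u, hu, hus⟩ := TransGen.head'_iff.1 h
    obtain rfl := hT.step_unique hu hst
    exact ih (TransGen.tail' hus hst)

theorem antisymm (hT : T.IsRootedTree) (h : T.Desc s t) (h' : T.Desc t s) : s = t := by
  rcases reflTransGen_iff_eq_or_transGen.1 h with h | h
  · exact h.symm
  · exact (hT.acyclic (h.trans_left h')).elim

theorem not_step_of_desc (hT : T.IsRootedTree) (h : T.Desc t s) : ¬ T.Step s t :=
  fun h' => hT.acyclic (TransGen.head' h' h)

theorem out_ne_inp (hT : T.IsRootedTree) (h : T.out a b) : ¬ T.inp a b :=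
  fun h' => hT.not_step_of_desc (hT.desc_inp h') (hT.step_out h)

theorem desc_inr_cases (h : T.Desc s (.inr b)) :
    s = .inr b ∨ ∃ a, T.out a b ∧ T.Desc s (.inl a) := by
  rcases ReflTransGen.cases_tail h with h | ⟨c, h1, h2⟩
  · exact Or.inl h.symm
  · cases h2 with
    | node a _ _ _ h => exact Or.inr ⟨a, h, h1⟩

theorem desc_inl_cases (h : T.Desc s (.inl a)) :
    s = .inl a ∨ ∃ b, T.inp a b ∧ T.Desc s (.inr b) := by
  rcases ReflTransGen.cases_tail h with h | ⟨c, h1, h2⟩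
  · exact Or.inl h.symm
  · cases h2 with
    | edge _ b _ _ h => exact Or.inr ⟨b, h, h1⟩

theorem desc_out_cases (hT : T.IsRootedTree) (ho : T.out a b) (h : T.Desc s (.inr b)) :
    s = .inr b ∨ T.Desc s (.inl a) := by
  rcases desc_inr_cases h with h | ⟨a', h1, h2⟩
  · exact Or.inl h
  · rw [hT.source_node a a' b ho h1]
    exact Or.inr h2

theorem desc_of_inp (hT : T.IsRootedTree) (h : T.inp a b) (hd : T.Desc (.inr b) t) :
    t = .inr b ∨ T.Desc (.inl a) t := by
  rcases ReflTransGen.cases_head hd with h' | ⟨c, h1, h2⟩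
  · exact Or.inl h'.symm
  · rw [hT.step_unique (hT.step_inp h) h1]
    exact Or.inr h2

theorem desc_of_out (hT : T.IsRootedTree) (h : T.out a b) (hd : T.Desc (.inl a) t) :
    t = .inl a ∨ T.Desc (.inr b) t := by
  rcases ReflTransGen.cases_head hd with h' | ⟨c, h1, h2⟩
  · exact Or.inl h'.symm
  · rw [hT.step_unique (hT.step_out h) h1]
    exact Or.inr h2

theorem desc_leaf (h : b ∈ T.leaves) (hd : T.Desc s (.inr b)) : s = .inr b := by
  rcases desc_inr_cases hd with h' | ⟨a, h1, _⟩
  · exact h'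
  · exact (h.2 a h1).elim

/-- Descending paths from `s` are totally ordered, so one of the two edges lies above the other. If
they differ, the path between them passes through `a` and then re-enters `a`, a cycle. -/
theorem eq_of_desc_siblings (hT : T.IsRootedTree) (h : T.inp a b) (h' : T.inp a b')
    (hs : T.Desc s (.inr b)) (hs' : T.Desc s (.inr b')) : b = b' := by
  have key : ∀ {b b'}, T.inp a b → T.inp a b' → T.Desc (.inr b) (.inr b') → b = b' := by
    intro b b' h h' hd
    rcases hT.desc_of_inp h hd with h1 | h1
    · exact (Sum.inr.inj h1).symm
    · exact (hT.not_step_of_desc h1 (hT.step_inp h')).elim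
  rcases hT.total hs hs' with h1 | h1
  · exact key h h' h1
  · exact (key h' h h1).symm

/-- Follow both paths backwards from `t` to the place where they separate. This place is a node,
because an edge has at most one source node. -/
theorem exists_meet (hT : T.IsRootedTree) (h : T.Desc s t) (h' : T.Desc s' t)
    (hn : ¬ T.Desc s s') (hn' : ¬ T.Desc s' s) :
    ∃ a b b', b ≠ b' ∧ T.inp a b ∧ T.inp a b' ∧ T.Desc s (.inr b) ∧ T.Desc s' (.inr b') := by
  induction h with
  | refl => exact (hn' h').elim
  | @tail u t hu hut ih =>
    rcases ReflTransGen.cases_tail h' with h1 | ⟨c, h1, h2⟩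
    · subst h1
      exact (hn (hu.tail hut)).elim
    · by_cases hcu : c = u
      · exact ih (hcu ▸ h1)
      · cases hut with
        | edge a b _ _ hb =>
          cases h2 with
          | edge _ b' _ _ hb' =>
            exact ⟨a, b, b', fun e => hcu (e ▸ rfl), hb, hb', hu, h1⟩
        | node a b _ _ hb =>
          cases h2 with
          | node a' _ _ _ hb' => exact (hcu (by rw [hT.source_node a a' b hb hb'])).elim

/-- Both `b` and `b₁` are on the path from `s`. If one were strictly above the other, then `s'`
would descend through its node into the lower edge, and so lie above two distinct sources of the
lower node. -/
theorem meet_unique (hT : T.IsRootedTree) {b₁ b₁' : E} (h : T.inp a b) (h' : T.inp a b')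
    (hne : b ≠ b') (h₁ : T.inp a' b₁) (h₁' : T.inp a' b₁') (hne₁ : b₁ ≠ b₁')
    (hs : T.Desc s (.inr b)) (hs' : T.Desc s' (.inr b'))
    (hs₁ : T.Desc s (.inr b₁)) (hs₁' : T.Desc s' (.inr b₁')) : a = a' ∧ b = b₁ ∧ b' = b₁' := by
  have key : ∀ {a a' b b' b₁ b₁'}, T.inp a b → T.inp a b' → T.inp a' b₁ → T.inp a' b₁' →
      b₁ ≠ b₁' → T.Desc s' (.inr b') → T.Desc s' (.inr b₁') →
      T.Desc (.inr b) (.inr b₁) → b = b₁ := by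
    intro a a' b b' b₁ b₁' h h' h₁ h₁' hne₁ hs' hs₁' hd
    rcases hT.desc_of_inp h hd with e | e
    · exact (Sum.inr.inj e).symm
    · exact (hne₁ (hT.eq_of_desc_siblings h₁ h₁' ((hs'.trans (hT.desc_inp h')).trans e) hs₁')).elim
  have e : b = b₁ := by
    rcases hT.total hs hs₁ with hd | hd
    · exact key h h' h₁ h₁' hne₁ hs' hs₁' hd
    · exact (key h₁ h₁' h h' hne hs₁' hs' hd).symm
  subst e
  have e := hT.target_node a a' b h h₁
  subst e
  exact ⟨rfl, rfl, hT.eq_of_desc_siblings h' h₁' hs' hs₁'⟩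

theorem desc_finite (hT : T.IsRootedTree) (s : N ⊕ E) : {t | T.Desc s t}.Finite := by
  refine ((hT.nodes_finite.image Sum.inl).union
    ((hT.edges_finite.image Sum.inr).union (Set.finite_singleton s))).subset fun t ht => ?_
  rcases ReflTransGen.cases_tail ht with h | ⟨c, _, h⟩
  · exact Or.inr (Or.inr h)
  · cases h with
    | edge a b ha hb _ => exact Or.inl ⟨a, ha, rfl⟩
    | node a b ha hb _ => exact Or.inr (Or.inl ⟨b, hb, rfl⟩)

theorem asc_finite (hT : T.IsRootedTree) (s : N ⊕ E) : {t | T.Desc t s}.Finite := by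
  refine ((hT.nodes_finite.image Sum.inl).union
    ((hT.edges_finite.image Sum.inr).union (Set.finite_singleton s))).subset fun t ht => ?_
  rcases ReflTransGen.cases_head ht with h | ⟨c, h, _⟩
  · exact Or.inr (Or.inr h)
  · cases h with
    | edge a b ha hb _ => exact Or.inr (Or.inl ⟨b, hb, rfl⟩)
    | node a b ha hb _ => exact Or.inl ⟨a, ha, rfl⟩

theorem depth_lt (hT : T.IsRootedTree) (h : T.Desc s t) (hne : s ≠ t) :
    T.depth t < T.depth s := by
  refine Set.ncard_lt_ncard ⟨fun u hu => h.trans hu, fun hc => hne ?_⟩ (hT.desc_finite s)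
  exact hT.antisymm h (hc (show T.Desc s s from ReflTransGen.refl))

theorem height_lt (hT : T.IsRootedTree) (h : T.Desc s t) (hne : s ≠ t) :
    T.height s < T.height t := by
  refine Set.ncard_lt_ncard ⟨fun u hu => ReflTransGen.trans hu h, fun hc => hne ?_⟩
    (hT.asc_finite t)
  exact hT.antisymm h (hc (show T.Desc t t from ReflTransGen.refl))

/-- Induction on edges, from the leaves to the root. -/
theorem up_induction (hT : T.IsRootedTree) {P : E → Prop}
    (h : ∀ b ∈ T.edges, (∀ a b', T.out a b → T.inp a b' → P b') → P b) :
    ∀ b ∈ T.edges, P b := by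
  intro b hb
  induction hm : T.height (.inr b) using Nat.strong_induction_on generalizing b with
  | _ m ih =>
    subst hm
    refine h b hb fun a b' ho hi => ih _ ?_ b' (hT.inp_mem a b' hi).2 rfl
    refine hT.height_lt (hT.desc_inp_out hi ho) fun e => ?_
    exact hT.out_ne_inp ho (Sum.inr.inj e ▸ hi)

theorem leavesAbove_leaf (h : b ∈ T.leaves) : T.leavesAbove b = {b} := by
  ext l
  constructor
  · rintro ⟨_, h2⟩
    exact Sum.inr.inj (desc_leaf h h2)
  · rintro rfl
    exact ⟨h, ReflTransGen.refl⟩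

theorem leavesAbove_out (hT : T.IsRootedTree) (ho : T.out a b) :
    T.leavesAbove b = ⋃ b' ∈ {b' | T.inp a b'}, T.leavesAbove b' := by
  ext l
  simp only [Set.mem_iUnion, Set.mem_ofPred_eq, exists_prop, leavesAbove]
  constructor
  · rintro ⟨hl, hd⟩
    rcases hT.desc_out_cases ho hd with e | hd
    · exact (hl.2 a (Sum.inr.inj e ▸ ho)).elim
    · rcases desc_inl_cases hd with e | ⟨b', hi, hd⟩
      · simp at e
      · exact ⟨b', hi, hl, hd⟩
  · rintro ⟨b', hi, hl, hd⟩
    exact ⟨hl, hd.trans (hT.desc_inp_out hi ho)⟩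

theorem leavesAbove_finite (hT : T.IsRootedTree) (b : E) : (T.leavesAbove b).Finite :=
  hT.edges_finite.subset fun _ h => h.1.1

theorem inp_finite (hT : T.IsRootedTree) (a : N) : {b | T.inp a b}.Finite :=
  hT.edges_finite.subset fun _ h => (hT.inp_mem _ _ h).2

theorem leafSum_out (hT : T.IsRootedTree) (f : E → ℤ) (ho : T.out a b) :
    ∑ᶠ l ∈ T.leavesAbove b, f l =
      ∑ᶠ b' ∈ {b' | T.inp a b'}, ∑ᶠ l ∈ T.leavesAbove b', f l := by
  rw [hT.leavesAbove_out ho, finsum_mem_biUnion _ (hT.inp_finite a)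
    fun b' _ => hT.leavesAbove_finite b']
  intro b₁ h₁ b₂ h₂ hne
  refine Set.disjoint_left.2 fun l hl hl' => hne ?_
  exact hT.eq_of_desc_siblings h₁ h₂ hl.2 hl'.2

/-- A function on edges that is additive at the nodes is determined by its values on leaves. -/
theorem eq_leafSum (hT : T.IsRootedTree) (f : E → ℤ)
    (hf : ∀ a b, T.out a b → f b = ∑ᶠ b' ∈ {b' | T.inp a b'}, f b') :
    ∀ b ∈ T.edges, f b = ∑ᶠ l ∈ T.leavesAbove b, f l := by
  refine hT.up_induction fun b hb ih => ?_
  by_cases hl : b ∈ T.leaves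
  · rw [leavesAbove_leaf hl, finsum_mem_singleton]
  · obtain ⟨a, ho⟩ : ∃ a, T.out a b := by
      by_contra hc
      push Not at hc
      exact hl ⟨hb, hc⟩
    rw [hf a b ho, hT.leafSum_out f ho]
    exact finsum_mem_congr rfl fun b' hi => ih a b' ho hi

end IsRootedTree

end PreTree

/-! ## Connected parts of a subdivided tree -/

namespace PreTree

variable {N E V : Type u}

/-- The dot `d` lies on the edge `z`; a black dot is attributed to its target edge. -/
def OnEdge (T : PreTree N E) (W : E → Set V) : N ⊕ V → E → Prop
  | .inl a, z => T.out a z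
  | .inr w, z => w ∈ W z

/-- The white dot `v` lies on the edge `z`, below the dot `d` of that edge. -/
def Under (W : E → Set V) (lt : E → V → V → Prop) (z : E) (v : V) : N ⊕ V → Prop
  | .inl _ => v ∈ W z
  | .inr w => v ∈ W z ∧ lt z v w

/-- White dots on the edges of a tree. -/
structure IsSubdivision (T : PreTree N E) (W : E → Set V) (lt : E → V → V → Prop) : Prop where
  edge : ∀ b w, w ∈ W b → b ∈ T.edges
  finite : ∀ b, (W b).Finite
  order : ∀ b, IsStrictTotalOrder (W b) fun w w' => lt b w w'
  disjoint : ∀ b b' w, w ∈ W b → w ∈ W b' → b = b'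

/-- The set `D` of dots is connected, with `z₀` as root edge of the subtree that it spans. -/
structure IsNest (T : PreTree N E) (W : E → Set V) (lt : E → V → V → Prop) (D : Set (N ⊕ V))
    (z₀ : E) : Prop where
  bottom : ∃ d ∈ D, T.OnEdge W d z₀
  inner : ∀ d ∈ D, ∀ z, T.OnEdge W d z → z ≠ z₀ → ∃ a, T.inp a z ∧ .inl a ∈ D
  under : ∀ d ∈ D, ∀ z, T.OnEdge W d z → z ≠ z₀ → ∀ v, Under W lt z v d → .inr v ∈ D
  convex : ∀ d ∈ D, T.OnEdge W d z₀ → ∀ v, Under W lt z₀ v d → ∀ u, .inr u ∈ D →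
    Under (N := N) W lt z₀ u (.inr v) → .inr v ∈ D
  root : ∀ a, T.inp a z₀ → .inl a ∉ D

/-- The dot `d'` is the lower neighbour of the dot `d` in the subdivided tree. -/
def Parent (T : PreTree N E) (W : E → Set V) (lt : E → V → V → Prop) (d d' : N ⊕ V) : Prop :=
  ∃ e ∈ (T.subdivide W lt).edges, (T.subdivide W lt).inp d' e ∧ (T.subdivide W lt).out d e

/-- The number of white dots below a dot on its edge. -/
noncomputable def pos (W : E → Set V) (lt : E → V → V → Prop) (z : E) (d : N ⊕ V) : ℕ :=
  {v | Under W lt z v d}.ncard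

namespace IsSubdivision

variable {T : PreTree N E} {W : E → Set V} {lt : E → V → V → Prop} {z z' : E} {v v' w : V}
  {d d' : N ⊕ V} {D : Set (N ⊕ V)}

theorem irrefl (hS : T.IsSubdivision W lt) (hw : w ∈ W z) : ¬ lt z w w := by
  have := hS.order z
  exact irrefl_of (fun w w' : W z => lt z w w') ⟨w, hw⟩

theorem trans (hS : T.IsSubdivision W lt) (h₁ : v ∈ W z) (h₂ : v' ∈ W z) (h₃ : w ∈ W z)
    (h : lt z v v') (h' : lt z v' w) : lt z v w := by
  have := hS.order z
  exact trans_of (fun w w' : W z => lt z w w') (a := ⟨v, h₁⟩) (b := ⟨v', h₂⟩) (c := ⟨w, h₃⟩) h h'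

theorem trichotomous (hS : T.IsSubdivision W lt) (h₁ : v ∈ W z) (h₂ : v' ∈ W z) :
    lt z v v' ∨ v = v' ∨ lt z v' v := by
  have := hS.order z
  simpa using trichotomous_of (fun w w' : W z => lt z w w') ⟨v, h₁⟩ ⟨v', h₂⟩

theorem asymm (hS : T.IsSubdivision W lt) (h₁ : v ∈ W z) (h₂ : v' ∈ W z)
    (h : lt z v v') : ¬ lt z v' v := fun h' => hS.irrefl h₁ (hS.trans h₁ h₂ h₁ h h')

theorem under_mem (h : Under W lt z v d) : v ∈ W z := by
  cases d with
  | inl a => exact h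
  | inr w => exact h.1

theorem under_trans (hS : T.IsSubdivision W lt) (hd : T.OnEdge W d z) (h : Under W lt z v d)
    (h' : Under (N := N) W lt z w (.inr v)) : Under W lt z w d := by
  cases d with
  | inl a => exact h'.1
  | inr u => exact ⟨h'.1, hS.trans h'.1 h.1 hd h'.2 h.2⟩

theorem pos_lt (hS : T.IsSubdivision W lt) (hd : T.OnEdge W d z) (h : Under W lt z v d) :
    pos (N := N) W lt z (.inr v) < pos W lt z d := by
  refine Set.ncard_lt_ncard ⟨fun u hu => hS.under_trans hd h hu, fun hc => ?_⟩
    ((hS.finite z).subset fun u hu => under_mem hu)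
  exact hS.irrefl (under_mem h) (hc h).2

theorem onEdge_unique (hS : T.IsSubdivision W lt) (hT : T.IsRootedTree) (hd : T.OnEdge W d z)
    (hd' : T.OnEdge W d z') : z = z' := by
  cases d with
  | inl a => exact hT.out_unique hd hd'
  | inr w => exact hS.disjoint _ _ _ hd hd'

theorem parent_inr (hS : T.IsSubdivision W lt) : T.Parent W lt d (.inr w) ↔
    ∃ z, T.OnEdge W d z ∧ Under W lt z w d ∧ ∀ v, Under W lt z v d → ¬ lt z w v := by
  constructor
  · rintro ⟨⟨z, s⟩, _, ⟨h1, h2⟩, h3⟩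
    obtain rfl : s = some w := h2
    cases d with
    | inl a => exact ⟨z, h3.1, h3.2.1, h3.2.2⟩
    | inr u => exact ⟨z, h3.1, ⟨h3.2.1, h3.2.2.1⟩, fun v hv h => h3.2.2.2 v hv.1 ⟨h, hv.2⟩⟩
  · rintro ⟨z, h1, h2, h3⟩
    have hw := under_mem h2
    refine ⟨(z, some w), ⟨hS.edge _ _ hw, ?_⟩, ⟨hw, rfl⟩, ?_⟩
    · rintro _ ⟨⟩
      exact hw
    · cases d with
      | inl a => exact ⟨h1, hw, h3⟩
      | inr u => exact ⟨h1, hw, h2.2, fun v hv h => h3 v ⟨hv, h.2⟩ h.1⟩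

theorem parent_inl (hT : T.IsRootedTree) {a : N} : T.Parent W lt d (.inl a) ↔
    ∃ z, T.OnEdge W d z ∧ T.inp a z ∧ ∀ v, ¬ Under W lt z v d := by
  constructor
  · rintro ⟨⟨z, s⟩, _, ⟨h1, h2⟩, h3⟩
    obtain rfl : s = none := h2
    cases d with
    | inl a =>
      refine ⟨z, h3.1, h1, fun v hv => ?_⟩
      have := h3.2
      exact (Set.eq_empty_iff_forall_notMem.1 this) v hv
    | inr u => exact ⟨z, h3.1, h1, fun v hv => h3.2 v hv.1 hv.2⟩
  · rintro ⟨z, h1, h2, h3⟩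
    refine ⟨(z, none), ⟨(hT.inp_mem _ _ h2).2, by simp⟩, ⟨h2, rfl⟩, ?_⟩
    cases d with
    | inl a => exact ⟨h1, Set.eq_empty_iff_forall_notMem.2 h3⟩
    | inr u => exact ⟨h1, fun v hv h => h3 v ⟨hv, h⟩⟩

theorem parent_unique (hS : T.IsSubdivision W lt) (hT : T.IsRootedTree) {e e' : N ⊕ V}
    (h : T.Parent W lt d e) (h' : T.Parent W lt d e') : e = e' := by
  cases e with
  | inl a =>
    obtain ⟨z, h1, h2, h3⟩ := (parent_inl hT).1 h
    cases e' with
    | inl a' =>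
      obtain ⟨z', h1', h2', h3'⟩ := (parent_inl hT).1 h'
      obtain rfl := hS.onEdge_unique hT h1 h1'
      rw [hT.target_node _ _ _ h2 h2']
    | inr w' =>
      obtain ⟨z', h1', h2', h3'⟩ := hS.parent_inr.1 h'
      obtain rfl := hS.onEdge_unique hT h1 h1'
      exact (h3 _ h2').elim
  | inr w =>
    obtain ⟨z, h1, h2, h3⟩ := hS.parent_inr.1 h
    cases e' with
    | inl a' =>
      obtain ⟨z', h1', h2', h3'⟩ := (parent_inl hT).1 h'
      obtain rfl := hS.onEdge_unique hT h1 h1'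
      exact (h3' _ h2).elim
    | inr w' =>
      obtain ⟨z', h1', h2', h3'⟩ := hS.parent_inr.1 h'
      obtain rfl := hS.onEdge_unique hT h1 h1'
      rcases hS.trichotomous (under_mem h2) (under_mem h2') with h | h | h
      · exact (h3 _ h2' h).elim
      · rw [h]
      · exact (h3' _ h2 h).elim

/-- Among the finitely many white dots under `d`, the one with the greatest `pos` is the lower
neighbour. -/
theorem exists_parent_of_under (hS : T.IsSubdivision W lt) (hd : T.OnEdge W d z)
    (h : Under W lt z v d) : ∃ p, T.Parent W lt d (.inr p) ∧ Under W lt z p d ∧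
      (v = p ∨ Under (N := N) W lt z v (.inr p)) := by
  obtain ⟨p, hp, hmax⟩ := Set.exists_max_image {v | Under W lt z v d}
    (fun v => pos (N := N) W lt z (.inr v))
    ((hS.finite z).subset fun u hu => under_mem hu) ⟨v, h⟩
  have hp' : ∀ v, Under W lt z v d → ¬ lt z p v := fun u hu hlt =>
    (hS.pos_lt (T := T) (d := .inr u) (under_mem hu) ⟨under_mem hp, hlt⟩).not_ge (hmax u hu)
  refine ⟨p, hS.parent_inr.2 ⟨z, hd, hp, hp'⟩, hp, ?_⟩
  rcases hS.trichotomous (under_mem h) (under_mem hp) with h1 | h1 | h1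
  · exact Or.inr ⟨under_mem h, h1⟩
  · exact Or.inl h1
  · exact (hp' v h h1).elim

/-- Passing to lower neighbours inside `D` terminates: a white neighbour is on the same edge with
smaller `pos`, a black one has a target edge of smaller `depth`. The bound on depths later excludes
black dots below the root edge. -/
theorem exists_bottom (hS : T.IsSubdivision W lt) (hT : T.IsRootedTree) (hd : d ∈ D)
    (hz : T.OnEdge W d z) : ∃ e z', e ∈ D ∧ T.OnEdge W e z' ∧
      T.depth (.inr z') ≤ T.depth (.inr z) ∧ (∀ f ∈ D, ¬ T.Parent W lt e f) ∧
      ReflTransGen (fun x y => T.Parent W lt x y ∧ y ∈ D) d e := by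
  induction hm : T.depth (.inr z) using Nat.strong_induction_on generalizing z d with
  | _ m ihm =>
  induction hp : pos W lt z d using Nat.strong_induction_on generalizing d with
  | _ p ihp =>
  subst hm hp
  by_cases hn : ∀ f ∈ D, ¬ T.Parent W lt d f
  · exact ⟨d, z, hd, hz, le_rfl, hn, .refl⟩
  · push Not at hn
    obtain ⟨f, hf, hpar⟩ := hn
    cases f with
    | inl a =>
      obtain ⟨z', h1, h2, h3⟩ := (parent_inl hT).1 hpar
      obtain rfl := hS.onEdge_unique hT hz h1
      obtain ⟨z', ho⟩ := hT.exists_out (hT.inp_mem _ _ h2).1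
      have hlt : T.depth (.inr z') < T.depth (.inr z) :=
        hT.depth_lt (hT.desc_inp_out h2 ho) fun e => hT.out_ne_inp ho (Sum.inr.inj e ▸ h2)
      obtain ⟨e, z₁, h4, h5, h6, h7, h8⟩ := ihm _ hlt hf ho rfl
      exact ⟨e, z₁, h4, h5, by omega, h7, .head ⟨hpar, hf⟩ h8⟩
    | inr w =>
      obtain ⟨z', h1, h2, h3⟩ := hS.parent_inr.1 hpar
      obtain rfl := hS.onEdge_unique hT hz h1
      obtain ⟨e, z₁, h4, h5, h6, h7, h8⟩ :=
        ihp _ (hS.pos_lt hz h2) hf (show T.OnEdge W (.inr w) z from under_mem h2) rfl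
      exact ⟨e, z₁, h4, h5, h6, h7, .head ⟨hpar, hf⟩ h8⟩

/-- A set of dots is connected when exactly one of its elements has no lower neighbour in it. -/
theorem connected_iff_bottom (hS : T.IsSubdivision W lt) (hT : T.IsRootedTree)
    (hD : ∀ d ∈ D, ∃ z, T.OnEdge W d z) : ((T.subdivide W lt).graph.induce D).Connected ↔
      ∃ d₀ ∈ D, (∀ f ∈ D, ¬ T.Parent W lt d₀ f) ∧
        ∀ d ∈ D, (∀ f ∈ D, ¬ T.Parent W lt d f) → d = d₀ := by
  constructor
  · intro hc
    obtain ⟨⟨d, hd⟩⟩ := hc.nonempty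
    obtain ⟨z, hz⟩ := hD d hd
    obtain ⟨d₀, -, h1, -, -, h2, -⟩ := hS.exists_bottom hT hd hz
    refine ⟨d₀, h1, h2, fun e he hne => ?_⟩
    -- Invariant along a walk from `d₀`: the current dot descends to `d₀` inside `D`. A step upwards
    -- lengthens this descent; a step downwards shortens it, since lower neighbours are unique and
    -- `d₀` has none in `D`.
    have key : ∀ x : D, ReflTransGen ((T.subdivide W lt).graph.induce D).Adj ⟨d₀, h1⟩ x →
        ReflTransGen (fun x y => T.Parent W lt x y ∧ y ∈ D) x.1 d₀ := by
      intro x hx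
      induction hx with
      | refl => exact .refl
      | @tail x y _ hxy ih =>
        rcases hxy with ⟨-, h | h⟩
        · exact .head ⟨h, x.2⟩ ih
        · rcases ReflTransGen.cases_head ih with h' | ⟨c, ⟨h3, _⟩, h4⟩
          · exact (h2 y y.2 (h' ▸ h)).elim
          · have hcy : c = y.1 := hS.parent_unique hT h3 h
            exact hcy ▸ h4
    rcases ReflTransGen.cases_head
      (key ⟨e, he⟩ ((SimpleGraph.reachable_iff_reflTransGen _ _).1 (hc.preconnected _ _))) with
      h | ⟨c, ⟨h3, h4⟩, _⟩
    · exact h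
    · exact (hne c h4 h3).elim
  · rintro ⟨d₀, h1, h2, h3⟩
    rw [SimpleGraph.connected_iff_exists_forall_reachable]
    refine ⟨⟨d₀, h1⟩, fun ⟨e, he⟩ => ?_⟩
    obtain ⟨z, hz⟩ := hD e he
    obtain ⟨f, -, h4, -, -, h5, h6⟩ := hS.exists_bottom hT he hz
    obtain rfl := h3 f h4 h5
    clear h4 h5 hz
    induction h6 using ReflTransGen.head_induction_on with
    | refl => exact SimpleGraph.Reachable.refl _
    | @head x y hxy _ ih =>
      refine (ih hxy.2).trans ?_
      by_cases hne : y = x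
      · subst hne
        exact SimpleGraph.Reachable.refl _
      · exact SimpleGraph.Adj.reachable (show (T.subdivide W lt).graph.Adj y x from
          ⟨hne, Or.inl hxy.1⟩)

/-- The connected sets of dots are the nests. -/
theorem connected_iff (hS : T.IsSubdivision W lt) (hT : T.IsRootedTree)
    (hD : ∀ d ∈ D, ∃ z, T.OnEdge W d z) :
    ((T.subdivide W lt).graph.induce D).Connected ↔ ∃ z₀, T.IsNest W lt D z₀ := by
  rw [hS.connected_iff_bottom hT hD]
  constructor
  · rintro ⟨d₀, h1, h2, h3⟩
    obtain ⟨z₀, hz₀⟩ := hD d₀ h1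
    -- A white dot under an element of `D` but missing from `D` lies under `d₀`: the lowest element
    -- of `D` above the gap on that edge has its lower neighbour outside `D`, so it is the bottom.
    have low : ∀ d ∈ D, ∀ z, T.OnEdge W d z → ∀ v, Under W lt z v d → .inr v ∉ D →
        z = z₀ ∧ Under W lt z v d₀ := by
      intro d hd z hz v hv hvD
      obtain ⟨d', ⟨h4, h5, h6⟩, h7⟩ := (measure (pos (N := N) W lt z)).wf.has_min
        {d | d ∈ D ∧ T.OnEdge W d z ∧ Under W lt z v d} ⟨d, hd, hz, hv⟩
      obtain ⟨p, hp, hp1, hp2⟩ := hS.exists_parent_of_under h5 h6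
      have hpD : .inr p ∉ D := by
        intro hpD
        rcases hp2 with rfl | hp2
        · exact hvD hpD
        · exact h7 _ ⟨hpD, under_mem hp1, hp2⟩ (hS.pos_lt h5 hp1)
      obtain rfl := h3 d' h4 fun f hf hf' => hpD (hS.parent_unique hT hf' hp ▸ hf)
      exact ⟨hS.onEdge_unique hT h5 hz₀, h6⟩
    -- A black dot of `D` below `z₀` would descend to a bottom on an edge of smaller depth than
    -- `z₀`, but the only bottom is on `z₀`.
    have root : ∀ a, T.inp a z₀ → .inl a ∉ D := by
      intro a ha haD
      obtain ⟨z, ho⟩ := hT.exists_out (hT.inp_mem _ _ ha).1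
      obtain ⟨e, z', h4, h5, h6, h7, -⟩ :=
        hS.exists_bottom (d := .inl a) (z := z) hT haD ho
      obtain rfl := h3 e h4 h7
      obtain rfl := hS.onEdge_unique hT h5 hz₀
      have := hT.depth_lt (hT.desc_inp_out ha ho) fun e => hT.out_ne_inp ho (Sum.inr.inj e ▸ ha)
      omega
    -- Take the lowest element of `D` on `z` at or below `d`. It is either `d₀`, or its lower
    -- neighbour in `D` is black.
    have inner : ∀ d ∈ D, ∀ z, T.OnEdge W d z → ((∃ a, T.inp a z ∧ .inl a ∈ D) ∨
        (T.OnEdge W d₀ z ∧ (d = d₀ ∨ ∃ w, d₀ = .inr w ∧ Under W lt z w d))) := by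
      intro d hd z hz
      obtain ⟨d', ⟨h4, h5, h6⟩, h7⟩ := (measure (pos (N := N) W lt z)).wf.has_min
        {e | e ∈ D ∧ T.OnEdge W e z ∧ (d = e ∨ ∃ w, e = .inr w ∧ Under W lt z w d)}
        ⟨d, hd, hz, Or.inl rfl⟩
      by_cases hd' : d' = d₀
      · subst hd'
        exact Or.inr ⟨h5, h6⟩
      · have : ¬ ∀ f ∈ D, ¬ T.Parent W lt d' f := fun h => hd' (h3 d' h4 h)
        push Not at this
        obtain ⟨f, hf, hpar⟩ := this
        cases f with
        | inl a =>
          obtain ⟨z', h8, h9, _⟩ := (parent_inl hT).1 hpar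
          obtain rfl := hS.onEdge_unique hT h5 h8
          exact Or.inl ⟨a, h9, hf⟩
        | inr w =>
          obtain ⟨z', h8, h9, _⟩ := hS.parent_inr.1 hpar
          obtain rfl := hS.onEdge_unique hT h5 h8
          refine (h7 _ ⟨hf, under_mem h9, Or.inr ⟨w, rfl, ?_⟩⟩ (hS.pos_lt h5 h9)).elim
          rcases h6 with rfl | ⟨u, rfl, hu⟩
          · exact h9
          · exact hS.under_trans hz hu h9
    refine ⟨z₀, ⟨d₀, h1, hz₀⟩, ?_, ?_, ?_, root⟩
    · intro d hd z hz hne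
      rcases inner d hd z hz with h | ⟨h, -⟩
      · exact h
      · exact (hne (hS.onEdge_unique hT h hz₀)).elim
    · intro d hd z hz hne v hv
      by_contra hvD
      exact hne (low d hd z hz v hv hvD).1
    · intro d hd hz v hv u hu huv
      by_contra hvD
      obtain ⟨-, h4⟩ := low d hd z₀ hz v hv hvD
      rcases inner (.inr u) hu z₀ huv.1 with ⟨a, ha, haD⟩ | ⟨-, h | ⟨w, rfl, hw⟩⟩
      · exact root a ha haD
      · subst h
        exact hS.asymm huv.1 h4.1 huv.2 h4.2
      · exact hS.asymm h4.1 hw.1 h4.2 (hS.trans hw.1 huv.1 h4.1 hw.2 huv.2)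
  · rintro ⟨z₀, hn⟩
    -- On an edge other than `z₀`, closure under lower dots provides a lower neighbour inside `D`,
    -- white or black.
    have onroot : ∀ d ∈ D, (∀ f ∈ D, ¬ T.Parent W lt d f) → T.OnEdge W d z₀ := by
      intro d hd hf
      obtain ⟨z, hz⟩ := hD d hd
      by_cases hne : z = z₀
      · exact hne ▸ hz
      by_cases hv : ∃ v, Under W lt z v d
      · obtain ⟨v, hv⟩ := hv
        obtain ⟨p, hp, hp1, hp2⟩ := hS.exists_parent_of_under hz hv
        exact (hf _ (hn.under d hd z hz hne p hp1) hp).elim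
      · push Not at hv
        obtain ⟨a, ha, haD⟩ := hn.inner d hd z hz hne
        exact (hf _ haD ((parent_inl hT).2 ⟨z, hz, ha, hv⟩)).elim
    have uniq : ∀ d ∈ D, ∀ u, .inr u ∈ D → T.OnEdge W d z₀ → Under W lt z₀ u d →
        ∃ f ∈ D, T.Parent W lt d f := by
      intro d hd u hu hz huz
      obtain ⟨p, hp, hp1, hp2⟩ := hS.exists_parent_of_under hz huz
      refine ⟨_, ?_, hp⟩
      rcases hp2 with rfl | hp2
      · exact hu
      · exact hn.convex d hd hz p hp1 u hu hp2
    obtain ⟨d, hd, hz⟩ := hn.bottom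
    obtain ⟨d₀, z', h1, -, -, h2, -⟩ := hS.exists_bottom hT hd hz
    have hz₀ := onroot d₀ h1 h2
    refine ⟨d₀, h1, h2, fun e he hne => ?_⟩
    have hez := onroot e he hne
    by_contra hcon
    -- Two distinct bottoms would both be on `z₀`, where at most one dot is black, so one of them is
    -- a white dot under the other.
    have : (∃ u, d₀ = .inr u ∧ Under W lt z₀ u e) ∨ ∃ u, e = .inr u ∧ Under W lt z₀ u d₀ := by
      cases d₀ with
      | inl a =>
        cases e with
        | inl a' => exact (hcon (by rw [hT.source_node _ _ _ hez hz₀])).elim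
        | inr w => exact Or.inr ⟨w, rfl, hez⟩
      | inr w =>
        cases e with
        | inl a' => exact Or.inl ⟨w, rfl, hz₀⟩
        | inr w' =>
          rcases hS.trichotomous hz₀ hez with h | h | h
          · exact Or.inl ⟨w, rfl, hz₀, h⟩
          · exact (hcon (by rw [h])).elim
          · exact Or.inr ⟨w', rfl, hez, h⟩
    rcases this with ⟨u, rfl, hu⟩ | ⟨u, rfl, hu⟩
    · obtain ⟨f, hf, hpar⟩ := uniq e he u h1 hez hu
      exact hne f hf hpar
    · obtain ⟨f, hf, hpar⟩ := uniq d₀ h1 u he hz₀ hu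
      exact h2 f hf hpar

end IsSubdivision

end PreTree

/-! ## Nests of an exact constellation -/

namespace PreTree

variable {A : Type u} {T U : PreTree A A} {W : A → Set A} {lt : A → A → A → Prop} {x : A ⊕ A}

theorem inl_mem_dotsAbove {a : A} :
    .inl a ∈ T.dotsAbove W U x ↔ a ∈ T.nodes ∧ U.Desc (.inr a) x := by
  simp [dotsAbove]

theorem inr_mem_dotsAbove {w : A} :
    .inr w ∈ T.dotsAbove W U x ↔ (∃ b ∈ T.edges, w ∈ W b) ∧ U.Desc (.inl w) x := by
  simp [dotsAbove]

theorem dotsAbove_mono {y : A ⊕ A} (h : U.Desc x y) :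
    T.dotsAbove W U x ⊆ T.dotsAbove W U y := fun _ hd => ⟨hd.1, hd.2.trans h⟩

theorem exists_onEdge (hT : T.IsRootedTree) : ∀ d ∈ T.dotsAbove W U x, ∃ z, T.OnEdge W d z := by
  rintro (a | w) hd
  · exact hT.exists_out (inl_mem_dotsAbove.1 hd).1
  · obtain ⟨⟨b, _, hb⟩, _⟩ := inr_mem_dotsAbove.1 hd
    exact ⟨b, hb⟩

theorem onEdge_mem_nestEdges (hT : T.IsRootedTree) (hS : T.IsSubdivision W lt) {d : A ⊕ A} {z : A}
    (hd : d ∈ T.dotsAbove W U x) (hz : T.OnEdge W d z) : z ∈ T.nestEdges W U x := by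
  cases d with
  | inl a => exact ⟨(hT.out_mem _ _ hz).2, Or.inl ⟨a, hd, Or.inl hz⟩⟩
  | inr w => exact ⟨hS.edge _ _ hz, Or.inr ⟨w, hz, hd⟩⟩

/-- The subtree spanned by the dots above `x`, without its white dots. -/
def nestTree (T : PreTree A A) (W : A → Set A) (U : PreTree A A) (x : A ⊕ A) : PreTree A A where
  nodes := {a | .inl a ∈ T.dotsAbove W U x}
  edges := T.nestEdges W U x
  out a b := .inl a ∈ T.dotsAbove W U x ∧ T.out a b
  inp a b := .inl a ∈ T.dotsAbove W U x ∧ T.inp a b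
  root := T.nestRoot W U x

theorem nestTree_leaves : (T.nestTree W U x).leaves = T.nestLeaves W U x := by
  ext b
  simp [leaves, nestLeaves, nestTree]

theorem nestTree_desc {s t : A ⊕ A} (h : (T.nestTree W U x).Desc s t) : T.Desc s t := by
  refine ReflTransGen.mono (fun s t h => ?_) s t h
  cases h with
  | edge a b ha hb h => exact .edge a b (inl_mem_dotsAbove.1 ha).1 hb.1 h.2
  | node a b ha hb h => exact .node a b (inl_mem_dotsAbove.1 ha).1 hb.1 h.2

theorem mem_nestEdges_of_out (hT : T.IsRootedTree) {a b : A} (ha : .inl a ∈ T.dotsAbove W U x)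
    (h : T.out a b) : b ∈ T.nestEdges W U x :=
  ⟨(hT.out_mem _ _ h).2, Or.inl ⟨a, ha, Or.inl h⟩⟩

theorem mem_nestEdges_of_inp (hT : T.IsRootedTree) {a b : A} (ha : .inl a ∈ T.dotsAbove W U x)
    (h : T.inp a b) : b ∈ T.nestEdges W U x :=
  ⟨(hT.inp_mem _ _ h).2, Or.inl ⟨a, ha, Or.inr h⟩⟩

namespace IsNest

variable {z₀ : A}

theorem nestRoot_eq (hn : T.IsNest W lt (T.dotsAbove W U x) z₀) (hT : T.IsRootedTree)
    (hS : T.IsSubdivision W lt) : T.nestRoot W U x = {z₀} := by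
  ext z
  constructor
  · rintro ⟨⟨h1, h2⟩, h3⟩
    by_contra hne
    have : ∃ d ∈ T.dotsAbove W U x, T.OnEdge W d z := by
      rcases h2 with ⟨a, ha, h | h⟩ | ⟨w, hw, hd⟩
      · exact ⟨_, ha, h⟩
      · exact (h3 ⟨a, ha, h⟩).elim
      · exact ⟨_, hd, hw⟩
    obtain ⟨d, hd, hz⟩ := this
    obtain ⟨a, ha, haD⟩ := hn.inner d hd z hz hne
    exact h3 ⟨a, haD, ha⟩
  · rintro rfl
    obtain ⟨d, hd, hz⟩ := hn.bottom
    refine ⟨onEdge_mem_nestEdges hT hS hd hz, ?_⟩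
    rintro ⟨a, ha, h⟩
    exact hn.root a h ha

theorem exists_inp_of_ne (hn : T.IsNest W lt (T.dotsAbove W U x) z₀) (hT : T.IsRootedTree)
    (hS : T.IsSubdivision W lt) {z : A} (hz : z ∈ T.nestEdges W U x) (hne : z ≠ z₀) :
    ∃ a, .inl a ∈ T.dotsAbove W U x ∧ T.inp a z := by
  by_contra hc
  have : z ∈ T.nestRoot W U x := ⟨hz, hc⟩
  rw [hn.nestRoot_eq hT hS] at this
  exact hne this

theorem nestTree_desc_root (hn : T.IsNest W lt (T.dotsAbove W U x) z₀) (hT : T.IsRootedTree)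
    (hS : T.IsSubdivision W lt) {z : A} (hz : z ∈ T.nestEdges W U x) :
    (T.nestTree W U x).Desc (.inr z) (.inr z₀) := by
  induction hm : T.depth (.inr z) using Nat.strong_induction_on generalizing z with
  | _ m ih =>
    subst hm
    by_cases hne : z = z₀
    · subst hne
      exact .refl
    · obtain ⟨a, ha, hi⟩ := hn.exists_inp_of_ne hT hS hz hne
      obtain ⟨z', ho⟩ := hT.exists_out (hT.inp_mem _ _ hi).1
      have hz' := mem_nestEdges_of_out hT ha ho
      refine .head (.edge a z ha hz ⟨ha, hi⟩) (.head (.node a z' ha hz' ⟨ha, ho⟩) ?_)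
      refine ih _ (hT.depth_lt (hT.desc_inp_out hi ho) fun e => ?_) hz' rfl
      exact hT.out_ne_inp ho (Sum.inr.inj e ▸ hi)

theorem nestTree_isRootedTree (hn : T.IsNest W lt (T.dotsAbove W U x) z₀) (hT : T.IsRootedTree)
    (hS : T.IsSubdivision W lt) : (T.nestTree W U x).IsRootedTree where
  nodes_finite := hT.nodes_finite.subset fun _ h => (inl_mem_dotsAbove.1 h).1
  edges_finite := hT.edges_finite.subset fun _ h => h.1
  out_mem _ _ h := ⟨h.1, mem_nestEdges_of_out hT h.1 h.2⟩
  inp_mem _ _ h := ⟨h.1, mem_nestEdges_of_inp hT h.1 h.2⟩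
  target_edge a ha := by
    obtain ⟨b, h1, h2⟩ := hT.target_edge a (inl_mem_dotsAbove.1 ha).1
    exact ⟨b, ⟨ha, h1⟩, fun b' h => h2 b' h.2⟩
  source_node _ _ _ h h' := hT.source_node _ _ _ h.2 h'.2
  target_node _ _ _ h h' := hT.target_node _ _ _ h.2 h'.2
  root := by
    have h := hn.nestRoot_eq hT hS
    have h' : z₀ ∈ T.nestRoot W U x := h ▸ rfl
    exact ⟨z₀, h'.1, h, fun a ha => hn.root a ha.2 ha.1, fun b hb => hn.nestTree_desc_root hT hS hb⟩

theorem desc_root (hn : T.IsNest W lt (T.dotsAbove W U x) z₀) (hT : T.IsRootedTree)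
    (hS : T.IsSubdivision W lt) {z : A} (hz : z ∈ T.nestEdges W U x) :
    T.Desc (.inr z) (.inr z₀) := nestTree_desc (hn.nestTree_desc_root hT hS hz)

theorem nestTree_desc_of_desc (hn : T.IsNest W lt (T.dotsAbove W U x) z₀) (hT : T.IsRootedTree)
    (hS : T.IsSubdivision W lt) {y y' : A} (hy : y ∈ T.nestEdges W U x)
    (hy' : y' ∈ T.nestEdges W U x) (h : T.Desc (.inr y) (.inr y')) :
    (T.nestTree W U x).Desc (.inr y) (.inr y') := by
  induction hm : T.depth (.inr y) using Nat.strong_induction_on generalizing y with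
  | _ m ih =>
    subst hm
    by_cases hne : y = z₀
    · subst hne
      rw [Sum.inr.inj (hT.antisymm h (hn.desc_root hT hS hy'))]
      exact .refl
    · obtain ⟨a, ha, hi⟩ := hn.exists_inp_of_ne hT hS hy hne
      obtain ⟨z', ho⟩ := hT.exists_out (hT.inp_mem _ _ hi).1
      have hz' := mem_nestEdges_of_out hT ha ho
      rcases hT.desc_of_inp hi h with e | h
      · rw [Sum.inr.inj e]
        exact .refl
      rcases hT.desc_of_out ho h with e | h
      · simp at e
      refine .head (.edge a y ha hy ⟨ha, hi⟩) (.head (.node a z' ha hz' ⟨ha, ho⟩) ?_)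
      refine ih _ (hT.depth_lt (hT.desc_inp_out hi ho) fun e => ?_) hz' h rfl
      exact hT.out_ne_inp ho (Sum.inr.inj e ▸ hi)

/-- Descending paths from `s` are totally ordered, and a path between two edges of the nest stays in
the nest. A path in the nest that arrives at one of its leaves is trivial. -/
theorem nestLeaves_disjoint (hn : T.IsNest W lt (T.dotsAbove W U x) z₀) (hT : T.IsRootedTree)
    (hS : T.IsSubdivision W lt) {y y' : A} {s : A ⊕ A} (hy : y ∈ T.nestLeaves W U x)
    (hy' : y' ∈ T.nestLeaves W U x) (h : T.Desc s (.inr y)) (h' : T.Desc s (.inr y')) : y = y' := by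
  rcases hT.total h h' with h | h
  · have h := hn.nestTree_desc_of_desc hT hS hy.1 hy'.1 h
    exact Sum.inr.inj (IsRootedTree.desc_leaf (nestTree_leaves ▸ hy') h)
  · have h := hn.nestTree_desc_of_desc hT hS hy'.1 hy.1 h
    exact (Sum.inr.inj (IsRootedTree.desc_leaf (nestTree_leaves ▸ hy) h)).symm

theorem exists_nestLeaf_above (hn : T.IsNest W lt (T.dotsAbove W U x) z₀) (hT : T.IsRootedTree)
    (hS : T.IsSubdivision W lt) {l : A} (hl : l ∈ T.leaves) {z : A} (hz : z ∈ T.nestEdges W U x)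
    (h : T.Desc (.inr l) (.inr z)) : ∃ y ∈ T.nestLeaves W U x, T.Desc (.inr l) (.inr y) := by
  revert h
  refine (hn.nestTree_isRootedTree hT hS).up_induction (P := fun z => T.Desc (.inr l) (.inr z) →
    ∃ y ∈ T.nestLeaves W U x, T.Desc (.inr l) (.inr y)) (fun z hz ih h => ?_) z hz
  by_cases hy : z ∈ T.nestLeaves W U x
  · exact ⟨z, hy, h⟩
  · obtain ⟨a, ha, ho⟩ : ∃ a, .inl a ∈ T.dotsAbove W U x ∧ T.out a z := by
      by_contra hc
      exact hy ⟨hz, hc⟩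
    rcases hT.desc_out_cases ho h with e | h
    · exact (hl.2 a (Sum.inr.inj e ▸ ho)).elim
    · rcases IsRootedTree.desc_inl_cases h with e | ⟨b, hi, h⟩
      · simp at e
      · exact ih a b ⟨ha, ho⟩ ⟨ha, hi⟩ h

/-- If the subtree has a black dot, then one of them has the root edge as target. -/
theorem exists_out_root (hn : T.IsNest W lt (T.dotsAbove W U x) z₀) (hT : T.IsRootedTree)
    {a : A} (ha : .inl a ∈ T.dotsAbove W U x) :
    ∃ a', .inl a' ∈ T.dotsAbove W U x ∧ T.out a' z₀ := by
  obtain ⟨z, ho⟩ := hT.exists_out (inl_mem_dotsAbove.1 ha).1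
  induction hm : T.depth (.inr z) using Nat.strong_induction_on generalizing z a with
  | _ m ih =>
    subst hm
    by_cases hne : z = z₀
    · exact ⟨a, ha, hne ▸ ho⟩
    · obtain ⟨a', hi, ha'⟩ := hn.inner _ ha z ho hne
      obtain ⟨z', ho'⟩ := hT.exists_out (hT.inp_mem _ _ hi).1
      refine ih _ (hT.depth_lt (hT.desc_inp_out hi ho') fun e => ?_) ha' z' ho' rfl
      exact hT.out_ne_inp ho' (Sum.inr.inj e ▸ hi)

/-- If the root edge is a leaf, then the subtree has only white dots, all on the root edge. -/
theorem eq_root_of_loop (hn : T.IsNest W lt (T.dotsAbove W U x) z₀) (hT : T.IsRootedTree)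
    (hS : T.IsSubdivision W lt) {z : A} (hz : z ∈ T.nestRoot W U x)
    (hz' : z ∈ T.nestLeaves W U x) :
    z = z₀ ∧ (∀ a, .inl a ∉ T.dotsAbove W U x) ∧
      (∀ w, .inr w ∈ T.dotsAbove W U x → w ∈ W z₀) ∧ T.nestEdges W U x = {z₀} := by
  have e : z = z₀ := by
    rw [hn.nestRoot_eq hT hS] at hz
    exact hz
  subst e
  have hb : ∀ a, .inl a ∉ T.dotsAbove W U x := fun a ha =>
    hz'.2 (hn.exists_out_root hT ha)
  refine ⟨rfl, hb, fun w hw => ?_, ?_⟩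
  · obtain ⟨⟨b, _, hwb⟩, _⟩ := inr_mem_dotsAbove.1 hw
    by_cases hne : b = z
    · exact hne ▸ hwb
    · obtain ⟨a, _, ha⟩ := hn.inner _ hw b hwb hne
      exact (hb a ha).elim
  · refine Set.eq_singleton_iff_unique_mem.2 ⟨hz.1, fun y hy => ?_⟩
    by_contra hne
    obtain ⟨a, ha, _⟩ := hn.exists_inp_of_ne hT hS hy hne
    exact hb a ha

end IsNest

/-- The kernel rule concerns nodes whereas faces are indexed by edges. Between an edge and its
source node there is no dot, since an edge with a source node is not a leaf. -/
theorem dotsAbove_inr_eq_inl (hb : T.nodes = U.leaves) (hU : U.IsRootedTree) {a y : A}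
    (ho : U.out a y) : T.dotsAbove W U (.inr y) = T.dotsAbove W U (.inl a) := by
  refine Set.Subset.antisymm (fun d hd => ⟨hd.1, ?_⟩) (dotsAbove_mono (hU.desc_out ho))
  rcases hU.desc_out_cases ho hd.2 with e | h
  · cases d with
    | inl b =>
      have hbl : b ∈ U.leaves := hb ▸ (inl_mem_dotsAbove.1 hd).1
      obtain rfl : b = y := Sum.inr.inj e
      exact (hbl.2 a ho).elim
    | inr w => simp at e
  · exact h

namespace IsExactConstellation

theorem isSubdivision (hc : T.IsExactConstellation W lt U) : T.IsSubdivision W lt :=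
  ⟨hc.white_edge, hc.white_finite, hc.white_order, hc.white_disjoint⟩

theorem inl_mem (hc : T.IsExactConstellation W lt U) {a y : A} :
    .inl a ∈ T.dotsAbove W U (.inr y) ↔ a ∈ U.leavesAbove y := by
  rw [inl_mem_dotsAbove, hc.black]
  rfl

theorem mem_nulldots (hc : T.IsExactConstellation W lt U) {b w : A} (h : w ∈ W b) :
    w ∈ U.nulldots := hc.white ▸ ⟨b, h⟩

theorem exists_white (hc : T.IsExactConstellation W lt U) {w : A} (h : w ∈ U.nulldots) :
    ∃ b, w ∈ W b := by
  rw [← hc.white] at h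
  exact h

theorem inr_mem (hc : T.IsExactConstellation W lt U) {w : A} {x : A ⊕ A} :
    .inr w ∈ T.dotsAbove W U x ↔ w ∈ U.nulldots ∧ U.Desc (.inl w) x := by
  rw [inr_mem_dotsAbove]
  refine and_congr_left fun _ => ⟨fun ⟨b, _, h⟩ => hc.mem_nulldots h, fun h => ?_⟩
  obtain ⟨b, hb⟩ := hc.exists_white h
  exact ⟨b, hc.white_edge _ _ hb, hb⟩

theorem dotsAbove_leaf (hc : T.IsExactConstellation W lt U) {y : A} (hy : y ∈ U.leaves) :
    T.dotsAbove W U (.inr y) = {.inl y} := by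
  ext d
  cases d with
  | inl a =>
    rw [hc.inl_mem, IsRootedTree.leavesAbove_leaf hy]
    simp
  | inr w =>
    rw [hc.inr_mem]
    refine ⟨fun h => ?_, fun h => by simp at h⟩
    have := IsRootedTree.desc_leaf hy h.2
    simp at this

theorem dotsAbove_out (hc : T.IsExactConstellation W lt U) (hU : U.IsRootedTree) {a y : A}
    (ho : U.out a y) : T.dotsAbove W U (.inr y) = T.dotsAbove W U (.inl a) :=
  dotsAbove_inr_eq_inl hc.black hU ho

/-- Going up from any edge, one arrives at a leaf, which is a black dot, or at a sourceless node,
which is a white dot. -/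
theorem dotsAbove_nonempty (hc : T.IsExactConstellation W lt U) (hU : U.IsRootedTree) :
    ∀ y ∈ U.edges, (T.dotsAbove W U (.inr y)).Nonempty := by
  refine hU.up_induction fun y hy ih => ?_
  by_cases hl : y ∈ U.leaves
  · rw [hc.dotsAbove_leaf hl]
    exact ⟨_, rfl⟩
  · obtain ⟨a, ho⟩ : ∃ a, U.out a y := by
      by_contra h
      push Not at h
      exact hl ⟨hy, h⟩
    by_cases hn : ∃ b, U.inp a b
    · obtain ⟨b, hi⟩ := hn
      exact (ih a b ho hi).mono (dotsAbove_mono (hU.desc_inp_out hi ho))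
    · push Not at hn
      exact ⟨.inr a, hc.inr_mem.2 ⟨⟨(hU.out_mem _ _ ho).1, hn⟩, hU.desc_out ho⟩⟩

/-- A leaf gives a single black dot, which the kernel rule does not cover. For the other edges the
rule applies at the source node. -/
theorem exists_isNest (hc : T.IsExactConstellation W lt U) (hT : T.IsRootedTree)
    (hU : U.IsRootedTree) {y : A} (hy : y ∈ U.edges) :
    ∃ z₀, T.IsNest W lt (T.dotsAbove W U (.inr y)) z₀ := by
  by_cases hl : y ∈ U.leaves
  · rw [hc.dotsAbove_leaf hl]
    have hyT : y ∈ T.nodes := hc.black ▸ hl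
    obtain ⟨z₀, ho⟩ := hT.exists_out hyT
    refine ⟨z₀, ⟨_, rfl, ho⟩, ?_, ?_, ?_, ?_⟩
    · rintro _ rfl z hz hne
      exact (hne (hT.out_unique hz ho)).elim
    · rintro _ rfl z hz hne
      exact (hne (hT.out_unique hz ho)).elim
    · intro _ _ _ _ _ u hu
      simp at hu
    · intro a ha h
      obtain rfl : a = y := by simpa using h
      exact hT.out_ne_inp ho ha
  · obtain ⟨a, ho⟩ : ∃ a, U.out a y := by
      by_contra h
      push Not at h
      exact hl ⟨hy, h⟩
    rw [hc.dotsAbove_out hU ho]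
    exact (hc.isSubdivision.connected_iff hT (exists_onEdge hT)).1
      (hc.kernel a (hU.out_mem _ _ ho).1)

end IsExactConstellation

/-! ### Signs -/

open Classical in
/-- The sign of an edge with respect to a node. -/
noncomputable def nodeSign (T : PreTree A A) (z a : A) : ℤ :=
  if T.out a z then 1 else if T.inp a z then -1 else 0

/-- The sign of an edge with respect to the subtree spanned by the dots above `y`. -/
noncomputable def nestSign (T U : PreTree A A) (z y : A) : ℤ :=
  ∑ᶠ a ∈ U.leavesAbove y, T.nodeSign z a

theorem nodeSign_eq_one {z a : A} : T.nodeSign z a = 1 ↔ T.out a z := by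
  unfold nodeSign
  split_ifs <;> simp [*]

theorem nodeSign_eq_neg_one (hT : T.IsRootedTree) {z a : A} :
    T.nodeSign z a = -1 ↔ T.inp a z := by
  unfold nodeSign
  split_ifs with h1 h2
  · simp [hT.out_ne_inp h1]
  · simp [h2]
  · simp [h2]

-- An edge is the target of at most one node and a source of at most one node, so each nonzero sign
-- occurs at most once in the sum.
open Classical in
theorem nestSign_eq (hT : T.IsRootedTree) (hU : U.IsRootedTree) (z y : A) :
    T.nestSign U z y = (if ∃ a ∈ U.leavesAbove y, T.out a z then 1 else 0) -
      (if ∃ a ∈ U.leavesAbove y, T.inp a z then 1 else 0) := by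
  unfold nestSign
  rw [finsum_mem_sign (hU.leavesAbove_finite y)]
  · simp only [nodeSign_eq_one, nodeSign_eq_neg_one hT]
  · intro a _
    unfold nodeSign
    split_ifs <;> simp
  · intro a _ a' _ h h'
    exact hT.source_node _ _ _ (nodeSign_eq_one.1 h) (nodeSign_eq_one.1 h')
  · intro a _ a' _ h h'
    exact hT.target_node _ _ _ ((nodeSign_eq_neg_one hT).1 h) ((nodeSign_eq_neg_one hT).1 h')

theorem nestSign_eq_one (hT : T.IsRootedTree) (hU : U.IsRootedTree) {z y : A} :
    T.nestSign U z y = 1 ↔ (∃ a ∈ U.leavesAbove y, T.out a z) ∧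
      ¬ ∃ a ∈ U.leavesAbove y, T.inp a z := by
  rw [nestSign_eq hT hU]
  split_ifs <;> simp [*]

theorem nestSign_eq_neg_one (hT : T.IsRootedTree) (hU : U.IsRootedTree) {z y : A} :
    T.nestSign U z y = -1 ↔ (¬ ∃ a ∈ U.leavesAbove y, T.out a z) ∧
      ∃ a ∈ U.leavesAbove y, T.inp a z := by
  rw [nestSign_eq hT hU]
  split_ifs <;> simp [*]

theorem nestSign_range (hT : T.IsRootedTree) (hU : U.IsRootedTree) (z y : A) :
    T.nestSign U z y = 1 ∨ T.nestSign U z y = -1 ∨ T.nestSign U z y = 0 := by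
  rw [nestSign_eq hT hU]
  split_ifs <;> simp

/-- The signs with respect to the leaves of a nest add up to the sign with respect to its
root. -/
theorem finsum_nestSign {V : PreTree A A} {W' : A → Set A} {lt' : A → A → A → Prop}
    {x : A ⊕ A} {y₀ : A} (hU : U.IsRootedTree)
    (hn : U.IsNest W' lt' (U.dotsAbove W' V x) y₀) (hS : U.IsSubdivision W' lt') (z : A) :
    T.nestSign U z y₀ = ∑ᶠ y ∈ U.nestLeaves W' V x, T.nestSign U z y := by
  have hN := hn.nestTree_isRootedTree hU hS
  have hy₀ : y₀ ∈ U.nestRoot W' V x := hn.nestRoot_eq hU hS ▸ rfl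
  -- At a node of the nest, the leaves of `U` above its target are distributed among its sources. So
  -- the sign is additive on the tree spanned by the nest, all of whose leaves lie above `y₀`.
  rw [hN.eq_leafSum (fun y => T.nestSign U z y) ?_ y₀ hy₀.1]
  · refine finsum_mem_congr ?_ fun _ _ => rfl
    ext l
    simp only [leavesAbove, nestTree_leaves]
    exact ⟨fun h => h.1, fun h => ⟨h, hn.nestTree_desc_root hU hS h.1⟩⟩
  · rintro a b ⟨ha, ho⟩
    rw [nestSign, hU.leafSum_out _ ho]
    refine finsum_mem_congr ?_ fun _ _ => rfl
    ext b'
    exact ⟨fun h => ⟨ha, h⟩, fun h => h.2⟩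

end PreTree

theorem isStrictTotalOrder_of {α : Type*} {r : α → α → Prop}
    (tri : ∀ a b, ¬ r a b → ¬ r b a → a = b) (irr : ∀ a, ¬ r a a)
    (tra : ∀ a b c, r a b → r b c → r a c) : IsStrictTotalOrder α r :=
  { toTrichotomous := ⟨tri⟩, toIsStrictOrder := { toIrrefl := ⟨irr⟩, toIsTrans := ⟨tra⟩ } }

/-! ## Renaming the elements of trees -/

namespace PreTree

variable {A B : Type u} {T U : PreTree A A} {f : A → B}

/-- The image of a tree under a map of the ambient types. -/
def map (f : A → B) (T : PreTree A A) : PreTree B B where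
  nodes := f '' T.nodes
  edges := f '' T.edges
  out a b := ∃ x y, T.out x y ∧ a = f x ∧ b = f y
  inp a b := ∃ x y, T.inp x y ∧ a = f x ∧ b = f y
  root := f '' T.root

theorem map_out (hf : f.Injective) {a b : A} : (T.map f).out (f a) (f b) ↔ T.out a b := by
  constructor
  · rintro ⟨x, y, h, h1, h2⟩
    rwa [hf h1, hf h2]
  · exact fun h => ⟨a, b, h, rfl, rfl⟩

theorem map_inp (hf : f.Injective) {a b : A} : (T.map f).inp (f a) (f b) ↔ T.inp a b := by
  constructor
  · rintro ⟨x, y, h, h1, h2⟩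
    rwa [hf h1, hf h2]
  · exact fun h => ⟨a, b, h, rfl, rfl⟩

theorem map_mem {S : Set A} (hf : f.Injective) {a : A} : f a ∈ f '' S ↔ a ∈ S :=
  hf.mem_set_image

theorem sumMap_injective (hf : f.Injective) : (Sum.map f f).Injective := hf.sumMap hf

/-- A step that starts in the image of the renaming ends there, so that descending paths are
reflected and not only preserved. -/
theorem map_step (hf : f.Injective) {s : A ⊕ A} {t : B ⊕ B} :
    (T.map f).Step (Sum.map f f s) t ↔ ∃ t', T.Step s t' ∧ t = Sum.map f f t' := by
  constructor
  · intro h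
    cases s with
    | inl a =>
      cases h with
      | node _ b ha hb h =>
        obtain ⟨x, y, h, h1, rfl⟩ := h
        obtain rfl := hf h1
        exact ⟨.inr y, .node _ _ ((map_mem hf).1 ha) ((map_mem hf).1 hb) h, rfl⟩
    | inr b =>
      cases h with
      | edge a _ ha hb h =>
        obtain ⟨x, y, h, rfl, h1⟩ := h
        obtain rfl := hf h1
        exact ⟨.inl x, .edge _ _ ((map_mem hf).1 ha) ((map_mem hf).1 hb) h, rfl⟩
  · rintro ⟨t', h, rfl⟩
    cases h with
    | node a b ha hb h => exact .node _ _ ⟨a, ha, rfl⟩ ⟨b, hb, rfl⟩ ((map_out hf).2 h)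
    | edge a b ha hb h => exact .edge _ _ ⟨a, ha, rfl⟩ ⟨b, hb, rfl⟩ ((map_inp hf).2 h)

theorem map_desc (hf : f.Injective) {s t : A ⊕ A} :
    (T.map f).Desc (Sum.map f f s) (Sum.map f f t) ↔ T.Desc s t := by
  constructor
  · intro h
    generalize hs : Sum.map f f s = s₁ at h
    induction h using ReflTransGen.head_induction_on generalizing s with
    | refl =>
      rw [sumMap_injective hf hs]
      exact .refl
    | head h1 _ ih =>
      subst hs
      obtain ⟨t', h2, rfl⟩ := (map_step hf).1 h1
      exact .head h2 (ih rfl)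
  · exact fun h => ReflTransGen.lift _ (fun s t h => (map_step hf).2 ⟨t, h, rfl⟩) _ _ h

theorem map_isRootedTree (hf : f.Injective) (hT : T.IsRootedTree) : (T.map f).IsRootedTree where
  nodes_finite := hT.nodes_finite.image f
  edges_finite := hT.edges_finite.image f
  out_mem := by
    rintro _ _ ⟨x, y, h, rfl, rfl⟩
    exact ⟨⟨x, (hT.out_mem _ _ h).1, rfl⟩, ⟨y, (hT.out_mem _ _ h).2, rfl⟩⟩
  inp_mem := by
    rintro _ _ ⟨x, y, h, rfl, rfl⟩
    exact ⟨⟨x, (hT.inp_mem _ _ h).1, rfl⟩, ⟨y, (hT.inp_mem _ _ h).2, rfl⟩⟩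
  target_edge := by
    rintro _ ⟨x, hx, rfl⟩
    obtain ⟨b, hb, huniq⟩ := hT.target_edge x hx
    refine ⟨f b, (map_out hf).2 hb, ?_⟩
    rintro _ ⟨x', y, h, h1, rfl⟩
    rw [huniq y (hf h1 ▸ h)]
  source_node := by
    rintro _ _ _ ⟨x, y, h, rfl, rfl⟩ ⟨x', y', h', rfl, h1⟩
    rw [hT.source_node x x' y h (hf h1 ▸ h')]
  target_node := by
    rintro _ _ _ ⟨x, y, h, rfl, rfl⟩ ⟨x', y', h', rfl, h1⟩
    rw [hT.target_node x x' y h (hf h1 ▸ h')]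
  root := by
    obtain ⟨r, h1, h2, h3, h4⟩ := hT.root
    refine ⟨f r, ⟨r, h1, rfl⟩, ?_, ?_, ?_⟩
    · show f '' T.root = {f r}
      rw [h2, Set.image_singleton]
    · rintro _ ⟨x, y, h, rfl, h5⟩
      exact h3 x (hf h5 ▸ h)
    · rintro _ ⟨b, hb, rfl⟩
      exact (map_desc hf (s := .inr b) (t := .inr r)).2 (h4 b hb)

theorem map_leaves (hf : f.Injective) : (T.map f).leaves = f '' T.leaves := by
  ext b
  constructor
  · rintro ⟨⟨b, hb, rfl⟩, h⟩
    exact ⟨b, ⟨hb, fun a ha => h _ ((map_out hf).2 ha)⟩, rfl⟩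
  · rintro ⟨b, ⟨hb, h⟩, rfl⟩
    refine ⟨⟨b, hb, rfl⟩, ?_⟩
    rintro _ ⟨x, y, h', rfl, h1⟩
    exact h x (hf h1 ▸ h')

theorem map_nulldots (hf : f.Injective) : (T.map f).nulldots = f '' T.nulldots := by
  ext b
  constructor
  · rintro ⟨⟨b, hb, rfl⟩, h⟩
    exact ⟨b, ⟨hb, fun a ha => h _ ((map_inp hf).2 ha)⟩, rfl⟩
  · rintro ⟨b, ⟨hb, h⟩, rfl⟩
    refine ⟨⟨b, hb, rfl⟩, ?_⟩
    rintro _ ⟨x, y, h', h1, rfl⟩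
    exact h y (hf h1 ▸ h')

variable {W : A → Set A} {W' : B → Set B}

theorem map_dotsAbove (hf : f.Injective) (hW : ∀ b ∈ T.edges, W' (f b) = f '' W b) (x : A ⊕ A) :
    (T.map f).dotsAbove W' (U.map f) (Sum.map f f x) = Sum.map f f '' T.dotsAbove W U x := by
  ext d
  constructor
  · rintro ⟨⟨_, ⟨a, ha, rfl⟩, rfl⟩ | ⟨_, ⟨b, hb, rfl⟩, w, hw, rfl⟩, h⟩
    · exact ⟨.inl a, ⟨Or.inl ⟨a, ha, rfl⟩, (map_desc hf (s := .inr a)).1 h⟩, rfl⟩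
    · rw [hW b hb] at hw
      obtain ⟨w, hw, rfl⟩ := hw
      exact ⟨.inr w, ⟨Or.inr ⟨b, hb, w, hw, rfl⟩, (map_desc hf (s := .inl w)).1 h⟩, rfl⟩
  · rintro ⟨_, ⟨⟨a, ha, rfl⟩ | ⟨b, hb, w, hw, rfl⟩, h⟩, rfl⟩
    · exact ⟨Or.inl ⟨f a, ⟨a, ha, rfl⟩, rfl⟩, (map_desc hf (s := .inr a)).2 h⟩
    · refine ⟨Or.inr ⟨f b, ⟨b, hb, rfl⟩, f w, ?_, rfl⟩, (map_desc hf (s := .inl w)).2 h⟩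
      rw [hW b hb]
      exact ⟨w, hw, rfl⟩

theorem map_inl_mem_dotsAbove (hf : f.Injective) (hW : ∀ b ∈ T.edges, W' (f b) = f '' W b)
    {x : A ⊕ A} {a : A} : .inl (f a) ∈ (T.map f).dotsAbove W' (U.map f) (Sum.map f f x) ↔
      .inl a ∈ T.dotsAbove W U x := by
  rw [map_dotsAbove hf hW]
  exact (sumMap_injective hf).mem_set_image (a := .inl a)

theorem map_inr_mem_dotsAbove (hf : f.Injective) (hW : ∀ b ∈ T.edges, W' (f b) = f '' W b)
    {x : A ⊕ A} {a : A} : .inr (f a) ∈ (T.map f).dotsAbove W' (U.map f) (Sum.map f f x) ↔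
      .inr a ∈ T.dotsAbove W U x := by
  rw [map_dotsAbove hf hW]
  exact (sumMap_injective hf).mem_set_image (a := .inr a)

theorem map_nestEdges (hf : f.Injective) (hW : ∀ b ∈ T.edges, W' (f b) = f '' W b) (x : A ⊕ A) :
    (T.map f).nestEdges W' (U.map f) (Sum.map f f x) = f '' T.nestEdges W U x := by
  ext z
  constructor
  · rintro ⟨⟨z, hz, rfl⟩, h⟩
    refine ⟨z, ⟨hz, ?_⟩, rfl⟩
    rcases h with ⟨a', ha, h⟩ | ⟨w, hw, h⟩
    · obtain ⟨a, -, rfl⟩ : a' ∈ f '' T.nodes := (inl_mem_dotsAbove.1 ha).1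
      exact Or.inl ⟨a, (map_inl_mem_dotsAbove hf hW).1 ha, h.imp (map_out hf).1 (map_inp hf).1⟩
    · rw [hW z hz] at hw
      obtain ⟨w, hw, rfl⟩ := hw
      exact Or.inr ⟨w, hw, (map_inr_mem_dotsAbove hf hW).1 h⟩
  · rintro ⟨z, ⟨hz, h⟩, rfl⟩
    refine ⟨⟨z, hz, rfl⟩, ?_⟩
    rcases h with ⟨a, ha, h⟩ | ⟨w, hw, h⟩
    · exact Or.inl ⟨f a, (map_inl_mem_dotsAbove hf hW).2 ha, h.imp (map_out hf).2 (map_inp hf).2⟩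
    · refine Or.inr ⟨f w, ?_, (map_inr_mem_dotsAbove hf hW).2 h⟩
      rw [hW z hz]
      exact ⟨w, hw, rfl⟩

theorem map_nestRoot (hf : f.Injective) (hW : ∀ b ∈ T.edges, W' (f b) = f '' W b) (x : A ⊕ A) :
    (T.map f).nestRoot W' (U.map f) (Sum.map f f x) = f '' T.nestRoot W U x := by
  ext z
  simp only [nestRoot, map_nestEdges hf hW]
  constructor
  · rintro ⟨⟨z, hz, rfl⟩, h⟩
    refine ⟨z, ⟨hz, ?_⟩, rfl⟩
    rintro ⟨a, ha, hi⟩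
    exact h ⟨f a, (map_inl_mem_dotsAbove hf hW).2 ha, (map_inp hf).2 hi⟩
  · rintro ⟨z, ⟨hz, h⟩, rfl⟩
    refine ⟨⟨z, hz, rfl⟩, ?_⟩
    rintro ⟨a', ha, hi⟩
    obtain ⟨a, -, rfl⟩ : a' ∈ f '' T.nodes := (inl_mem_dotsAbove.1 ha).1
    exact h ⟨a, (map_inl_mem_dotsAbove hf hW).1 ha, (map_inp hf).1 hi⟩

theorem map_nestLeaves (hf : f.Injective) (hW : ∀ b ∈ T.edges, W' (f b) = f '' W b) (x : A ⊕ A) :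
    (T.map f).nestLeaves W' (U.map f) (Sum.map f f x) = f '' T.nestLeaves W U x := by
  ext z
  simp only [nestLeaves, map_nestEdges hf hW]
  constructor
  · rintro ⟨⟨z, hz, rfl⟩, h⟩
    refine ⟨z, ⟨hz, ?_⟩, rfl⟩
    rintro ⟨a, ha, hi⟩
    exact h ⟨f a, (map_inl_mem_dotsAbove hf hW).2 ha, (map_out hf).2 hi⟩
  · rintro ⟨z, ⟨hz, h⟩, rfl⟩
    refine ⟨⟨z, hz, rfl⟩, ?_⟩
    rintro ⟨a', ha, hi⟩
    obtain ⟨a, -, rfl⟩ : a' ∈ f '' T.nodes := (inl_mem_dotsAbove.1 ha).1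
    exact h ⟨a, (map_inl_mem_dotsAbove hf hW).1 ha, (map_out hf).1 hi⟩

variable {lt : A → A → A → Prop} {lt' : B → B → B → Prop}

theorem map_isSubdivision (hf : f.Injective) (hW : ∀ b ∈ T.edges, W' (f b) = f '' W b)
    (hW' : ∀ c w, w ∈ W' c → c ∈ f '' T.edges)
    (hlt : ∀ b ∈ T.edges, ∀ w ∈ W b, ∀ w' ∈ W b, lt' (f b) (f w) (f w') ↔ lt b w w')
    (hS : T.IsSubdivision W lt) : (T.map f).IsSubdivision W' lt' where
  edge c w h := hW' c w h
  finite c := by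
    by_cases h : c ∈ f '' T.edges
    · obtain ⟨b, hb, rfl⟩ := h
      rw [hW b hb]
      exact (hS.finite b).image f
    · have : W' c = ∅ := Set.eq_empty_iff_forall_notMem.2 fun w hw => h (hW' c w hw)
      rw [this]
      exact Set.finite_empty
  order c := by
    have mem : ∀ w : W' c, ∃ b ∈ T.edges, c = f b ∧ ∃ v ∈ W b, w.1 = f v := by
      rintro ⟨w, hw⟩
      obtain ⟨b, hb, rfl⟩ := hW' c w hw
      rw [hW b hb] at hw
      obtain ⟨v, hv, rfl⟩ := hw
      exact ⟨b, hb, rfl, v, hv, rfl⟩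
    refine isStrictTotalOrder_of (fun w w' h h' => ?_) (fun w h => ?_) fun w w' w'' h h' => ?_
    · obtain ⟨b, hb, rfl, v, hv, e⟩ := mem w
      obtain ⟨b', hb', e1, v', hv', e'⟩ := mem w'
      obtain rfl := hf e1
      rw [e, e', hlt _ hb _ hv _ hv'] at h
      rw [e, e', hlt _ hb _ hv' _ hv] at h'
      rcases hS.trichotomous hv hv' with h1 | h1 | h1
      · exact (h h1).elim
      · exact Subtype.ext (by rw [e, e', h1])
      · exact (h' h1).elim
    · obtain ⟨b, hb, rfl, v, hv, e⟩ := mem w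
      rw [e, hlt _ hb _ hv _ hv] at h
      exact hS.irrefl hv h
    · obtain ⟨b, hb, rfl, v, hv, e⟩ := mem w
      obtain ⟨b', hb', e1, v', hv', e'⟩ := mem w'
      obtain rfl := hf e1
      obtain ⟨b'', hb'', e1, v'', hv'', e''⟩ := mem w''
      obtain rfl := hf e1
      rw [e, e', hlt _ hb _ hv _ hv'] at h
      rw [e', e'', hlt _ hb _ hv' _ hv''] at h'
      rw [e, e'', hlt _ hb _ hv _ hv'']
      exact hS.trans hv hv' hv'' h h'
  disjoint c c' w h h' := by
    obtain ⟨b, hb, rfl⟩ := hW' c w h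
    obtain ⟨b', hb', rfl⟩ := hW' c' w h'
    rw [hW b hb] at h
    rw [hW b' hb'] at h'
    obtain ⟨v, hv, rfl⟩ := h
    obtain ⟨v', hv', e⟩ := h'
    rw [hf e] at hv'
    rw [hS.disjoint _ _ _ hv hv']

theorem map_onEdge (hf : f.Injective) (hW : ∀ b ∈ T.edges, W' (f b) = f '' W b)
    (hT : T.IsRootedTree)
    (hW' : ∀ c w, w ∈ W' c → c ∈ f '' T.edges) {d : A ⊕ A} {z : B} :
    (T.map f).OnEdge W' (Sum.map f f d) z ↔ ∃ z', z = f z' ∧ z' ∈ T.edges ∧ T.OnEdge W d z' := by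
  cases d with
  | inl a =>
    constructor
    · rintro ⟨x, y, h, h1, h2⟩
      exact ⟨y, h2, (hT.out_mem _ _ h).2, hf h1 ▸ h⟩
    · rintro ⟨y, rfl, _, h⟩
      exact (map_out hf).2 h
  | inr w =>
    constructor
    · intro h
      obtain ⟨b, hb, rfl⟩ := hW' _ _ h
      have h : f w ∈ W' (f b) := h
      rw [hW b hb, map_mem hf] at h
      exact ⟨b, rfl, hb, h⟩
    · rintro ⟨b, rfl, hb, h⟩
      show f w ∈ W' (f b)
      rw [hW b hb]
      exact ⟨w, h, rfl⟩

theorem map_under (hW : ∀ b ∈ T.edges, W' (f b) = f '' W b)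
    (hlt : ∀ b ∈ T.edges, ∀ w ∈ W b, ∀ w' ∈ W b, lt' (f b) (f w) (f w') ↔ lt b w w')
    {d : A ⊕ A} {z : A} (hz : z ∈ T.edges) (hd : T.OnEdge W d z) {v : B} :
    Under W' lt' (f z) v (Sum.map f f d) ↔ ∃ v', v = f v' ∧ Under W lt z v' d := by
  cases d with
  | inl a =>
    simp only [Under, Sum.map_inl, hW z hz, Set.mem_image]
    exact ⟨fun ⟨x, hx, e⟩ => ⟨x, e.symm, hx⟩, fun ⟨x, e, hx⟩ => ⟨x, hx, e.symm⟩⟩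
  | inr w =>
    simp only [Under, Sum.map_inr, hW z hz, Set.mem_image]
    constructor
    · rintro ⟨⟨x, hx, rfl⟩, h⟩
      exact ⟨x, rfl, hx, (hlt z hz x hx w hd).1 h⟩
    · rintro ⟨x, rfl, hx, h⟩
      exact ⟨⟨x, hx, rfl⟩, (hlt z hz x hx w hd).2 h⟩

theorem map_isNest (hf : f.Injective) (hW : ∀ b ∈ T.edges, W' (f b) = f '' W b)
    (hW' : ∀ c w, w ∈ W' c → c ∈ f '' T.edges)
    (hlt : ∀ b ∈ T.edges, ∀ w ∈ W b, ∀ w' ∈ W b, lt' (f b) (f w) (f w') ↔ lt b w w')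
    (hT : T.IsRootedTree) {D : Set (A ⊕ A)} {z₀ : A}
    (hz₀ : z₀ ∈ T.edges) (hn : T.IsNest W lt D z₀) :
    (T.map f).IsNest W' lt' (Sum.map f f '' D) (f z₀) where
  bottom := by
    obtain ⟨d, hd, hz⟩ := hn.bottom
    exact ⟨_, ⟨d, hd, rfl⟩, (map_onEdge hf hW hT hW').2 ⟨z₀, rfl, hz₀, hz⟩⟩
  inner := by
    rintro _ ⟨d, hd, rfl⟩ z hz hne
    obtain ⟨z, rfl, hzT, hz⟩ := (map_onEdge hf hW hT hW').1 hz
    obtain ⟨a, ha, haD⟩ := hn.inner d hd z hz fun e => hne (by rw [e])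
    exact ⟨f a, (map_inp hf).2 ha, ⟨_, haD, rfl⟩⟩
  under := by
    rintro _ ⟨d, hd, rfl⟩ z hz hne v hv
    obtain ⟨z, rfl, hzT, hz⟩ := (map_onEdge hf hW hT hW').1 hz
    obtain ⟨v, rfl, hv'⟩ := (map_under hW hlt hzT hz).1 hv
    exact ⟨_, hn.under d hd z hz (fun e => hne (by rw [e])) v hv', rfl⟩
  convex := by
    rintro _ ⟨d, hd, rfl⟩ hz v hv u ⟨u', hu, e⟩ huv
    obtain ⟨z, hzz, hzT, hz⟩ := (map_onEdge hf hW hT hW').1 hz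
    obtain rfl := hf hzz
    obtain ⟨v, rfl, hv'⟩ := (map_under hW hlt hzT hz).1 hv
    cases u' with
    | inl _ => simp at e
    | inr u' =>
      obtain rfl : f u' = u := by simpa using e
      have huv := (map_under hW hlt (d := .inr v) hzT (IsSubdivision.under_mem hv')).1 huv
      obtain ⟨u'', e', huv⟩ := huv
      obtain rfl := hf e'
      exact ⟨_, hn.convex d hd hz v hv' u' hu huv, rfl⟩
  root := by
    rintro _ ⟨a, z, ha, rfl, e⟩ ⟨d, hd, e'⟩
    obtain rfl := hf e
    cases d with
    | inl a' =>
      obtain rfl : a' = a := hf (by simpa using e')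
      exact hn.root a' ha hd
    | inr _ => simp at e'

theorem map_isExactConstellation (hf : f.Injective)
    (hW : ∀ b ∈ T.edges, W' (f b) = f '' W b) (hW' : ∀ c w, w ∈ W' c → c ∈ f '' T.edges)
    (hlt : ∀ b ∈ T.edges, ∀ w ∈ W b, ∀ w' ∈ W b, lt' (f b) (f w) (f w') ↔ lt b w w')
    (hT : T.IsRootedTree) (hc : T.IsExactConstellation W lt U) :
    (T.map f).IsExactConstellation W' lt' (U.map f) := by
  have hS := hc.isSubdivision
  have hS' := map_isSubdivision hf hW hW' hlt hS
  refine ⟨hS'.edge, hS'.finite, hS'.order, hS'.disjoint, ?_, ?_, ?_⟩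
  · rw [map_leaves hf, ← hc.black]
    rfl
  · rw [map_nulldots hf, ← hc.white]
    ext w
    constructor
    · rintro ⟨c, hw⟩
      obtain ⟨b, hb, rfl⟩ := hW' c w hw
      rw [hW b hb] at hw
      obtain ⟨v, hv, rfl⟩ := hw
      exact ⟨v, ⟨b, hv⟩, rfl⟩
    · rintro ⟨v, ⟨b, hv⟩, rfl⟩
      refine ⟨f b, ?_⟩
      rw [hW b (hS.edge _ _ hv)]
      exact ⟨v, hv, rfl⟩
  -- Connectedness is transported in its local form `IsNest`, so no isomorphism between the two
  -- graphs has to be built.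
  · rintro _ ⟨x, hx, rfl⟩
    rw [hS'.connected_iff (map_isRootedTree hf hT) (exists_onEdge (map_isRootedTree hf hT))]
    obtain ⟨z₀, hn⟩ := (hS.connected_iff hT (exists_onEdge hT)).1 (hc.kernel x hx)
    have hz₀ : z₀ ∈ T.edges := by
      obtain ⟨d, hd, hz⟩ := hn.bottom
      exact (onEdge_mem_nestEdges hT hS hd hz).1
    refine ⟨f z₀, ?_⟩
    rw [show (Sum.inl (f x) : B ⊕ B) = Sum.map f f (.inl x) from rfl, map_dotsAbove hf hW]
    exact map_isNest hf hW hW' hlt hT hz₀ hn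

end PreTree

/-! ## The trees of a dendritic face complex -/

namespace PreMOP

variable {C : PreMOP.{u}}

/-- The tree with nodes `Λ_{k+1}` and edges `C_k`. -/
def cellTree (C : PreMOP.{u}) (k : ℕ) : PreTree C.Cell C.Cell where
  nodes := {x | x ∈ C.Lam ∧ C.dim x = k + 1}
  edges := {y | C.dim y = k}
  out x y := x ∈ C.Lam ∧ C.dim x = k + 1 ∧ C.Pos y x
  inp x y := x ∈ C.Lam ∧ C.dim x = k + 1 ∧ C.Neg y x
  root := {y | C.dim y = k ∧ C.IterTarget y}

open Classical in
/-- The sign of `y ≺ x`, which is `0` for loops and for unrelated cells. -/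
noncomputable def eps (C : PreMOP.{u}) (y x : C.Cell) : ℤ :=
  if C.Pos y x then 1 else if C.Neg y x then -1 else 0

theorem Pos.facet {y x : C.Cell} (h : C.Pos y x) : C.Facet y x := Or.inr h.1
theorem Neg.facet {y x : C.Cell} (h : C.Neg y x) : C.Facet y x := Or.inl h.1
theorem Loop.facet {y x : C.Cell} (h : C.Loop y x) : C.Facet y x := Or.inl h.1
theorem Pos.not_neg {y x : C.Cell} (h : C.Pos y x) : ¬ C.Neg y x := fun h' => h.2 h'.1

theorem facet_cases {y x : C.Cell} (h : C.Facet y x) : C.Pos y x ∨ C.Neg y x ∨ C.Loop y x := by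
  by_cases h1 : y ∈ C.δ x <;> by_cases h2 : y ∈ C.γ x
  · exact Or.inr (Or.inr ⟨h1, h2⟩)
  · exact Or.inr (Or.inl ⟨h1, h2⟩)
  · exact Or.inl ⟨h2, h1⟩
  · exact (h.elim h1 h2).elim

theorem eps_eq_one {y x : C.Cell} : C.eps y x = 1 ↔ C.Pos y x := by
  unfold eps
  split_ifs <;> simp [*]

theorem eps_eq_neg_one {y x : C.Cell} : C.eps y x = -1 ↔ C.Neg y x := by
  unfold eps
  split_ifs with h1 h2
  · simp [h1.not_neg]
  · simp [h2]
  · simp [h2]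

theorem eps_range (y x : C.Cell) : C.eps y x = 1 ∨ C.eps y x = -1 ∨ C.eps y x = 0 := by
  unfold eps
  split_ifs <;> simp

theorem eps_ne_zero {y x : C.Cell} : C.eps y x ≠ 0 ↔ C.Pos y x ∨ C.Neg y x := by
  rw [← eps_eq_one, ← eps_eq_neg_one]
  rcases C.eps_range y x with h | h | h <;> simp [h]

theorem eps_eq_zero {y x : C.Cell} : C.eps y x = 0 ↔ ¬ C.Pos y x ∧ ¬ C.Neg y x := by
  rw [← not_or, ← eps_ne_zero, not_not]

theorem rel_iff_eps {α : SignType} (hα : α ≠ 0) {y x : C.Cell} :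
    C.Rel α y x ↔ C.eps y x = (α : ℤ) := by
  cases α with
  | zero => exact (hα rfl).elim
  | pos => exact eps_eq_one.symm
  | neg => exact eps_eq_neg_one.symm

theorem exists_sign_of_eps {y x : C.Cell} (h : C.eps y x ≠ 0) :
    ∃ α : SignType, α ≠ 0 ∧ C.Rel α y x ∧ C.eps y x = (α : ℤ) := by
  rcases C.eps_range y x with h1 | h1 | h1
  · exact ⟨1, by decide, eps_eq_one.1 h1, h1⟩
  · exact ⟨.neg, by decide, eps_eq_neg_one.1 h1, h1⟩
  · exact (h h1).elim

namespace IsMOP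

variable {x y y' z t : C.Cell}

theorem dim_pos (h : C.IsMOP) (h1 : C.Pos y x) : C.dim x = C.dim y + 1 := h.dim_facet _ _ h1.facet
theorem dim_neg (h : C.IsMOP) (h1 : C.Neg y x) : C.dim x = C.dim y + 1 := h.dim_facet _ _ h1.facet
theorem dim_loop (h : C.IsMOP) (h1 : C.Loop y x) : C.dim x = C.dim y + 1 :=
  h.dim_facet _ _ h1.facet

theorem γ_unique (h : C.IsMOP) (h1 : y ∈ C.γ x) (h2 : y' ∈ C.γ x) : y = y' := by
  have h3 := h.dim_facet x y (Or.inr h1)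
  have h4 := h.dim_ge y
  obtain ⟨t, ht⟩ := h.target x (by omega)
  rw [ht] at h1 h2
  exact h1.trans h2.symm

theorem γ_dim (h : C.IsMOP) (h1 : y ∈ C.γ x) : C.dim x = C.dim y + 1 := h.dim_facet _ _ (Or.inr h1)

theorem pos_unique (h : C.IsMOP) (h1 : C.Pos y x) (h2 : C.Pos y' x) : y = y' :=
  h.γ_unique h1.1 h2.1

theorem not_loop_of_neg (h : C.IsMOP) (h1 : C.Neg y x) : ¬ C.Loop z x := fun h2 =>
  h1.2 (h.loop x ⟨z, h2⟩ ▸ h1.1)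

theorem not_loop_of_pos (h : C.IsMOP) (h1 : C.Pos y x) : ¬ C.Loop z x := fun h2 =>
  h1.2 (h.loop x ⟨z, h2⟩ ▸ h1.1)

theorem loop_eq (h : C.IsMOP) (h1 : C.Loop z x) (h2 : C.Facet y x) : y = z := by
  have h3 := h.loop x ⟨z, h1⟩
  have : y ∈ C.γ x := h2.elim (fun h => h3 ▸ h) id
  exact h.γ_unique this h1.2

theorem exists_pos (h : C.IsMOP) (h0 : 0 ≤ C.dim x) (hl : ∀ z, ¬ C.Loop z x) : ∃ t, C.Pos t x := by
  obtain ⟨t, ht⟩ := h.target x h0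
  have h1 : t ∈ C.γ x := ht ▸ rfl
  exact ⟨t, h1, fun h2 => hl t ⟨h2, h1⟩⟩

theorem le_dim (h : C.IsMOP) (hle : C.Le x y) : x = y ∨ C.dim x < C.dim y := by
  induction hle with
  | refl => exact Or.inl rfl
  | @tail u v _ huv ih =>
    have := h.dim_facet v u huv
    rcases ih with rfl | ih
    · exact Or.inr (by omega)
    · exact Or.inr (by omega)

theorem top_unique (h : C.IsMOP) (h1 : C.IsTop x) (h2 : C.IsTop y) : x = y := by
  rcases h.le_dim (h1 y) with e | e
  · exact e.symm
  · rcases h.le_dim (h2 x) with e' | e'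
    · exact e'
    · omega

theorem topDim_eq (h : C.IsMOP) (h1 : C.IsTop x) (h0 : 0 ≤ C.dim x) : (C.topDim : ℤ) = C.dim x := by
  have : sSup (Set.range C.dim) = C.dim x := by
    refine IsGreatest.csSup_eq ⟨⟨x, rfl⟩, ?_⟩
    rintro _ ⟨y, rfl⟩
    rcases h.le_dim (h1 y) with e | e
    · rw [e]
    · exact e.le
  rw [topDim, this]
  omega

/-- The sequence of iterated targets is deterministic and loses one dimension at each step, so it
meets each dimension at most once. -/
theorem iterTarget_unique (h : C.IsMOP) (h1 : C.IterTarget y) (h2 : C.IterTarget y')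
    (hd : C.dim y = C.dim y') : y = y' := by
  obtain ⟨ω, hω, h1⟩ := h1
  obtain ⟨ω', hω', h2⟩ := h2
  obtain rfl := h.top_unique hω hω'
  have key : ∀ {u v : C.Cell}, ReflTransGen (fun x t => t ∈ C.γ x) u v → u = v ∨
      C.dim v < C.dim u := by
    intro u v huv
    induction huv with
    | refl => exact Or.inl rfl
    | @tail b c _ hbc ih =>
      have := h.γ_dim hbc
      rcases ih with rfl | ih
      · exact Or.inr (by omega)
      · exact Or.inr (by omega)
  rcases ReflTransGen.total_of_right_unique (r := fun x t => t ∈ C.γ x)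
    (fun _ _ _ => h.γ_unique) h1 h2 with h3 | h3
  · rcases key h3 with e | e
    · exact e
    · omega
  · rcases key h3 with e | e
    · exact e.symm
    · omega

theorem iterTarget_γ (h1 : C.IterTarget x) (h2 : y ∈ C.γ x) : C.IterTarget y := by
  obtain ⟨ω, hω, h1⟩ := h1
  exact ⟨ω, hω, h1.tail h2⟩

end IsMOP

/-! ### Signed thinness, and loops as targets -/

namespace IsDFC

variable {x y y' z t : C.Cell} {k : ℕ}

theorem lam_not_loop (h : C.IsDFC) (hx : x ∈ C.Lam) : ¬ C.Loop z x := fun h1 =>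
  hx (h.loops z x h1)

/-- With integer signs, loops and unrelated cells both have sign `0`. The quantification over
nonzero signs in the axiom becomes nonvanishing of `eps`, and the sign rule becomes an equation
between integers. -/
theorem thin_eps (h : C.IsDFC) (h1 : C.eps z y ≠ 0) (h2 : C.eps y x ≠ 0) :
    ∃ y', y' ≠ y ∧ C.eps z y * C.eps y x = -(C.eps z y' * C.eps y' x) ∧
      ∀ y'', y'' ≠ y → C.eps z y'' ≠ 0 → C.eps y'' x ≠ 0 → y'' = y' := by
  obtain ⟨β, hβ, hr1, e1⟩ := exists_sign_of_eps h1
  obtain ⟨α, hα, hr2, e2⟩ := exists_sign_of_eps h2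
  obtain ⟨y', hne, ⟨α', β', hα', hβ', hr1', hr2', hs⟩, hu⟩ := h.thin x y z α β hα hβ hr1 hr2
  refine ⟨y', hne, ?_, fun y'' hne' h3 h4 => ?_⟩
  · rw [e1, e2, (rel_iff_eps hα').1 hr2', (rel_iff_eps hβ').1 hr1']
    clear * - hs
    revert hs
    cases α <;> cases β <;> cases α' <;> cases β' <;> decide
  · obtain ⟨β'', hβ'', hr1'', -⟩ := exists_sign_of_eps h3
    obtain ⟨α'', hα'', hr2'', -⟩ := exists_sign_of_eps h4
    exact hu y'' hne' ⟨α'', β'', hα'', hβ'', hr1'', hr2''⟩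

/-- Each of two distinct sources would be the unique completion of the chain through the other.
Thinness then requires opposite products, while equal signs give equal ones. -/
theorem thin_unique (h : C.IsDFC) (h1 : C.Neg y x) (h2 : C.Neg y' x) (h3 : C.eps z y ≠ 0)
    (h4 : C.eps z y' = C.eps z y) : y = y' := by
  by_contra hne
  have e1 := eps_eq_neg_one.2 h1
  have e2 := eps_eq_neg_one.2 h2
  obtain ⟨y₁, -, hs, hu⟩ := h.thin_eps h3 (x := x) (by omega)
  obtain rfl := hu y' (Ne.symm hne) (by omega) (by omega)
  rw [e1, e2, h4] at hs
  omega

theorem thin_unique_pos (h : C.IsDFC) (h1 : C.Neg y x) (h2 : C.Neg y' x) (h3 : C.Pos z y)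
    (h4 : C.Pos z y') : y = y' :=
  h.thin_unique h1 h2 (eps_ne_zero.2 (Or.inl h3)) (by rw [eps_eq_one.2 h3, eps_eq_one.2 h4])

theorem thin_unique_neg (h : C.IsDFC) (h1 : C.Neg y x) (h2 : C.Neg y' x) (h3 : C.Neg z y)
    (h4 : C.Neg z y') : y = y' :=
  h.thin_unique h1 h2 (eps_ne_zero.2 (Or.inr h3))
    (by rw [eps_eq_neg_one.2 h3, eps_eq_neg_one.2 h4])

/-- A source `y` of `x` that contains `z` with a sign is matched by another source with the
opposite sign, or by the target with the same sign. -/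
theorem thin_source (h : C.IsDFC) (ht : C.Pos t x) (h1 : C.Neg y x) (h2 : C.eps z y ≠ 0) :
    C.eps z t = C.eps z y ∨ (C.eps z t = 0 ∧ ∃ y', C.Neg y' x ∧ C.eps z y' = - C.eps z y) := by
  have e1 := eps_eq_neg_one.2 h1
  have et := eps_eq_one.2 ht
  have hty : t ≠ y := fun e => ht.not_neg (e ▸ h1)
  obtain ⟨y₁, hne, hs, hu⟩ := h.thin_eps h2 (x := x) (by omega)
  have h3 : C.eps y₁ x ≠ 0 := by
    intro h0
    rw [h0, e1] at hs
    omega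
  rcases eps_ne_zero.1 h3 with h4 | h4
  · obtain rfl := h.pos_unique ht h4
    rw [e1, et] at hs
    exact Or.inl (by omega)
  · have e4 := eps_eq_neg_one.2 h4
    rw [e1, e4] at hs
    refine Or.inr ⟨?_, y₁, h4, by omega⟩
    by_contra h0
    obtain rfl := hu t hty h0 (by omega)
    exact ht.not_neg h4

/-- The completion of a chain through the target goes through another cell, hence through a source.
The sign rule then makes the two signs of `z` equal. -/
theorem thin_target (h : C.IsDFC) (ht : C.Pos t x) (h2 : C.eps z t ≠ 0) :
    ∃ y, C.Neg y x ∧ C.eps z y = C.eps z t := by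
  have et := eps_eq_one.2 ht
  obtain ⟨y₁, hne, hs, hu⟩ := h.thin_eps h2 (x := x) (by omega)
  have h3 : C.eps y₁ x ≠ 0 := by
    intro h0
    rw [h0, et] at hs
    omega
  rcases eps_ne_zero.1 h3 with h4 | h4
  · exact (hne (h.pos_unique h4 ht)).elim
  · have e4 := eps_eq_neg_one.2 h4
    rw [et, e4] at hs
    exact ⟨y₁, h4, by omega⟩

theorem finite_set (h : C.IsDFC) (s : Set C.Cell) : s.Finite :=
  have := h.finite
  Set.toFinite s

/-- The signs of `z` with respect to the sources of `x` add up to the sign with respect to its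
target. -/
theorem eps_target_eq_sum (h : C.IsDFC) (ht : C.Pos t x) (z : C.Cell) :
    C.eps z t = ∑ᶠ y ∈ {y | C.Neg y x}, C.eps z y := by
  classical
  rw [finsum_mem_sign (S := {y | C.Neg y x}) (h.finite_set _) _ (fun y _ => C.eps_range z y)
    (fun y hy y' hy' e e' => h.thin_unique (z := z) hy hy' (by omega) (by omega))
    (fun y hy y' hy' e e' => h.thin_unique (z := z) hy hy' (by omega) (by omega))]
  split_ifs with h1 h2 h2
  · obtain ⟨y, hy, e⟩ := h1
    obtain ⟨y', hy', e'⟩ := h2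
    rcases h.thin_source ht hy (z := z) (by omega) with h3 | h3
    · rcases h.thin_source ht hy' (z := z) (by omega) with h4 | h4
      · omega
      · omega
    · omega
  · obtain ⟨y, hy, e⟩ := h1
    rcases h.thin_source ht hy (z := z) (by omega) with h3 | ⟨-, y', h3, h4⟩
    · omega
    · exact (h2 ⟨y', h3, by omega⟩).elim
  · obtain ⟨y, hy, e⟩ := h2
    rcases h.thin_source ht hy (z := z) (by omega) with h3 | ⟨-, y', h3, h4⟩
    · omega
    · exact (h1 ⟨y', h3, by omega⟩).elim
  · by_contra h0
    obtain ⟨y, hy, e⟩ := h.thin_target ht (z := z) (by omega)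
    rcases C.eps_range z t with e' | e' | e'
    · exact h1 ⟨y, hy, by omega⟩
    · exact h2 ⟨y, hy, by omega⟩
    · omega

/-- If the target of `x` is a loop on `z`, then so are all sources of `x`. -/
theorem loop_of_loop_target (h : C.IsDFC) (ht : C.Pos t x) (hl : C.Loop z t) (hy : C.Neg y x) :
    C.Loop z y := by
  have hx1 := h.dim_pos ht
  have ht1 := h.dim_loop hl
  have hz1 := h.dim_ge z
  have e0 : ∀ z', C.eps z' t = 0 := fun z' =>
    eps_eq_zero.2 ⟨fun h1 => h.not_loop_of_pos h1 hl, fun h1 => h.not_loop_of_neg h1 hl⟩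
  -- No source of `x` has a signed facet. Otherwise choose such a source `y₁` that is last for the
  -- acyclic relation, and let `z₂` be its target. As `ε(z₂, t) = 0`, thinness gives a source `y₂`
  -- with `z₂ ≺⁻ y₂`, which comes later.
  have no : ∀ y z', C.Neg y x → C.eps z' y = 0 := by
    by_contra hc
    push Not at hc
    obtain ⟨y₀, z', hy₀, hz'⟩ := hc
    have := h.finite
    let r : C.Cell → C.Cell → Prop := fun y y' => C.Neg y x ∧ C.Neg y' x ∧ ∃ z, C.Pos z y ∧ C.Neg z y'
    have hwf : WellFounded (flip (TransGen r)) := by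
      have : Std.Irrefl (flip (TransGen r)) := ⟨fun a ha => h.acyclic x (by omega) a ha⟩
      have : IsTrans _ (flip (TransGen r)) := ⟨fun a b c h1 h2 => TransGen.trans h2 h1⟩
      exact Finite.wellFounded_of_trans_of_irrefl _
    obtain ⟨y₁, ⟨h1, z₁, h2⟩, h3⟩ := hwf.has_min {y | C.Neg y x ∧ ∃ z, C.eps z y ≠ 0}
      ⟨y₀, hy₀, z', hz'⟩
    have hnl : ∀ z, ¬ C.Loop z y₁ := by
      intro z hz
      rcases eps_ne_zero.1 h2 with h4 | h4
      · exact h.not_loop_of_pos h4 hz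
      · exact h.not_loop_of_neg h4 hz
    have hy₁ := h.dim_neg h1
    obtain ⟨z₂, hz₂⟩ := h.exists_pos (x := y₁) (by omega) hnl
    have e2 := eps_eq_one.2 hz₂
    rcases h.thin_source ht h1 (z := z₂) (by omega) with h4 | ⟨-, y₂, h4, h5⟩
    · rw [e0] at h4
      omega
    · exact h3 y₂ ⟨h4, z₂, by omega⟩
        (.single ⟨h1, h4, z₂, hz₂, eps_eq_neg_one.1 (by omega)⟩)
  have hyl : ∃ z', C.Loop z' y := by
    by_contra hc
    push Not at hc
    have := h.dim_neg hy
    obtain ⟨z', hz'⟩ := h.exists_pos (x := y) (by omega) hc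
    have := no y z' hy
    rw [eps_eq_one.2 hz'] at this
    omega
  obtain ⟨z', hz'⟩ := hyl
  -- All sources of `x` are now loops, so the completion provided for the loop `y` on `z'` must pass
  -- through the target `t`. As the only facet of `t` is `z`, this gives `z' = z`.
  obtain ⟨y', hne, α, β, hab, hr1, hr2⟩ := h.thin_loop x y z' hz' hy
  cases α with
  | zero => exact (h.not_loop_of_neg hy hr2).elim
  | pos =>
    obtain rfl := h.pos_unique ht hr2
    have : C.Facet z' t := by
      cases β with
      | zero => exact Loop.facet hr1
      | pos => exact Pos.facet hr1
      | neg => exact Neg.facet hr1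
    rwa [h.loop_eq hl this] at hz'
  | neg =>
    have h0 := no y' z' hr2
    rw [eps_eq_zero] at h0
    cases β with
    | zero => exact (hab rfl).elim
    | pos => exact (h0.1 hr1).elim
    | neg => exact (h0.2 hr1).elim

theorem le_topDim (h : C.IsDFC) (x : C.Cell) : C.dim x ≤ C.topDim := by
  obtain ⟨ω, h0, hω⟩ := h.greatest
  rw [h.topDim_eq hω h0]
  rcases h.le_dim (hω x) with e | e
  · rw [e]
  · exact e.le

theorem exists_top (h : C.IsDFC) : ∃ ω, C.IsTop ω ∧ C.dim ω = C.topDim := by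
  obtain ⟨ω, h0, hω⟩ := h.greatest
  exact ⟨ω, hω, (h.topDim_eq hω h0).symm⟩

theorem isTop_of_dim (h : C.IsDFC) (hx : C.dim x = C.topDim) : C.IsTop x := by
  obtain ⟨ω, hω, h0⟩ := h.exists_top
  rcases h.le_dim (hω x) with e | e
  · rwa [e]
  · omega

theorem exists_facet (h : C.IsDFC) (hx : C.dim x < C.topDim) : ∃ y, C.Facet x y := by
  obtain ⟨ω, hω, h0⟩ := h.exists_top
  rcases ReflTransGen.cases_head (hω x) with e | ⟨c, hc, _⟩
  · rw [e] at hx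
    omega
  · exact ⟨c, hc⟩

theorem exists_iterTarget (h : C.IsDFC) (hk : k ≤ C.topDim) :
    ∃ r, C.IterTarget r ∧ C.dim r = k := by
  obtain ⟨j, hj⟩ := Nat.exists_eq_add_of_le hk
  induction j generalizing k with
  | zero =>
    obtain ⟨ω, hω, h0⟩ := h.exists_top
    exact ⟨ω, ⟨ω, hω, .refl⟩, by rw [h0, hj]; simp⟩
  | succ j ih =>
    obtain ⟨r, hr, hd⟩ := ih (k := k + 1) (by omega) (by omega)
    obtain ⟨t, ht⟩ := h.target r (by omega)
    have ht' : t ∈ C.γ r := ht ▸ rfl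
    have := h.γ_dim ht'
    exact ⟨t, IsMOP.iterTarget_γ hr ht', by push_cast at hd; omega⟩

end IsDFC

/-! ### The cell trees, by descending induction on the degree -/

/-- What is to be shown about the tree with nodes `Λ_{k+1}` and edges `C_k`. -/
structure TreeHyp (C : PreMOP.{u}) (k : ℕ) : Prop where
  rooted : (C.cellTree k).IsRootedTree
  leaves : (C.cellTree k).leaves = {x | x ∈ C.Lam ∧ C.dim x = k}
  -- Uniqueness in thinness and acyclicity are statements about the sources of one cell. The first
  -- alternative makes them available for all of `Λ_k` at once.
  common : (∃ t, ∀ x ∈ C.Lam, C.dim x = k → C.Neg x t) ∨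
    ∀ x y, C.dim x = k → C.dim y = k → x = y

namespace TreeHyp

variable {x y y' z t a a' : C.Cell} {k : ℕ}

theorem mem_leavesAbove (H : C.TreeHyp k) : a ∈ (C.cellTree k).leavesAbove y ↔
    (a ∈ C.Lam ∧ C.dim a = k) ∧ (C.cellTree k).Desc (.inr a) (.inr y) := by
  rw [PreTree.leavesAbove, H.leaves]
  exact Iff.rfl

/-- By `eps_target_eq_sum` the function `ε(z, ·)` is additive at the nodes of the cell tree. -/
theorem eps_eq_leafSum (H : C.TreeHyp k) (h : C.IsDFC) (hy : C.dim y = k) (z : C.Cell) :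
    C.eps z y = ∑ᶠ a ∈ (C.cellTree k).leavesAbove y, C.eps z a := by
  refine H.rooted.eq_leafSum (fun y => C.eps z y) (fun x t hx => ?_) y hy
  rw [h.eps_target_eq_sum hx.2.2]
  refine finsum_mem_congr ?_ fun _ _ => rfl
  ext b
  exact ⟨fun hb => ⟨hx.1, hx.2.1, hb⟩, fun hb => hb.2.2⟩

theorem exists_pos_above (H : C.TreeHyp k) (h : C.IsDFC) (hy : C.dim y = k) (hz : C.Pos z y) :
    ∃ a ∈ (C.cellTree k).leavesAbove y, C.Pos z a := by
  have e := H.eps_eq_leafSum h hy z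
  rw [eps_eq_one.2 hz] at e
  obtain ⟨a, ha, h1⟩ := exists_pos_of_finsum_mem_pos (C.eps z) (by rw [← e]; norm_num)
  refine ⟨a, ha, eps_eq_one.1 ?_⟩
  rcases C.eps_range z a with e | e | e <;> omega

theorem exists_neg_above (H : C.TreeHyp k) (h : C.IsDFC) (hy : C.dim y = k) (hz : C.Neg z y) :
    ∃ a ∈ (C.cellTree k).leavesAbove y, C.Neg z a := by
  have e := H.eps_eq_leafSum h hy z
  rw [eps_eq_neg_one.2 hz] at e
  obtain ⟨a, ha, h1⟩ := exists_neg_of_finsum_mem_neg (C.eps z) (by rw [← e]; norm_num)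
  refine ⟨a, ha, eps_eq_neg_one.1 ?_⟩
  rcases C.eps_range z a with e | e | e <;> omega

theorem lam_unique (H : C.TreeHyp k) (h : C.IsDFC) (ha : a ∈ C.Lam) (hd : C.dim a = k)
    (ha' : a' ∈ C.Lam) (hd' : C.dim a' = k) (h1 : C.eps z a ≠ 0) (h2 : C.eps z a' = C.eps z a) :
    a = a' := by
  rcases H.common with ⟨t, ht⟩ | hs
  · exact h.thin_unique (ht a ha hd) (ht a' ha' hd') h1 h2
  · exact hs a a' hd hd'

open Classical in
theorem eps_eq_ite (H : C.TreeHyp k) (h : C.IsDFC) (hy : C.dim y = k) (z : C.Cell) :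
    C.eps z y = (if ∃ a ∈ (C.cellTree k).leavesAbove y, C.Pos z a then 1 else 0) -
      (if ∃ a ∈ (C.cellTree k).leavesAbove y, C.Neg z a then 1 else 0) := by
  rw [H.eps_eq_leafSum h hy, finsum_mem_sign (h.finite_set _) _ (fun y _ => C.eps_range z y)]
  · simp only [eps_eq_one, eps_eq_neg_one]
  · intro a ha a' ha' e e'
    rw [H.mem_leavesAbove] at ha ha'
    exact H.lam_unique h ha.1.1 ha.1.2 ha'.1.1 ha'.1.2 (z := z) (by omega) (by omega)
  · intro a ha a' ha' e e'
    rw [H.mem_leavesAbove] at ha ha'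
    exact H.lam_unique h ha.1.1 ha.1.2 ha'.1.1 ha'.1.2 (z := z) (by omega) (by omega)

theorem not_neg_above (H : C.TreeHyp k) (h : C.IsDFC) (hy : C.dim y = k) (hz : C.Pos z y) :
    ¬ ∃ a ∈ (C.cellTree k).leavesAbove y, C.Neg z a := by
  have e := H.eps_eq_ite h hy z
  rw [eps_eq_one.2 hz] at e
  intro hn
  rw [if_pos hn] at e
  split_ifs at e <;> omega

theorem not_pos_above (H : C.TreeHyp k) (h : C.IsDFC) (hy : C.dim y = k) (hz : C.Neg z y) :
    ¬ ∃ a ∈ (C.cellTree k).leavesAbove y, C.Pos z a := by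
  have e := H.eps_eq_ite h hy z
  rw [eps_eq_neg_one.2 hz] at e
  intro hn
  rw [if_pos hn] at e
  split_ifs at e <;> omega

/-- Everything above a loop on `z` is a loop on `z`. -/
theorem loop_above (h : C.IsDFC) (hl : C.Loop z y)
    (hd : (C.cellTree k).Desc (.inr y') (.inr y)) : C.Loop z y' := by
  have key : ∀ s t, (C.cellTree k).Desc s t →
      (∀ y, t = .inr y → C.Loop z y) → (∀ x, t = .inl x → ∃ y, C.Pos y x ∧ C.Loop z y) →
      (∀ y, s = .inr y → C.Loop z y) ∧ (∀ x, s = .inl x → ∃ y, C.Pos y x ∧ C.Loop z y) := by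
    intro s t hst h1 h2
    induction hst using ReflTransGen.head_induction_on with
    | refl => exact ⟨h1, h2⟩
    | head hst _ ih =>
      cases hst with
      | edge a b ha hb hi =>
        refine ⟨fun y e => ?_, fun x e => by simp at e⟩
        obtain rfl := Sum.inr.inj e
        obtain ⟨t, ht, hlt⟩ := ih.2 a rfl
        exact h.loop_of_loop_target ht hlt hi.2.2
      | node a b ha hb ho =>
        refine ⟨fun x e => by simp at e, fun x e => ?_⟩
        obtain rfl := Sum.inl.inj e
        exact ⟨b, ho.2.2, ih.1 b rfl⟩
  exact (key _ _ hd (fun y e => Sum.inr.inj e ▸ hl) (fun x e => by simp at e)).1 y' rfl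

/-- Whatever is above a loop is a loop, whereas the leaves are in `Λ` and hence are not loops. So
only white dots can be above a loop. -/
theorem not_leafAbove_loop (H : C.TreeHyp k) (h : C.IsDFC) (hl : C.Loop z y) :
    a ∉ (C.cellTree k).leavesAbove y := by
  intro ha
  rw [H.mem_leavesAbove] at ha
  exact h.lam_not_loop ha.1.1 (loop_above h hl ha.2)

/-- `z` is a facet of `y`, or an inner edge of the tree of the leaves above `y`. -/
def Has (C : PreMOP.{u}) (k : ℕ) (z y : C.Cell) : Prop := C.Facet z y ∨
  ((∃ a ∈ (C.cellTree k).leavesAbove y, C.Pos z a) ∧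
    ∃ a ∈ (C.cellTree k).leavesAbove y, C.Neg z a)

theorem leavesAbove_mono (hd : (C.cellTree k).Desc (.inr y) (.inr y')) :
    (C.cellTree k).leavesAbove y ⊆ (C.cellTree k).leavesAbove y' :=
  fun _ ha => ⟨ha.1, ha.2.trans hd⟩

/-- A sign of `z` in a source of `x` either survives in the target or is cancelled by the opposite
sign in another source, and then `z` becomes an inner edge. If `z` occurs as a loop, the second part
of thinness reduces to these cases or to a facet of the target. -/
theorem has_target (H : C.TreeHyp k) (h : C.IsDFC) (hi : (C.cellTree k).inp x y)
    (ho : (C.cellTree k).out x t) (hz : Has C k z y) : Has C k z t := by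
  have sub : ∀ y, C.Neg y x → (C.cellTree k).leavesAbove y ⊆ (C.cellTree k).leavesAbove t :=
    fun y hy => leavesAbove_mono (H.rooted.desc_inp_out (a := x) ⟨hi.1, hi.2.1, hy⟩ ho)
  have dim : ∀ y, C.Neg y x → C.dim y = k := fun y hy =>
    (H.rooted.inp_mem x y ⟨hi.1, hi.2.1, hy⟩).2
  have pm : ∀ y, C.Neg y x → C.eps z y ≠ 0 → Has C k z t := by
    intro y hy hz
    rcases h.thin_source ho.2.2 hy hz with e | ⟨-, y', hy', e⟩
    · rcases eps_ne_zero.1 (e ▸ hz) with h1 | h1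
      · exact Or.inl h1.facet
      · exact Or.inl h1.facet
    · right
      rcases eps_ne_zero.1 hz with h1 | h1
      · rw [eps_eq_one.2 h1, eps_eq_neg_one] at e
        obtain ⟨a, ha, h2⟩ := H.exists_pos_above h (dim y hy) h1
        obtain ⟨a', ha', h2'⟩ := H.exists_neg_above h (dim y' hy') e
        exact ⟨⟨a, sub y hy ha, h2⟩, a', sub y' hy' ha', h2'⟩
      · rw [eps_eq_neg_one.2 h1, neg_neg, eps_eq_one] at e
        obtain ⟨a, ha, h2⟩ := H.exists_neg_above h (dim y hy) h1
        obtain ⟨a', ha', h2'⟩ := H.exists_pos_above h (dim y' hy') e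
        exact ⟨⟨a', sub y' hy' ha', h2'⟩, a, sub y hy ha, h2⟩
  rcases hz with hz | ⟨⟨a, ha, h1⟩, a', ha', h1'⟩
  · rcases facet_cases hz with h1 | h1 | h1
    · exact pm y hi.2.2 (eps_ne_zero.2 (Or.inl h1))
    · exact pm y hi.2.2 (eps_ne_zero.2 (Or.inr h1))
    · obtain ⟨y', hne, α, β, hab, hr1, hr2⟩ := h.thin_loop x y z h1 hi.2.2
      cases α with
      | zero => exact (h.not_loop_of_neg hi.2.2 hr2).elim
      | pos =>
        obtain rfl := h.pos_unique ho.2.2 hr2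
        cases β with
        | zero => exact Or.inl (Loop.facet hr1)
        | pos => exact Or.inl (Pos.facet hr1)
        | neg => exact Or.inl (Neg.facet hr1)
      | neg =>
        cases β with
        | zero => exact (hab rfl).elim
        | pos => exact pm y' hr2 (eps_ne_zero.2 (Or.inl hr1))
        | neg => exact pm y' hr2 (eps_ne_zero.2 (Or.inr hr1))
  · exact Or.inr ⟨⟨a, sub y hi.2.2 ha, h1⟩, a', sub y hi.2.2 ha', h1'⟩

theorem has_desc (H : C.TreeHyp k) (h : C.IsDFC) (hd : (C.cellTree k).Desc (.inr y) (.inr y'))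
    (hz : Has C k z y) : Has C k z y' := by
  revert hz
  generalize hs : (Sum.inr y : C.Cell ⊕ C.Cell) = s at hd
  have key : (∀ y, s = .inr y → Has C k z y → Has C k z y') ∧ (∀ x, s = .inl x →
      ∀ y, (C.cellTree k).inp x y → Has C k z y → Has C k z y') := by
    clear hs
    induction hd using ReflTransGen.head_induction_on with
    | refl => exact ⟨fun y e hz => Sum.inr.inj e ▸ hz, fun x e => by simp at e⟩
    | head hst _ ih =>
      cases hst with
      | edge a b ha hb hi =>
        refine ⟨fun y e hz => ?_, fun x e => by simp at e⟩
        obtain rfl := Sum.inr.inj e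
        exact ih.2 a rfl b hi hz
      | node a b ha hb ho =>
        refine ⟨fun x e => by simp at e, fun x e y hi hz => ?_⟩
        obtain rfl := Sum.inl.inj e
        exact ih.1 b rfl (H.has_target h hi ho hz)
  exact key.1 y hs.symm

theorem top (h : C.IsDFC) : C.TreeHyp C.topDim := by
  obtain ⟨ω, hω, h0⟩ := h.exists_top
  have nd : ∀ x, C.dim x ≠ C.topDim + 1 := fun x hx => by
    have := h.le_topDim x
    omega
  have hs : ∀ x, C.dim x = C.topDim → x = ω := fun x hx => h.top_unique (h.isTop_of_dim hx) hω
  refine ⟨⟨h.finite_set _, h.finite_set _, fun a b hab => (nd a hab.2.1).elim,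
    fun a b hab => (nd a hab.2.1).elim, fun a ha => (nd a ha.2).elim,
    fun a a' b hab => (nd a hab.2.1).elim, fun a a' b hab => (nd a hab.2.1).elim, ω, h0, ?_,
    fun a hab => (nd a hab.2.1).elim, ?_⟩, ?_, Or.inr fun x y hx hy => (hs x hx).trans (hs y hy).symm⟩
  · ext x
    constructor
    · exact fun hx => hs x hx.1
    · rintro rfl
      exact ⟨h0, x, hω, .refl⟩
  · intro b hb
    rw [hs b hb]
    exact .refl
  · ext x
    constructor
    · rintro ⟨hx, -⟩
      refine ⟨?_, hx⟩
      rintro ⟨w, hw⟩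
      have h1 := h.dim_pos hw
      have h2 : C.dim x = C.topDim := hx
      exact nd w (by omega)
    · rintro ⟨-, hx⟩
      exact ⟨hx, fun a hab => nd a hab.2.1⟩

/-- Let `r` be the root of the tree in degree `k + 1` and `z₀ = γ(r)`. All of `Λ_{k+1}` is above
`r`. Every cell of dimension `k` is a facet of some edge of that tree, so `r` has it as a facet or
as an inner edge. Hence each `z ≠ z₀` is a source of an element of `Λ_{k+1}`, and following these
nodes downwards leads to `z₀`. -/
theorem pred (h : C.IsDFC) (H : C.TreeHyp (k + 1)) (hk : k + 1 ≤ C.topDim) : C.TreeHyp k := by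
  obtain ⟨r, hr, hrd⟩ := h.exists_iterTarget hk
  obtain ⟨r', hr', hroot, -, hdesc⟩ := H.rooted.root
  obtain rfl : r = r' := by
    have : r ∈ (C.cellTree (k + 1)).root := ⟨hrd, hr⟩
    rw [hroot] at this
    exact this
  have hLr : ∀ a, a ∈ C.Lam → C.dim a = k + 1 → a ∈ (C.cellTree (k + 1)).leavesAbove r := by
    intro a ha had
    exact H.mem_leavesAbove.2 ⟨⟨ha, by push_cast; exact had⟩, hdesc a (by
      show C.dim a = _
      push_cast
      exact had)⟩
  have hLr' : ∀ a ∈ (C.cellTree (k + 1)).leavesAbove r, a ∈ C.Lam ∧ C.dim a = k + 1 := by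
    intro a ha
    have := (H.mem_leavesAbove.1 ha).1
    push_cast at this
    exact this
  obtain ⟨z₀, hz₀⟩ := h.target r (by omega)
  have hz₀r : z₀ ∈ C.γ r := hz₀ ▸ rfl
  have hz₀d : C.dim z₀ = k := by
    have := h.γ_dim hz₀r
    push_cast at hrd
    omega
  have hz₀i : C.IterTarget z₀ := IsMOP.iterTarget_γ hr hz₀r
  have has : ∀ z, C.dim z = k → Has C (k + 1) z r := by
    intro z hz
    obtain ⟨y, hy⟩ := h.exists_facet (x := z) (by omega)
    have hyd := h.dim_facet y z hy
    exact H.has_desc h (hdesc y (by show C.dim y = _; push_cast; omega)) (Or.inl hy)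
  -- If `r` is a loop, there is no leaf above it, so `Λ_{k+1}` is empty. Otherwise `z₀` has sign `1`
  -- in `r`, which excludes leaves with source `z₀`.
  have hnotinp : ∀ a, a ∈ C.Lam → C.dim a = k + 1 → ¬ C.Neg z₀ a := by
    intro a ha had hn
    by_cases hl : C.Loop z₀ r
    · exact H.not_leafAbove_loop h hl (hLr a ha had)
    · have hp : C.Pos z₀ r := ⟨hz₀r, fun h1 => hl ⟨h1, hz₀r⟩⟩
      exact H.not_neg_above h hrd hp ⟨a, hLr a ha had, hn⟩
  have hinp : ∀ z, C.dim z = k → z ≠ z₀ → ∃ a, a ∈ C.Lam ∧ C.dim a = k + 1 ∧ C.Neg z a := by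
    intro z hz hne
    have : ∃ a ∈ (C.cellTree (k + 1)).leavesAbove r, C.Neg z a := by
      rcases has z hz with h1 | ⟨-, h1⟩
      · rcases facet_cases h1 with h1 | h1 | h1
        · exact (hne (h.γ_unique h1.1 hz₀r)).elim
        · exact H.exists_neg_above h hrd h1
        · exact (hne (h.γ_unique h1.2 hz₀r)).elim
      · exact h1
    obtain ⟨a, ha, hn⟩ := this
    exact ⟨a, (hLr' a ha).1, (hLr' a ha).2, hn⟩
  -- Descending steps between nodes are well founded: by `H.common` the nodes are sources of a
  -- single cell, where the acyclicity axiom applies, or there is only one cell of that dimension.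
  let R : C.Cell → C.Cell → Prop := fun a a' => (a ∈ C.Lam ∧ C.dim a = k + 1) ∧
    (a' ∈ C.Lam ∧ C.dim a' = k + 1) ∧ ∃ z, C.Pos z a ∧ C.Neg z a'
  have hwf : WellFounded (flip (TransGen R)) := by
    have := h.finite
    have : Std.Irrefl (flip (TransGen R)) := by
      refine ⟨fun a ha => ?_⟩
      rcases H.common with ⟨t, ht⟩ | hs
      · push_cast at ht
        have ha1 : a ∈ C.Lam ∧ C.dim a = k + 1 := by
          obtain ⟨b, hb, -⟩ := TransGen.head'_iff.1 ha
          exact hb.1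
        have := h.dim_neg (ht a ha1.1 ha1.2)
        refine h.acyclic t (by omega) a (TransGen.mono (fun u v huv => ?_) _ _ ha)
        exact ⟨ht u huv.1.1 huv.1.2, ht v huv.2.1.1 huv.2.1.2, huv.2.2⟩
      · obtain ⟨b, ⟨h1, h2, z, h3, h4⟩, -⟩ := TransGen.head'_iff.1 ha
        obtain rfl := hs a b (by push_cast; exact h1.2) (by push_cast; exact h2.2)
        exact h3.not_neg h4
    have : IsTrans _ (flip (TransGen R)) := ⟨fun a b c h1 h2 => TransGen.trans h2 h1⟩
    exact Finite.wellFounded_of_trans_of_irrefl _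
  have hpos : ∀ a, a ∈ C.Lam → C.dim a = k + 1 → ∃ t, C.Pos t a ∧ C.dim t = k := by
    intro a ha had
    obtain ⟨t, ht⟩ := h.exists_pos (x := a) (by omega) (fun z => h.lam_not_loop ha)
    have := h.dim_pos ht
    exact ⟨t, ht, by omega⟩
  have hdescA : ∀ a, a ∈ C.Lam → C.dim a = k + 1 →
      (C.cellTree k).Desc (.inl a) (.inr z₀) := by
    intro a
    induction a using hwf.induction with
    | _ a ih =>
      intro ha had
      obtain ⟨t, ht, htd⟩ := hpos a ha had
      refine .head (.node a t ⟨ha, had⟩ htd ⟨ha, had, ht⟩) ?_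
      by_cases hne : t = z₀
      · rw [hne]
      · obtain ⟨a', ha', had', hn⟩ := hinp t htd hne
        refine .head (.edge a' t ⟨ha', had'⟩ htd ⟨ha', had', hn⟩) (ih a' ?_ ha' had')
        exact .single ⟨⟨ha, had⟩, ⟨ha', had'⟩, t, ht, hn⟩
  have hdesc' : ∀ b, C.dim b = k → (C.cellTree k).Desc (.inr b) (.inr z₀) := by
    intro b hb
    by_cases hne : b = z₀
    · rw [hne]
      exact .refl
    · obtain ⟨a', ha', had', hn⟩ := hinp b hb hne
      exact .head (.edge a' b ⟨ha', had'⟩ hb ⟨ha', had', hn⟩) (hdescA a' ha' had')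
  have uniq : ∀ a a' z, a ∈ C.Lam → C.dim a = k + 1 → a' ∈ C.Lam → C.dim a' = k + 1 →
      C.eps z a ≠ 0 → C.eps z a' = C.eps z a → a = a' := fun a a' z h1 h2 h3 h4 =>
    H.lam_unique h h1 (by push_cast; exact h2) h3 (by push_cast; exact h4)
  have rooted : (C.cellTree k).IsRootedTree := by
    refine ⟨h.finite_set _, h.finite_set _, ?_, ?_, ?_, ?_, ?_, z₀, hz₀d, ?_, ?_, hdesc'⟩
    · rintro a b ⟨h1, h2, h3⟩
      have := h.dim_pos h3
      exact ⟨⟨h1, h2⟩, by show C.dim b = k; omega⟩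
    · rintro a b ⟨h1, h2, h3⟩
      have := h.dim_neg h3
      exact ⟨⟨h1, h2⟩, by show C.dim b = k; omega⟩
    · rintro a ⟨ha, had⟩
      obtain ⟨t, ht, htd⟩ := hpos a ha had
      exact ⟨t, ⟨ha, had, ht⟩, fun t' ht' => h.pos_unique ht'.2.2 ht⟩
    · rintro a a' b ⟨h1, h2, h3⟩ ⟨h1', h2', h3'⟩
      have e := eps_eq_one.2 h3
      have e' := eps_eq_one.2 h3'
      exact uniq a a' b h1 h2 h1' h2' (by omega) (by omega)
    · rintro a a' b ⟨h1, h2, h3⟩ ⟨h1', h2', h3'⟩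
      have e := eps_eq_neg_one.2 h3
      have e' := eps_eq_neg_one.2 h3'
      exact uniq a a' b h1 h2 h1' h2' (by omega) (by omega)
    · ext b
      constructor
      · exact fun hb => h.iterTarget_unique hb.2 hz₀i (hb.1.trans hz₀d.symm)
      · rintro rfl
        exact ⟨hz₀d, hz₀i⟩
    · rintro a ⟨h1, h2, h3⟩
      exact hnotinp a h1 h2 h3
  have hleaves : (C.cellTree k).leaves = {x | x ∈ C.Lam ∧ C.dim x = k} := by
    ext b
    constructor
    · rintro ⟨hb, hbn⟩
      refine ⟨?_, hb⟩
      rintro ⟨x, hx⟩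
      have hb' : C.dim b = k := hb
      have := h.dim_pos hx
      obtain ⟨a, ha, hp⟩ := H.exists_pos_above h (y := x) (by push_cast; omega) hx
      have ha := (H.mem_leavesAbove.1 ha).1
      exact hbn a ⟨ha.1, by have := ha.2; push_cast at this; exact this, hp⟩
    · rintro ⟨hb, hbd⟩
      exact ⟨hbd, fun a ha => hb ⟨a, ha.2.2⟩⟩
  refine ⟨rooted, hleaves, ?_⟩
  -- If the root `z₀` is in `Λ`, it is a leaf and hence the only edge. Otherwise every `x` in `Λ_k`
  -- differs from `z₀`, so it is a source of some node; it is the target of none, so its sign in `r`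
  -- is `-1`.
  by_cases hz₀l : z₀ ∈ C.Lam
  · right
    have : ∀ x, C.dim x = k → x = z₀ := fun x hx =>
      Sum.inr.inj (PreTree.IsRootedTree.desc_leaf (hleaves ▸ ⟨hz₀l, hz₀d⟩) (hdesc' x hx))
    exact fun x y hx hy => (this x hx).trans (this y hy).symm
  · left
    refine ⟨r, fun x hx hxd => ?_⟩
    have hne : x ≠ z₀ := fun e => hz₀l (e ▸ hx)
    obtain ⟨a, ha, had, hn⟩ := hinp x hxd hne
    have e := H.eps_eq_ite h hrd x
    rw [if_neg, if_pos ⟨a, hLr a ha had, hn⟩] at e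
    · exact eps_eq_neg_one.1 (by omega)
    · rintro ⟨a', -, hp⟩
      exact hx ⟨a', hp⟩

end TreeHyp

theorem IsDFC.treeHyp (h : C.IsDFC) {k : ℕ} (hk : k ≤ C.topDim) : C.TreeHyp k := by
  obtain ⟨j, hj⟩ := Nat.exists_eq_add_of_le hk
  induction j generalizing k with
  | zero =>
    have := TreeHyp.top h
    rwa [hj] at this
  | succ j ih => exact TreeHyp.pred h (ih (k := k + 1) (by omega) (by omega)) (by omega)

end PreMOP

/-! ## The order of the white dots -/

namespace PreMOP

variable {C : PreMOP.{u}} {x y y' y'' z t t' w w' a a' b b' : C.Cell} {j : ℕ}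

theorem IsDFC.local_irrefl (h : C.IsDFC) (hx : x ∈ C.Lam) (h1 : C.Loop z y) (h2 : C.Neg y x) :
    ¬ C.localLT x z y y := by
  have := h.local_order x hx z
  exact irrefl_of (fun y y' : {y // C.Loop z y ∧ C.Neg y x} => C.localLT x z y y') ⟨y, h1, h2⟩

theorem IsDFC.local_trans (h : C.IsDFC) (hx : x ∈ C.Lam) (h1 : C.Loop z y) (h2 : C.Neg y x)
    (h1' : C.Loop z y') (h2' : C.Neg y' x) (h1'' : C.Loop z y'') (h2'' : C.Neg y'' x)
    (h3 : C.localLT x z y y') (h4 : C.localLT x z y' y'') : C.localLT x z y y'' := by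
  have := h.local_order x hx z
  exact trans_of (fun y y' : {y // C.Loop z y ∧ C.Neg y x} => C.localLT x z y y')
    (a := ⟨y, h1, h2⟩) (b := ⟨y', h1', h2'⟩) (c := ⟨y'', h1'', h2''⟩) h3 h4

theorem IsDFC.local_asymm (h : C.IsDFC) (hx : x ∈ C.Lam) (h1 : C.Loop z y) (h2 : C.Neg y x)
    (h1' : C.Loop z y') (h2' : C.Neg y' x)
    (h3 : C.localLT x z y y') : ¬ C.localLT x z y' y := fun h4 =>
  h.local_irrefl hx h1 h2 (h.local_trans hx h1 h2 h1' h2' h1 h2 h3 h4)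

theorem IsDFC.local_total (h : C.IsDFC) (hx : x ∈ C.Lam) (h1 : C.Loop z y) (h2 : C.Neg y x)
    (h1' : C.Loop z y') (h2' : C.Neg y' x) (hne : y ≠ y') :
    C.localLT x z y y' ∨ C.localLT x z y' y := by
  have := h.local_order x hx z
  have := trichotomous_of (fun y y' : {y // C.Loop z y ∧ C.Neg y x} => C.localLT x z y y')
    ⟨y, h1, h2⟩ ⟨y', h1', h2'⟩
  simpa [hne] using this

theorem IsDFC.null_not_neg (hw : w ∈ C.Null) : ¬ C.Neg y w := fun h1 => by
  have h2 := h1.1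
  rw [show C.δ w = ∅ from hw] at h2
  exact h2

/-- If `z ≺⁺ t ≺⁺ w`, then thinness would produce a source of `w`, and `w` has none. So the target
of a white dot on `z` is a loop on `z`. -/
theorem IsDFC.white_spec (h : C.IsDFC) (hw : w ∈ C.whites z) :
    w ∈ C.Lam ∧ (∀ y, ¬ C.Neg y w) ∧ ∃ t, C.Pos t w ∧ C.Loop z t := by
  obtain ⟨hl, hn, t, ht, hz⟩ := hw
  have ht' : C.Pos t w := ⟨ht, fun h1 => h.lam_not_loop hl ⟨h1, ht⟩⟩
  refine ⟨hl, fun y => IsDFC.null_not_neg hn, t, ht', ?_⟩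
  by_contra hc
  have hp : C.Pos z t := ⟨hz, fun h1 => hc ⟨h1, hz⟩⟩
  obtain ⟨y, hy, -⟩ := h.thin_target ht' (eps_ne_zero.2 (Or.inl hp))
  exact IsDFC.null_not_neg hn hy

/-- Comparison of two sources of `x` that contain white dots on `z`. -/
def SourceLT (C : PreMOP.{u}) (x z y y' : C.Cell) : Prop :=
  C.Neg z y ∨ C.Pos z y' ∨ (C.Loop z y ∧ C.Loop z y' ∧ C.localLT x z y y')

/-- `a` is the middle of a chain of two signed relations that starts at `z`. -/
def Zig (C : PreMOP.{u}) (z a : C.Cell) : Prop := ∃ y, C.eps z y ≠ 0 ∧ C.eps y a ≠ 0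

theorem ZigStep.zig_left (h : C.ZigStep z a a') : C.Zig z a := by
  obtain ⟨_, _, b, ⟨h1, h2, h3⟩ | ⟨h1, h2, h3⟩⟩ := h
  · exact ⟨b, eps_ne_zero.2 (Or.inr h1), eps_ne_zero.2 (Or.inl h2)⟩
  · exact ⟨b, eps_ne_zero.2 (Or.inl h1), eps_ne_zero.2 (Or.inr h2)⟩

theorem ZigStep.zig_right (h : C.ZigStep z a a') : C.Zig z a' := by
  obtain ⟨_, _, b, ⟨h1, h2, h3⟩ | ⟨h1, h2, h3⟩⟩ := h
  · exact ⟨b, eps_ne_zero.2 (Or.inr h1), eps_ne_zero.2 (Or.inr h3)⟩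
  · exact ⟨b, eps_ne_zero.2 (Or.inl h1), eps_ne_zero.2 (Or.inl h3)⟩

/-- If the target of `a` were a loop on `z`, then so would be every source of `a`. But some facet of
`a` has a nonzero sign with respect to `z`. -/
theorem IsDFC.not_loop_target_of_zig (h : C.IsDFC) (ha : C.Zig z a) (ht : C.Pos t a) :
    ¬ C.Loop z t := by
  obtain ⟨y, h1, h2⟩ := ha
  intro hl
  have hy : C.Loop z y := by
    rcases eps_ne_zero.1 h2 with h3 | h3
    · rwa [h.pos_unique h3 ht]
    · exact h.loop_of_loop_target ht hl h3
  rcases eps_ne_zero.1 h1 with h3 | h3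
  · exact h.not_loop_of_pos h3 hy
  · exact h.not_loop_of_neg h3 hy

namespace TreeHyp

/-- The target of `w` is a loop on `z`, in particular it has `z` as a facet. `has_desc` carries this
down the path. -/
theorem has_white (H : C.TreeHyp j) (h : C.IsDFC) (hw : w ∈ C.whites z) (hd : C.dim w = j + 1)
    (hy : (C.cellTree j).Desc (.inl w) (.inr y)) : Has C j z y := by
  obtain ⟨hl, -, t, ht, hz⟩ := h.white_spec hw
  have ho : (C.cellTree j).out w t := ⟨hl, hd, ht⟩
  rcases H.rooted.desc_of_out ho hy with e | e
  · simp at e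
  · exact H.has_desc h e (Or.inl hz.facet)

/-- Only one element of `Λ` has the target `z`, and its descending path passes through only one
source of `x`. -/
theorem pos_siblings (H : C.TreeHyp j) (h : C.IsDFC) (hi : (C.cellTree j).inp x y)
    (hi' : (C.cellTree j).inp x y') (h1 : ∃ a ∈ (C.cellTree j).leavesAbove y, C.Pos z a)
    (h2 : ∃ a ∈ (C.cellTree j).leavesAbove y', C.Pos z a) : y = y' := by
  obtain ⟨a, ha, hp⟩ := h1
  obtain ⟨a', ha', hp'⟩ := h2
  have h3 := H.mem_leavesAbove.1 ha
  have h3' := H.mem_leavesAbove.1 ha'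
  obtain rfl := H.lam_unique h h3.1.1 h3.1.2 h3'.1.1 h3'.1.2 (eps_ne_zero.2 (Or.inl hp))
    (by rw [eps_eq_one.2 hp, eps_eq_one.2 hp'])
  exact H.rooted.eq_of_desc_siblings hi hi' h3.2 h3'.2

theorem neg_siblings (H : C.TreeHyp j) (h : C.IsDFC) (hi : (C.cellTree j).inp x y)
    (hi' : (C.cellTree j).inp x y') (h1 : ∃ a ∈ (C.cellTree j).leavesAbove y, C.Neg z a)
    (h2 : ∃ a ∈ (C.cellTree j).leavesAbove y', C.Neg z a) : y = y' := by
  obtain ⟨a, ha, hp⟩ := h1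
  obtain ⟨a', ha', hp'⟩ := h2
  have h3 := H.mem_leavesAbove.1 ha
  have h3' := H.mem_leavesAbove.1 ha'
  obtain rfl := H.lam_unique h h3.1.1 h3.1.2 h3'.1.1 h3'.1.2 (eps_ne_zero.2 (Or.inr hp))
    (by rw [eps_eq_neg_one.2 hp, eps_eq_neg_one.2 hp'])
  exact H.rooted.eq_of_desc_siblings hi hi' h3.2 h3'.2

/-- Two sources of `x` cannot both contain `z` unless it is a facet of both. -/
theorem facet_of_siblings (H : C.TreeHyp j) (h : C.IsDFC) (hi : (C.cellTree j).inp x y)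
    (hi' : (C.cellTree j).inp x y') (hne : y ≠ y') (hz : Has C j z y) (hz' : Has C j z y') :
    C.Facet z y := by
  have dim : ∀ y, (C.cellTree j).inp x y → C.dim y = j := fun y hy => (H.rooted.inp_mem x y hy).2
  rcases hz with hz | ⟨hp, hn⟩
  · exact hz
  exfalso
  rcases hz' with hz' | ⟨hp', -⟩
  · rcases facet_cases hz' with h1 | h1 | h1
    · exact hne (H.pos_siblings h hi hi' hp (H.exists_pos_above h (dim y' hi') h1))
    · exact hne (H.neg_siblings h hi hi' hn (H.exists_neg_above h (dim y' hi') h1))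
    -- Here `z` is an inner edge above `y` and `y'` is a loop on `z`. The second part of thinness
    -- yields a further occurrence of `z`. In the target of `x` it is incompatible with the leaves
    -- above `y`; in a source it forces that source to be `y`, where the signs of `z` cancel.
    · obtain ⟨y₁, hne₁, α, β, hab, hr1, hr2⟩ := h.thin_loop x y' z h1 hi'.2.2
      cases α with
      | zero => exact h.not_loop_of_neg hi.2.2 hr2
      | pos =>
        have ho : (C.cellTree j).out x y₁ := ⟨hi.1, hi.2.1, hr2⟩
        have sub := leavesAbove_mono (H.rooted.desc_inp_out hi ho)
        have hyd := (H.rooted.out_mem x y₁ ho).2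
        cases β with
        | zero =>
          obtain ⟨a, ha, _⟩ := hp
          exact H.not_leafAbove_loop h hr1 (sub ha)
        | pos =>
          obtain ⟨a, ha, h2⟩ := hn
          exact H.not_neg_above h hyd hr1 ⟨a, sub ha, h2⟩
        | neg =>
          obtain ⟨a, ha, h2⟩ := hp
          exact H.not_pos_above h hyd hr1 ⟨a, sub ha, h2⟩
      | neg =>
        have hi₁ : (C.cellTree j).inp x y₁ := ⟨hi.1, hi.2.1, hr2⟩
        cases β with
        | zero => exact hab rfl
        | pos =>
          obtain rfl := H.pos_siblings h hi hi₁ hp (H.exists_pos_above h (dim y₁ hi₁) hr1)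
          exact H.not_neg_above h (dim y hi) hr1 hn
        | neg =>
          obtain rfl := H.neg_siblings h hi hi₁ hn (H.exists_neg_above h (dim y₁ hi₁) hr1)
          exact H.not_pos_above h (dim y hi) hr1 hp
  · exact hne (H.pos_siblings h hi hi' hp hp')

theorem sourceLT_asymm (h : C.IsDFC) (hi : (C.cellTree j).inp x y)
    (hi' : (C.cellTree j).inp x y') (hne : y ≠ y') (h1 : C.SourceLT x z y y') :
    ¬ C.SourceLT x z y' y := by
  rintro h2
  rcases h1 with h1 | h1 | ⟨h1, h1', h1''⟩
  · rcases h2 with h2 | h2 | ⟨h2, h2', h2''⟩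
    · exact hne (h.thin_unique_neg hi.2.2 hi'.2.2 h1 h2)
    · exact h2.not_neg h1
    · exact h.not_loop_of_neg h1 h2'
  · rcases h2 with h2 | h2 | ⟨h2, h2', h2''⟩
    · exact h1.not_neg h2
    · exact hne (h.thin_unique_pos hi.2.2 hi'.2.2 h2 h1)
    · exact h.not_loop_of_pos h1 h2
  · rcases h2 with h2 | h2 | ⟨h2, h2', h2''⟩
    · exact h.not_loop_of_neg h2 h1'
    · exact h.not_loop_of_pos h2 h1
    · exact h.local_asymm hi.1 h1 hi.2.2 h1' hi'.2.2 h1'' h2''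

theorem sourceLT_total (h : C.IsDFC) (hi : (C.cellTree j).inp x y)
    (hi' : (C.cellTree j).inp x y') (hne : y ≠ y') (hz : C.Facet z y) (hz' : C.Facet z y') :
    C.SourceLT x z y y' ∨ C.SourceLT x z y' y := by
  rcases facet_cases hz with h1 | h1 | h1
  · exact Or.inr (Or.inr (Or.inl h1))
  · exact Or.inl (Or.inl h1)
  · rcases facet_cases hz' with h2 | h2 | h2
    · exact Or.inl (Or.inr (Or.inl h2))
    · exact Or.inr (Or.inl h2)
    · rcases h.local_total hi.1 h1 hi.2.2 h2 hi'.2.2 hne with h3 | h3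
      · exact Or.inl (Or.inr (Or.inr ⟨h1, h2, h3⟩))
      · exact Or.inr (Or.inr (Or.inr ⟨h2, h1, h3⟩))

theorem sourceLT_trans (h : C.IsDFC) (hi : (C.cellTree j).inp x y)
    (hi' : (C.cellTree j).inp x y') (hi'' : (C.cellTree j).inp x y'') (hne : y' ≠ y'')
    (h1 : C.SourceLT x z y y') (h2 : C.SourceLT x z y' y'') : C.SourceLT x z y y'' := by
  rcases h1 with h1 | h1 | ⟨h1, h1', h1''⟩
  · exact Or.inl h1
  · rcases h2 with h2 | h2 | ⟨h2, h2', h2''⟩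
    · exact (h1.not_neg h2).elim
    · exact (hne (h.thin_unique_pos hi'.2.2 hi''.2.2 h1 h2)).elim
    · exact (h.not_loop_of_pos h1 h2).elim
  · rcases h2 with h2 | h2 | ⟨h2, h2', h2''⟩
    · exact (h.not_loop_of_neg h2 h1').elim
    · exact Or.inr (Or.inl h2)
    · exact Or.inr (Or.inr ⟨h1, h2',
        h.local_trans hi.1 h1 hi.2.2 h2 hi'.2.2 h2' hi''.2.2 h1'' h2''⟩)

end TreeHyp

/-- The order of white dots on `z`, by comparison of the branches at the cell where their
descending paths meet. -/
def MeetLT (C : PreMOP.{u}) (j : ℕ) (z w w' : C.Cell) : Prop :=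
  ∃ x y y', y ≠ y' ∧ (C.cellTree j).inp x y ∧ (C.cellTree j).inp x y' ∧
    (C.cellTree j).Desc (.inl w) (.inr y) ∧ (C.cellTree j).Desc (.inl w') (.inr y') ∧
    C.SourceLT x z y y'

namespace TreeHyp

theorem desc_nodes (H : C.TreeHyp j) :
    ∃ r, ∀ s, ((∃ w, s = .inl w ∧ w ∈ C.Lam ∧ C.dim w = j + 1) ∨ ∃ y, s = .inr y ∧ C.dim y = j) →
      (C.cellTree j).Desc s (.inr r) := by
  obtain ⟨r, -, -, -, hr⟩ := H.rooted.root
  refine ⟨r, ?_⟩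
  rintro _ (⟨w, rfl, hw, hd⟩ | ⟨y, rfl, hy⟩)
  · obtain ⟨t, ht⟩ := H.rooted.exists_out (a := w) ⟨hw, hd⟩
    exact .head (H.rooted.step_out ht) (hr t (H.rooted.out_mem _ _ ht).2)
  · exact hr y hy

theorem not_desc_null (hn : ∀ y, ¬ C.Neg y w) {s : C.Cell ⊕ C.Cell} (hs : s ≠ .inl w) :
    ¬ (C.cellTree j).Desc s (.inl w) := by
  intro hd
  rcases PreTree.IsRootedTree.desc_inl_cases hd with e | ⟨b, hb, -⟩
  · exact hs e
  · exact hn b hb.2.2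

/-- White dots have no sources, so neither of two distinct ones is below the other and their
descending paths have a proper meeting point. -/
theorem exists_meet_white (H : C.TreeHyp j) (h : C.IsDFC) (hw : w ∈ C.whites z)
    (hd : C.dim w = j + 1) (hw' : w' ∈ C.whites z) (hd' : C.dim w' = j + 1) (hne : w ≠ w') :
    ∃ x y y', y ≠ y' ∧ (C.cellTree j).inp x y ∧ (C.cellTree j).inp x y' ∧
      (C.cellTree j).Desc (.inl w) (.inr y) ∧ (C.cellTree j).Desc (.inl w') (.inr y') := by
  obtain ⟨hl, hn, -⟩ := h.white_spec hw
  obtain ⟨hl', hn', -⟩ := h.white_spec hw'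
  obtain ⟨r, hr⟩ := H.desc_nodes
  exact H.rooted.exists_meet (hr _ (Or.inl ⟨w, rfl, hl, hd⟩)) (hr _ (Or.inl ⟨w', rfl, hl', hd'⟩))
    (not_desc_null hn' fun e => hne (Sum.inl.inj e))
    (not_desc_null hn fun e => hne (Sum.inl.inj e).symm)

theorem exists_meet_edge (H : C.TreeHyp j) (h : C.IsDFC) (hw : w ∈ C.whites z)
    (hd : C.dim w = j + 1) (hy : C.dim y = j) (hn : ¬ (C.cellTree j).Desc (.inl w) (.inr y)) :
    ∃ x y₁ y₂, y₁ ≠ y₂ ∧ (C.cellTree j).inp x y₁ ∧ (C.cellTree j).inp x y₂ ∧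
      (C.cellTree j).Desc (.inr y) (.inr y₁) ∧ (C.cellTree j).Desc (.inl w) (.inr y₂) := by
  obtain ⟨hl, hnull, -⟩ := h.white_spec hw
  obtain ⟨r, hr⟩ := H.desc_nodes
  exact H.rooted.exists_meet (hr _ (Or.inr ⟨y, rfl, hy⟩)) (hr _ (Or.inl ⟨w, rfl, hl, hd⟩))
    (not_desc_null hnull (by simp)) hn

theorem meetLT_iff (H : C.TreeHyp j) (hne : y ≠ y') (hi : (C.cellTree j).inp x y)
    (hi' : (C.cellTree j).inp x y') (hw : (C.cellTree j).Desc (.inl w) (.inr y))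
    (hw' : (C.cellTree j).Desc (.inl w') (.inr y')) :
    C.MeetLT j z w w' ↔ C.SourceLT x z y y' := by
  constructor
  · rintro ⟨x₁, y₁, y₁', hne₁, hi₁, hi₁', hw₁, hw₁', hlt⟩
    obtain ⟨rfl, rfl, rfl⟩ := H.rooted.meet_unique hi hi' hne hi₁ hi₁' hne₁ hw hw' hw₁ hw₁'
    exact hlt
  · exact fun hlt => ⟨x, y, y', hne, hi, hi', hw, hw', hlt⟩

theorem meetLT_asymm (H : C.TreeHyp j) (h : C.IsDFC) (h1 : C.MeetLT j z w w') :
    ¬ C.MeetLT j z w' w := by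
  obtain ⟨x, y, y', hne, hi, hi', hw, hw', hlt⟩ := h1
  rw [H.meetLT_iff hne.symm hi' hi hw' hw]
  exact sourceLT_asymm h hi hi' hne hlt

theorem meetLT_total (H : C.TreeHyp j) (h : C.IsDFC) (hw : w ∈ C.whites z)
    (hd : C.dim w = j + 1) (hw' : w' ∈ C.whites z) (hd' : C.dim w' = j + 1) (hne : w ≠ w') :
    C.MeetLT j z w w' ∨ C.MeetLT j z w' w := by
  obtain ⟨x, y, y', hne', hi, hi', h1, h1'⟩ := H.exists_meet_white h hw hd hw' hd' hne
  rw [H.meetLT_iff hne' hi hi' h1 h1', H.meetLT_iff hne'.symm hi' hi h1' h1]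
  have hz := H.has_white h hw hd h1
  have hz' := H.has_white h hw' hd' h1'
  exact sourceLT_total h hi hi' hne' (H.facet_of_siblings h hi hi' hne' hz hz')
    (H.facet_of_siblings h hi' hi hne'.symm hz' hz)

/-- The two meeting points are both on the descending path of `w₂`. If they differ, the lower one is
also the meeting point of `w₁` and `w₃`; if they coincide, three branches at one node are compared.
-/
theorem meetLT_trans (H : C.TreeHyp j) (h : C.IsDFC) {w₁ w₂ w₃ : C.Cell}
    (h1 : C.MeetLT j z w₁ w₂) (h2 : C.MeetLT j z w₂ w₃) : C.MeetLT j z w₁ w₃ := by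
  obtain ⟨x, y₁, y₂, hne, hi₁, hi₂, hw₁, hw₂, hlt⟩ := h1
  obtain ⟨x', y₂', y₃, hne', hi₂', hi₃, hw₂', hw₃, hlt'⟩ := h2
  rcases H.rooted.total hw₂ hw₂' with hd | hd
  · rcases H.rooted.desc_of_inp hi₂ hd with e | hd
    · obtain rfl : y₂' = y₂ := Sum.inr.inj e
      obtain rfl := H.rooted.target_node _ _ _ hi₂ hi₂'
      have hne'' : y₁ ≠ y₃ := by
        rintro rfl
        exact sourceLT_asymm h hi₁ hi₂ hne hlt hlt'
      exact ⟨x, y₁, y₃, hne'', hi₁, hi₃, hw₁, hw₃,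
        sourceLT_trans h hi₁ hi₂ hi₃ hne' hlt hlt'⟩
    · exact ⟨x', y₂', y₃, hne', hi₂', hi₃, (hw₁.trans (H.rooted.desc_inp hi₁)).trans hd, hw₃, hlt'⟩
  · rcases H.rooted.desc_of_inp hi₂' hd with e | hd
    · obtain rfl : y₂ = y₂' := Sum.inr.inj e
      obtain rfl := H.rooted.target_node _ _ _ hi₂ hi₂'
      have hne'' : y₁ ≠ y₃ := by
        rintro rfl
        exact sourceLT_asymm h hi₁ hi₂ hne hlt hlt'
      exact ⟨x, y₁, y₃, hne'', hi₁, hi₃, hw₁, hw₃,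
        sourceLT_trans h hi₁ hi₂ hi₃ hne' hlt hlt'⟩
    · exact ⟨x, y₁, y₂, hne, hi₁, hi₂, hw₁, (hw₃.trans (H.rooted.desc_inp hi₃)).trans hd, hlt⟩

/-! ### Comparison with the order defined by the zig-zags -/

/-- Above a loop on `z` all edges are loops on `z`, and each passage through a node of the tree is
one step of `⊂`. With `desc_of_inclEq` this identifies `⊆` on loops with the descending relation. -/
theorem inclEq_of_desc (H : C.TreeHyp j) (h : C.IsDFC) (ht : C.Pos t w) (hy : C.dim y = j)
    (hl : C.Loop z y) (hd : (C.cellTree j).Desc (.inl w) (.inr y)) : C.InclEq z t y := by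
  revert hl hd
  refine H.rooted.up_induction (P := fun y => C.Loop z y →
    (C.cellTree j).Desc (.inl w) (.inr y) → C.InclEq z t y) (fun y hy ih hl hd => ?_) y hy
  rcases PreTree.IsRootedTree.desc_inr_cases hd with e | ⟨a, ho, hd⟩
  · simp at e
  rcases PreTree.IsRootedTree.desc_inl_cases hd with e | ⟨b, hi, hd⟩
  · obtain rfl := Sum.inl.inj e
    rw [h.pos_unique ht ho.2.2]
    exact .refl
  · have hlb := h.loop_of_loop_target ho.2.2 hl hi.2.2
    exact .tail (ih a b ho hi hlb hd) ⟨a, ho.1, hl, ho.2.2, hlb, hi.2.2⟩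

theorem desc_of_inclEq (H : C.TreeHyp j) (h : C.IsDFC) (hb : C.dim b' = j)
    (hi : C.InclEq z b' b) : C.dim b = j ∧ (C.cellTree j).Desc (.inr b') (.inr b) := by
  induction hi with
  | refl => exact ⟨hb, .refl⟩
  | tail _ hs ih =>
    obtain ⟨a, ha, h1, h2, h3, h4⟩ := hs
    have e1 := h.dim_pos h2
    have e2 := h.dim_neg h4
    have had : C.dim a = j + 1 := by omega
    exact ⟨by omega, ih.2.trans (H.rooted.desc_inp_out (a := a) ⟨ha, had, h4⟩ ⟨ha, had, h2⟩)⟩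

/-- Let `x` be the node with target `y`. The sign of `z` in `y` comes from one source `y₁` of `x`.
If `w` is above `y₁`, continue upwards and add one step to the zig-zag. If `w` is above another
source, then `z` is a facet of that source; the uniqueness of signs leaves only a loop, and the
zig-zag starts at `x`. -/
theorem zig_of_neg (H : C.TreeHyp j) (h : C.IsDFC) (hw : w ∈ C.whites z) (hd : C.dim w = j + 1)
    (ht : C.Pos t w) (hy : C.dim y = j) (hz : C.Neg z y)
    (hwy : (C.cellTree j).Desc (.inl w) (.inr y)) :
    ∃ b a x, C.Loop z b ∧ C.Neg b a ∧ C.InclEq z t b ∧ (C.cellTree j).out x y ∧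
      ReflTransGen (C.ZigStep z) a x := by
  revert hz hwy
  refine H.rooted.up_induction (P := fun y => C.Neg z y →
    (C.cellTree j).Desc (.inl w) (.inr y) → ∃ b a x, C.Loop z b ∧ C.Neg b a ∧ C.InclEq z t b ∧
      (C.cellTree j).out x y ∧ ReflTransGen (C.ZigStep z) a x) (fun y hy ih hz hwy => ?_) y hy
  obtain ⟨-, hn, t', ht', hl⟩ := h.white_spec hw
  rcases PreTree.IsRootedTree.desc_inr_cases hwy with e | ⟨x, ho, hwx⟩
  · simp at e
  obtain ⟨y₁, hy₁, e₁⟩ := h.thin_target ho.2.2 (eps_ne_zero.2 (Or.inr hz))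
  rw [eps_eq_neg_one.2 hz, eps_eq_neg_one] at e₁
  have hi₁ : (C.cellTree j).inp x y₁ := ⟨ho.1, ho.2.1, hy₁⟩
  rcases PreTree.IsRootedTree.desc_inl_cases hwx with e | ⟨y₂, hi₂, hwy₂⟩
  · obtain rfl := Sum.inl.inj e
    exact (hn y₁ hy₁).elim
  have hd₂ : C.dim y₂ = j := (H.rooted.inp_mem _ _ hi₂).2
  by_cases hne : y₂ = y₁
  · subst hne
    obtain ⟨b, a, x', h1, h2, h3, h4, h5⟩ := ih x y₂ ho hi₂ e₁ hwy₂
    exact ⟨b, a, x, h1, h2, h3, ho, h5.tail ⟨h4.1, ho.1, y₂, Or.inl ⟨e₁, h4.2.2, hy₁⟩⟩⟩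
  · have hf := H.facet_of_siblings h hi₂ hi₁ hne (H.has_white h hw hd hwy₂) (Or.inl e₁.facet)
    rcases facet_cases hf with h1 | h1 | h1
    · rcases h.thin_source ho.2.2 hi₂.2.2 (eps_ne_zero.2 (Or.inl h1)) with e | ⟨e, -⟩
      · rw [eps_eq_neg_one.2 hz, eps_eq_one.2 h1] at e
        omega
      · rw [eps_eq_neg_one.2 hz] at e
        omega
    · exact (hne (h.thin_unique_neg hi₂.2.2 hy₁ h1 e₁)).elim
    · exact ⟨y₂, x, x, h1, hi₂.2.2, H.inclEq_of_desc h ht hd₂ h1 hwy₂, ho, .refl⟩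

/-- Mirror image of `zig_of_neg`: along edges with target `z`, the zig-zag runs upwards, from `x` to
`a`. -/
theorem zig_of_pos (H : C.TreeHyp j) (h : C.IsDFC) (hw : w ∈ C.whites z) (hd : C.dim w = j + 1)
    (ht : C.Pos t w) (hy : C.dim y = j) (hz : C.Pos z y)
    (hwy : (C.cellTree j).Desc (.inl w) (.inr y)) :
    ∃ b a x, C.Loop z b ∧ C.Neg b a ∧ C.InclEq z t b ∧ (C.cellTree j).out x y ∧
      ReflTransGen (C.ZigStep z) x a := by
  revert hz hwy
  refine H.rooted.up_induction (P := fun y => C.Pos z y →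
    (C.cellTree j).Desc (.inl w) (.inr y) → ∃ b a x, C.Loop z b ∧ C.Neg b a ∧ C.InclEq z t b ∧
      (C.cellTree j).out x y ∧ ReflTransGen (C.ZigStep z) x a) (fun y hy ih hz hwy => ?_) y hy
  obtain ⟨-, hn, t', ht', hl⟩ := h.white_spec hw
  rcases PreTree.IsRootedTree.desc_inr_cases hwy with e | ⟨x, ho, hwx⟩
  · simp at e
  obtain ⟨y₁, hy₁, e₁⟩ := h.thin_target ho.2.2 (eps_ne_zero.2 (Or.inl hz))
  rw [eps_eq_one.2 hz, eps_eq_one] at e₁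
  have hi₁ : (C.cellTree j).inp x y₁ := ⟨ho.1, ho.2.1, hy₁⟩
  rcases PreTree.IsRootedTree.desc_inl_cases hwx with e | ⟨y₂, hi₂, hwy₂⟩
  · obtain rfl := Sum.inl.inj e
    exact (hn y₁ hy₁).elim
  have hd₂ : C.dim y₂ = j := (H.rooted.inp_mem _ _ hi₂).2
  by_cases hne : y₂ = y₁
  · subst hne
    obtain ⟨b, a, x', h1, h2, h3, h4, h5⟩ := ih x y₂ ho hi₂ e₁ hwy₂
    exact ⟨b, a, x, h1, h2, h3, ho, .head ⟨ho.1, h4.1, y₂, Or.inr ⟨e₁, hy₁, h4.2.2⟩⟩ h5⟩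
  · have hf := H.facet_of_siblings h hi₂ hi₁ hne (H.has_white h hw hd hwy₂) (Or.inl e₁.facet)
    rcases facet_cases hf with h1 | h1 | h1
    · exact (hne (h.thin_unique_pos hi₂.2.2 hy₁ h1 e₁)).elim
    · rcases h.thin_source ho.2.2 hi₂.2.2 (eps_ne_zero.2 (Or.inr h1)) with e | ⟨e, -⟩
      · rw [eps_eq_one.2 hz, eps_eq_neg_one.2 h1] at e
        omega
      · rw [eps_eq_one.2 hz] at e
        omega
    · exact ⟨y₂, x, x, h1, hi₂.2.2, H.inclEq_of_desc h ht hd₂ h1 hwy₂, ho, .refl⟩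

-- A zig-zag first runs down the tree along edges `b` with `z ≺⁻ b`, then up along edges with `z ≺⁺
-- b`. So minus the depth on the first part and the depth on the second increases strictly; the
-- shifts by one separate the two parts from the value `0` of the remaining nodes.
open Classical in
theorem exists_potential (H : C.TreeHyp j) (h : C.IsDFC) (z : C.Cell) :
    ∃ f : C.Cell → ℤ, ∀ a a', C.dim a = j + 1 → C.ZigStep z a a' →
      C.dim a' = j + 1 ∧ f a < f a' := by
  let d : C.Cell → ℤ := fun a => (C.cellTree j).depth (.inl a)
  have hd0 : ∀ a, 0 ≤ d a := fun a => Int.natCast_nonneg _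
  refine ⟨fun a => if ∃ t, C.Pos t a ∧ C.Neg z t then - d a - 1 else
    if ∃ t, C.Pos t a ∧ C.Pos z t then d a + 1 else 0, ?_⟩
  have dlt : ∀ a a' b, (C.cellTree j).out a b → (C.cellTree j).inp a' b → d a' < d a := by
    intro a a' b ho hi
    have := H.rooted.depth_lt ((H.rooted.desc_out ho).trans (H.rooted.desc_inp hi)) fun e =>
      H.rooted.out_ne_inp ho (Sum.inl.inj e ▸ hi)
    exact Int.ofNat_lt.2 this
  rintro a a' had ⟨hl, hl', b, ⟨h1, h2, h3⟩ | ⟨h1, h2, h3⟩⟩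
  · have e1 := h.dim_pos h2
    have e2 := h.dim_neg h3
    have had' : C.dim a' = j + 1 := by omega
    refine ⟨had', ?_⟩
    have hlt := dlt a a' b ⟨hl, had, h2⟩ ⟨hl', had', h3⟩
    have h4 : ∃ t, C.Pos t a ∧ C.Neg z t := ⟨b, h2, h1⟩
    have := hd0 a
    have := hd0 a'
    simp only [if_pos h4]
    split_ifs <;> omega
  · have e1 := h.dim_pos h3
    have e2 := h.dim_neg h2
    have had' : C.dim a' = j + 1 := by omega
    refine ⟨had', ?_⟩
    have hlt := dlt a' a b ⟨hl', had', h3⟩ ⟨hl, had, h2⟩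
    have h4 : ¬ ∃ t, C.Pos t a' ∧ C.Neg z t := by
      rintro ⟨t, h5, h6⟩
      obtain rfl := h.pos_unique h3 h5
      exact h1.not_neg h6
    have h5 : ∃ t, C.Pos t a' ∧ C.Pos z t := ⟨b, h3, h1⟩
    have := hd0 a
    have := hd0 a'
    simp only [if_neg h4, if_pos h5]
    split_ifs <;> omega

theorem before_irrefl (H : C.TreeHyp j) (h : C.IsDFC) (ha : C.dim a = j + 1) :
    ¬ C.Before z a a := by
  obtain ⟨f, hf⟩ := H.exists_potential h z
  have key : ∀ a', C.Before z a a' → C.dim a' = j + 1 ∧ f a < f a' := by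
    intro a' hb
    induction hb with
    | single hs => exact hf a _ ha hs
    | tail _ hs ih =>
      have := hf _ _ ih.1 hs
      exact ⟨this.1, ih.2.trans this.2⟩
  exact fun hb => lt_irrefl _ (key a hb).2

/-- On a descending path no loop on `z` lies below a node that takes part in the zig-zag, since its
target is not such a loop. So at most one such node on the path is entered through a loop. -/
theorem zig_unique (H : C.TreeHyp j) (h : C.IsDFC) {s : C.Cell ⊕ C.Cell}
    (hs : (C.cellTree j).Desc s (.inr b)) (hs' : (C.cellTree j).Desc s (.inr b'))
    (hi : (C.cellTree j).inp a b) (hi' : (C.cellTree j).inp a' b') (hl : C.Loop z b)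
    (hl' : C.Loop z b') (hz : C.Zig z a) (hz' : C.Zig z a') : a = a' := by
  have key : ∀ {a a' b b'}, (C.cellTree j).Desc (.inr b) (.inr b') → (C.cellTree j).inp a b →
      (C.cellTree j).inp a' b' → C.Loop z b' → C.Zig z a → a = a' := by
    intro a a' b b' hd hi hi' hl' hz
    rcases H.rooted.desc_of_inp hi hd with e | hd
    · obtain rfl := Sum.inr.inj e
      exact H.rooted.target_node _ _ _ hi hi'
    · obtain ⟨t, ho⟩ := H.rooted.exists_out (H.rooted.inp_mem _ _ hi).1
      rcases H.rooted.desc_of_out ho hd with e | hd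
      · simp at e
      · exact (h.not_loop_target_of_zig hz ho.2.2 (loop_above h hl' hd)).elim
  rcases H.rooted.total hs hs' with hd | hd
  · exact key hd hi hi' hl' hz
  · exact (key hd hi' hi hl hz').symm

theorem loopLT₁_spec (H : C.TreeHyp j) (h : C.IsDFC) (ht : C.dim t = j) (ht' : C.dim t' = j)
    (hlt : C.LoopLT₁ z t t') : ∃ b b' a a', (C.cellTree j).inp a b ∧ (C.cellTree j).inp a' b' ∧
      C.Loop z b ∧ C.Loop z b' ∧ C.Zig z a ∧ C.Zig z a' ∧ C.Before z a a' ∧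
      (C.cellTree j).Desc (.inr t) (.inr b) ∧ (C.cellTree j).Desc (.inr t') (.inr b') := by
  obtain ⟨b, b', a, a', h1, h2, h3, h4, h5, h6, h7⟩ := hlt
  obtain ⟨hb, hd⟩ := H.desc_of_inclEq h ht h6
  obtain ⟨hb', hd'⟩ := H.desc_of_inclEq h ht' h7
  obtain ⟨c, hc, -⟩ := TransGen.head'_iff.1 h5
  obtain ⟨c', -, hc'⟩ := TransGen.tail'_iff.1 h5
  have e := h.dim_neg h2
  have e' := h.dim_neg h4
  exact ⟨b, b', a, a', ⟨hc.1, by omega, h2⟩, ⟨hc'.2.1, by omega, h4⟩, h1, h3, hc.zig_left,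
    hc'.zig_right, h5, hd, hd'⟩

/-- By `zig_unique` the two zig-zag nodes depend only on `t` and `t'`. Both comparisons together
would close the zig-zag. -/
theorem loopLT₁_asymm (H : C.TreeHyp j) (h : C.IsDFC) (ht : C.dim t = j) (ht' : C.dim t' = j)
    (hlt : C.LoopLT₁ z t t') : ¬ C.LoopLT₁ z t' t := by
  intro hlt'
  obtain ⟨b, b', a, a', h1, h2, h3, h4, h5, h6, h7, h8, h9⟩ := H.loopLT₁_spec h ht ht' hlt
  obtain ⟨c', c, d', d, k1, k2, k3, k4, k5, k6, k7, k8, k9⟩ := H.loopLT₁_spec h ht' ht hlt'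
  obtain rfl := H.zig_unique h h8 k9 h1 k2 h3 k4 h5 k6
  obtain rfl := H.zig_unique h h9 k8 h2 k1 h4 k3 h6 k5
  exact H.before_irrefl h h1.2.1 (h7.trans k7)

/-- Loops that meet at a cell of which they are both contained in loop sources are not
distinguished by the zig-zag. -/
theorem not_loopLT₁_of_loops (H : C.TreeHyp j) (h : C.IsDFC) (ht : C.dim t = j)
    (ht' : C.dim t' = j) (hi : (C.cellTree j).inp x y) (hi' : (C.cellTree j).inp x y')
    (hl : C.Loop z y) (hl' : C.Loop z y') (hty : (C.cellTree j).Desc (.inr t) (.inr y))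
    (hty' : (C.cellTree j).Desc (.inr t') (.inr y')) : ¬ C.LoopLT₁ z t t' := by
  intro hlt
  obtain ⟨b, b', a, a', h1, h2, h3, h4, h5, h6, h7, h8, h9⟩ := H.loopLT₁_spec h ht ht' hlt
  obtain ⟨u, ho⟩ := H.rooted.exists_out (H.rooted.inp_mem _ _ hi).1
  -- The zig-zag node is the meeting node `x` itself, or the loop through which it is entered is
  -- below the target `u` of `x`. It cannot be strictly above `x`, as its target would then be a
  -- loop.
  have key : ∀ {t y b a}, (C.cellTree j).inp x y → C.Loop z y →
      (C.cellTree j).Desc (.inr t) (.inr y) → (C.cellTree j).Desc (.inr t) (.inr b) →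
      (C.cellTree j).inp a b → C.Zig z a →
      (a = x ∨ (C.cellTree j).Desc (.inr u) (.inr b)) := by
    intro t y b a hi hl hty htb hab hz
    rcases H.rooted.total hty htb with hd | hd
    · rcases H.rooted.desc_of_inp hi hd with e | hd
      · obtain rfl := Sum.inr.inj e
        exact Or.inl (H.rooted.target_node _ _ _ hab hi)
      · rcases H.rooted.desc_of_out ho hd with e | hd
        · simp at e
        · exact Or.inr hd
    · rcases H.rooted.desc_of_inp hab hd with e | hd
      · obtain rfl := Sum.inr.inj e
        exact Or.inl (H.rooted.target_node _ _ _ hab hi)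
      · obtain ⟨v, hv⟩ := H.rooted.exists_out (H.rooted.inp_mem _ _ hab).1
        rcases H.rooted.desc_of_out hv hd with e | hd
        · simp at e
        · exact (h.not_loop_target_of_zig hz hv.2.2 (loop_above h hl hd)).elim
  -- In the mixed cases `u` lies above a loop and is therefore a loop itself, although it is the
  -- target of a zig-zag node. In the remaining cases both nodes are equal, and a node does not
  -- precede itself.
  have haa : a = a' := by
    rcases key hi hl hty h8 h1 h5 with e | hd
    · rcases key hi' hl' hty' h9 h2 h6 with e' | hd'
      · rw [e, e']
      · exact (h.not_loop_target_of_zig h5 (e ▸ ho.2.2) (loop_above h h4 hd')).elim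
    · rcases key hi' hl' hty' h9 h2 h6 with e' | hd'
      · exact (h.not_loop_target_of_zig h6 (e' ▸ ho.2.2) (loop_above h h3 hd)).elim
      · exact H.zig_unique h hd hd' h1 h2 h3 h4 h5 h6
  subst haa
  exact H.before_irrefl h h1.2.1 h7

/-- The second order excludes the first one by definition. Two comparisons of the second kind take
place at the same node and between the same branches, by `meet_unique`, and contradict each other in
the local order. -/
theorem loopLT_asymm (H : C.TreeHyp j) (h : C.IsDFC) (ht : C.dim t = j) (ht' : C.dim t' = j)
    (hlt : C.LoopLT z t t') : ¬ C.LoopLT z t' t := by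
  intro hlt'
  rcases hlt with h1 | ⟨h1, h2, h3, a, ha, y, y', k1, k2, k3, k4, k5, k6, k7, k8⟩
  · rcases hlt' with h1' | h1'
    · exact H.loopLT₁_asymm h ht ht' h1 h1'
    · exact h1'.2.2.1 h1
  · rcases hlt' with h1' | ⟨-, -, -, a', ha', u', u, l1, l2, l3, l4, l5, l6, l7, l8⟩
    · exact h3 h1'
    · obtain ⟨e1, d1⟩ := H.desc_of_inclEq h ht k6
      obtain ⟨e2, d2⟩ := H.desc_of_inclEq h ht' k7
      obtain ⟨e3, d3⟩ := H.desc_of_inclEq h ht l7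
      obtain ⟨e4, d4⟩ := H.desc_of_inclEq h ht' l6
      have f1 := h.dim_neg k2
      have f2 := h.dim_neg l2
      obtain ⟨rfl, rfl, rfl⟩ := H.rooted.meet_unique (a := a) (a' := a')
        ⟨ha, by omega, k2⟩ ⟨ha, by omega, k4⟩ k5 ⟨ha', by omega, l4⟩ ⟨ha', by omega, l2⟩ l5.symm
        d1 d2 d3 d4
      exact h.local_asymm ha k1 k2 k3 k4 k8 l8

/-- At the meeting node `x`, a branch that is a loop serves as its own witness, attached to `x`. If
`z ≺⁻ y`, a zig-zag leads from above `y` to `x`; if `z ≺⁺ y'`, one leads from `x` to above `y'`. Two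
loop branches are compared by the local order, and `not_loopLT₁_of_loops` provides the exclusions.
-/
theorem loopLT_of_meetLT (H : C.TreeHyp j) (h : C.IsDFC) (hw : w ∈ C.whites z)
    (hd : C.dim w = j + 1) (hw' : w' ∈ C.whites z) (hd' : C.dim w' = j + 1)
    (ht : C.Pos t w) (ht' : C.Pos t' w') (hlt : C.MeetLT j z w w') : C.LoopLT z t t' := by
  obtain ⟨x, y, y', hne, hi, hi', hwy, hwy', hlt⟩ := hlt
  have hz := H.has_white h hw hd hwy
  have hz' := H.has_white h hw' hd' hwy'
  have hf := H.facet_of_siblings h hi hi' hne hz hz'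
  have hf' := H.facet_of_siblings h hi' hi hne.symm hz' hz
  have hyd : C.dim y = j := (H.rooted.inp_mem _ _ hi).2
  have hyd' : C.dim y' = j := (H.rooted.inp_mem _ _ hi').2
  have hto : (C.cellTree j).out w t := ⟨hw.1, hd, ht⟩
  have hto' : (C.cellTree j).out w' t' := ⟨hw'.1, hd', ht'⟩
  have left : C.Neg z y → ∃ b a, C.Loop z b ∧ C.Neg b a ∧ C.InclEq z t b ∧ C.Before z a x := by
    intro hn
    obtain ⟨b, a, x', h1, h2, h3, h4, h5⟩ := H.zig_of_neg h hw hd ht hyd hn hwy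
    exact ⟨b, a, h1, h2, h3, TransGen.tail' h5 ⟨h4.1, hi.1, y, Or.inl ⟨hn, h4.2.2, hi.2.2⟩⟩⟩
  have right : C.Pos z y' → ∃ b a, C.Loop z b ∧ C.Neg b a ∧ C.InclEq z t' b ∧
      C.Before z x a := by
    intro hp
    obtain ⟨b, a, x', h1, h2, h3, h4, h5⟩ := H.zig_of_pos h hw' hd' ht' hyd' hp hwy'
    exact ⟨b, a, h1, h2, h3, TransGen.head' ⟨hi.1, h4.1, y', Or.inr ⟨hp, hi'.2.2, h4.2.2⟩⟩ h5⟩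
  by_cases hl : C.Loop z y
  · by_cases hl' : C.Loop z y'
    · obtain h1 | h1 | ⟨-, -, h1⟩ := hlt
      · exact (h.not_loop_of_neg h1 hl).elim
      · exact (h.not_loop_of_pos h1 hl').elim
      have hty : (C.cellTree j).Desc (.inr t) (.inr y) := by
        rcases H.rooted.desc_of_out hto hwy with e | e
        · simp at e
        · exact e
      have hty' : (C.cellTree j).Desc (.inr t') (.inr y') := by
        rcases H.rooted.desc_of_out hto' hwy' with e | e
        · simp at e
        · exact e
      have htd : C.dim t = j := (H.rooted.out_mem _ _ hto).2
      have htd' : C.dim t' = j := (H.rooted.out_mem _ _ hto').2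
      refine Or.inr ⟨?_, H.not_loopLT₁_of_loops h htd htd' hi hi' hl hl' hty hty',
        H.not_loopLT₁_of_loops h htd' htd hi' hi hl' hl hty' hty, x, hi.1, y, y', hl, hi.2.2, hl',
        hi'.2.2, hne, H.inclEq_of_desc h ht hyd hl hwy, H.inclEq_of_desc h ht' hyd' hl' hwy', h1⟩
      rintro rfl
      exact hne (H.rooted.eq_of_desc_siblings hi hi' hty hty')
    · have hp : C.Pos z y' := by
        obtain h1 | h1 | ⟨-, h1, -⟩ := hlt
        · exact (h.not_loop_of_neg h1 hl).elim
        · exact h1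
        · exact (hl' h1).elim
      obtain ⟨b, a, h1, h2, h3, h4⟩ := right hp
      exact Or.inl ⟨y, b, x, a, hl, hi.2.2, h1, h2, h4, H.inclEq_of_desc h ht hyd hl hwy, h3⟩
  · rcases facet_cases hf with hp | hn | hc
    · exfalso
      obtain h1 | h1 | ⟨h1, -⟩ := hlt
      · exact hp.not_neg h1
      · exact hne (h.thin_unique_pos hi.2.2 hi'.2.2 hp h1)
      · exact hl h1
    · obtain ⟨b, a, h1, h2, h3, h4⟩ := left hn
      rcases facet_cases hf' with hp' | hn' | hl'
      · obtain ⟨b', a', h1', h2', h3', h4'⟩ := right hp'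
        exact Or.inl ⟨b, b', a, a', h1, h2, h1', h2', h4.trans h4', h3, h3'⟩
      · exact (hne (h.thin_unique_neg hi.2.2 hi'.2.2 hn hn')).elim
      · exact Or.inl ⟨b, y', a, x, h1, h2, hl', hi'.2.2, h4, h3,
          H.inclEq_of_desc h ht' hyd' hl' hwy'⟩
    · exact (hl hc).elim

/-- A total relation contained in an asymmetric one coincides with it. -/
theorem whiteLT_iff_meetLT (H : C.TreeHyp j) (h : C.IsDFC) (hw : w ∈ C.whites z)
    (hd : C.dim w = j + 1) (hw' : w' ∈ C.whites z) (hd' : C.dim w' = j + 1) :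
    C.WhiteLT z w w' ↔ C.MeetLT j z w w' := by
  obtain ⟨hl, -, t, ht, -⟩ := h.white_spec hw
  obtain ⟨hl', -, t', ht', -⟩ := h.white_spec hw'
  have htd : C.dim t = j := by
    have := h.dim_pos ht
    omega
  have htd' : C.dim t' = j := by
    have := h.dim_pos ht'
    omega
  constructor
  · rintro ⟨u, hu, u', hu', hlt⟩
    obtain rfl := h.γ_unique ht.1 hu
    obtain rfl := h.γ_unique ht'.1 hu'
    by_cases hne : w = w'
    · subst hne
      obtain rfl := h.γ_unique hu hu'
      exact (H.loopLT_asymm h htd htd hlt hlt).elim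
    · rcases H.meetLT_total h hw hd hw' hd' hne with h1 | h1
      · exact h1
      · exact (H.loopLT_asymm h htd htd' hlt
          (H.loopLT_of_meetLT h hw' hd' hw hd ht' ht h1)).elim
  · exact fun h1 => ⟨t, ht.1, t', ht'.1, H.loopLT_of_meetLT h hw hd hw' hd' ht ht' h1⟩

theorem whiteLT_iff (H : C.TreeHyp j) (h : C.IsDFC) (hw : w ∈ C.whites z)
    (hd : C.dim w = j + 1) (hw' : w' ∈ C.whites z) (hd' : C.dim w' = j + 1) (hne : y ≠ y')
    (hi : (C.cellTree j).inp x y) (hi' : (C.cellTree j).inp x y')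
    (hwy : (C.cellTree j).Desc (.inl w) (.inr y))
    (hwy' : (C.cellTree j).Desc (.inl w') (.inr y')) :
    C.WhiteLT z w w' ↔ C.SourceLT x z y y' :=
  (H.whiteLT_iff_meetLT h hw hd hw' hd').trans (H.meetLT_iff hne hi hi' hwy hwy')

end TreeHyp

end PreMOP

/-! ## The constellations of a dendritic face complex -/

namespace PreMOP

/-- The white dots on the edges of `cellTree k`. -/
def cellWhite (C : PreMOP.{u}) (k : ℕ) (b : C.Cell) : Set C.Cell :=
  {w | C.dim b = k ∧ w ∈ C.whites b}

variable {C : PreMOP.{u}} {x y y' z w w' a : C.Cell} {k : ℕ}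

theorem IsDFC.dim_white (h : C.IsDFC) (hw : w ∈ C.whites z) : C.dim w = C.dim z + 2 := by
  obtain ⟨-, -, t, ht, hz⟩ := hw
  have e1 := h.γ_dim ht
  have e2 := h.γ_dim hz
  omega

theorem IsDFC.dim_cellWhite (h : C.IsDFC) (hw : w ∈ C.cellWhite k z) :
    C.dim w = ((k + 1 : ℕ) : ℤ) + 1 := by
  have e1 := h.dim_white hw.2
  have e2 := hw.1
  push_cast
  omega

theorem IsDFC.mem_cellWhite_of_loop (h : C.IsDFC) (hx : x ∈ (C.cellTree (k + 1)).nulldots)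
    (ho : (C.cellTree (k + 1)).out x y) (hz : z ∈ C.γ y) : x ∈ C.cellWhite k z := by
  have e1 := h.γ_dim hz
  have e2 := h.dim_pos ho.2.2
  have e3 := hx.1.2
  push_cast at e3
  refine ⟨by omega, hx.1.1, ?_, y, ho.2.2.1, hz⟩
  refine Set.eq_empty_iff_forall_notMem.2 fun t ht => hx.2 t ⟨hx.1.1, hx.1.2, ht, fun ht' => ?_⟩
  exact h.lam_not_loop hx.1.1 ⟨ht, ht'⟩

theorem IsDFC.exists_white_edge (h : C.IsDFC) (H : C.TreeHyp (k + 1))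
    (hx : x ∈ (C.cellTree (k + 1)).nulldots) : ∃ z, x ∈ C.cellWhite k z := by
  obtain ⟨y, hy⟩ := H.rooted.exists_out hx.1
  have e1 : C.dim y = ((k + 1 : ℕ) : ℤ) := (H.rooted.out_mem _ _ hy).2
  obtain ⟨z, hz⟩ := h.target y (by rw [e1]; positivity)
  exact ⟨z, h.mem_cellWhite_of_loop hx hy (hz ▸ rfl)⟩

theorem IsDFC.cellWhite_nulldot (h : C.IsDFC) (hw : w ∈ C.cellWhite k z) :
    w ∈ (C.cellTree (k + 1)).nulldots :=
  ⟨⟨hw.2.1, h.dim_cellWhite hw⟩, fun b hb => (h.white_spec hw.2).2.1 b hb.2.2⟩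

theorem IsDFC.cellWhite_unique (h : C.IsDFC) {b b' : C.Cell} (hw : w ∈ C.cellWhite k b)
    (hw' : w ∈ C.cellWhite k b') : b = b' := by
  obtain ⟨-, -, -, t, ht, hz⟩ := hw
  obtain ⟨-, -, -, t', ht', hz'⟩ := hw'
  obtain rfl := h.γ_unique ht ht'
  exact h.γ_unique hz hz'

/-! ### The nest of a cell -/

namespace TreeHyp

/-- Going up from a loop on `z`, one only meets loops on `z`. None of them is a leaf, so the way
ends at a sourceless node. -/
theorem exists_white_above (H : C.TreeHyp (k + 1)) (h : C.IsDFC)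
    (hl : C.Loop z y) (hy : C.dim y = ((k + 1 : ℕ) : ℤ)) :
    ∃ w ∈ C.cellWhite k z, (C.cellTree (k + 1)).Desc (.inl w) (.inr y) := by
  revert hl
  refine H.rooted.up_induction (P := fun y => C.Loop z y → ∃ w ∈ C.cellWhite k z,
    (C.cellTree (k + 1)).Desc (.inl w) (.inr y)) (fun y hy ih hl => ?_) y hy
  obtain ⟨x, ho⟩ : ∃ x, (C.cellTree (k + 1)).out x y := by
    by_contra hc
    have : y ∈ (C.cellTree (k + 1)).leaves := ⟨hy, fun a ha => hc ⟨a, ha⟩⟩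
    rw [H.leaves] at this
    exact h.lam_not_loop this.1 hl
  by_cases hn : x ∈ (C.cellTree (k + 1)).nulldots
  · exact ⟨x, h.mem_cellWhite_of_loop hn ho hl.2, H.rooted.desc_out ho⟩
  · obtain ⟨b, hb⟩ : ∃ b, (C.cellTree (k + 1)).inp x b := by
      by_contra hc
      exact hn ⟨(H.rooted.out_mem _ _ ho).1, fun b hb => hc ⟨b, hb⟩⟩
    obtain ⟨w, hw, hd⟩ := ih x b ho hb (h.loop_of_loop_target ho.2.2 hl hb.2.2)
    exact ⟨w, hw, hd.trans (H.rooted.desc_inp_out hb ho)⟩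

theorem nodes_eq_leaves (H : C.TreeHyp (k + 1)) :
    (C.cellTree k).nodes = (C.cellTree (k + 1)).leaves := by
  rw [H.leaves]
  push_cast
  rfl

theorem cell_isSubdivision (H : C.TreeHyp (k + 1)) (h : C.IsDFC) :
    (C.cellTree k).IsSubdivision (C.cellWhite k) C.WhiteLT where
  edge b w hw := hw.1
  finite b := h.finite_set _
  disjoint b b' w hw hw' := h.cellWhite_unique hw hw'
  order b := by
    refine isStrictTotalOrder_of ?_ ?_ ?_
    · rintro ⟨w, hw⟩ ⟨w', hw'⟩ h1 h2
      by_contra hne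
      have hne' : w ≠ w' := fun e => hne (Subtype.ext e)
      have e := h.dim_cellWhite hw
      have e' := h.dim_cellWhite hw'
      rw [H.whiteLT_iff_meetLT h hw.2 e hw'.2 e'] at h1
      rw [H.whiteLT_iff_meetLT h hw'.2 e' hw.2 e] at h2
      exact (H.meetLT_total h hw.2 e hw'.2 e' hne').elim h1 h2
    · rintro ⟨w, hw⟩ h1
      have e := h.dim_cellWhite hw
      rw [H.whiteLT_iff_meetLT h hw.2 e hw.2 e] at h1
      exact H.meetLT_asymm h h1 h1
    · rintro ⟨w, hw⟩ ⟨w', hw'⟩ ⟨w'', hw''⟩ h1 h2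
      have e := h.dim_cellWhite hw
      have e' := h.dim_cellWhite hw'
      have e'' := h.dim_cellWhite hw''
      rw [H.whiteLT_iff_meetLT h hw.2 e hw'.2 e'] at h1
      rw [H.whiteLT_iff_meetLT h hw'.2 e' hw''.2 e''] at h2
      rw [H.whiteLT_iff_meetLT h hw.2 e hw''.2 e'']
      exact H.meetLT_trans h h1 h2

/-- The dots above the edge `y` of `cellTree (k + 1)`. -/
abbrev cellDots (C : PreMOP.{u}) (k : ℕ) (y : C.Cell) : Set (C.Cell ⊕ C.Cell) :=
  (C.cellTree k).dotsAbove (C.cellWhite k) (C.cellTree (k + 1)) (.inr y)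

theorem inl_mem_cellDots (H : C.TreeHyp (k + 1)) :
    .inl a ∈ cellDots C k y ↔ a ∈ (C.cellTree (k + 1)).leavesAbove y := by
  rw [PreTree.inl_mem_dotsAbove, H.nodes_eq_leaves]
  rfl

theorem inr_mem_cellDots : .inr w ∈ cellDots C k y ↔
    (∃ b, w ∈ C.cellWhite k b) ∧ (C.cellTree (k + 1)).Desc (.inl w) (.inr y) := by
  rw [PreTree.inr_mem_dotsAbove]
  exact and_congr_left fun _ => ⟨fun ⟨b, _, hb⟩ => ⟨b, hb⟩, fun ⟨b, hb⟩ => ⟨b, hb.1, hb⟩⟩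

theorem node_of_leavesAbove (H : C.TreeHyp (k + 1))
    (ha : a ∈ (C.cellTree (k + 1)).leavesAbove y) : a ∈ C.Lam ∧ C.dim a = k + 1 := by
  have := (H.mem_leavesAbove.1 ha).1
  push_cast at this
  exact this

/-- A black dot with target `z` and no black dot with source `z` would give `z` the sign `1` in `y`,
that is `z = γ(y)`. For a white dot, `z` is a facet of `y` or an inner edge. -/
theorem exists_neg_dot (H : C.TreeHyp (k + 1)) (h : C.IsDFC) (hy : C.dim y = ((k + 1 : ℕ) : ℤ))
    (hz : z ∉ C.γ y) {d : C.Cell ⊕ C.Cell} (hd : d ∈ cellDots C k y)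
    (he : (C.cellTree k).OnEdge (C.cellWhite k) d z) :
    ∃ a ∈ (C.cellTree (k + 1)).leavesAbove y, C.Neg z a := by
  cases d with
  | inl a =>
    rw [H.inl_mem_cellDots] at hd
    by_contra hn
    have e := H.eps_eq_ite h hy z
    rw [if_neg hn, if_pos ⟨a, hd, he.2.2⟩, sub_zero, eps_eq_one] at e
    exact hz e.1
  | inr w =>
    rw [inr_mem_cellDots] at hd
    rcases H.has_white h he.2 (h.dim_cellWhite he) hd.2 with hf | hf
    · rcases facet_cases hf with h1 | h1 | h1
      · exact (hz h1.1).elim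
      · exact H.exists_neg_above h hy h1
      · exact (hz h1.2).elim
    · exact hf.2

theorem has_dot (H : C.TreeHyp (k + 1)) (h : C.IsDFC) (hy : C.dim y = ((k + 1 : ℕ) : ℤ))
    {d : C.Cell ⊕ C.Cell} (hd : d ∈ cellDots C k y)
    (he : (C.cellTree k).OnEdge (C.cellWhite k) d z) : Has C (k + 1) z y := by
  cases d with
  | inl a =>
    by_cases hz : z ∈ C.γ y
    · exact Or.inl (Or.inr hz)
    · have h1 := H.exists_neg_dot h hy hz hd he
      rw [H.inl_mem_cellDots] at hd
      exact Or.inr ⟨⟨a, hd, he.2.2⟩, h1⟩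
  | inr w =>
    rw [inr_mem_cellDots] at hd
    exact H.has_white h he.2 (h.dim_cellWhite he) hd.2

/-- The meeting point of `y` and a white dot on `z` that is not above `y`. -/
theorem exists_meet_dot (H : C.TreeHyp (k + 1)) (h : C.IsDFC) (hy : C.dim y = ((k + 1 : ℕ) : ℤ))
    {d : C.Cell ⊕ C.Cell} (hd : d ∈ cellDots C k y)
    (he : (C.cellTree k).OnEdge (C.cellWhite k) d z) (hw : w ∈ C.cellWhite k z)
    (hn : .inr w ∉ cellDots C k y) :
    ∃ x y₁ y₂, y₁ ≠ y₂ ∧ (C.cellTree (k + 1)).inp x y₁ ∧ (C.cellTree (k + 1)).inp x y₂ ∧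
      (C.cellTree (k + 1)).Desc (.inr y) (.inr y₁) ∧
      (C.cellTree (k + 1)).Desc (.inl w) (.inr y₂) ∧ C.Facet z y₁ := by
  have hn' : ¬ (C.cellTree (k + 1)).Desc (.inl w) (.inr y) := fun hc =>
    hn (inr_mem_cellDots.2 ⟨⟨z, hw⟩, hc⟩)
  obtain ⟨x, y₁, y₂, hne, hi₁, hi₂, h1, h2⟩ :=
    H.exists_meet_edge h hw.2 (h.dim_cellWhite hw) hy hn'
  exact ⟨x, y₁, y₂, hne, hi₁, hi₂, h1, h2, H.facet_of_siblings h hi₁ hi₂ hne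
    (H.has_desc h h1 (H.has_dot h hy hd he)) (H.has_white h hw.2 (h.dim_cellWhite hw) h2)⟩

/-- Most conditions are sign computations in `y`. For a white dot missing from the nest, its path
and that of `y` meet in branches `y₂` and `y₁`, and the comparison of these branches at `z`
contradicts the assumed position of the dot. -/
theorem cell_isNest (H : C.TreeHyp (k + 1)) (h : C.IsDFC) (hy : C.dim y = ((k + 1 : ℕ) : ℤ))
    {z₀ : C.Cell} (hz₀ : z₀ ∈ C.γ y) :
    (C.cellTree k).IsNest (C.cellWhite k) C.WhiteLT (cellDots C k y) z₀ where
  bottom := by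
    by_cases hl : z₀ ∈ C.δ y
    · obtain ⟨w, hw, hd⟩ := H.exists_white_above h ⟨hl, hz₀⟩ hy
      exact ⟨.inr w, inr_mem_cellDots.2 ⟨⟨z₀, hw⟩, hd⟩, hw⟩
    · obtain ⟨a, ha, hp⟩ := H.exists_pos_above h hy ⟨hz₀, hl⟩
      have := H.node_of_leavesAbove ha
      exact ⟨.inl a, H.inl_mem_cellDots.2 ha, this.1, this.2, hp⟩
  inner d hd z he hne := by
    have hz : z ∉ C.γ y := fun hz => hne (h.γ_unique hz hz₀)
    obtain ⟨a, ha, hn⟩ := H.exists_neg_dot h hy hz hd he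
    have := H.node_of_leavesAbove ha
    exact ⟨a, ⟨this.1, this.2, hn⟩, H.inl_mem_cellDots.2 ha⟩
  under d hd z he hne v hv := by
    have hz : z ∉ C.γ y := fun hz => hne (h.γ_unique hz hz₀)
    by_contra hc
    have hvm := PreTree.IsSubdivision.under_mem hv
    obtain ⟨x, y₁, y₂, hne', hi₁, hi₂, h1, h2, hf⟩ := H.exists_meet_dot h hy hd he hvm hc
    have hy₁ := (H.rooted.inp_mem _ _ hi₁).2
    obtain ⟨a, ha, hn⟩ := H.exists_neg_dot h hy hz hd he
    -- The leaf above `y` with source `z` is also above `y₁`, so `y₁` has `z` neither as target nor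
    -- as a loop. Hence the white dots of the branch `y₁` on `z` come before those of `y₂`.
    have hneg : C.Neg z y₁ := by
      rcases facet_cases hf with k1 | k1 | k1
      · exact (H.not_neg_above h hy₁ k1 ⟨a, leavesAbove_mono h1 ha, hn⟩).elim
      · exact k1
      · exact (H.not_leafAbove_loop h k1 (leavesAbove_mono h1 ha)).elim
    cases d with
    | inl b =>
      rw [H.inl_mem_cellDots] at hd
      exact H.not_pos_above h hy₁ hneg ⟨b, leavesAbove_mono h1 hd, he.2.2⟩
    | inr w =>
      rw [inr_mem_cellDots] at hd
      have := (H.whiteLT_iff h hvm.2 (h.dim_cellWhite hvm) he.2 (h.dim_cellWhite he) hne'.symm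
        hi₂ hi₁ h2 (hd.2.trans h1)).1 hv.2
      exact sourceLT_asymm h hi₂ hi₁ hne'.symm this (Or.inl hneg)
  convex d hd he v hv v' hv' hlt := by
    by_contra hc
    have hvm := PreTree.IsSubdivision.under_mem hv
    have hvm' := hlt.1
    obtain ⟨x, y₁, y₂, hne', hi₁, hi₂, h1, h2, hf⟩ := H.exists_meet_dot h hy hd he hvm hc
    have hy₁ := (H.rooted.inp_mem _ _ hi₁).2
    rw [inr_mem_cellDots] at hv'
    have := (H.whiteLT_iff h hvm'.2 (h.dim_cellWhite hvm') hvm.2 (h.dim_cellWhite hvm) hne'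
      hi₁ hi₂ (hv'.2.trans h1) h2).1 hlt.2
    -- The lower dot `v'` places `y₁` before `y₂`. The dot `d` above `v` places `y₂` before `y₁`,
    -- directly if it is white; if it is black, it forces `z ≺⁺ y₁`.
    refine sourceLT_asymm h hi₁ hi₂ hne' this ?_
    cases d with
    | inl b =>
      rw [H.inl_mem_cellDots] at hd
      rcases facet_cases hf with k1 | k1 | k1
      · exact Or.inr (Or.inl k1)
      · exact (H.not_pos_above h hy₁ k1 ⟨b, leavesAbove_mono h1 hd, he.2.2⟩).elim
      · exact (H.not_leafAbove_loop h k1 (leavesAbove_mono h1 hd)).elim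
    | inr w =>
      rw [inr_mem_cellDots] at hd
      exact (H.whiteLT_iff h hvm.2 (h.dim_cellWhite hvm) he.2 (h.dim_cellWhite he) hne'.symm
        hi₂ hi₁ h2 (hd.2.trans h1)).1 hv.2
  root a hi ha := by
    rw [H.inl_mem_cellDots] at ha
    by_cases hl : z₀ ∈ C.δ y
    · exact H.not_leafAbove_loop h ⟨hl, hz₀⟩ ha
    · exact H.not_neg_above h hy ⟨hz₀, hl⟩ ⟨a, ha, hi.2.2⟩

end TreeHyp

namespace IsDFC

/-- The constellation between two consecutive cell trees. -/
theorem cell_isExactConstellation (h : C.IsDFC) (hk : k + 1 ≤ C.topDim) :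
    (C.cellTree k).IsExactConstellation (C.cellWhite k) C.WhiteLT (C.cellTree (k + 1)) := by
  have H := h.treeHyp hk
  have H₀ := h.treeHyp (Nat.le_of_succ_le hk)
  have hS := H.cell_isSubdivision h
  refine ⟨hS.edge, hS.finite, hS.order, hS.disjoint, H.nodes_eq_leaves, ?_, fun x hx => ?_⟩
  · ext w
    exact ⟨fun ⟨b, hb⟩ => h.cellWhite_nulldot hb, fun hw => h.exists_white_edge H hw⟩
  · obtain ⟨y, hy⟩ := H.rooted.exists_out hx
    have hyd := (H.rooted.out_mem _ _ hy).2
    obtain ⟨z, hz⟩ := h.target y (by rw [show C.dim y = _ from hyd]; positivity)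
    rw [← PreTree.dotsAbove_inr_eq_inl H.nodes_eq_leaves H.rooted hy,
      hS.connected_iff H₀.rooted (PreTree.exists_onEdge H₀.rooted)]
    exact ⟨z, H.cell_isNest h hyd (hz ▸ rfl)⟩

/-- With `cell_nestLeaves` this recovers the faces of a cell from its nest, which is what makes `θ`
compatible with targets and sources. -/
theorem cell_nestRoot (h : C.IsDFC) (hk : k + 1 ≤ C.topDim) (hy : C.dim y = ((k + 1 : ℕ) : ℤ)) :
    (C.cellTree k).nestRoot (C.cellWhite k) (C.cellTree (k + 1)) (.inr y) = C.γ y := by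
  have H := h.treeHyp hk
  obtain ⟨z, hz⟩ := h.target y (by rw [hy]; positivity)
  rw [hz]
  exact (H.cell_isNest h hy (hz ▸ rfl)).nestRoot_eq (h.treeHyp (Nat.le_of_succ_le hk)).rooted
    (H.cell_isSubdivision h)

/-- At a leaf `z` of the nest no black dot has target `z`. So a black dot with source `z` gives the
sign `-1`, and a white dot on `z` makes `z` a facet that is not `≺⁺ y`. Conversely a source has sign
`-1`, or is a loop, with white dots above it and no black ones. -/
theorem cell_nestLeaves (h : C.IsDFC) (hk : k + 1 ≤ C.topDim)
    (hy : C.dim y = ((k + 1 : ℕ) : ℤ)) :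
    (C.cellTree k).nestLeaves (C.cellWhite k) (C.cellTree (k + 1)) (.inr y) = C.δ y := by
  have H := h.treeHyp hk
  ext z
  constructor
  · rintro ⟨⟨hz, hzd⟩, hn⟩
    have hnp : ¬ ∃ a ∈ (C.cellTree (k + 1)).leavesAbove y, C.Pos z a := by
      rintro ⟨a, ha, hp⟩
      have := H.node_of_leavesAbove ha
      exact hn ⟨a, H.inl_mem_cellDots.2 ha, this.1, this.2, hp⟩
    rcases hzd with ⟨a, ha, ho | hi⟩ | ⟨w, hw, hd⟩
    · exact (hn ⟨a, ha, ho⟩).elim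
    · have e := H.eps_eq_ite h hy z
      rw [if_neg hnp, if_pos ⟨a, H.inl_mem_cellDots.1 ha, hi.2.2⟩, zero_sub, eps_eq_neg_one] at e
      exact e.1
    · rcases H.has_dot h hy hd hw with hf | hf
      · rcases facet_cases hf with h1 | h1 | h1
        · exact (hnp (H.exists_pos_above h hy h1)).elim
        · exact h1.1
        · exact h1.1
      · exact (hnp hf.1).elim
  · intro hz
    have hzd : C.dim z = k := by
      have := h.dim_facet y z (Or.inl hz)
      push_cast at hy
      omega
    by_cases hl : z ∈ C.γ y
    · obtain ⟨w, hw, hd⟩ := H.exists_white_above h ⟨hz, hl⟩ hy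
      refine ⟨⟨hzd, Or.inr ⟨w, hw, TreeHyp.inr_mem_cellDots.2 ⟨⟨z, hw⟩, hd⟩⟩⟩, ?_⟩
      rintro ⟨a, ha, -⟩
      exact H.not_leafAbove_loop h ⟨hz, hl⟩ (H.inl_mem_cellDots.1 ha)
    · obtain ⟨a, ha, hn⟩ := H.exists_neg_above h hy ⟨hz, hl⟩
      have := H.node_of_leavesAbove ha
      refine ⟨⟨hzd, Or.inl ⟨a, H.inl_mem_cellDots.2 ha, Or.inr ⟨this.1, this.2, hn⟩⟩⟩, ?_⟩
      rintro ⟨b, hb, ho⟩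
      exact H.not_pos_above h hy ⟨hz, hl⟩ ⟨b, H.inl_mem_cellDots.1 hb, ho.2.2⟩

end IsDFC

end PreMOP

/-! ## The zoom complex of a dendritic face complex is an opetope -/

namespace PreTree

variable {A : Type u}

theorem ext_iff' {T U : PreTree A A} : T = U ↔ T.nodes = U.nodes ∧ T.edges = U.edges ∧
    (∀ a b, T.out a b ↔ U.out a b) ∧ (∀ a b, T.inp a b ↔ U.inp a b) ∧ T.root = U.root := by
  constructor
  · rintro rfl
    simp
  · rintro ⟨h1, h2, h3, h4, h5⟩
    cases T
    cases U
    simp only [PreTree.mk.injEq]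
    exact ⟨h1, h2, funext fun a => funext fun b => propext (h3 a b),
      funext fun a => funext fun b => propext (h4 a b), h5⟩

/-- The tree with one node `a`, the root `r` and the leaf `l`. -/
def stick (a r l : A) : PreTree A A where
  nodes := {a}
  edges := {r, l}
  out x y := x = a ∧ y = r
  inp x y := x = a ∧ y = l
  root := {r}

variable {a r l : A}

theorem stick_isRootedTree (h : r ≠ l) : (stick a r l).IsRootedTree where
  nodes_finite := Set.finite_singleton a
  edges_finite := (Set.finite_singleton l).insert r
  out_mem x y hxy := ⟨hxy.1, Or.inl hxy.2⟩
  inp_mem x y hxy := ⟨hxy.1, Or.inr hxy.2⟩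
  target_edge x hx := ⟨r, ⟨hx, rfl⟩, fun y hy => hy.2⟩
  source_node x x' y hx hx' := hx.1.trans hx'.1.symm
  target_node x x' y hx hx' := hx.1.trans hx'.1.symm
  root := by
    refine ⟨r, Or.inl rfl, rfl, fun x hx => h hx.2, ?_⟩
    rintro y (rfl | rfl)
    · exact .refl
    · exact .head (.edge a y rfl (Or.inr rfl) ⟨rfl, rfl⟩)
        (.single (.node a r rfl (Or.inl rfl) ⟨rfl, rfl⟩))

theorem stick_leaves (h : r ≠ l) : (stick a r l).leaves = {l} := by
  ext y
  constructor
  · rintro ⟨rfl | rfl, hn⟩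
    · exact (hn a ⟨rfl, rfl⟩).elim
    · rfl
  · rintro rfl
    exact ⟨Or.inr rfl, fun x hx => h hx.2.symm⟩

theorem stick_isLinear : (stick a r l).IsLinear := fun _ hx => ⟨l, ⟨hx, rfl⟩, fun _ hy => hy.2⟩

theorem stick_isElementary (h : r ≠ l) : (stick a r l).IsElementary :=
  ⟨⟨a, rfl⟩, l, stick_leaves h⟩

/-- Constellations from a tree with one node to a linear tree. -/
theorem isExactConstellation_of_isLinear {T U : PreTree A A} {W : A → Set A}
    {lt : A → A → A → Prop} (hU : U.IsRootedTree) (hl : U.IsLinear) (ha : T.nodes = {a})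
    (hb : U.leaves = {a}) (hW : ∀ b, W b = ∅) : T.IsExactConstellation W lt U := by
  have hW' : ∀ b w, w ∉ W b := fun b => Set.eq_empty_iff_forall_notMem.1 (hW b)
  refine ⟨fun b w hw => (hW' b w hw).elim, fun b => by simp [hW b], fun b =>
    isStrictTotalOrder_of (fun w => (hW' b _ w.2).elim) (fun w => (hW' b _ w.2).elim)
      (fun w => (hW' b _ w.2).elim), fun b b' w hw => (hW' b w hw).elim, ha.trans hb.symm, ?_, ?_⟩
  · ext w
    refine ⟨fun ⟨b, hb⟩ => (hW' b w hb).elim, fun hw => ?_⟩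
    obtain ⟨b, hb, -⟩ := hl w hw.1
    exact (hw.2 b hb).elim
  · intro x hx
    have key : ∀ b ∈ U.edges, U.Desc (.inr a) (.inr b) := by
      refine hU.up_induction fun b hb' ih => ?_
      by_cases hlf : b ∈ U.leaves
      · rw [hb] at hlf
        obtain rfl : b = a := hlf
        exact .refl
      · obtain ⟨y, hy⟩ : ∃ y, U.out y b := by
          by_contra hc
          exact hlf ⟨hb', fun y hy => hc ⟨y, hy⟩⟩
        obtain ⟨c, hc, -⟩ := hl y (hU.out_mem _ _ hy).1
        exact (ih y c hy hc).trans (hU.desc_inp_out hc hy)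
    obtain ⟨c, hc, -⟩ := hl x hx
    have hD : T.dotsAbove W U (.inl x) = {.inl a} := by
      ext d
      cases d with
      | inl d =>
        rw [inl_mem_dotsAbove, ha]
        constructor
        · rintro ⟨rfl, -⟩
          rfl
        · intro hd
          obtain rfl := Sum.inl.inj hd
          exact ⟨rfl, (key c (hU.inp_mem _ _ hc).2).trans (hU.desc_inp hc)⟩
      | inr w =>
        rw [inr_mem_dotsAbove]
        simp [hW]
    rw [hD]
    exact SimpleGraph.Connected.mk SimpleGraph.Preconnected.of_subsingleton

end PreTree

namespace PreMOP

variable {C : PreMOP.{u}} {x y s : C.Cell} {k : ℕ}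

/-- Cells as elements of the zoom complex. -/
def cellElem (C : PreMOP.{u}) : C.Cell → C.zoom.Elem := Sum.inl

/-- The additional elements of the zoom complex. -/
def augElem (C : PreMOP.{u}) : AugElem → C.zoom.Elem := Sum.inr

theorem cellElem_injective (C : PreMOP.{u}) : C.cellElem.Injective :=
  fun _ _ e => Sum.inl.inj e

theorem augElem_injective (C : PreMOP.{u}) : C.augElem.Injective :=
  fun _ _ e => Sum.inr.inj e

theorem cellElem_ne_augElem (x : C.Cell) (a : AugElem) : C.cellElem x ≠ C.augElem a :=
  fun e => by cases e

theorem augElem_root_ne_leaf (C : PreMOP.{u}) : C.augElem .root ≠ C.augElem .leaf :=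
  fun e => by cases C.augElem_injective e

theorem treeSucc_eq (h : C.IsDFC) (k : ℕ) : C.treeSucc k = (C.cellTree k).map Sum.inl := by
  have e : ∀ x y : C.Cell, C.dim x = k + 1 → C.Facet y x → C.dim y = k := fun x y h1 h2 => by
    have := h.dim_facet x y h2
    omega
  rw [PreTree.ext_iff']
  refine ⟨?_, ?_, fun a b => ?_, fun a b => ?_, ?_⟩
  · ext a
    exact ⟨fun ⟨x, h1, h2, h3⟩ => ⟨x, ⟨h1, h2⟩, h3.symm⟩, fun ⟨x, h1, h2⟩ => ⟨x, h1.1, h1.2, h2.symm⟩⟩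
  · ext a
    exact ⟨fun ⟨x, h1, h3⟩ => ⟨x, h1, h3.symm⟩, fun ⟨x, h1, h2⟩ => ⟨x, h1, h2.symm⟩⟩
  · exact ⟨fun ⟨x, y, h1, h2, h3, h4, h5, h6⟩ => ⟨x, y, ⟨h1, h2, h4⟩, h5, h6⟩,
      fun ⟨x, y, ⟨h1, h2, h4⟩, h5, h6⟩ => ⟨x, y, h1, h2, e x y h2 h4.facet, h4, h5, h6⟩⟩
  · exact ⟨fun ⟨x, y, h1, h2, h3, h4, h5, h6⟩ => ⟨x, y, ⟨h1, h2, h4⟩, h5, h6⟩,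
      fun ⟨x, y, ⟨h1, h2, h4⟩, h5, h6⟩ => ⟨x, y, h1, h2, e x y h2 h4.facet, h4, h5, h6⟩⟩
  · ext a
    exact ⟨fun ⟨x, h1, h2, h3⟩ => ⟨x, ⟨h1, h2⟩, h3.symm⟩, fun ⟨x, h1, h2⟩ => ⟨x, h1.1, h1.2, h2.symm⟩⟩

namespace IsDFC

theorem pos_bottom (h : C.IsDFC) (hs : C.dim s = -1) (hx : C.dim x = 0) : C.Pos s x := by
  obtain ⟨s', h1, h2⟩ := h.bottom
  obtain rfl := (h1 s).1 hs
  have := h2 x hx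
  have hm : s ∈ C.γ x \ C.δ x := this ▸ rfl
  exact hm

/-- There is exactly one cell of dimension zero that is not the target of a non-loop. -/
theorem exists_lam_zero (h : C.IsDFC) :
    ∃ x, x ∈ C.Lam ∧ C.dim x = 0 ∧ ∀ y ∈ C.Lam, C.dim y = 0 → y = x := by
  have H := h.treeHyp (Nat.zero_le _)
  obtain ⟨s, h1, -⟩ := h.bottom
  have hs := (h1 s).2 rfl
  obtain ⟨r, -, hr⟩ := h.exists_iterTarget (Nat.zero_le C.topDim)
  -- The bottom cell has sign `1` in every cell of dimension `0`. The root therefore has above it a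
  -- leaf with this sign, and two such leaves would violate uniqueness.
  obtain ⟨x, hx, hp⟩ := H.exists_pos_above h hr (h.pos_bottom hs (by simpa using hr))
  obtain ⟨⟨hx1, hx2⟩, -⟩ := H.mem_leavesAbove.1 hx
  refine ⟨x, hx1, by simpa using hx2, fun y hy hy0 => ?_⟩
  have e1 := eps_eq_one.2 hp
  have e2 := eps_eq_one.2 (h.pos_bottom hs hy0)
  exact (H.lam_unique h hx1 hx2 hy (by simpa using hy0) (z := s) (by omega) (by omega)).symm

theorem cellTree_zero_leaves (h : C.IsDFC) (hx : x ∈ C.Lam) (hx0 : C.dim x = 0) :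
    (C.cellTree 0).leaves = {x} := by
  rw [(h.treeHyp (Nat.zero_le _)).leaves]
  obtain ⟨x', h1, h2, h3⟩ := h.exists_lam_zero
  ext y
  constructor
  · rintro ⟨hy, hy0⟩
    rw [Set.mem_singleton_iff, h3 y hy (by simpa using hy0), h3 x hx hx0]
  · rintro rfl
    exact ⟨hx, by simpa using hx0⟩

/-- All facets of a cell of dimension `1` contain the bottom cell with sign `1`, and thinness allows
this sign for only one source. -/
theorem cellTree_zero_isLinear (h : C.IsDFC) : (C.cellTree 0).IsLinear := by
  obtain ⟨s, h1, -⟩ := h.bottom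
  have hs := (h1 s).2 rfl
  have e : ∀ x y : C.Cell, C.dim x = ((0 : ℕ) : ℤ) + 1 → C.Facet y x → C.eps s y = 1 :=
    fun x y hx hy => by
      have := h.dim_facet x y hy
      exact eps_eq_one.2 (h.pos_bottom hs (by push_cast at hx; omega))
  rintro x ⟨hx, hx1⟩
  obtain ⟨t, ht⟩ := h.exists_pos (x := x) (by rw [hx1]; positivity) fun z => h.lam_not_loop hx
  have et := e x t hx1 ht.facet
  obtain ⟨y, hy, ey⟩ := h.thin_target ht (z := s) (by omega)
  refine ⟨y, ⟨hx, hx1, hy⟩, fun y' hy' => ?_⟩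
  have ey' := e x y' hx1 hy'.2.2.facet
  exact h.thin_unique hy'.2.2 hy (z := s) (by omega) (by omega)

theorem tree₁_eq (h : C.IsDFC) (hx : x ∈ C.Lam) (hx0 : C.dim x = 0) (hs : C.dim s = -1) :
    C.tree₁ = PreTree.stick (.inl x) (.inl s) (.inr .node) := by
  obtain ⟨x', h1, h2, h3⟩ := h.exists_lam_zero
  have hxx : ∀ a : C.Cell ⊕ AugElem, (∃ x ∈ C.Lam, C.dim x = 0 ∧ a = .inl x) ↔ a = .inl x := by
    intro a
    constructor
    · rintro ⟨y, hy, hy0, rfl⟩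
      rw [h3 y hy hy0, h3 x hx hx0]
    · rintro rfl
      exact ⟨x, hx, hx0, rfl⟩
  obtain ⟨s', g1, -⟩ := h.bottom
  have hss : ∀ b : C.Cell ⊕ AugElem, (∃ y, C.dim y = -1 ∧ b = .inl y) ↔ b = .inl s := by
    intro a
    constructor
    · rintro ⟨y, hy, rfl⟩
      rw [(g1 y).1 hy, (g1 s).1 hs]
    · rintro rfl
      exact ⟨s, hs, rfl⟩
  rw [PreTree.ext_iff']
  refine ⟨?_, ?_, fun a b => and_congr (hxx a) (hss b), fun a b => and_congr_left' (hxx a), ?_⟩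
  · ext a
    exact hxx a
  · ext a
    exact or_congr_left (hss a)
  · ext a
    exact hss a

theorem zoom_tree_zero (C : PreMOP.{u}) :
    C.zoom.tree 0 = PreTree.stick (C.augElem .node) (C.augElem .root) (C.augElem .leaf) :=
  if_pos (e := PreTree.void _ _) (Nat.zero_le C.topDim)

theorem zoom_tree_one (h : C.IsDFC) (h1 : 1 ≤ C.topDim) (hx : x ∈ C.Lam) (hx0 : C.dim x = 0)
    (hs : C.dim s = -1) :
    C.zoom.tree 1 = PreTree.stick (C.cellElem x) (C.cellElem s) (C.augElem .node) :=
  (if_pos h1).trans (h.tree₁_eq hx hx0 hs)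

theorem zoom_tree_succ (h : C.IsDFC) (hk : k + 2 ≤ C.topDim) :
    C.zoom.tree (k + 2) = (C.cellTree k).map C.cellElem :=
  (if_pos hk).trans (treeSucc_eq h k)

theorem zoom_white (hk : k + 2 < C.topDim) {b : C.Cell} :
    C.zoom.white (k + 2) (C.cellElem b) = C.cellElem '' C.cellWhite k b := by
  ext w
  constructor
  · rintro ⟨-, -, y, v, h1, h2, h3, rfl⟩
    obtain rfl := C.cellElem_injective h3
    exact ⟨v, ⟨by push_cast at h1; omega, h2⟩, rfl⟩
  · rintro ⟨v, ⟨h1, h2⟩, rfl⟩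
    exact ⟨hk, by omega, b, v, by push_cast; omega, h2, rfl, rfl⟩

theorem zoom_white_low (hk : k < 2) (b : C.zoom.Elem) : C.zoom.white k b = ∅ :=
  Set.eq_empty_iff_forall_notMem.2 fun _ hw => absurd hw.2.1 (by omega)

theorem zoom_whiteLT {b w w' : C.Cell} :
    C.zoom.whiteLT k (C.cellElem b) (C.cellElem w) (C.cellElem w') ↔ C.WhiteLT b w w' := by
  constructor
  · rintro ⟨y, v, v', h1, h2, h3, h4⟩
    rwa [Sum.inl.inj h2, Sum.inl.inj h3, Sum.inl.inj h4]
  · exact fun h1 => ⟨b, w, w', h1, rfl, rfl, rfl⟩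

theorem zoom_two_isLinear (h : C.IsDFC) : ((C.cellTree 0).map C.cellElem).IsLinear := by
  rintro _ ⟨x, hx, rfl⟩
  obtain ⟨y, hy, hu⟩ := h.cellTree_zero_isLinear x hx
  refine ⟨C.cellElem y, (PreTree.map_inp C.cellElem_injective).2 hy, ?_⟩
  rintro _ ⟨x', y', hi, e, rfl⟩
  obtain rfl := C.cellElem_injective e
  rw [hu y' hi]

/-- The zoom complex of a dendritic face complex is an opetope. -/
theorem zoom_isOpetope (h : C.IsDFC) : C.zoom.IsOpetope := by
  obtain ⟨x, hx, hx0, -⟩ := h.exists_lam_zero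
  obtain ⟨s, hs, -⟩ := h.bottom
  have hs := (hs s).2 rfl
  refine ⟨?_, ?_, fun k hk => ?_, ?_, fun h1 => ?_, fun h2 => ?_⟩
  · rintro (_ | _ | k) hk
    · rw [zoom_tree_zero]
      exact PreTree.stick_isRootedTree C.augElem_root_ne_leaf
    · rw [h.zoom_tree_one hk hx hx0 hs]
      exact PreTree.stick_isRootedTree (cellElem_ne_augElem _ _)
    · rw [h.zoom_tree_succ hk]
      exact PreTree.map_isRootedTree C.cellElem_injective
        (h.treeHyp (le_trans (by omega) hk)).rooted
  · rintro (_ | _ | k) hk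
    · rw [h.zoom_tree_one hk hx hx0 hs, zoom_tree_zero]
      exact PreTree.isExactConstellation_of_isLinear
        (PreTree.stick_isRootedTree (cellElem_ne_augElem _ _)) PreTree.stick_isLinear rfl
        (PreTree.stick_leaves (cellElem_ne_augElem _ _)) (zoom_white_low (by omega))
    · rw [h.zoom_tree_one (Nat.le_of_lt hk) hx hx0 hs, h.zoom_tree_succ hk]
      refine PreTree.isExactConstellation_of_isLinear (a := C.cellElem x) ?_
        h.zoom_two_isLinear rfl ?_ (zoom_white_low (by omega))
      · exact PreTree.map_isRootedTree C.cellElem_injective (h.treeHyp (Nat.zero_le _)).rooted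
      · rw [PreTree.map_leaves C.cellElem_injective, h.cellTree_zero_leaves hx hx0,
          Set.image_singleton]
    · rw [h.zoom_tree_succ (Nat.le_of_lt hk), show k + 1 + 1 + 1 = (k + 1) + 2 from rfl,
        h.zoom_tree_succ (k := k + 1) hk]
      refine PreTree.map_isExactConstellation C.cellElem_injective
        (fun b _ => zoom_white hk) ?_ (fun b _ w _ w' _ => zoom_whiteLT)
        (h.treeHyp (le_trans (by omega) (Nat.le_of_lt hk))).rooted
        (h.cell_isExactConstellation (le_trans (by omega) (Nat.le_of_lt hk)))
      rintro _ w ⟨-, -, y, v, h1, -, rfl, -⟩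
      exact ⟨y, by change C.dim y = k; push_cast at h1; omega, rfl⟩
  · have : C.zoom.tree k = PreTree.void _ _ := if_neg (not_le.2 hk)
    rw [this]
    exact ⟨rfl, rfl⟩
  · rw [zoom_tree_zero]
    exact PreTree.stick_isElementary C.augElem_root_ne_leaf
  · rw [h.zoom_tree_one h1 hx hx0 hs]
    exact PreTree.stick_isElementary (cellElem_ne_augElem _ _)
  · rw [h.zoom_tree_succ h2]
    exact h.zoom_two_isLinear

end IsDFC

end PreMOP

/-! ## The extension of an opetope is an opetope -/

namespace PreTree.IsRootedTree

variable {N E : Type u} {T : PreTree N E} {a : N} {b r : E}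

theorem desc_root (hT : T.IsRootedTree) (hr : r ∈ T.root) (hb : b ∈ T.edges) :
    T.Desc (.inr b) (.inr r) := by
  obtain ⟨r', -, h1, -, h3⟩ := hT.root
  rw [h1] at hr
  obtain rfl : r = r' := hr
  exact h3 b hb

theorem not_inp_root (hT : T.IsRootedTree) (hr : r ∈ T.root) : ¬ T.inp a r := by
  obtain ⟨r', -, h1, h2, -⟩ := hT.root
  rw [h1] at hr
  obtain rfl : r = r' := hr
  exact h2 a

theorem root_mem (hT : T.IsRootedTree) (hr : r ∈ T.root) : r ∈ T.edges := by
  obtain ⟨r', h0, h1, -, -⟩ := hT.root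
  rw [h1] at hr
  obtain rfl : r = r' := hr
  exact h0

theorem root_unique (hT : T.IsRootedTree) (hr : r ∈ T.root) (hb : b ∈ T.root) : r = b := by
  obtain ⟨r', -, h1, -, -⟩ := hT.root
  rw [h1] at hr hb
  exact hr.trans hb.symm

theorem exists_mem_root (hT : T.IsRootedTree) : ∃ r, r ∈ T.root := by
  obtain ⟨r, -, h1, -, -⟩ := hT.root
  exact ⟨r, h1 ▸ rfl⟩

theorem exists_inp_of_ne_root (hT : T.IsRootedTree) (hr : r ∈ T.root) (hb : b ∈ T.edges)
    (hne : b ≠ r) : ∃ a, T.inp a b := by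
  rcases (hT.desc_root hr hb).cases_head with e | ⟨c, hs, -⟩
  · exact (hne (Sum.inr.inj e)).elim
  · cases hs with
    | edge a _ _ _ h => exact ⟨a, h⟩

theorem mem_root_iff (hT : T.IsRootedTree) (hb : b ∈ T.edges) : b ∈ T.root ↔ ∀ a, ¬ T.inp a b := by
  refine ⟨fun h a => hT.not_inp_root h, fun h => ?_⟩
  obtain ⟨r, hr⟩ := hT.exists_mem_root
  by_cases e : b = r
  · rwa [e]
  · obtain ⟨a, ha⟩ := hT.exists_inp_of_ne_root hr hb e
    exact (h a ha).elim

theorem exists_out_root (hT : T.IsRootedTree) (hr : r ∈ T.root) (ha : a ∈ T.nodes) :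
    ∃ a', T.out a' r := by
  obtain ⟨b, hb⟩ := hT.exists_out ha
  have hd := (hT.desc_out hb).trans (hT.desc_root hr (hT.out_mem _ _ hb).2)
  rcases desc_inr_cases hd with e | ⟨a', ha', -⟩
  · simp at e
  · exact ⟨a', ha'⟩

end PreTree.IsRootedTree

namespace PreZoom

variable (Y : PreZoom.{u})

/-- The elements of a zoom complex as elements of its extension. -/
def oldElem : Y.Elem → Y.extend.Elem := Sum.inl

/-- The new elements of the extension. -/
def newElem : NewElem → Y.extend.Elem := Sum.inr

theorem oldElem_injective : Y.oldElem.Injective := fun _ _ e => Sum.inl.inj e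

theorem oldElem_ne_newElem (x : Y.Elem) (a : NewElem) : Y.oldElem x ≠ Y.newElem a :=
  fun e => by cases e

theorem newElem_ne : Y.newElem .top ≠ Y.newElem .root := fun e => by cases e

theorem extend_tree_old {k : ℕ} (hk : k ≤ Y.dim) :
    Y.extend.tree k = (Y.tree k).map Y.oldElem := by
  refine (if_pos hk).trans (PreTree.ext_iff'.2 ⟨?_, ?_, fun a b => Iff.rfl, fun a b => Iff.rfl, ?_⟩)
  · ext a
    exact ⟨fun ⟨x, h1, h3⟩ => ⟨x, h1, h3.symm⟩, fun ⟨x, h1, h2⟩ => ⟨x, h1, h2.symm⟩⟩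
  · ext a
    exact ⟨fun ⟨x, h1, h3⟩ => ⟨x, h1, h3.symm⟩, fun ⟨x, h1, h2⟩ => ⟨x, h1, h2.symm⟩⟩
  · ext a
    exact ⟨fun ⟨x, h1, h3⟩ => ⟨x, h1, h3.symm⟩, fun ⟨x, h1, h2⟩ => ⟨x, h1, h2.symm⟩⟩

theorem extend_tree_corolla : Y.extend.tree (Y.dim + 1) = Y.corolla :=
  (if_neg (by omega)).trans (if_pos rfl)

theorem extend_tree_unit : Y.extend.tree (Y.dim + 2) = Y.unit :=
  ((if_neg (by omega)).trans (if_neg (by omega))).trans (if_pos rfl)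

theorem extend_white_old {k : ℕ} (hk : k < Y.dim) (b : Y.Elem) :
    Y.extend.white k (Y.oldElem b) = Y.oldElem '' Y.white k b := by
  ext w
  constructor
  · rintro (⟨-, y, v, h1, h2, rfl⟩ | ⟨rfl, -⟩)
    · obtain rfl := Y.oldElem_injective h2
      exact ⟨v, h1, rfl⟩
    · omega
  · rintro ⟨v, hv, rfl⟩
    exact Or.inl ⟨hk, b, v, hv, rfl, rfl⟩

theorem extend_white_dim_succ (b : Y.extend.Elem) : Y.extend.white (Y.dim + 1) b = ∅ := by
  refine Set.eq_empty_iff_forall_notMem.2 fun w hw => ?_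
  rcases hw with ⟨h, -⟩ | ⟨h, -⟩ <;> omega

theorem extend_whiteLT_old {k : ℕ} (hk : k < Y.dim) {b w w' : Y.Elem} :
    Y.extend.whiteLT k (Y.oldElem b) (Y.oldElem w) (Y.oldElem w') ↔ Y.whiteLT k b w w' := by
  constructor
  · rintro ⟨-, y, v, v', h1, h2, h3, h4⟩
    rwa [Sum.inl.inj h2, Sum.inl.inj h3, Sum.inl.inj h4]
  · exact fun h1 => ⟨hk, b, w, w', h1, rfl, rfl, rfl⟩

theorem mem_extend_white_dim {b w : Y.extend.Elem} : w ∈ Y.extend.white Y.dim b ↔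
    (Y.tree Y.dim).nodes = ∅ ∧ (∃ y ∈ (Y.tree Y.dim).edges, b = Y.oldElem y) ∧
      w = Y.newElem .top := by
  constructor
  · rintro (⟨h, -⟩ | ⟨-, h⟩)
    · omega
    · exact h
  · exact fun h => Or.inr ⟨rfl, h⟩

theorem corolla_isRootedTree (hf : (Y.tree Y.dim).nodes.Finite) : Y.corolla.IsRootedTree where
  nodes_finite := Set.finite_singleton _
  edges_finite := by
    refine ((hf.image Sum.inl).insert (.inr .root)).subset ?_
    rintro b (⟨a, ha, rfl⟩ | rfl)
    · exact Or.inr ⟨a, ha, rfl⟩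
    · exact Or.inl rfl
  out_mem a b h := ⟨h.1, Or.inr h.2⟩
  inp_mem a b h := ⟨h.1, Or.inl h.2⟩
  target_edge a ha := ⟨.inr .root, ⟨ha, rfl⟩, fun b hb => hb.2⟩
  source_node a a' b h h' := h.1.trans h'.1.symm
  target_node a a' b h h' := h.1.trans h'.1.symm
  root := by
    refine ⟨.inr .root, Or.inr rfl, rfl, fun a ⟨_, x, _, e⟩ => by simp at e, ?_⟩
    rintro b (⟨a, ha, rfl⟩ | rfl)
    · exact .head (.edge (.inr .top) _ rfl (Or.inl ⟨a, ha, rfl⟩) ⟨rfl, a, ha, rfl⟩)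
        (.single (.node _ _ rfl (Or.inr rfl) ⟨rfl, rfl⟩))
    · exact .refl

theorem corolla_leaves : Y.corolla.leaves = Sum.inl '' (Y.tree Y.dim).nodes := by
  ext b
  constructor
  · rintro ⟨⟨a, ha, rfl⟩ | rfl, hn⟩
    · exact ⟨a, ha, rfl⟩
    · exact (hn (.inr .top) ⟨rfl, rfl⟩).elim
  · rintro ⟨a, ha, rfl⟩
    exact ⟨Or.inl ⟨a, ha, rfl⟩, fun x hx => by simp [corolla] at hx⟩

theorem unit_isRootedTree : Y.unit.IsRootedTree where
  nodes_finite := Set.finite_empty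
  edges_finite := Set.finite_singleton _
  out_mem _ _ h := h.elim
  inp_mem _ _ h := h.elim
  target_edge a ha := ha.elim
  source_node _ _ _ h := h.elim
  target_node _ _ _ h := h.elim
  root := by
    refine ⟨.inr .top, rfl, rfl, fun _ h => h, ?_⟩
    rintro b rfl
    exact .refl

theorem corolla_isLinear {a : Y.Elem} (ha : (Y.tree Y.dim).nodes = {a}) : Y.corolla.IsLinear := by
  rintro x hx
  refine ⟨.inl a, ⟨hx, a, ha ▸ rfl, rfl⟩, ?_⟩
  rintro _ ⟨-, y, hy, rfl⟩
  rw [ha] at hy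
  exact congrArg Sum.inl hy

namespace IsOpetope

variable {Y}

/-- The only node of the corolla is `⊤`, and the dots above it are all dots of `S_n`; the whole tree
is a nest. If `S_n` has no node, then its only edge is the root and carries the white dot `⊤`. -/
theorem corolla_isExactConstellation (h : Y.IsOpetope) :
    ((Y.tree Y.dim).map Y.oldElem).IsExactConstellation (Y.extend.white Y.dim)
      (Y.extend.whiteLT Y.dim) Y.corolla := by
  have hT := h.tree Y.dim le_rfl
  obtain ⟨r, hr⟩ := hT.exists_mem_root
  have hT' := PreTree.map_isRootedTree Y.oldElem_injective hT
  have hr' : Y.oldElem r ∈ ((Y.tree Y.dim).map Y.oldElem).root := ⟨r, hr, rfl⟩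
  have hU := Y.corolla_isRootedTree hT.nodes_finite
  have hsub : ∀ b, (Y.extend.white Y.dim b) ⊆ {Y.newElem .top} := fun b w hw =>
    (Y.mem_extend_white_dim.1 hw).2.2
  have hlt : ∀ b w w', ¬ Y.extend.whiteLT Y.dim b w w' := fun b w w' hw => lt_irrefl _ hw.1
  have hone : (Y.tree Y.dim).nodes = ∅ → ∀ b ∈ (Y.tree Y.dim).edges, b = r := by
    intro he b hb
    by_contra hne
    obtain ⟨a, ha⟩ := hT.exists_inp_of_ne_root hr hb hne
    have := (hT.inp_mem _ _ ha).1
    rw [he] at this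
    exact this
  have hS : ((Y.tree Y.dim).map Y.oldElem).IsSubdivision (Y.extend.white Y.dim)
      (Y.extend.whiteLT Y.dim) := by
    refine ⟨?_, fun b => (Set.finite_singleton _).subset (hsub b), fun b => ?_, ?_⟩
    · intro b w hw
      obtain ⟨-, ⟨y, hy, rfl⟩, -⟩ := Y.mem_extend_white_dim.1 hw
      exact ⟨y, hy, rfl⟩
    · exact isStrictTotalOrder_of (fun w w' _ _ => Subtype.ext
        ((hsub b w.2).trans (hsub b w'.2).symm)) (fun w => hlt _ _ _)
        (fun w w' w'' h1 => (hlt _ _ _ h1).elim)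
    · intro b b' w hw hw'
      obtain ⟨he, ⟨y, hy, rfl⟩, -⟩ := Y.mem_extend_white_dim.1 hw
      obtain ⟨-, ⟨y', hy', rfl⟩, -⟩ := Y.mem_extend_white_dim.1 hw'
      rw [hone he y hy, hone he y' hy']
  have hb : ((Y.tree Y.dim).map Y.oldElem).nodes = Y.corolla.leaves := Y.corolla_leaves.symm
  refine ⟨hS.edge, hS.finite, hS.order, hS.disjoint, hb, ?_, ?_⟩
  · ext w
    constructor
    · rintro ⟨b, hw⟩
      obtain ⟨he, -, rfl⟩ := Y.mem_extend_white_dim.1 hw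
      refine ⟨rfl, ?_⟩
      rintro b ⟨-, x, hx, -⟩
      rw [he] at hx
      exact hx
    · rintro ⟨rfl, hn⟩
      refine ⟨Y.oldElem r, Y.mem_extend_white_dim.2 ⟨?_, ⟨r, hT.root_mem hr, rfl⟩, rfl⟩⟩
      exact Set.eq_empty_iff_forall_notMem.2 fun x hx => hn (.inl x) ⟨rfl, x, hx, rfl⟩
  · rintro x rfl
    refine (hS.connected_iff hT' (PreTree.exists_onEdge hT')).2 ?_
    have hall : ∀ a ∈ ((Y.tree Y.dim).map Y.oldElem).nodes, .inl a ∈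
        ((Y.tree Y.dim).map Y.oldElem).dotsAbove (Y.extend.white Y.dim) Y.corolla
          (.inl (.inr .top)) := by
      rintro _ ⟨a, ha, rfl⟩
      exact PreTree.inl_mem_dotsAbove.2 ⟨⟨a, ha, rfl⟩,
        hU.desc_inp ⟨rfl, a, ha, rfl⟩⟩
    have hallw : ∀ b w, w ∈ Y.extend.white Y.dim b → .inr w ∈
        ((Y.tree Y.dim).map Y.oldElem).dotsAbove (Y.extend.white Y.dim) Y.corolla
          (.inl (.inr .top)) := by
      intro b w hw
      obtain rfl := hsub b hw
      exact PreTree.inr_mem_dotsAbove.2 ⟨⟨b, hS.edge b _ hw, hw⟩, .refl⟩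
    refine ⟨Y.oldElem r, ?_, ?_, ?_, ?_, ?_⟩
    · by_cases he : (Y.tree Y.dim).nodes = ∅
      · have hw : Y.newElem .top ∈ Y.extend.white Y.dim (Y.oldElem r) :=
          Y.mem_extend_white_dim.2 ⟨he, ⟨r, hT.root_mem hr, rfl⟩, rfl⟩
        exact ⟨.inr (Y.newElem .top), hallw _ _ hw, hw⟩
      · obtain ⟨a, ha⟩ := Set.nonempty_iff_ne_empty.2 he
        obtain ⟨a', ha'⟩ := hT'.exists_out_root hr' (a := Y.oldElem a) ⟨a, ha, rfl⟩
        exact ⟨.inl a', hall a' (hT'.out_mem _ _ ha').1, ha'⟩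
    · intro d hd z hz hne
      have hze : z ∈ ((Y.tree Y.dim).map Y.oldElem).edges := by
        cases d with
        | inl a => exact (hT'.out_mem _ _ hz).2
        | inr w => exact hS.edge _ _ hz
      obtain ⟨a, ha⟩ := hT'.exists_inp_of_ne_root hr' hze hne
      exact ⟨a, ha, hall a (hT'.inp_mem _ _ ha).1⟩
    · exact fun d hd z hz hne v hv => hallw z v (PreTree.IsSubdivision.under_mem hv)
    · exact fun d hd hz v hv _ _ _ => hallw _ v (PreTree.IsSubdivision.under_mem hv)
    · exact fun a ha _ => hT'.not_inp_root hr' ha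

theorem unit_isExactConstellation (Y : PreZoom.{u}) :
    Y.corolla.IsExactConstellation (Y.extend.white (Y.dim + 1)) (Y.extend.whiteLT (Y.dim + 1))
      Y.unit := by
  have hW : ∀ b w, w ∉ Y.extend.white (Y.dim + 1) b := fun b =>
    Set.eq_empty_iff_forall_notMem.1 (Y.extend_white_dim_succ b)
  refine ⟨fun b w hw => (hW b w hw).elim,
    fun b => Set.finite_empty.subset fun w hw => (hW b w hw).elim,
    fun b => isStrictTotalOrder_of (fun w => (hW b _ w.2).elim) (fun w => (hW b _ w.2).elim)
      (fun w => (hW b _ w.2).elim), fun b b' w hw => (hW b w hw).elim, ?_, ?_,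
    fun x hx => hx.elim⟩
  · ext b
    exact ⟨fun hb => ⟨hb, fun _ h => h⟩, fun hb => hb.1⟩
  · ext w
    exact ⟨fun ⟨b, hb⟩ => (hW b w hb).elim, fun hw => hw.1.elim⟩

theorem map_isElementary {A B : Type u} {f : A → B} (hf : f.Injective) {T : PreTree A A}
    (hT : T.IsElementary) : (T.map f).IsElementary := by
  obtain ⟨⟨a, ha⟩, l, hl⟩ := hT
  refine ⟨⟨f a, ?_⟩, f l, ?_⟩
  · change f '' T.nodes = _
    rw [ha, Set.image_singleton]
  · rw [PreTree.map_leaves hf, hl, Set.image_singleton]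

/-- The extension of an opetope is an opetope. -/
theorem extend_isOpetope (h : Y.IsOpetope) : Y.extend.IsOpetope := by
  have hf := (h.tree Y.dim le_rfl).nodes_finite
  refine ⟨fun k hk => ?_, fun k hk => ?_, fun k hk => ?_, ?_, fun _ => ?_, fun _ => ?_⟩
  · change k ≤ Y.dim + 2 at hk
    rcases (by omega : k ≤ Y.dim ∨ k = Y.dim + 1 ∨ k = Y.dim + 2) with hk | rfl | rfl
    · rw [Y.extend_tree_old hk]
      exact PreTree.map_isRootedTree Y.oldElem_injective (h.tree k hk)
    · rw [extend_tree_corolla]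
      exact Y.corolla_isRootedTree hf
    · rw [extend_tree_unit]
      exact Y.unit_isRootedTree
  · change k < Y.dim + 2 at hk
    rcases (by omega : k < Y.dim ∨ k = Y.dim ∨ k = Y.dim + 1) with hk | rfl | rfl
    · rw [Y.extend_tree_old hk.le, Y.extend_tree_old (k := k + 1) hk]
      refine PreTree.map_isExactConstellation Y.oldElem_injective
        (fun b _ => Y.extend_white_old hk b) ?_ (fun b _ w _ w' _ => Y.extend_whiteLT_old hk)
        (h.tree k hk.le) (h.constellation k hk)
      rintro c w (⟨-, y, v, h1, rfl, -⟩ | ⟨rfl, -⟩)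
      · exact ⟨y, (h.constellation k hk).white_edge y v h1, rfl⟩
      · omega
    · rw [Y.extend_tree_old le_rfl, extend_tree_corolla]
      exact h.corolla_isExactConstellation
    · rw [extend_tree_corolla, show Y.dim + 1 + 1 = Y.dim + 2 from rfl, extend_tree_unit]
      exact unit_isExactConstellation Y
  · change Y.dim + 2 < k at hk
    have : Y.extend.tree k = PreTree.void _ _ :=
      ((if_neg (by omega)).trans (if_neg (by omega))).trans (if_neg (by omega))
    rw [this]
    exact ⟨rfl, rfl⟩
  · rw [Y.extend_tree_old (Nat.zero_le _)]
    exact map_isElementary Y.oldElem_injective h.zero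
  -- In dimension `0` the corolla itself is `S_1`; it has one leaf because `S_0` has one node.
  -- Likewise `S_2` is the corolla in dimension `1`, and the unit tree, without nodes, in dimension
  -- `0`.
  · rcases (by omega : 1 ≤ Y.dim ∨ 0 = Y.dim) with h1 | h0
    · rw [Y.extend_tree_old h1]
      exact map_isElementary Y.oldElem_injective (h.one h1)
    · rw [show 1 = Y.dim + 1 by omega, extend_tree_corolla]
      obtain ⟨⟨a, ha⟩, -⟩ := h.zero
      rw [h0] at ha
      refine ⟨⟨_, rfl⟩, Y.oldElem a, ?_⟩
      refine Y.corolla_leaves.trans ?_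
      rw [ha, Set.image_singleton]
      rfl
  · rcases (by omega : 2 ≤ Y.dim ∨ 1 = Y.dim ∨ 0 = Y.dim) with h2 | h1 | h0
    · rw [Y.extend_tree_old h2]
      rintro _ ⟨x, hx, rfl⟩
      obtain ⟨y, hy, hu⟩ := h.two h2 x hx
      refine ⟨Y.oldElem y, (PreTree.map_inp Y.oldElem_injective).2 hy, ?_⟩
      rintro _ ⟨x', y', hi, e, rfl⟩
      obtain rfl := Y.oldElem_injective e
      rw [hu y' hi]
    · rw [show 2 = Y.dim + 1 by omega, extend_tree_corolla]
      obtain ⟨⟨a, ha⟩, -⟩ := h.one h1.le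
      rw [h1] at ha
      exact Y.corolla_isLinear ha
    · rw [show 2 = Y.dim + 2 by omega, extend_tree_unit]
      exact fun a ha => ha.elim

end IsOpetope

end PreZoom

/-! ## The face complex of an opetope is a dendritic face complex -/

namespace PreMOP

variable {C : PreMOP.{u}}

theorem sign_eq_of_cast : ∀ α β α' β' : SignType,
    (α : ℤ) * (β : ℤ) = -((α' : ℤ) * (β' : ℤ)) → α * β = -(α' * β') := by
  decide

open Classical in
/-- Oriented thinness follows from the formula that expresses the signs of the target of `x` by
those of its sources. -/
theorem thin_of_sum {x z y₀ : C.Cell} (hpos : ∀ y, C.Pos y x ↔ y = y₀)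
    (hsum : C.eps z y₀ = (if ∃ y, C.Neg y x ∧ C.eps z y = 1 then 1 else 0) -
      (if ∃ y, C.Neg y x ∧ C.eps z y = -1 then 1 else 0))
    (huniq : ∀ y y', C.Neg y x → C.Neg y' x → C.eps z y ≠ 0 → C.eps z y' = C.eps z y → y = y')
    {y : C.Cell} {α β : SignType} (hα : α ≠ 0) (hβ : β ≠ 0) (hr : C.Rel β z y)
    (hr' : C.Rel α y x) :
    ∃ y', y' ≠ y ∧
      (∃ α' β' : SignType, α' ≠ 0 ∧ β' ≠ 0 ∧ C.Rel β' z y' ∧ C.Rel α' y' x ∧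
        α * β = -(α' * β')) ∧
      ∀ y'', y'' ≠ y →
        (∃ α' β' : SignType, α' ≠ 0 ∧ β' ≠ 0 ∧ C.Rel β' z y'' ∧ C.Rel α' y'' x) → y'' = y' := by
  rw [rel_iff_eps hβ] at hr
  rw [rel_iff_eps hα] at hr'
  have hβ' : C.eps z y ≠ 0 := by
    rw [hr]
    cases β <;> simp at hβ ⊢
  have hα' : C.eps y x ≠ 0 := by
    rw [hr']
    cases α <;> simp at hα ⊢
  suffices hs : ∃ y', y' ≠ y ∧ C.eps z y * C.eps y x = -(C.eps z y' * C.eps y' x) ∧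
      ∀ y'', y'' ≠ y → C.eps z y'' ≠ 0 → C.eps y'' x ≠ 0 → y'' = y' by
    obtain ⟨y', h1, h2, h3⟩ := hs
    have h4 : C.eps z y' ≠ 0 := fun e => by
      rw [e, zero_mul, neg_zero] at h2
      exact mul_ne_zero hβ' hα' h2
    have h5 : C.eps y' x ≠ 0 := fun e => by
      rw [e, mul_zero, neg_zero] at h2
      exact mul_ne_zero hβ' hα' h2
    obtain ⟨β', k1, k2, k3⟩ := exists_sign_of_eps h4
    obtain ⟨α', l1, l2, l3⟩ := exists_sign_of_eps h5
    refine ⟨y', h1, ⟨α', β', l1, k1, k2, l2, sign_eq_of_cast _ _ _ _ ?_⟩, ?_⟩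
    · rw [mul_comm, ← hr, ← hr', h2, k3, l3, mul_comm]
    · rintro y'' hne ⟨α'', β'', m1, m2, m3, m4⟩
      rw [rel_iff_eps m2] at m3
      rw [rel_iff_eps m1] at m4
      refine h3 y'' hne ?_ ?_
      · rw [m3]
        cases β'' <;> simp at m2 ⊢
      · rw [m4]
        cases α'' <;> simp at m1 ⊢
  have hy₀ : C.eps y₀ x = 1 := eps_eq_one.2 ((hpos y₀).2 rfl)
  have hnn : ∀ y, C.Neg y x → y ≠ y₀ := fun y hy e => ((hpos y).2 e).not_neg hy
  have hr := C.eps_range z y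
  have opp : ∀ y'', C.eps z y'' ≠ 0 → C.eps z y'' ≠ C.eps z y → C.eps z y'' = - C.eps z y := by
    clear hsum
    intro y'' k1 k2
    rcases C.eps_range z y'' with k5 | k5 | k5 <;> rcases hr with e | e | e <;> omega
  rcases eps_ne_zero.1 hα' with hp | hn
  · obtain rfl := (hpos y).1 hp
    -- The sign of `z` in the target is nonzero, so by the formula exactly one of the two signs
    -- occurs among the sources, namely that of the target.
    obtain ⟨y', hy', e', hno⟩ : ∃ y', C.Neg y' x ∧ C.eps z y' = C.eps z y ∧
        ¬ ∃ y', C.Neg y' x ∧ C.eps z y' = - C.eps z y := by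
      rcases hr with e | e | e
      · rw [e] at hsum ⊢
        split_ifs at hsum with h1 h2 h2
        · omega
        · obtain ⟨y', k1, k2⟩ := h1
          exact ⟨y', k1, k2, h2⟩
        · omega
        · omega
      · rw [e] at hsum ⊢
        split_ifs at hsum with h1 h2 h2
        · omega
        · omega
        · obtain ⟨y', k1, k2⟩ := h2
          exact ⟨y', k1, k2, by simpa using h1⟩
        · omega
      · exact (hβ' e).elim
    refine ⟨y', hnn y' hy', by rw [hy₀, e', eps_eq_neg_one.2 hy']; ring, ?_⟩
    intro y'' hne k1 k2
    rcases eps_ne_zero.1 k2 with k3 | k3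
    · exact (hne ((hpos y'').1 k3)).elim
    · by_cases k4 : C.eps z y'' = C.eps z y
      · exact huniq _ _ k3 hy' k1 (e'.trans k4.symm)
      · exact (hno ⟨y'', k3, opp y'' k1 k4⟩).elim
  · have hen := eps_eq_neg_one.2 hn
    -- For a source `y` there are two cases: the opposite sign occurs in another source and the
    -- target has sign `0`, or it does not occur and the target has the sign of `y`.
    have hex : (∃ y', C.Neg y' x ∧ C.eps z y' = - C.eps z y) ∧ C.eps z y₀ = 0 ∨
        (¬ ∃ y', C.Neg y' x ∧ C.eps z y' = - C.eps z y) ∧ C.eps z y₀ = C.eps z y := by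
      rcases hr with e | e | e
      · rw [e]
        rw [if_pos (⟨y, hn, e⟩ : ∃ y, C.Neg y x ∧ C.eps z y = 1)] at hsum
        split_ifs at hsum with h1
        · exact Or.inl ⟨h1, by omega⟩
        · exact Or.inr ⟨h1, by omega⟩
      · rw [e, neg_neg]
        rw [if_pos (⟨y, hn, e⟩ : ∃ y, C.Neg y x ∧ C.eps z y = -1)] at hsum
        split_ifs at hsum with h1
        · exact Or.inl ⟨h1, by omega⟩
        · exact Or.inr ⟨h1, by omega⟩
      · exact (hβ' e).elim
    rcases hex with ⟨⟨y', hy', e'⟩, e₀⟩ | ⟨hno, e₀⟩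
    · refine ⟨y', fun e => by rw [e] at e'; omega, by rw [e', hen, eps_eq_neg_one.2 hy']; ring, ?_⟩
      intro y'' hne k1 k2
      rcases eps_ne_zero.1 k2 with k3 | k3
      · rw [(hpos y'').1 k3] at k1
        exact (k1 e₀).elim
      · by_cases k4 : C.eps z y'' = C.eps z y
        · exact (hne (huniq _ _ k3 hn k1 k4.symm)).elim
        · exact huniq _ _ k3 hy' k1 (e'.trans (opp y'' k1 k4).symm)
    · refine ⟨y₀, (hnn y hn).symm, by rw [e₀, hen, hy₀]; ring, ?_⟩
      intro y'' hne k1 k2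
      rcases eps_ne_zero.1 k2 with k3 | k3
      · exact (hpos y'').1 k3
      · by_cases k4 : C.eps z y'' = C.eps z y
        · exact (hne (huniq _ _ k3 hn k1 k4.symm)).elim
        · exact (hno ⟨y'', k3, opp y'' k1 k4⟩).elim

end PreMOP

/-! ### Nests and signs in an opetope -/

namespace PreZoom

variable (X : PreZoom.{u})

/-- The dots of `S_j` above the edge `y` of `S_{j+1}`. -/
def dotsAt (j : ℕ) (y : X.Elem) : Set (X.Elem ⊕ X.Elem) :=
  (X.tree j).dotsAbove (X.white j) (X.tree (j + 1)) (.inr y)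

/-- The edges of the nest of `y` in `S_j`. -/
def edgesAt (j : ℕ) (y : X.Elem) : Set X.Elem :=
  (X.tree j).nestEdges (X.white j) (X.tree (j + 1)) (.inr y)

/-- The root of the nest of `y` in `S_j`. -/
def rootsAt (j : ℕ) (y : X.Elem) : Set X.Elem :=
  (X.tree j).nestRoot (X.white j) (X.tree (j + 1)) (.inr y)

/-- The leaves of the nest of `y` in `S_j`. -/
def leavesAt (j : ℕ) (y : X.Elem) : Set X.Elem :=
  (X.tree j).nestLeaves (X.white j) (X.tree (j + 1)) (.inr y)

/-- Some black dot above `y` has the target edge `z`. -/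
def OutAt (j : ℕ) (z y : X.Elem) : Prop :=
  ∃ a ∈ (X.tree (j + 1)).leavesAbove y, (X.tree j).out a z

/-- Some black dot above `y` has the source edge `z`. -/
def InpAt (j : ℕ) (z y : X.Elem) : Prop :=
  ∃ a ∈ (X.tree (j + 1)).leavesAbove y, (X.tree j).inp a z

/-- Some white dot above `y` is on the edge `z`. -/
def WhiteAt (j : ℕ) (z y : X.Elem) : Prop :=
  ∃ w ∈ X.white j z, (X.tree (j + 1)).Desc (.inl w) (.inr y)

/-- The sign of `z` in the nest of `y`. -/
noncomputable def sgn (j : ℕ) (z y : X.Elem) : ℤ := (X.tree j).nestSign (X.tree (j + 1)) z y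

namespace IsOpetope

variable {X} {j : ℕ} {x y y' y₀ z z₀ w a : X.Elem}

theorem isSubdivision (h : X.IsOpetope) (hj : j < X.dim) :
    (X.tree j).IsSubdivision (X.white j) (X.whiteLT j) := (h.constellation j hj).isSubdivision

theorem inl_mem_dotsAt (h : X.IsOpetope) (hj : j < X.dim) :
    .inl a ∈ X.dotsAt j y ↔ a ∈ (X.tree (j + 1)).leavesAbove y := (h.constellation j hj).inl_mem

theorem inr_mem_dotsAt (h : X.IsOpetope) (hj : j < X.dim) : .inr w ∈ X.dotsAt j y ↔
    w ∈ (X.tree (j + 1)).nulldots ∧ (X.tree (j + 1)).Desc (.inl w) (.inr y) :=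
  (h.constellation j hj).inr_mem

theorem inr_mem_dotsAt_of_white (h : X.IsOpetope) (hj : j < X.dim) (hw : w ∈ X.white j z)
    (hd : (X.tree (j + 1)).Desc (.inl w) (.inr y)) : .inr w ∈ X.dotsAt j y :=
  (h.inr_mem_dotsAt hj).2 ⟨(h.constellation j hj).mem_nulldots hw, hd⟩

theorem exists_nest (h : X.IsOpetope) (hj : j < X.dim) (hy : y ∈ (X.tree (j + 1)).edges) :
    ∃ z₀, (X.tree j).IsNest (X.white j) (X.whiteLT j) (X.dotsAt j y) z₀ :=
  (h.constellation j hj).exists_isNest (h.tree j hj.le) (h.tree (j + 1) hj) hy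

theorem mem_edgesAt (h : X.IsOpetope) (hj : j < X.dim) : z ∈ X.edgesAt j y ↔
    X.OutAt j z y ∨ X.InpAt j z y ∨ X.WhiteAt j z y := by
  have hT := h.tree j hj.le
  constructor
  · rintro ⟨-, ⟨a, ha, ho | hi⟩ | ⟨w, hw, hd⟩⟩
    · exact Or.inl ⟨a, (h.inl_mem_dotsAt hj).1 ha, ho⟩
    · exact Or.inr (Or.inl ⟨a, (h.inl_mem_dotsAt hj).1 ha, hi⟩)
    · exact Or.inr (Or.inr ⟨w, hw, ((h.inr_mem_dotsAt hj).1 hd).2⟩)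
  · rintro (⟨a, ha, ho⟩ | ⟨a, ha, hi⟩ | ⟨w, hw, hd⟩)
    · exact ⟨(hT.out_mem _ _ ho).2, Or.inl ⟨a, (h.inl_mem_dotsAt hj).2 ha, Or.inl ho⟩⟩
    · exact ⟨(hT.inp_mem _ _ hi).2, Or.inl ⟨a, (h.inl_mem_dotsAt hj).2 ha, Or.inr hi⟩⟩
    · exact ⟨(h.isSubdivision hj).edge _ _ hw,
        Or.inr ⟨w, hw, h.inr_mem_dotsAt_of_white hj hw hd⟩⟩

theorem mem_rootsAt (h : X.IsOpetope) (hj : j < X.dim) : z ∈ X.rootsAt j y ↔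
    z ∈ X.edgesAt j y ∧ ¬ X.InpAt j z y :=
  and_congr_right' (not_congr (exists_congr fun _ => and_congr_left' (h.inl_mem_dotsAt hj)))

theorem mem_leavesAt (h : X.IsOpetope) (hj : j < X.dim) : z ∈ X.leavesAt j y ↔
    z ∈ X.edgesAt j y ∧ ¬ X.OutAt j z y :=
  and_congr_right' (not_congr (exists_congr fun _ => and_congr_left' (h.inl_mem_dotsAt hj)))

theorem sgn_eq_one (h : X.IsOpetope) (hj : j < X.dim) :
    X.sgn j z y = 1 ↔ X.OutAt j z y ∧ ¬ X.InpAt j z y :=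
  PreTree.nestSign_eq_one (h.tree j hj.le) (h.tree (j + 1) hj)

theorem sgn_eq_neg_one (h : X.IsOpetope) (hj : j < X.dim) :
    X.sgn j z y = -1 ↔ ¬ X.OutAt j z y ∧ X.InpAt j z y :=
  PreTree.nestSign_eq_neg_one (h.tree j hj.le) (h.tree (j + 1) hj)

theorem mem_roots_diff (h : X.IsOpetope) (hj : j < X.dim) :
    z ∈ X.rootsAt j y ∧ z ∉ X.leavesAt j y ↔ X.sgn j z y = 1 := by
  rw [h.mem_rootsAt hj, h.mem_leavesAt hj, h.sgn_eq_one hj, h.mem_edgesAt hj]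
  tauto

theorem mem_leaves_diff (h : X.IsOpetope) (hj : j < X.dim) :
    z ∈ X.leavesAt j y ∧ z ∉ X.rootsAt j y ↔ X.sgn j z y = -1 := by
  rw [h.mem_rootsAt hj, h.mem_leavesAt hj, h.sgn_eq_neg_one hj, h.mem_edgesAt hj]
  tauto

theorem mem_leaves_inter (h : X.IsOpetope) (hj : j < X.dim) :
    z ∈ X.leavesAt j y ∧ z ∈ X.rootsAt j y ↔
      X.WhiteAt j z y ∧ ¬ X.OutAt j z y ∧ ¬ X.InpAt j z y := by
  rw [h.mem_rootsAt hj, h.mem_leavesAt hj, h.mem_edgesAt hj]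
  tauto

theorem rootsAt_eq (h : X.IsOpetope) (hj : j < X.dim)
    (hn : (X.tree j).IsNest (X.white j) (X.whiteLT j) (X.dotsAt j y) z₀) :
    X.rootsAt j y = {z₀} := hn.nestRoot_eq (h.tree j hj.le) (h.isSubdivision hj)

theorem nest_of_root (h : X.IsOpetope) (hj : j < X.dim) (hy : y ∈ (X.tree (j + 1)).edges)
    (hz : z ∈ X.rootsAt j y) :
    (X.tree j).IsNest (X.white j) (X.whiteLT j) (X.dotsAt j y) z := by
  obtain ⟨z₀, hn⟩ := h.exists_nest hj hy
  rw [h.rootsAt_eq hj hn] at hz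
  obtain rfl : z = z₀ := hz
  exact hn

/-- A nest with an edge that is both its root and a leaf has no other edge. -/
theorem loop_edges (h : X.IsOpetope) (hj : j < X.dim) (hy : y ∈ (X.tree (j + 1)).edges)
    (hz : z ∈ X.rootsAt j y) (hz' : z ∈ X.leavesAt j y) :
    (∀ a, a ∉ (X.tree (j + 1)).leavesAbove y) ∧
      (∀ w, .inr w ∈ X.dotsAt j y → w ∈ X.white j z) ∧ X.edgesAt j y = {z} := by
  have hn := h.nest_of_root hj hy hz
  obtain ⟨-, h1, h2, h3⟩ := hn.eq_root_of_loop (h.tree j hj.le) (h.isSubdivision hj) hz hz'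
  exact ⟨fun a ha => h1 a ((h.inl_mem_dotsAt hj).2 ha), h2, h3⟩

theorem leaves_eq_of_loop (h : X.IsOpetope) (hj : j < X.dim) (hy : y ∈ (X.tree (j + 1)).edges)
    (hz : z ∈ X.rootsAt j y) (hz' : z ∈ X.leavesAt j y) :
    X.rootsAt j y = {z} ∧ X.leavesAt j y = {z} := by
  have he := (h.loop_edges hj hy hz hz').2.2
  refine ⟨h.rootsAt_eq hj (h.nest_of_root hj hy hz), ?_⟩
  ext t
  refine ⟨fun ht => ?_, fun ht => ?_⟩
  · rw [← he]
    exact ht.1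
  · rwa [show t = z from ht]

theorem leavesAt_disjoint (h : X.IsOpetope) (hj : j < X.dim) (hx : x ∈ (X.tree (j + 1)).edges)
    {s : X.Elem ⊕ X.Elem} (hy : y ∈ X.leavesAt j x) (hy' : y' ∈ X.leavesAt j x)
    (hs : (X.tree j).Desc s (.inr y)) (hs' : (X.tree j).Desc s (.inr y')) : y = y' := by
  obtain ⟨z₀, hn⟩ := h.exists_nest hj hx
  exact hn.nestLeaves_disjoint (h.tree j hj.le) (h.isSubdivision hj) hy hy' hs hs'

/-- A nonzero sign of `z` in `y` is due to the one node with target `z`, or to the one with source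
`z`. This node, seen as a leaf in the next degree, is above only one leaf of the nest of `x`. -/
theorem sgn_unique (h : X.IsOpetope) (hj : j + 1 < X.dim) (hx : x ∈ (X.tree (j + 2)).edges)
    (hy : y ∈ X.leavesAt (j + 1) x) (hy' : y' ∈ X.leavesAt (j + 1) x) (h0 : X.sgn j z y ≠ 0)
    (he : X.sgn j z y' = X.sgn j z y) : y = y' := by
  have hj' : j < X.dim := by omega
  have hT := h.tree j hj'.le
  rcases PreTree.nestSign_range hT (h.tree (j + 1) hj.le) z y with e | e | e
  · rw [show X.sgn j z y = 1 from e, h.sgn_eq_one hj'] at he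
    obtain ⟨⟨a, ha, hao⟩, -⟩ := (h.sgn_eq_one hj').1 e
    obtain ⟨⟨a', ha', hao'⟩, -⟩ := he
    obtain rfl := hT.source_node _ _ _ hao hao'
    exact h.leavesAt_disjoint hj hx hy hy' ha.2 ha'.2
  · rw [show X.sgn j z y = -1 from e, h.sgn_eq_neg_one hj'] at he
    obtain ⟨-, a, ha, hao⟩ := (h.sgn_eq_neg_one hj').1 e
    obtain ⟨-, a', ha', hao'⟩ := he
    obtain rfl := hT.target_node _ _ _ hao hao'
    exact h.leavesAt_disjoint hj hx hy hy' ha.2 ha'.2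
  · exact (h0 e).elim

open Classical in
theorem sgn_root (h : X.IsOpetope) (hj : j + 1 < X.dim) (hx : x ∈ (X.tree (j + 2)).edges)
    (hy₀ : y₀ ∈ X.rootsAt (j + 1) x) (z : X.Elem) :
    X.sgn j z y₀ = (if ∃ y ∈ X.leavesAt (j + 1) x, X.sgn j z y = 1 then 1 else 0) -
      (if ∃ y ∈ X.leavesAt (j + 1) x, X.sgn j z y = -1 then 1 else 0) := by
  have hj' : j < X.dim := by omega
  have hU := h.tree (j + 1) hj.le
  have hs : X.sgn j z y₀ = ∑ᶠ y ∈ X.leavesAt (j + 1) x, X.sgn j z y :=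
    PreTree.finsum_nestSign (T := X.tree j) hU (h.nest_of_root hj hx hy₀)
      (h.isSubdivision hj) z
  rw [hs]
  refine finsum_mem_sign (hU.edges_finite.subset fun y hy => hy.1.1) _
    (fun y _ => PreTree.nestSign_range (h.tree j hj'.le) hU z y) ?_ ?_
  · intro y hy y' hy' e e'
    exact h.sgn_unique (z := z) hj hx hy hy' (by omega) (by omega)
  · intro y hy y' hy' e e'
    exact h.sgn_unique (z := z) hj hx hy hy' (by omega) (by omega)

theorem desc_rootsAt (h : X.IsOpetope) (hj : j < X.dim) (hx : x ∈ (X.tree (j + 1)).edges)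
    (hy : y ∈ X.edgesAt j x) (hy₀ : y₀ ∈ X.rootsAt j x) :
    (X.tree j).Desc (.inr y) (.inr y₀) :=
  (h.nest_of_root hj hx hy₀).desc_root (h.tree j hj.le) (h.isSubdivision hj) hy

/-- The leaves above the root of a nest are distributed over its leaves. -/
theorem exists_leafAt (h : X.IsOpetope) (hj : j < X.dim) (hx : x ∈ (X.tree (j + 1)).edges)
    (hy₀ : y₀ ∈ X.rootsAt j x) (ha : a ∈ (X.tree j).leavesAbove y₀) :
    ∃ y ∈ X.leavesAt j x, a ∈ (X.tree j).leavesAbove y := by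
  obtain ⟨y, hy, hd⟩ := (h.nest_of_root hj hx hy₀).exists_nestLeaf_above (h.tree j hj.le)
    (h.isSubdivision hj) ha.1 hy₀.1 ha.2
  exact ⟨y, hy, ha.1, hd⟩

/-- A white dot on an inner edge of a nest belongs to the nest. -/
theorem white_of_inner (h : X.IsOpetope) (hj : j < X.dim) (hy : y ∈ (X.tree (j + 1)).edges)
    (ho : X.OutAt j z y) (hi : X.InpAt j z y) (hw : w ∈ X.white j z) :
    (X.tree (j + 1)).Desc (.inl w) (.inr y) := by
  obtain ⟨z₀, hn⟩ := h.exists_nest hj hy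
  obtain ⟨a, ha, hao⟩ := ho
  obtain ⟨b, hb, hbi⟩ := hi
  refine ((h.inr_mem_dotsAt hj).1 (hn.under (.inl a) ((h.inl_mem_dotsAt hj).2 ha) z hao ?_ w hw)).2
  rintro rfl
  exact hn.root b hbi ((h.inl_mem_dotsAt hj).2 hb)

/-- The second part of thinness, for loops. -/
theorem thin_loop_at (h : X.IsOpetope) (hj : j + 1 < X.dim) (hx : x ∈ (X.tree (j + 2)).edges)
    (hy : y ∈ X.leavesAt (j + 1) x) (hy₀ : y₀ ∈ X.rootsAt (j + 1) x) (hw : X.WhiteAt j z y)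
    (ho : ¬ X.OutAt j z y) :
    (X.WhiteAt j z y₀ ∧ ¬ X.OutAt j z y₀ ∧ ¬ X.InpAt j z y₀) ∨ X.sgn j z y₀ = 1 ∨
      X.sgn j z y₀ = -1 ∨ ∃ y' ∈ X.leavesAt (j + 1) x, X.sgn j z y' = 1 ∨ X.sgn j z y' = -1 := by
  have hj' : j < X.dim := by omega
  obtain ⟨w, hwz, hwy⟩ := hw
  by_cases ho₀ : X.OutAt j z y₀
  · by_cases hi₀ : X.InpAt j z y₀
    · right; right; right
      -- Now `z` is an inner edge for `y₀`. The black dot with target `z` is above some leaf `y'`.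
      -- If `z` were inner for `y'` too, then `w` would be above `y'`, hence `y' = y`, although no
      -- black dot above `y` has target `z`.
      obtain ⟨a, ha, hao⟩ := ho₀
      obtain ⟨y', hy', ha'⟩ := h.exists_leafAt hj hx hy₀ ha
      refine ⟨y', hy', Or.inl ((h.sgn_eq_one hj').2 ⟨⟨a, ha', hao⟩, fun hi' => ?_⟩)⟩
      have hd := h.white_of_inner hj' hy'.1.1 ⟨a, ha', hao⟩ hi' hwz
      obtain rfl := h.leavesAt_disjoint hj hx hy hy' hwy hd
      exact ho ⟨a, ha', hao⟩
    · exact Or.inr (Or.inl ((h.sgn_eq_one hj').2 ⟨ho₀, hi₀⟩))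
  · by_cases hi₀ : X.InpAt j z y₀
    · exact Or.inr (Or.inr (Or.inl ((h.sgn_eq_neg_one hj').2 ⟨ho₀, hi₀⟩)))
    · exact Or.inl ⟨⟨w, hwz, hwy.trans (h.desc_rootsAt hj hx hy.1 hy₀)⟩, ho₀, hi₀⟩

theorem leavesAbove_leaf {N E : Type u} {T : PreTree N E} {b c : E} (hb : b ∈ T.leaves) :
    c ∈ T.leavesAbove b ↔ c = b := by
  rw [PreTree.IsRootedTree.leavesAbove_leaf hb]
  rfl

theorem outAt_leaf (hx : x ∈ (X.tree (j + 1)).leaves) :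
    X.OutAt j y x ↔ (X.tree j).out x y :=
  ⟨fun ⟨_, ha, ho⟩ => (leavesAbove_leaf hx).1 ha ▸ ho, fun ho => ⟨x, (leavesAbove_leaf hx).2 rfl, ho⟩⟩

theorem inpAt_leaf (hx : x ∈ (X.tree (j + 1)).leaves) :
    X.InpAt j y x ↔ (X.tree j).inp x y :=
  ⟨fun ⟨_, ha, ho⟩ => (leavesAbove_leaf hx).1 ha ▸ ho, fun ho => ⟨x, (leavesAbove_leaf hx).2 rfl, ho⟩⟩

theorem sgn_leaf_eq_one (h : X.IsOpetope) (hj : j < X.dim) (hx : x ∈ (X.tree (j + 1)).leaves) :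
    X.sgn j y x = 1 ↔ (X.tree j).out x y := by
  rw [h.sgn_eq_one hj, outAt_leaf hx, inpAt_leaf hx]
  exact ⟨fun hh => hh.1, fun hh => ⟨hh, (h.tree j hj.le).out_ne_inp hh⟩⟩

theorem sgn_leaf_eq_neg_one (h : X.IsOpetope) (hj : j < X.dim)
    (hx : x ∈ (X.tree (j + 1)).leaves) : X.sgn j y x = -1 ↔ (X.tree j).inp x y := by
  rw [h.sgn_eq_neg_one hj, outAt_leaf hx, inpAt_leaf hx]
  exact ⟨fun hh => hh.2, fun hh => ⟨fun ho => (h.tree j hj.le).out_ne_inp ho hh, hh⟩⟩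

/-- The tree in degree one, and its nests. -/
theorem tree_one (h : X.IsOpetope) (h2 : 2 ≤ X.dim) : ∃ a r, (X.tree 1).nodes = {a} ∧
    (X.tree 1).root = {r} ∧ (X.tree 1).out a r ∧ ∀ y ∈ (X.tree 2).edges, X.dotsAt 1 y = {.inl a} := by
  have hT := h.tree 1 (by omega)
  obtain ⟨⟨a, ha⟩, -⟩ := h.one (by omega)
  obtain ⟨r, -, hr, -⟩ := hT.root
  obtain ⟨a', ho⟩ := hT.exists_out_root (r := r) (hr ▸ rfl) (a := a) (ha ▸ rfl)
  have ha' : a' = a := by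
    have := (hT.out_mem _ _ ho).1
    rwa [ha] at this
  subst ha'
  refine ⟨a', r, ha, hr, ho, fun y hy => ?_⟩
  have hc := h.constellation 1 (by omega)
  have hsub : X.dotsAt 1 y ⊆ {.inl a'} := by
    rintro (d | w) hd
    · have := ((PreTree.inl_mem_dotsAbove).1 hd).1
      rw [ha] at this
      exact congrArg Sum.inl this
    · have hw := (hc.inr_mem.1 hd).1
      obtain ⟨b, hb, -⟩ := h.two h2 w hw.1
      exact (hw.2 b hb).elim
  obtain ⟨d, hd⟩ := hc.dotsAbove_nonempty (h.tree 2 h2) y hy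
  have hde : d = .inl a' := hsub hd
  exact Set.Subset.antisymm hsub (Set.singleton_subset_iff.2 (hde ▸ hd))

theorem rootsAt_one (h : X.IsOpetope) (h2 : 2 ≤ X.dim) (hy : y ∈ (X.tree 2).edges) :
    X.rootsAt 1 y = (X.tree 1).root := by
  obtain ⟨a, r, ha, hr, ho, hd⟩ := h.tree_one h2
  rw [hr]
  obtain ⟨z₀, hn⟩ := h.exists_nest (j := 1) (by omega) hy
  rw [h.rootsAt_eq (by omega) hn]
  obtain ⟨d, hd', he⟩ := hn.bottom
  rw [hd y hy] at hd'
  obtain rfl : d = .inl a := hd'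
  rw [(h.tree 1 (by omega)).out_unique he ho]

theorem sgn_one (h : X.IsOpetope) (h2 : 2 ≤ X.dim) (hz : z ∈ (X.tree 1).root)
    (hy : y ∈ (X.tree 2).edges) : X.sgn 1 z y = 1 := by
  obtain ⟨a, r, ha, hr, ho, hd⟩ := h.tree_one h2
  have hj : 1 < X.dim := by omega
  rw [hr] at hz
  obtain rfl : z = r := hz
  refine (h.sgn_eq_one hj).2 ⟨⟨a, ?_, ho⟩, ?_⟩
  · rw [← h.inl_mem_dotsAt hj, hd y hy]
    rfl
  · rintro ⟨b, -, hb⟩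
    exact (h.tree 1 (by omega)).not_inp_root (hr ▸ rfl) hb

/-- Every edge is the root or a leaf of some nest. -/
theorem exists_facet (h : X.IsOpetope) (hj : j < X.dim) (hy : y ∈ (X.tree j).edges) :
    ∃ x ∈ (X.tree (j + 1)).edges, X.sgn j y x = 1 ∨ X.sgn j y x = -1 ∨
      (y ∈ X.leavesAt j x ∧ y ∈ X.rootsAt j x) := by
  have hT := h.tree j hj.le
  have hc := h.constellation j hj
  by_cases he : ∃ a, (X.tree j).out a y ∨ (X.tree j).inp a y
  · obtain ⟨a, ha⟩ := he
    have hl : a ∈ (X.tree (j + 1)).leaves := by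
      rw [← hc.black]
      rcases ha with ha | ha
      · exact (hT.out_mem _ _ ha).1
      · exact (hT.inp_mem _ _ ha).1
    refine ⟨a, hl.1, ?_⟩
    rw [h.sgn_leaf_eq_one hj hl, h.sgn_leaf_eq_neg_one hj hl]
    tauto
  · push Not at he
    -- An edge adjacent to no node is the only edge of a tree without nodes. Any edge of the next
    -- tree then has only white dots above it, all on `y`.
    obtain ⟨r, hr⟩ := hT.exists_mem_root
    have hroot : ∀ b ∈ (X.tree j).edges, b = r := by
      intro b hb
      by_contra hne
      obtain ⟨a, ha⟩ := hT.exists_inp_of_ne_root hr hb hne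
      have hyr := (hT.mem_root_iff hy).2 fun a => (he a).2
      obtain ⟨a', ha'⟩ := hT.exists_out_root hyr (hT.inp_mem _ _ ha).1
      exact (he a').1 ha'
    obtain rfl := hroot y hy
    obtain ⟨x, hx⟩ := (h.tree (j + 1) hj).exists_mem_root
    have hx := (h.tree (j + 1) hj).root_mem hx
    refine ⟨x, hx, Or.inr (Or.inr ((h.mem_leaves_inter hj).2 ⟨?_, ?_, ?_⟩))⟩
    · obtain ⟨d | w, hd⟩ := hc.dotsAbove_nonempty (h.tree (j + 1) hj) x hx
      · have hd' := (PreTree.inl_mem_dotsAbove.1 hd).1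
        obtain ⟨a', ha'⟩ := hT.exists_out_root hr hd'
        exact ((he a').1 ha').elim
      · obtain ⟨⟨b, hb, hw⟩, hdesc⟩ := PreTree.inr_mem_dotsAbove.1 hd
        obtain rfl := hroot b hb
        exact ⟨w, hw, hdesc⟩
    · rintro ⟨a, -, ha⟩
      exact (he a).1 ha
    · rintro ⟨a, -, ha⟩
      exact (he a).2 ha

end IsOpetope

end PreZoom

/-! ### The cells of the face complex -/

namespace PreZoom

variable {Y : PreZoom.{u}} {p q x y y' z z' : Y.faces.Cell}

theorem face_lt (e : p.1.1 = q.1.1 + 1) : q.1.1 < Y.extend.dim := by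
  have := p.2.2.1
  change _ < Y.dim + 2
  omega

theorem face_edge (p : Y.faces.Cell) : p.1.2 ∈ (Y.extend.tree p.1.1).edges := p.2.2.2.1

theorem face_edge_succ (e : p.1.1 = q.1.1 + 1) :
    p.1.2 ∈ (Y.extend.tree (q.1.1 + 1)).edges := e ▸ face_edge p

theorem two_le_extend_dim (Y : PreZoom.{u}) : 2 ≤ Y.extend.dim := Nat.le_add_left 2 Y.dim

theorem face_root (p : Y.faces.Cell) (h : p.1.1 = 1) : p.1.2 ∈ (Y.extend.tree 1).root :=
  p.2.2.2.2 h

theorem face_ext (h1 : p.1.1 = q.1.1) (h2 : p.1.2 = q.1.2) : p = q :=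
  Subtype.ext (Prod.ext h1 h2)

theorem face_sgn_one (hX : Y.extend.IsOpetope) (e : p.1.1 = q.1.1 + 1) (h1 : q.1.1 = 1) :
    Y.extend.sgn q.1.1 q.1.2 p.1.2 = 1 := by
  have hp := face_edge_succ e
  rw [h1] at hp ⊢
  exact hX.sgn_one Y.two_le_extend_dim (face_root q h1) hp

theorem face_pos (hX : Y.extend.IsOpetope) : Y.faces.Pos q p ↔
    p.1.1 = q.1.1 + 1 ∧ Y.extend.sgn q.1.1 q.1.2 p.1.2 = 1 := by
  constructor
  · rintro ⟨⟨e, h1⟩, h2⟩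
    refine ⟨e, ?_⟩
    -- Below degree three, `δ` is empty by definition and says nothing about the leaves of the nest;
    -- there the sign is `1` by `face_sgn_one`.
    by_cases h3 : 3 ≤ p.1.1
    · exact (hX.mem_roots_diff (face_lt e)).1 ⟨h1, fun h4 => h2 ⟨e, h3, h4⟩⟩
    · exact face_sgn_one hX e (by have := q.2.1; omega)
  · rintro ⟨e, h1⟩
    obtain ⟨h2, h3⟩ := (hX.mem_roots_diff (face_lt e)).2 h1
    exact ⟨⟨e, h2⟩, fun h4 => h3 h4.2.2⟩

theorem face_neg (hX : Y.extend.IsOpetope) : Y.faces.Neg q p ↔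
    p.1.1 = q.1.1 + 1 ∧ Y.extend.sgn q.1.1 q.1.2 p.1.2 = -1 := by
  constructor
  · rintro ⟨⟨e, h3, h1⟩, h2⟩
    exact ⟨e, (hX.mem_leaves_diff (face_lt e)).1 ⟨h1, fun h4 => h2 ⟨e, h4⟩⟩⟩
  · rintro ⟨e, h1⟩
    obtain ⟨h2, h3⟩ := (hX.mem_leaves_diff (face_lt e)).2 h1
    refine ⟨⟨e, ?_, h2⟩, fun h4 => h3 h4.2⟩
    by_contra h4
    have := face_sgn_one hX e (by have := q.2.1; omega)
    omega

theorem face_loop : Y.faces.Loop q p ↔ p.1.1 = q.1.1 + 1 ∧ 3 ≤ p.1.1 ∧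
    q.1.2 ∈ Y.extend.leavesAt q.1.1 p.1.2 ∧ q.1.2 ∈ Y.extend.rootsAt q.1.1 p.1.2 :=
  ⟨fun h => ⟨h.1.1, h.1.2.1, h.1.2.2, h.2.2⟩, fun h => ⟨⟨h.1, h.2.1, h.2.2.1⟩, h.1, h.2.2.2⟩⟩

theorem face_eps (hX : Y.extend.IsOpetope) (e : p.1.1 = q.1.1 + 1) :
    Y.faces.eps q p = Y.extend.sgn q.1.1 q.1.2 p.1.2 := by
  have h1 := PreMOP.eps_eq_one (C := Y.faces) (y := q) (x := p)
  have h2 := PreMOP.eps_eq_neg_one (C := Y.faces) (y := q) (x := p)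
  rw [face_pos hX, and_iff_right e] at h1
  rw [face_neg hX, and_iff_right e] at h2
  rcases Y.faces.eps_range q p with e1 | e1 | e1
  · rw [e1, h1.1 e1]
  · rw [e1, h2.1 e1]
  · rcases PreTree.nestSign_range (hX.tree _ (face_lt e).le) (hX.tree (q.1.1 + 1) (face_lt e))
      q.1.2 p.1.2 with e2 | e2 | e2
    · rw [h1.2 e2] at e1
      omega
    · rw [h2.2 e2] at e1
      omega
    · exact e1.trans e2.symm

theorem face_neg_iff_of_not_loop (hl : ∀ z, ¬ Y.faces.Loop z p)
    (e : p.1.1 = q.1.1 + 1) (h3 : 3 ≤ p.1.1) :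
    Y.faces.Neg q p ↔ q.1.2 ∈ Y.extend.leavesAt q.1.1 p.1.2 :=
  ⟨fun h => h.1.2.2, fun h => ⟨⟨e, h3, h⟩, fun h' => hl q ⟨⟨e, h3, h⟩, h'⟩⟩⟩

theorem faces_finite (hX : Y.extend.IsOpetope) : Finite Y.faces.Cell := by
  have : (⋃ j ∈ Set.Iic (Y.dim + 2), (fun x => (j, x)) '' (Y.extend.tree j).edges).Finite :=
    (Set.finite_Iic _).biUnion fun j hj => (hX.tree j hj).edges_finite.image _
  refine (this.subset ?_).to_subtype
  rintro ⟨j, x⟩ ⟨-, h2, h3, -⟩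
  simp only [Set.mem_iUnion]
  exact ⟨j, h2, x, h3, rfl⟩

theorem faces_target (hX : Y.extend.IsOpetope) (h2 : 2 ≤ p.1.1) : ∃ q, Y.faces.γ p = {q} := by
  obtain ⟨j, hj⟩ : ∃ j, p.1.1 = j + 1 := ⟨p.1.1 - 1, by omega⟩
  have hjd : j < Y.extend.dim := by
    have := p.2.2.1
    change _ < Y.dim + 2
    omega
  have hp : p.1.2 ∈ (Y.extend.tree (j + 1)).edges := hj ▸ face_edge p
  obtain ⟨z₀, hn⟩ := hX.exists_nest hjd hp
  have hr := hX.rootsAt_eq hjd hn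
  have hz₀ : z₀ ∈ Y.extend.rootsAt j p.1.2 := hr ▸ rfl
  -- In degree one only the root edge is a cell, so the root of the nest has to be identified with
  -- it.
  have h1 : j = 1 → z₀ ∈ (Y.extend.tree 1).root := by
    rintro rfl
    rwa [hX.rootsAt_one Y.two_le_extend_dim hp] at hz₀
  refine ⟨⟨(j, z₀), by dsimp only; omega, hjd.le, hz₀.1.1, h1⟩, ?_⟩
  ext q
  constructor
  · rintro ⟨e, hq⟩
    have e' : q.1.1 = j := by omega
    have hq : q.1.2 ∈ Y.extend.rootsAt j p.1.2 := e' ▸ hq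
    rw [hr] at hq
    exact face_ext e' hq
  · rintro rfl
    exact ⟨hj, hz₀⟩

/-- Two disjoint convex sets of white dots on an edge are comparable. -/
theorem face_local_total (hX : Y.extend.IsOpetope) (hl : Y.faces.Loop z y) (hn : Y.faces.Neg y x)
    (hl' : Y.faces.Loop z y') (hn' : Y.faces.Neg y' x) (hne : y ≠ y') :
    Y.faces.localLT x z y y' ∨ Y.faces.localLT x z y' y := by
  obtain ⟨e, h3, k1, k2⟩ := face_loop.1 hl
  obtain ⟨e', h3', k1', k2'⟩ := face_loop.1 hl'
  have hj := face_lt e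
  have hS := hX.isSubdivision hj
  have hy := face_edge_succ e
  have hy' := face_edge_succ e'
  have hw := (hX.loop_edges hj hy k2 k1).2.1
  have hw' := (hX.loop_edges hj hy' k2' k1').2.1
  have hnest := hX.nest_of_root hj hy k2
  have hnest' := hX.nest_of_root hj hy' k2'
  have hdisj : ∀ w, .inr w ∈ Y.extend.dotsAt z.1.1 y.1.2 →
      .inr w ∉ Y.extend.dotsAt z.1.1 y'.1.2 := by
    intro w h1 h2
    have f := hn.1.1
    have f' := hn'.1.1
    have g1 : y.1.2 ∈ Y.extend.leavesAt y.1.1 x.1.2 := hn.1.2.2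
    have g2 : y'.1.2 ∈ Y.extend.leavesAt y'.1.1 x.1.2 := hn'.1.2.2
    have e2 : y'.1.1 = y.1.1 := by omega
    rw [e2] at g2
    have d1 := ((hX.inr_mem_dotsAt hj).1 h1).2
    have d2 := ((hX.inr_mem_dotsAt hj).1 h2).2
    rw [← e] at d1 d2
    exact hne (face_ext e2.symm (hX.leavesAt_disjoint (face_lt f) (face_edge_succ f) g1 g2 d1 d2))
  -- One comparison `w < w'` decides all others: if `v' < v` for other dots of the two nests,
  -- convexity would put a dot of one nest into the other.
  have key : ∀ {y y' : Y.faces.Cell},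
      (Y.extend.tree z.1.1).IsNest (Y.extend.white z.1.1) (Y.extend.whiteLT z.1.1)
        (Y.extend.dotsAt z.1.1 y.1.2) z.1.2 →
      (Y.extend.tree z.1.1).IsNest (Y.extend.white z.1.1) (Y.extend.whiteLT z.1.1)
        (Y.extend.dotsAt z.1.1 y'.1.2) z.1.2 →
      (∀ w, .inr w ∈ Y.extend.dotsAt z.1.1 y.1.2 → w ∈ Y.extend.white z.1.1 z.1.2) →
      (∀ w, .inr w ∈ Y.extend.dotsAt z.1.1 y'.1.2 → w ∈ Y.extend.white z.1.1 z.1.2) →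
      (∀ w, .inr w ∈ Y.extend.dotsAt z.1.1 y.1.2 → .inr w ∉ Y.extend.dotsAt z.1.1 y'.1.2) →
      ∀ w w', .inr w ∈ Y.extend.dotsAt z.1.1 y.1.2 → .inr w' ∈ Y.extend.dotsAt z.1.1 y'.1.2 →
        Y.extend.whiteLT z.1.1 z.1.2 w w' → Y.faces.localLT x z y y' := by
    intro y y' hnest hnest' hw hw' hdisj w w' h1 h1' hlt v v' h2 h2'
    have m1 := hw w h1
    have m2 := hw v h2
    have m1' := hw' w' h1'
    have m2' := hw' v' h2'
    refine ⟨m2, m2', ?_⟩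
    rcases hS.trichotomous m2 m2' with h4 | h4 | h4
    · exact h4
    · subst h4
      exact (hdisj v h2 h2').elim
    · exfalso
      rcases hS.trichotomous m1 m2' with h5 | h5 | h5
      · exact hdisj v' (hnest.convex (.inr v) h2 m2 v' ⟨m2', h4⟩ w h1 ⟨m1, h5⟩) h2'
      · subst h5
        exact hdisj w h1 h2'
      · exact hdisj w h1 (hnest'.convex (.inr w') h1' m1' w ⟨m1, hlt⟩ v' h2' ⟨m2', h5⟩)
  obtain ⟨w, m, d⟩ := ((hX.mem_leaves_inter hj).1 ⟨k1, k2⟩).1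
  obtain ⟨w', m', d'⟩ := ((hX.mem_leaves_inter hj).1 ⟨k1', k2'⟩).1
  have h1 := hX.inr_mem_dotsAt_of_white hj m d
  have h1' := hX.inr_mem_dotsAt_of_white hj m' d'
  rcases hS.trichotomous m m' with h4 | h4 | h4
  · exact Or.inl (key hnest hnest' hw hw' hdisj w w' h1 h1' h4)
  · subst h4
    exact (hdisj w h1 h1').elim
  · exact Or.inr (key hnest' hnest hw' hw (fun v a b => hdisj v b a) w' w h1' h1 h4)

theorem faces_isMOP (hX : Y.extend.IsOpetope) : Y.faces.IsMOP where
  finite := faces_finite hX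
  dim_ge p := by
    have := p.2.1
    change -1 ≤ (p.1.1 : ℤ) - 2
    omega
  dim_facet p q h := by
    have e : p.1.1 = q.1.1 + 1 := by
      rcases h with h | h
      · exact h.1
      · exact h.1
    change (p.1.1 : ℤ) - 2 = (q.1.1 : ℤ) - 2 + 1
    omega
  target p hp := by
    change 0 ≤ (p.1.1 : ℤ) - 2 at hp
    exact faces_target hX (by omega)
  loop p := by
    rintro ⟨q, hq⟩
    obtain ⟨e, h3, k1, k2⟩ := face_loop.1 hq
    obtain ⟨h4, h5⟩ := hX.leaves_eq_of_loop (face_lt e) (face_edge_succ e) k2 k1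
    ext t
    constructor
    · rintro ⟨e', -, h6⟩
      have e2 : t.1.1 = q.1.1 := by omega
      have h6 : t.1.2 ∈ Y.extend.leavesAt t.1.1 p.1.2 := h6
      refine ⟨e', (?_ : t.1.2 ∈ Y.extend.rootsAt t.1.1 p.1.2)⟩
      rw [e2, h5] at h6
      rw [e2, h4]
      exact h6
    · rintro ⟨e', h6⟩
      have e2 : t.1.1 = q.1.1 := by omega
      have h6 : t.1.2 ∈ Y.extend.rootsAt t.1.1 p.1.2 := h6
      refine ⟨e', h3, (?_ : t.1.2 ∈ Y.extend.leavesAt t.1.1 p.1.2)⟩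
      rw [e2, h4] at h6
      rw [e2, h5]
      exact h6
  bottom := by
    have hT := hX.tree 1 (le_trans (by omega) Y.two_le_extend_dim)
    obtain ⟨r, hr⟩ := hT.exists_mem_root
    let s : Y.faces.Cell := ⟨(1, r), le_rfl, by dsimp only; omega, hT.root_mem hr, fun _ => hr⟩
    have hs : ∀ x : Y.faces.Cell, x.1.1 = 1 → x = s := fun x hx =>
      face_ext hx (hT.root_unique (face_root x hx) hr)
    refine ⟨s, fun x => ⟨fun hx => hs x ?_, ?_⟩, fun x hx => ?_⟩
    · change (x.1.1 : ℤ) - 2 = -1 at hx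
      omega
    · rintro rfl
      rfl
    · change (x.1.1 : ℤ) - 2 = 0 at hx
      ext q
      constructor
      · intro hq
        have e : x.1.1 = q.1.1 + 1 := hq.1.1
        exact hs q (by omega)
      · intro hq
        obtain rfl : q = s := hq
        have e : x.1.1 = s.1.1 + 1 := by
          change _ = 1 + 1
          omega
        exact (face_pos hX).2 ⟨e, face_sgn_one hX e rfl⟩
  local_order x hx z := by
    -- `localLT` quantifies over all pairs of white dots, so irreflexivity and transitivity need
    -- each loop to have at least one.
    have hne : ∀ y : {y // Y.faces.Loop z y ∧ Y.faces.Neg y x}, ∃ w,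
        .inr w ∈ Y.extend.dotsAt z.1.1 y.1.1.2 ∧ w ∈ Y.extend.white z.1.1 z.1.2 := by
      rintro ⟨y, hl, hn⟩
      obtain ⟨e, h3, k1, k2⟩ := face_loop.1 hl
      obtain ⟨w, m, d⟩ := ((hX.mem_leaves_inter (face_lt e)).1 ⟨k1, k2⟩).1
      exact ⟨w, hX.inr_mem_dotsAt_of_white (face_lt e) m d, m⟩
    have hS : ∀ y : {y // Y.faces.Loop z y ∧ Y.faces.Neg y x},
        (Y.extend.tree z.1.1).IsSubdivision (Y.extend.white z.1.1) (Y.extend.whiteLT z.1.1) :=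
      fun y => hX.isSubdivision (face_lt (face_loop.1 y.2.1).1)
    refine isStrictTotalOrder_of ?_ ?_ ?_
    · rintro ⟨y, hl, hn⟩ ⟨y', hl', hn'⟩ h1 h2
      by_contra hne
      rcases face_local_total hX hl hn hl' hn' fun e => hne (Subtype.ext e) with h3 | h3
      · exact h1 h3
      · exact h2 h3
    · intro y h1
      obtain ⟨w, hw, m⟩ := hne y
      exact (hS y).irrefl m (h1 w w hw hw).2.2
    · intro y y' y'' h1 h2 w w'' hw hw''
      obtain ⟨w', hw', -⟩ := hne y'
      obtain ⟨a1, a2, a3⟩ := h1 w w' hw hw'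
      obtain ⟨b1, b2, b3⟩ := h2 w' w'' hw' hw''
      exact ⟨a1, b2, (hS y).trans a1 a2 b2 a3 b3⟩

/-- The greatest cell of the face complex. -/
def topFace (Y : PreZoom.{u}) : Y.faces.Cell :=
  ⟨(Y.dim + 2, Y.newElem .top), by dsimp only; omega, le_rfl,
    by dsimp only; rw [Y.extend_tree_unit]; rfl, by dsimp only; omega⟩

theorem eq_topFace (h : p.1.1 = Y.dim + 2) : p = Y.topFace := by
  refine face_ext h ?_
  have hp := face_edge p
  rw [h, Y.extend_tree_unit] at hp
  exact hp

theorem exists_face_above (hX : Y.extend.IsOpetope) (h : p.1.1 < Y.dim + 2) :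
    ∃ q, q.1.1 = p.1.1 + 1 ∧ Y.faces.Facet p q := by
  have h1 := p.2.1
  obtain ⟨x, hx, hs⟩ := hX.exists_facet (j := p.1.1) h (face_edge p)
  let q : Y.faces.Cell := ⟨(p.1.1 + 1, x), by dsimp only; omega, h, hx, by dsimp only; omega⟩
  refine ⟨q, rfl, ?_⟩
  rcases hs with hs | hs | hs
  · exact ((face_pos hX).2 ⟨rfl, hs⟩).facet
  · exact ((face_neg hX).2 ⟨rfl, hs⟩).facet
  · exact Or.inr ⟨rfl, hs.2⟩

theorem topFace_isTop (hX : Y.extend.IsOpetope) : Y.faces.IsTop Y.topFace := by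
  have key : ∀ m, ∀ p : Y.faces.Cell, p.1.1 + m = Y.dim + 2 → Y.faces.Le p Y.topFace := by
    intro m
    induction m with
    | zero =>
      intro p hp
      rw [eq_topFace hp]
      exact .refl
    | succ m ih =>
      intro p hp
      obtain ⟨q, hq, hf⟩ := exists_face_above hX (p := p) (by omega)
      exact .head hf (ih q (by omega))
  intro p
  have := p.2.2.1
  exact key (Y.dim + 2 - p.1.1) p (by omega)

/-- A node with target edge `p` is a leaf of the next tree, so it is a cell in which `p` has sign
`1`. Conversely, sign `1` exhibits a node with target edge `p`. -/
theorem face_leaf_of_lam (hX : Y.extend.IsOpetope) (h2 : 2 ≤ p.1.1) : p ∈ Y.faces.Lam ↔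
    p.1.2 ∈ (Y.extend.tree p.1.1).leaves := by
  constructor
  · intro hp
    refine ⟨face_edge p, fun a ha => hp ?_⟩
    have hT := hX.tree p.1.1 p.2.2.1
    have hlt : p.1.1 < Y.dim + 2 := by
      by_contra hc
      have e := eq_topFace (p := p) (by have := p.2.2.1; omega)
      rw [e] at ha
      change (Y.extend.tree (Y.dim + 2)).out _ _ at ha
      rw [Y.extend_tree_unit] at ha
      exact ha
    have hl : a ∈ (Y.extend.tree (p.1.1 + 1)).leaves := by
      rw [← (hX.constellation p.1.1 hlt).black]
      exact (hT.out_mem _ _ ha).1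
    exact ⟨⟨(p.1.1 + 1, a), by dsimp only; omega, hlt, hl.1, by dsimp only; omega⟩,
      (face_pos hX).2 ⟨rfl, (hX.sgn_leaf_eq_one hlt hl).2 ha⟩⟩
  · rintro hl ⟨q, hq⟩
    obtain ⟨e, hs⟩ := (face_pos hX).1 hq
    obtain ⟨⟨a, -, ha⟩, -⟩ := (hX.sgn_eq_one (face_lt e)).1 hs
    exact hl.2 a ha

/-- Thinness is `sgn_root` read through `thin_of_sum`, and its second part is `thin_loop_at`. A loop
has no black dot above it, so it is not a leaf and is therefore a target. Along the relation of the
acyclicity axiom the target edge moves strictly towards the root, so its depth decreases. -/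
theorem faces_isDFC (hX : Y.extend.IsOpetope) : Y.faces.IsDFC where
  toIsMOP := faces_isMOP hX
  greatest := by
    refine ⟨Y.topFace, ?_, topFace_isTop hX⟩
    change 0 ≤ ((Y.dim + 2 : ℕ) : ℤ) - 2
    omega
  loops z y hl := by
    obtain ⟨e, h3, k1, k2⟩ := face_loop.1 hl
    by_contra hc
    have hlam : y ∈ Y.faces.Lam := hc
    rw [face_leaf_of_lam hX (by omega), e] at hlam
    exact (hX.loop_edges (face_lt e) (face_edge_succ e) k2 k1).1 y.1.2 ⟨hlam, .refl⟩
  thin x y z α β hα hβ hr hr' := by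
    have M := faces_isMOP hX
    have ezy : y.1.1 = z.1.1 + 1 := by
      cases β with
      | zero => exact (hβ rfl).elim
      | pos => exact ((face_pos hX).1 hr).1
      | neg => exact ((face_neg hX).1 hr).1
    have eyx : x.1.1 = y.1.1 + 1 := by
      cases α with
      | zero => exact (hα rfl).elim
      | pos => exact ((face_pos hX).1 hr').1
      | neg => exact ((face_neg hX).1 hr').1
    have hnl : ∀ t, ¬ Y.faces.Loop t x := by
      cases α with
      | zero => exact (hα rfl).elim
      | pos => exact fun t => M.not_loop_of_pos hr'
      | neg => exact fun t => M.not_loop_of_neg hr'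
    have hz1 := z.2.1
    obtain ⟨y₀, hy₀⟩ := M.exists_pos (x := x)
      (by change 0 ≤ (x.1.1 : ℤ) - 2; omega) hnl
    have ey₀ := ((face_pos hX).1 hy₀).1
    have hx : x.1.2 ∈ (Y.extend.tree (z.1.1 + 2)).edges := by
      have := face_edge x
      rwa [eyx, ezy] at this
    have hj : z.1.1 + 1 < Y.extend.dim := by
      have := face_lt eyx
      omega
    have hneg : ∀ t : Y.faces.Cell, Y.faces.Neg t x ↔
        t.1.1 = z.1.1 + 1 ∧ t.1.2 ∈ Y.extend.leavesAt (z.1.1 + 1) x.1.2 := by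
      intro t
      constructor
      · intro ht
        have e1 : t.1.1 = z.1.1 + 1 := by
          have := ht.1.1
          omega
        refine ⟨e1, ?_⟩
        rw [← e1]
        exact ht.1.2.2
      · rintro ⟨e1, ht⟩
        rw [← e1] at ht
        exact (face_neg_iff_of_not_loop hnl (by omega) (by omega)).2 ht
    have hroot : y₀.1.2 ∈ Y.extend.rootsAt (z.1.1 + 1) x.1.2 := by
      have h1 : y₀.1.2 ∈ Y.extend.rootsAt y₀.1.1 x.1.2 := hy₀.1.2
      rwa [show y₀.1.1 = z.1.1 + 1 by omega] at h1
    have hcell : ∀ b ∈ Y.extend.leavesAt (z.1.1 + 1) x.1.2,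
        ∃ t : Y.faces.Cell, t.1.1 = z.1.1 + 1 ∧ t.1.2 = b := fun b hb =>
      ⟨⟨(z.1.1 + 1, b), by dsimp only; omega, hj.le, hb.1.1, by dsimp only; omega⟩, rfl, rfl⟩
    have hiff : ∀ c : ℤ, (∃ t, Y.faces.Neg t x ∧ Y.faces.eps z t = c) ↔
        ∃ b ∈ Y.extend.leavesAt (z.1.1 + 1) x.1.2, Y.extend.sgn z.1.1 z.1.2 b = c := by
      intro c
      constructor
      · rintro ⟨t, ht, e1⟩
        obtain ⟨e2, h1⟩ := (hneg t).1 ht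
        rw [face_eps hX e2] at e1
        exact ⟨t.1.2, h1, e1⟩
      · rintro ⟨b, hb, e1⟩
        obtain ⟨t, e2, rfl⟩ := hcell b hb
        exact ⟨t, (hneg t).2 ⟨e2, hb⟩, (face_eps hX e2).trans e1⟩
    refine PreMOP.thin_of_sum (y₀ := y₀) (fun t => ⟨fun ht => M.pos_unique ht hy₀, ?_⟩) ?_ ?_
      hα hβ hr hr'
    · rintro rfl
      exact hy₀
    · classical
      rw [face_eps hX (show y₀.1.1 = z.1.1 + 1 by omega), hX.sgn_root hj hx hroot z.1.2]
      simp only [hiff]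
    · intro t t' ht ht' h1 h2
      obtain ⟨e2, k⟩ := (hneg t).1 ht
      obtain ⟨e2', k'⟩ := (hneg t').1 ht'
      rw [face_eps hX e2] at h1 h2
      rw [face_eps hX e2'] at h2
      exact face_ext (e2.trans e2'.symm) (hX.sgn_unique hj hx k k' h1 h2)
  thin_loop x y z hl hn := by
    have M := faces_isMOP hX
    obtain ⟨e, h3, k1, k2⟩ := face_loop.1 hl
    have hnl : ∀ t, ¬ Y.faces.Loop t x := fun t => M.not_loop_of_neg hn
    have eyx : x.1.1 = y.1.1 + 1 := hn.1.1
    obtain ⟨y₀, hy₀⟩ := M.exists_pos (x := x)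
      (by change 0 ≤ (x.1.1 : ℤ) - 2; omega) hnl
    have ey₀ := ((face_pos hX).1 hy₀).1
    have ey₀' : y₀.1.1 = z.1.1 + 1 := by omega
    have hx : x.1.2 ∈ (Y.extend.tree (z.1.1 + 2)).edges := by
      have := face_edge x
      rwa [eyx, e] at this
    have hj : z.1.1 + 1 < Y.extend.dim := by
      have := face_lt eyx
      omega
    have hroot : y₀.1.2 ∈ Y.extend.rootsAt (z.1.1 + 1) x.1.2 := by
      have h1 : y₀.1.2 ∈ Y.extend.rootsAt y₀.1.1 x.1.2 := hy₀.1.2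
      rwa [ey₀'] at h1
    have hleaf : y.1.2 ∈ Y.extend.leavesAt (z.1.1 + 1) x.1.2 := by
      have h1 : y.1.2 ∈ Y.extend.leavesAt y.1.1 x.1.2 := hn.1.2.2
      rwa [e] at h1
    obtain ⟨hw, ho, hi⟩ := (hX.mem_leaves_inter (face_lt e)).1 ⟨k1, k2⟩
    have hne : y₀ ≠ y := fun e' => (e' ▸ hy₀).not_neg hn
    rcases hX.thin_loop_at hj hx hleaf hroot hw ho with h1 | h1 | h1 | ⟨b, hb, h1⟩
    · refine ⟨y₀, hne, .pos, .zero, by decide, face_loop.2 ⟨ey₀', by omega, ?_⟩, hy₀⟩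
      exact (hX.mem_leaves_inter (face_lt e)).2 h1
    · exact ⟨y₀, hne, .pos, .pos, by decide, (face_pos hX).2 ⟨ey₀', h1⟩, hy₀⟩
    · exact ⟨y₀, hne, .pos, .neg, by decide, (face_neg hX).2 ⟨ey₀', h1⟩, hy₀⟩
    · let t : Y.faces.Cell :=
        ⟨(z.1.1 + 1, b), by dsimp only; omega, hj.le, hb.1.1, by dsimp only; omega⟩
      have ht : Y.faces.Neg t x :=
        (face_neg_iff_of_not_loop hnl (by change _ = (z.1.1 + 1) + 1; omega) (by omega)).2 hb
      rcases h1 with h1 | h1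
      · have hp : Y.faces.Pos z t := (face_pos hX).2 ⟨rfl, h1⟩
        exact ⟨t, fun e' => M.not_loop_of_pos hp (e' ▸ hl), .neg, .pos, by decide, hp, ht⟩
      · have hp : Y.faces.Neg z t := (face_neg hX).2 ⟨rfl, h1⟩
        exact ⟨t, fun e' => M.not_loop_of_neg hp (e' ▸ hl), .neg, .neg, by decide, hp, ht⟩
  acyclic x hx y := by
    have M := faces_isMOP hX
    have key : ∀ y', TransGen (fun y y' => Y.faces.Neg y x ∧ Y.faces.Neg y' x ∧
        ∃ z, Y.faces.Pos z y ∧ Y.faces.Neg z y') y y' →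
        ∀ z ∈ Y.faces.γ y, ∀ z' ∈ Y.faces.γ y', z.1.1 = z'.1.1 ∧
          (Y.extend.tree z.1.1).depth (.inr z'.1.2) < (Y.extend.tree z.1.1).depth (.inr z.1.2) := by
      have step : ∀ y y', (Y.faces.Neg y x ∧ Y.faces.Neg y' x ∧
          ∃ z, Y.faces.Pos z y ∧ Y.faces.Neg z y') →
          ∀ z ∈ Y.faces.γ y, ∀ z' ∈ Y.faces.γ y', z.1.1 = z'.1.1 ∧
          (Y.extend.tree z.1.1).depth (.inr z'.1.2) < (Y.extend.tree z.1.1).depth (.inr z.1.2) := by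
        rintro y y' ⟨hn, hn', t, htp, htn⟩ z hz z' hz'
        obtain rfl := M.γ_unique hz htp.1
        have e1 : y'.1.1 = z.1.1 + 1 := htn.1.1
        have e2 : y'.1.1 = z'.1.1 + 1 := hz'.1
        have e3 : z.1.1 = z'.1.1 := by omega
        have hr : z'.1.2 ∈ Y.extend.rootsAt z.1.1 y'.1.2 := by
          rw [e3]
          exact hz'.2
        refine ⟨e3, (hX.tree _ (face_lt e1).le).depth_lt
          (hX.desc_rootsAt (face_lt e1) (face_edge_succ e1) htn.1.2.2.1 hr) fun e => ?_⟩
        have e4 : z.1.2 = z'.1.2 := Sum.inr.inj e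
        exact htn.2 (face_ext e3 e4 ▸ hz')
      intro y' hy'
      induction hy' with
      | single hs => exact step _ _ hs
      | @tail b c _ hs ih =>
        intro z hz z' hz'
        obtain ⟨t, htp, -⟩ := hs.2.2
        obtain ⟨e1, h1⟩ := ih z hz t htp.1
        obtain ⟨e2, h2⟩ := step _ _ hs t htp.1 z' hz'
        rw [← e1] at h2
        exact ⟨e1.trans e2, h2.trans h1⟩
    intro hy
    obtain ⟨c, ⟨-, -, z, hz, -⟩, -⟩ := TransGen.head'_iff.1 hy
    exact lt_irrefl _ (key y hy z hz.1 z hz.1).2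

end PreZoom

/-! ## The isomorphism from a dendritic face complex to the faces of its zoom complex -/

namespace PreTree

variable {A B D : Type u} {T : PreTree A A}

theorem map_congr {f g : A → B} (hT : T.IsRootedTree) (hn : ∀ a ∈ T.nodes, f a = g a)
    (he : ∀ b ∈ T.edges, f b = g b) : T.map f = T.map g := by
  rw [ext_iff']
  refine ⟨Set.image_congr hn, Set.image_congr he, fun a b => ?_, fun a b => ?_,
    Set.image_congr fun b hb => he b (hT.root_mem hb)⟩
  · refine exists_congr fun x => exists_congr fun y => and_congr_right fun h => ?_
    rw [hn x (hT.out_mem _ _ h).1, he y (hT.out_mem _ _ h).2]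
  · refine exists_congr fun x => exists_congr fun y => and_congr_right fun h => ?_
    rw [hn x (hT.inp_mem _ _ h).1, he y (hT.inp_mem _ _ h).2]

theorem map_map (f : A → B) (g : B → D) : (T.map f).map g = T.map (g ∘ f) := by
  rw [ext_iff']
  refine ⟨Set.image_image _ _ _, Set.image_image _ _ _, fun a b => ?_, fun a b => ?_,
    Set.image_image _ _ _⟩
  · constructor
    · rintro ⟨_, _, ⟨x, y, h, rfl, rfl⟩, rfl, rfl⟩
      exact ⟨x, y, h, rfl, rfl⟩
    · rintro ⟨x, y, h, rfl, rfl⟩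
      exact ⟨_, _, ⟨x, y, h, rfl, rfl⟩, rfl, rfl⟩
  · constructor
    · rintro ⟨_, _, ⟨x, y, h, rfl, rfl⟩, rfl, rfl⟩
      exact ⟨x, y, h, rfl, rfl⟩
    · rintro ⟨x, y, h, rfl, rfl⟩
      exact ⟨_, _, ⟨x, y, h, rfl, rfl⟩, rfl, rfl⟩

end PreTree

namespace PreMOP

/-- The edge of the extended zoom complex that corresponds to a cell. -/
noncomputable def thetaElem (C : PreMOP.{u}) (x : C.Cell) : C.zoom.extend.Elem := (thetaFun C x).2

variable {C : PreMOP.{u}} {x y y' z s ω w w' : C.Cell} {k : ℕ}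

theorem thetaElem_top (hω : C.IsTop ω) : C.thetaElem ω = C.zoom.newElem .top := if_pos hω

theorem thetaElem_other (h1 : ¬ C.IsTop x) (h2 : ¬ ∃ ω, C.IsTop ω ∧ x ∈ C.γ ω) :
    C.thetaElem x = C.zoom.oldElem (C.cellElem x) := (if_neg h1).trans (if_neg h2)

namespace IsDFC

theorem thetaElem_target (h : C.IsDFC) (hω : C.IsTop ω) (hx : x ∈ C.γ ω) :
    C.thetaElem x = C.zoom.newElem .root := by
  refine (if_neg fun hx' => ?_).trans (if_pos ⟨ω, hω, hx⟩)
  obtain rfl := h.top_unique hx' hω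
  have := h.γ_dim hx
  omega

theorem dim_top (h : C.IsDFC) (hω : C.IsTop ω) : C.dim ω = C.topDim := by
  obtain ⟨ω', hω', h1⟩ := h.exists_top
  rwa [h.top_unique hω hω']

theorem top_not_loop (h : C.IsDFC) (hω : C.IsTop ω) : ¬ C.Loop z ω := fun hl => by
  obtain ⟨x, hx⟩ := h.loops z ω hl
  have h1 := h.dim_pos hx
  have h2 := h.le_topDim x
  have h3 := h.dim_top hω
  omega

theorem pos_top (h : C.IsDFC) (hω : C.IsTop ω) (hx : x ∈ C.γ ω) : C.Pos x ω :=
  ⟨hx, fun h1 => h.top_not_loop hω ⟨h1, hx⟩⟩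

theorem thetaElem_lam (h : C.IsDFC) (hx : x ∈ C.Lam) (hd : C.dim x < C.topDim) :
    C.thetaElem x = C.zoom.oldElem (C.cellElem x) := by
  refine thetaElem_other (fun h1 => ?_) ?_
  · have := h.dim_top h1
    omega
  · rintro ⟨ω, hω, h1⟩
    exact hx ⟨ω, h.pos_top hω h1⟩

theorem thetaElem_low (h : C.IsDFC) (hd : C.dim x + 1 < C.topDim) :
    C.thetaElem x = C.zoom.oldElem (C.cellElem x) := by
  refine thetaElem_other (fun h1 => ?_) ?_
  · have := h.dim_top h1
    omega
  · rintro ⟨ω, hω, h1⟩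
    have := h.dim_top hω
    have := h.γ_dim h1
    omega

theorem thetaElem_injective (h : C.IsDFC) : C.thetaElem.Injective := by
  obtain ⟨ω, hω, -⟩ := h.exists_top
  have hcases : ∀ x, x = ω ∨ x ∈ C.γ ω ∨ C.thetaElem x = C.zoom.oldElem (C.cellElem x) := by
    intro x
    by_cases h1 : C.IsTop x
    · exact Or.inl (h.top_unique h1 hω)
    by_cases h2 : ∃ ω, C.IsTop ω ∧ x ∈ C.γ ω
    · obtain ⟨ω', hω', hx⟩ := h2
      rw [h.top_unique hω' hω] at hx
      exact Or.inr (Or.inl hx)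
    · exact Or.inr (Or.inr (thetaElem_other h1 h2))
  intro x y e
  rcases hcases x with rfl | hx | hx <;> rcases hcases y with rfl | hy | hy
  · rfl
  · rw [thetaElem_top hω, h.thetaElem_target hω hy] at e
    exact (C.zoom.newElem_ne e).elim
  · rw [thetaElem_top hω, hy] at e
    exact (C.zoom.oldElem_ne_newElem _ _ e.symm).elim
  · rw [thetaElem_top hω, h.thetaElem_target hω hx] at e
    exact (C.zoom.newElem_ne e.symm).elim
  · exact h.γ_unique hx hy
  · rw [h.thetaElem_target hω hx, hy] at e
    exact (C.zoom.oldElem_ne_newElem _ _ e.symm).elim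
  · rw [thetaElem_top hω, hx] at e
    exact (C.zoom.oldElem_ne_newElem _ _ e).elim
  · rw [h.thetaElem_target hω hy, hx] at e
    exact (C.zoom.oldElem_ne_newElem _ _ e).elim
  · rw [hx, hy] at e
    exact C.cellElem_injective (C.zoom.oldElem_injective e)

/-- The cells below the greatest one, in codimension one. -/
theorem codim_one (h : C.IsDFC) (hω : C.IsTop ω) (hx : C.dim x + 1 = C.topDim) :
    (C.Neg x ω ↔ x ∈ C.Lam) ∧ (C.Pos x ω ↔ x ∉ C.Lam) := by
  have hd := h.dim_top hω
  have key : ∀ y, C.Facet x y → y = ω := by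
    intro y hy
    have := h.dim_facet y x hy
    exact h.top_unique (h.isTop_of_dim (by omega)) hω
  have hp : C.Pos x ω ↔ x ∉ C.Lam := by
    constructor
    · exact fun h1 h2 => h2 ⟨ω, h1⟩
    · intro h1
      obtain ⟨y, hy⟩ := not_not.1 h1
      rwa [key y hy.facet] at hy
  refine ⟨⟨fun h1 h2 => ?_, fun h1 => ?_⟩, hp⟩
  · obtain ⟨y, hy⟩ := h2
    rw [key y hy.facet] at hy
    exact hy.not_neg h1
  · obtain ⟨y, hy⟩ := h.exists_facet (x := x) (by omega)
    have e := key y hy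
    subst e
    rcases facet_cases hy with h2 | h2 | h2
    · exact (hp.1 h2 h1).elim
    · exact h2
    · exact (h.top_not_loop hω h2).elim

theorem zoom_top_nodes (h : C.IsDFC) (hn : 1 ≤ C.topDim) : (C.zoom.tree C.zoom.dim).nodes =
    C.cellElem '' {x | x ∈ C.Lam ∧ C.dim x + 1 = C.topDim} := by
  change (C.zoom.tree C.topDim).nodes = _
  obtain ⟨m, hm⟩ : ∃ m, C.topDim = m + 1 := ⟨C.topDim - 1, by omega⟩
  rcases m with _ | m
  · obtain ⟨x, hx, hx0, hu⟩ := h.exists_lam_zero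
    obtain ⟨s, hs, -⟩ := h.bottom
    rw [show C.topDim = 1 from hm, h.zoom_tree_one hn hx hx0 ((hs s).2 rfl)]
    change {C.cellElem x} = _
    rw [← Set.image_singleton]
    congr 1
    ext y
    constructor
    · rintro rfl
      exact ⟨hx, by rw [hx0]; rfl⟩
    · rintro ⟨hy, hy0⟩
      refine hu y hy ?_
      push_cast at hy0
      omega
  · rw [hm, h.zoom_tree_succ (k := m) (by omega)]
    change C.cellElem '' {x | _} = _
    congr 1
    ext y
    simp only [Set.mem_ofPred_eq]
    push_cast
    exact and_congr_right fun _ => by omega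

/-- The trees of the extended zoom complex are the cell trees. -/
theorem extend_zoom_tree (h : C.IsDFC) (hk : k ≤ C.topDim) :
    C.zoom.extend.tree (k + 2) = (C.cellTree k).map C.thetaElem := by
  obtain ⟨ω, hω, hd⟩ := h.exists_top
  have hH := h.treeHyp hk
  -- The degree `k + 2` is that of an original tree, of the corolla, or of the unit tree.
  rcases (by omega : k + 2 ≤ C.topDim ∨ k + 1 = C.topDim ∨ k = C.topDim) with h2 | h1 | h0
  · rw [C.zoom.extend_tree_old (k := k + 2) h2, h.zoom_tree_succ h2, PreTree.map_map]
    refine PreTree.map_congr hH.rooted (fun a ha => ?_) (fun b hb => ?_)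
    · exact (h.thetaElem_lam ha.1 (by rw [ha.2]; omega)).symm
    · exact (h.thetaElem_low (by rw [show C.dim b = k from hb]; omega)).symm
  · have e : k + 2 = C.zoom.dim + 1 := by
      change k + 2 = C.topDim + 1
      omega
    rw [e, C.zoom.extend_tree_corolla]
    obtain ⟨t, ht⟩ := h.target ω (by omega)
    have ht' : t ∈ C.γ ω := ht ▸ rfl
    have htd := h.γ_dim ht'
    have hpos := h.pos_top hω ht'
    have hnode : ∀ a, a ∈ C.Lam ∧ C.dim a = k + 1 ↔ a = ω := by
      intro a
      constructor
      · exact fun ha => h.top_unique (h.isTop_of_dim (by omega)) hω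
      · rintro rfl
        refine ⟨?_, by omega⟩
        rintro ⟨w, hw⟩
        have := h.dim_pos hw
        have := h.le_topDim w
        omega
    have hlam : ∀ y, C.dim y = k → (y ∈ C.Lam ↔ y ≠ t) := by
      intro y hy
      have := (h.codim_one hω (x := y) (by omega)).2
      constructor
      · rintro h3 rfl
        exact this.1 hpos h3
      · intro h3
        by_contra h4
        exact h3 (h.pos_unique (this.2 h4) hpos)
    refine PreTree.ext_iff'.2 ⟨?_, ?_, fun a b => ?_, fun a b => ?_, ?_⟩
    · ext a
      constructor
      · rintro rfl
        exact ⟨ω, (hnode ω).2 rfl, thetaElem_top hω⟩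
      · rintro ⟨x, hx, rfl⟩
        rw [(hnode x).1 hx]
        exact thetaElem_top hω
    · ext b
      constructor
      · rintro (⟨a, ha, rfl⟩ | rfl)
        · rw [h.zoom_top_nodes (by omega)] at ha
          obtain ⟨y, ⟨hy, hyd⟩, rfl⟩ := ha
          exact ⟨y, by change C.dim y = k; omega, h.thetaElem_lam hy (by omega)⟩
        · exact ⟨t, by change C.dim t = k; omega, h.thetaElem_target hω ht'⟩
      · rintro ⟨y, hy, rfl⟩
        have hy : C.dim y = k := hy
        by_cases hyt : y = t
        · subst hyt
          exact Or.inr (h.thetaElem_target hω ht')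
        · have hyl := (hlam y hy).2 hyt
          refine Or.inl ⟨C.cellElem y, ?_, h.thetaElem_lam hyl (by omega)⟩
          rw [h.zoom_top_nodes (by omega)]
          exact ⟨y, ⟨hyl, by omega⟩, rfl⟩
    · constructor
      · rintro ⟨rfl, rfl⟩
        exact ⟨ω, t, ⟨((hnode ω).2 rfl).1, ((hnode ω).2 rfl).2, hpos⟩, (thetaElem_top hω).symm,
          (h.thetaElem_target hω ht').symm⟩
      · rintro ⟨x, y, ⟨h3, h4, h5⟩, rfl, rfl⟩
        obtain rfl := (hnode x).1 ⟨h3, h4⟩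
        exact ⟨thetaElem_top hω, h.thetaElem_target hω h5.1⟩
    · constructor
      · rintro ⟨rfl, a, ha, rfl⟩
        rw [h.zoom_top_nodes (by omega)] at ha
        obtain ⟨y, ⟨hy, hyd⟩, rfl⟩ := ha
        exact ⟨ω, y, ⟨((hnode ω).2 rfl).1, ((hnode ω).2 rfl).2, (h.codim_one hω hyd).1.2 hy⟩,
          (thetaElem_top hω).symm, (h.thetaElem_lam hy (by omega)).symm⟩
      · rintro ⟨x, y, ⟨h3, h4, h5⟩, rfl, rfl⟩
        obtain rfl := (hnode x).1 ⟨h3, h4⟩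
        have hyd := h.dim_neg h5
        have hyl := (h.codim_one hω (x := y) (by omega)).1.1 h5
        refine ⟨thetaElem_top hω, C.cellElem y, ?_, h.thetaElem_lam hyl (by omega)⟩
        rw [h.zoom_top_nodes (by omega)]
        exact ⟨y, ⟨hyl, by omega⟩, rfl⟩
    · have hti : C.IterTarget t := ⟨ω, hω, .single ht'⟩
      ext b
      constructor
      · rintro rfl
        exact ⟨t, ⟨by omega, hti⟩, h.thetaElem_target hω ht'⟩
      · rintro ⟨y, ⟨hy, hyi⟩, rfl⟩
        rw [h.iterTarget_unique hyi hti (by omega)]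
        exact h.thetaElem_target hω ht'
  · subst h0
    rw [show C.topDim + 2 = C.zoom.dim + 2 from rfl, C.zoom.extend_tree_unit]
    have hno : ∀ a, C.dim a ≠ C.topDim + 1 := fun a ha => by
      have := h.le_topDim a
      omega
    have hω' : ∀ a, C.dim a = C.topDim → a = ω := fun a ha =>
      h.top_unique (h.isTop_of_dim ha) hω
    refine PreTree.ext_iff'.2 ⟨?_, ?_, fun a b => ?_, fun a b => ?_, ?_⟩
    · ext a
      constructor
      · exact fun ha => ha.elim
      · rintro ⟨x, hx, rfl⟩
        exact (hno x hx.2).elim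
    · ext b
      constructor
      · rintro rfl
        exact ⟨ω, hd, thetaElem_top hω⟩
      · rintro ⟨y, hy, rfl⟩
        rw [hω' y hy]
        exact thetaElem_top hω
    · constructor
      · exact fun ha => ha.elim
      · rintro ⟨x, y, hx, -⟩
        exact (hno x hx.2.1).elim
    · constructor
      · exact fun ha => ha.elim
      · rintro ⟨x, y, hx, -⟩
        exact (hno x hx.2.1).elim
    · ext b
      constructor
      · rintro rfl
        exact ⟨ω, ⟨hd, ω, hω, .refl⟩, thetaElem_top hω⟩
      · rintro ⟨y, hy, rfl⟩
        rw [hω' y hy.1]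
        exact thetaElem_top hω

/-- In the degree of the original dimension the only possible white dot is `ω`, renamed `⊤`. It is
present exactly when `Λ` has no cell just below `ω`, that is, when `ω` is a sourceless node. -/
theorem extend_zoom_white (h : C.IsDFC) (hk : k + 1 ≤ C.topDim) (hy : C.dim y = k) :
    C.zoom.extend.white (k + 2) (C.thetaElem y) = C.thetaElem '' C.cellWhite k y := by
  obtain ⟨ω, hω, hd⟩ := h.exists_top
  rcases (by omega : k + 2 < C.topDim ∨ k + 2 = C.topDim ∨ k + 1 = C.topDim) with h2 | h2 | h1
  · rw [h.thetaElem_low (by omega), C.zoom.extend_white_old (k := k + 2) h2, zoom_white h2,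
      Set.image_image]
    refine Set.image_congr fun w hw => (h.thetaElem_lam hw.2.1 ?_).symm
    rw [h.dim_cellWhite hw]
    push_cast
    omega
  · have hX := h.zoom_isOpetope.extend_isOpetope
    have hH := h.treeHyp hk
    have hnd : ∀ w, w ∈ (C.cellTree (k + 1)).nulldots →
        w = ω ∧ C.zoom.newElem .top ∈ C.zoom.extend.white (k + 2) (C.thetaElem y) := by
      intro w hw
      have hwd := hw.1.2
      push_cast at hwd
      obtain rfl := h.top_unique (h.isTop_of_dim (x := w) (by omega)) hω
      refine ⟨rfl, ?_⟩
      rw [show k + 2 = C.zoom.dim from h2]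
      refine C.zoom.mem_extend_white_dim.2 ⟨?_, ⟨C.cellElem y, ?_, h.thetaElem_low (by omega)⟩, rfl⟩
      · rw [h.zoom_top_nodes (by omega)]
        refine Set.eq_empty_iff_forall_notMem.2 ?_
        rintro _ ⟨x, ⟨hx, hxd⟩, rfl⟩
        exact hw.2 x ⟨hw.1.1, hw.1.2, (h.codim_one hω hxd).1.2 hx⟩
      · rw [show C.zoom.dim = k + 2 from h2.symm, h.zoom_tree_succ h2.le]
        exact ⟨y, hy, rfl⟩
    ext w
    constructor
    · intro hw
      have hw' := hw
      rw [show k + 2 = C.zoom.dim from h2] at hw'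
      obtain ⟨he, -, rfl⟩ := C.zoom.mem_extend_white_dim.1 hw'
      have hnull : ω ∈ (C.cellTree (k + 1)).nulldots := by
        refine ⟨⟨?_, by push_cast; omega⟩, ?_⟩
        · rintro ⟨w, hw⟩
          have := h.dim_pos hw
          have := h.le_topDim w
          omega
        · rintro b ⟨h3, h4, h5⟩
          have hbd := h.dim_neg h5
          have hbl := (h.codim_one hω (x := b) (by omega)).1.1 h5
          have hm : C.cellElem b ∈ (C.zoom.tree C.zoom.dim).nodes := by
            rw [h.zoom_top_nodes (by omega)]
            exact ⟨b, ⟨hbl, by omega⟩, rfl⟩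
          rw [he] at hm
          exact hm
      obtain ⟨z, hz⟩ := h.exists_white_edge hH hnull
      refine ⟨ω, ?_, thetaElem_top hω⟩
      have h6 : C.zoom.newElem .top ∈ C.zoom.extend.white (k + 2) (C.thetaElem z) := by
        rw [show k + 2 = C.zoom.dim from h2]
        refine C.zoom.mem_extend_white_dim.2 ⟨he, ⟨C.cellElem z, ?_, h.thetaElem_low ?_⟩, rfl⟩
        · rw [show C.zoom.dim = k + 2 from h2.symm, h.zoom_tree_succ h2.le]
          exact ⟨z, hz.1, rfl⟩
        · rw [hz.1]
          omega
      have hc := hX.constellation (k + 2) (by change k + 2 < C.topDim + 2; omega)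
      -- `⊤` is on the edges of `y` and of `z`; disjointness of the white dots in the extended
      -- opetope identifies them.
      rw [h.thetaElem_injective (hc.white_disjoint _ _ _ hw h6)]
      exact hz
    · rintro ⟨v, hv, rfl⟩
      obtain ⟨rfl, h3⟩ := hnd v (h.cellWhite_nulldot hv)
      rw [thetaElem_top hω]
      exact h3
  · rw [show k + 2 = C.zoom.dim + 1 from congrArg (· + 1) h1, C.zoom.extend_white_dim_succ]
    refine (Set.eq_empty_iff_forall_notMem.2 ?_).symm
    rintro _ ⟨w, hw, rfl⟩
    have e := h.dim_cellWhite hw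
    have := h.le_topDim w
    push_cast at e
    omega

theorem extend_zoom_whiteLT (h : C.IsDFC) (hk : k + 1 ≤ C.topDim) (hw : w ∈ C.cellWhite k y)
    (hw' : w' ∈ C.cellWhite k y) :
    C.zoom.extend.whiteLT (k + 2) (C.thetaElem y) (C.thetaElem w) (C.thetaElem w') ↔
      C.WhiteLT y w w' := by
  obtain ⟨ω, hω, hd⟩ := h.exists_top
  have e := h.dim_cellWhite hw
  have e' := h.dim_cellWhite hw'
  have hy := hw.1
  have := h.le_topDim w
  push_cast at e e'
  rcases (by omega : k + 2 < C.topDim ∨ k + 2 = C.topDim) with h2 | h2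
  · rw [h.thetaElem_low (x := y) (by omega), h.thetaElem_lam hw.2.1 (by omega),
      h.thetaElem_lam hw'.2.1 (by omega), C.zoom.extend_whiteLT_old (k := k + 2) h2, zoom_whiteLT]
  -- Here both white dots are `ω`: the extended order is empty by definition, and `◂` is
  -- irreflexive.
  · constructor
    · rintro ⟨h3, -⟩
      change k + 2 < C.topDim at h3
      omega
    · intro hlt
      have e1 := h.top_unique (h.isTop_of_dim (x := w) (by omega)) hω
      have e2 := h.top_unique (h.isTop_of_dim (x := w') (by omega)) hω
      subst e1
      subst e2
      exact (((h.treeHyp hk).cell_isSubdivision h).irrefl hw hlt).elim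

end IsDFC

end PreMOP

/-- A bijection between dendritic face complexes that preserves and reflects sources and targets
and preserves the local orders is an isomorphism. -/
def DFCIso.ofEquiv {C D : PreMOP.{u}} (hC : C.IsDFC) (hD : D.IsDFC) (f : C.Cell ≃ D.Cell)
    (hdim : ∀ x, D.dim (f x) = C.dim x) (hδ : ∀ x y, y ∈ C.δ x ↔ f y ∈ D.δ (f x))
    (hγ : ∀ x y, y ∈ C.γ x ↔ f y ∈ D.γ (f x))
    (hloc : ∀ x ∈ C.Lam, ∀ z y y', C.Loop z y → C.Neg y x → C.Loop z y' → C.Neg y' x →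
      C.localLT x z y y' → D.localLT (f x) (f z) (f y) (f y')) : DFCIso C D where
  toEquiv := f
  hom := by
    refine ⟨hdim, fun x _ => ⟨fun y hy => (hδ x y).1 hy, f.injective.injOn, fun t ht => ?_⟩,
      fun x _ => ?_, fun x hx _ => hloc x hx⟩
    · exact ⟨f.symm t, (hδ _ _).2 (by simpa using ht), by simp⟩
    · ext t
      constructor
      · rintro ⟨y, hy, rfl⟩
        exact (hγ x y).1 hy
      · exact fun ht => ⟨f.symm t, (hγ _ _).2 (by simpa using ht), by simp⟩
  inv := by
    have hδ' : ∀ x y, y ∈ D.δ x ↔ f.symm y ∈ C.δ (f.symm x) := fun x y => by simp [hδ]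
    have hγ' : ∀ x y, y ∈ D.γ x ↔ f.symm y ∈ C.γ (f.symm x) := fun x y => by simp [hγ]
    refine ⟨fun x => by rw [← hdim]; simp, fun x _ => ⟨fun y hy => (hδ' x y).1 hy,
      f.symm.injective.injOn, fun t ht => ⟨f t, (hδ' _ _).2 (by simpa using ht), by simp⟩⟩,
      fun x _ => ?_, ?_⟩
    · ext t
      constructor
      · rintro ⟨y, hy, rfl⟩
        exact (hγ' x y).1 hy
      · exact fun ht => ⟨f t, (hγ' _ _).2 (by simpa using ht), by simp⟩
    · intro x hx hx' z y y' h1 h2 h1' h2' hlt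
      have hl : ∀ {z y}, D.Loop z y → C.Loop (f.symm z) (f.symm y) := fun h =>
        ⟨(hδ' _ _).1 h.1, (hγ' _ _).1 h.2⟩
      have hn : ∀ {y x}, D.Neg y x → C.Neg (f.symm y) (f.symm x) := fun h =>
        ⟨(hδ' _ _).1 h.1, fun h' => h.2 ((hγ' _ _).2 h')⟩
      -- Local orders are strict total orders on both sides, so a bijection that preserves them also
      -- reflects them.
      have hne : f.symm y ≠ f.symm y' := by
        intro e
        obtain rfl := f.symm.injective e
        exact hD.local_irrefl hx h1 h2 hlt
      rcases hC.local_total hx' (hl h1) (hn h2) (hl h1') (hn h2') hne with h3 | h3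
      · exact h3
      · have := hloc _ hx' _ _ _ (hl h1') (hn h2') (hl h1) (hn h2) h3
        simp only [Equiv.apply_symm_apply] at this
        exact (hD.local_asymm hx h1 h2 h1' h2' hlt this).elim

/-! ### The isomorphism `θ` -/

namespace PreMOP

variable {C : PreMOP.{u}} {x y y' z s w : C.Cell} {k : ℕ}

namespace IsDFC

theorem thetaElem_bottom (h : C.IsDFC) (hs : C.dim s = -1) :
    C.thetaElem s ∈ (C.zoom.extend.tree 1).root := by
  obtain ⟨ω, hω, hd⟩ := h.exists_top
  rcases Nat.eq_zero_or_pos C.topDim with h0 | h1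
  · have e : 1 = C.zoom.dim + 1 := by
      change 1 = C.topDim + 1
      omega
    rw [e, C.zoom.extend_tree_corolla]
    exact h.thetaElem_target hω (h.pos_bottom hs (by omega)).1
  · obtain ⟨x, hx, hx0, -⟩ := h.exists_lam_zero
    rw [C.zoom.extend_tree_old (k := 1) h1, h.zoom_tree_one h1 hx hx0 hs]
    exact ⟨C.cellElem s, rfl, (h.thetaElem_low (by omega)).symm⟩

theorem edge_thetaElem (h : C.IsDFC) (hx : C.dim x = k) :
    C.thetaElem x ∈ (C.zoom.extend.tree (k + 2)).edges := by
  rw [h.extend_zoom_tree (by have := h.le_topDim x; omega)]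
  exact ⟨x, hx, rfl⟩

theorem leavesAt_thetaElem (h : C.IsDFC) (hx : C.dim x = ((k + 1 : ℕ) : ℤ)) :
    C.zoom.extend.leavesAt (k + 2) (C.thetaElem x) = C.thetaElem '' C.δ x := by
  have hk : k + 1 ≤ C.topDim := by
    have := h.le_topDim x
    omega
  rw [PreZoom.leavesAt, h.extend_zoom_tree (Nat.le_of_succ_le hk),
    show k + 2 + 1 = (k + 1) + 2 from rfl, h.extend_zoom_tree hk, ← h.cell_nestLeaves hk hx]
  exact PreTree.map_nestLeaves (T := C.cellTree k) (W := C.cellWhite k)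
    (U := C.cellTree (k + 1)) (W' := C.zoom.extend.white (k + 2)) h.thetaElem_injective
    (fun b hb => h.extend_zoom_white hk hb) (.inr x)

theorem rootsAt_thetaElem (h : C.IsDFC) (hx : C.dim x = ((k + 1 : ℕ) : ℤ)) :
    C.zoom.extend.rootsAt (k + 2) (C.thetaElem x) = C.thetaElem '' C.γ x := by
  have hk : k + 1 ≤ C.topDim := by
    have := h.le_topDim x
    omega
  rw [PreZoom.rootsAt, h.extend_zoom_tree (Nat.le_of_succ_le hk),
    show k + 2 + 1 = (k + 1) + 2 from rfl, h.extend_zoom_tree hk, ← h.cell_nestRoot hk hx]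
  exact PreTree.map_nestRoot (T := C.cellTree k) (W := C.cellWhite k)
    (U := C.cellTree (k + 1)) (W' := C.zoom.extend.white (k + 2)) h.thetaElem_injective
    (fun b hb => h.extend_zoom_white hk hb) (.inr x)

theorem mem_dotsAt_thetaElem (h : C.IsDFC) (hx : C.dim x = ((k + 1 : ℕ) : ℤ))
    {v : C.zoom.extend.Elem} : .inr v ∈ C.zoom.extend.dotsAt (k + 2) (C.thetaElem x) ↔
      ∃ w, .inr w ∈ TreeHyp.cellDots C k x ∧ v = C.thetaElem w := by
  have hk : k + 1 ≤ C.topDim := by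
    have := h.le_topDim x
    omega
  rw [PreZoom.dotsAt, h.extend_zoom_tree (Nat.le_of_succ_le hk),
    show k + 2 + 1 = (k + 1) + 2 from rfl, h.extend_zoom_tree hk]
  have e := PreTree.map_dotsAbove (T := C.cellTree k) (W := C.cellWhite k)
    (U := C.cellTree (k + 1)) (W' := C.zoom.extend.white (k + 2)) h.thetaElem_injective
    (fun b hb => h.extend_zoom_white hk hb) (.inr x)
  rw [show Sum.inr (C.thetaElem x) = Sum.map C.thetaElem C.thetaElem (.inr x) from rfl, e]
  constructor
  · rintro ⟨d | w, hw, e⟩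
    · cases e
    · exact ⟨w, hw, (Sum.inr.inj e).symm⟩
  · rintro ⟨w, hw, rfl⟩
    exact ⟨.inr w, hw, rfl⟩

/-- The cell of the face complex of the zoom complex that corresponds to a cell. -/
noncomputable def thetaCell (h : C.IsDFC) (x : C.Cell) : C.zoom.faces.Cell :=
  ⟨thetaFun C x, by
    have h1 := h.dim_ge x
    have h2 := h.le_topDim x
    refine ⟨by change 1 ≤ (C.dim x + 2).toNat; omega,
      by change (C.dim x + 2).toNat ≤ C.topDim + 2; omega, ?_, ?_⟩
    · change C.thetaElem x ∈ (C.zoom.extend.tree (C.dim x + 2).toNat).edges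
      rcases (by omega : C.dim x = -1 ∨ 0 ≤ C.dim x) with h3 | h3
      · rw [show (C.dim x + 2).toNat = 1 by omega]
        exact (h.zoom_isOpetope.extend_isOpetope.tree 1 (Nat.le_add_left 1 _)).root_mem
          (h.thetaElem_bottom h3)
      · obtain ⟨k, hk⟩ := Int.eq_ofNat_of_zero_le h3
        rw [show (C.dim x + 2).toNat = k + 2 by omega]
        exact h.edge_thetaElem hk
    · intro h3
      change (C.dim x + 2).toNat = 1 at h3
      exact h.thetaElem_bottom (by omega)⟩

theorem thetaCell_fst (h : C.IsDFC) (x : C.Cell) : ((h.thetaCell x).1.1 : ℤ) = C.dim x + 2 := by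
  have h1 := h.dim_ge x
  change (((C.dim x + 2).toNat : ℕ) : ℤ) = _
  omega

theorem thetaCell_bijective (h : C.IsDFC) : h.thetaCell.Bijective := by
  refine ⟨fun x y e => h.thetaElem_injective (congrArg (fun p => p.1.2) e), fun p => ?_⟩
  have hp1 := p.2.1
  have hp2 : p.1.1 ≤ C.topDim + 2 := p.2.2.1
  have hp3 := PreZoom.face_edge p
  rcases (by omega : p.1.1 = 1 ∨ 2 ≤ p.1.1) with h1 | h2
  · obtain ⟨s, hs, -⟩ := h.bottom
    have hs := (hs s).2 rfl
    refine ⟨s, PreZoom.face_ext ?_ ?_⟩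
    · have := h.thetaCell_fst s
      omega
    · exact (h.zoom_isOpetope.extend_isOpetope.tree 1 (Nat.le_add_left 1 _)).root_unique
        (h.thetaElem_bottom hs) (PreZoom.face_root p h1)
  · obtain ⟨k, hk⟩ : ∃ k, p.1.1 = k + 2 := ⟨p.1.1 - 2, by omega⟩
    rw [hk, h.extend_zoom_tree (by omega)] at hp3
    obtain ⟨x, hx, e⟩ := hp3
    refine ⟨x, PreZoom.face_ext ?_ e⟩
    have h3 := h.thetaCell_fst x
    have h4 : C.dim x = k := hx
    omega

theorem δ_zero (h : C.IsDFC) (hx : C.dim x ≤ 0) : y ∉ C.δ x := by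
  intro hy
  have h1 := h.dim_facet x y (Or.inl hy)
  have h2 := h.dim_ge y
  exact (h.pos_bottom (s := y) (x := x) (by omega) (by omega)).2 hy

theorem mem_δ_thetaCell (h : C.IsDFC) (x y : C.Cell) :
    y ∈ C.δ x ↔ h.thetaCell y ∈ C.zoom.faces.δ (h.thetaCell x) := by
  have ex := h.thetaCell_fst x
  have ey := h.thetaCell_fst y
  rcases (by omega : C.dim x ≤ 0 ∨ 0 ≤ C.dim x - 1) with h1 | h1
  · refine ⟨fun hy => (h.δ_zero h1 hy).elim, fun hy => ?_⟩
    have := hy.2.1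
    omega
  · obtain ⟨k, hk⟩ := Int.eq_ofNat_of_zero_le h1
    have hx : C.dim x = ((k + 1 : ℕ) : ℤ) := by
      push_cast
      omega
    have hl := h.leavesAt_thetaElem hx
    constructor
    · intro hy
      have := h.dim_facet x y (Or.inl hy)
      have e2 : (h.thetaCell y).1.1 = k + 2 := by omega
      refine ⟨by omega, by omega, ?_⟩
      change C.thetaElem y ∈ C.zoom.extend.leavesAt _ (C.thetaElem x)
      rw [e2, hl]
      exact ⟨y, hy, rfl⟩
    · rintro ⟨e1, -, h3⟩
      have e2 : (h.thetaCell y).1.1 = k + 2 := by omega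
      change C.thetaElem y ∈ C.zoom.extend.leavesAt _ (C.thetaElem x) at h3
      rw [e2, hl] at h3
      obtain ⟨y', hy', e⟩ := h3
      rwa [← h.thetaElem_injective e]

theorem mem_γ_thetaCell (h : C.IsDFC) (x y : C.Cell) :
    y ∈ C.γ x ↔ h.thetaCell y ∈ C.zoom.faces.γ (h.thetaCell x) := by
  have ex := h.thetaCell_fst x
  have ey := h.thetaCell_fst y
  have hx1 := h.dim_ge x
  have hy1 := h.dim_ge y
  have hX := h.zoom_isOpetope.extend_isOpetope
  rcases (by omega : C.dim x = -1 ∨ C.dim x = 0 ∨ 0 ≤ C.dim x - 1) with h1 | h1 | h1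
  · constructor
    · intro hy
      have := h.γ_dim hy
      omega
    · intro hy
      have := hy.1
      omega
  · have hxe : C.thetaElem x ∈ (C.zoom.extend.tree 2).edges := h.edge_thetaElem (k := 0) h1
    constructor
    · intro hy
      have := h.γ_dim hy
      have e2 : (h.thetaCell y).1.1 = 1 := by omega
      refine ⟨by omega, ?_⟩
      change C.thetaElem y ∈ C.zoom.extend.rootsAt _ (C.thetaElem x)
      rw [e2, hX.rootsAt_one C.zoom.two_le_extend_dim hxe]
      exact h.thetaElem_bottom (by omega)
    · rintro ⟨e1, -⟩
      exact (h.pos_bottom (by omega) h1).1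
  · obtain ⟨k, hk⟩ := Int.eq_ofNat_of_zero_le h1
    have hx : C.dim x = ((k + 1 : ℕ) : ℤ) := by
      push_cast
      omega
    have hl := h.rootsAt_thetaElem hx
    constructor
    · intro hy
      have := h.γ_dim hy
      have e2 : (h.thetaCell y).1.1 = k + 2 := by omega
      refine ⟨by omega, ?_⟩
      change C.thetaElem y ∈ C.zoom.extend.rootsAt _ (C.thetaElem x)
      rw [e2, hl]
      exact ⟨y, hy, rfl⟩
    · rintro ⟨e1, h3⟩
      have e2 : (h.thetaCell y).1.1 = k + 2 := by omega
      change C.thetaElem y ∈ C.zoom.extend.rootsAt _ (C.thetaElem x) at h3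
      rw [e2, hl] at h3
      obtain ⟨y', hy', e⟩ := h3
      rwa [← h.thetaElem_injective e]

/-- The dots above the loops `y` and `y'` are white and on `z`. Two of them meet at `x`, with
branches `y` and `y'`, so `whiteLT_iff` reduces their order to the local order at `x`. -/
theorem localLT_thetaCell (h : C.IsDFC) (hx : x ∈ C.Lam) (hl : C.Loop z y) (hn : C.Neg y x)
    (hl' : C.Loop z y') (hn' : C.Neg y' x) (hlt : C.localLT x z y y') :
    C.zoom.faces.localLT (h.thetaCell x) (h.thetaCell z) (h.thetaCell y) (h.thetaCell y') := by
  have hz0 : 0 ≤ C.dim z := by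
    have h1 := h.dim_ge z
    have h2 := h.dim_loop hl
    by_contra hc
    exact h.δ_zero (by omega) hl.1
  obtain ⟨k, hk⟩ := Int.eq_ofNat_of_zero_le hz0
  have ez : (h.thetaCell z).1.1 = k + 2 := by
    have := h.thetaCell_fst z
    omega
  have hy : C.dim y = ((k + 1 : ℕ) : ℤ) := by
    have := h.dim_loop hl
    push_cast
    omega
  have hy' : C.dim y' = ((k + 1 : ℕ) : ℤ) := by
    have := h.dim_loop hl'
    push_cast
    omega
  have hkd : k + 1 ≤ C.topDim := by
    have := h.le_topDim y
    omega
  have H := h.treeHyp hkd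
  have hxd : C.dim x = ((k + 1 : ℕ) : ℤ) + 1 := by
    rw [h.dim_neg hn, hy]
  have hne : y ≠ y' := by
    rintro rfl
    exact h.local_irrefl hx hl hn hlt
  have hwz : ∀ {y w}, C.Loop z y → C.dim y = ((k + 1 : ℕ) : ℤ) → .inr w ∈ TreeHyp.cellDots C k y →
      w ∈ C.cellWhite k z := by
    intro y w hl hy hw
    obtain ⟨b, hb⟩ := (TreeHyp.inr_mem_cellDots.1 hw).1
    have hn := H.cell_isNest h hy hl.2
    have h0 := (h.treeHyp (Nat.le_of_succ_le hkd)).rooted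
    have hS := H.cell_isSubdivision h
    have h1 : z ∈ (C.cellTree k).nestRoot (C.cellWhite k) (C.cellTree (k + 1)) (.inr y) := by
      rw [h.cell_nestRoot hkd hy]
      exact hl.2
    have h2 : z ∈ (C.cellTree k).nestLeaves (C.cellWhite k) (C.cellTree (k + 1)) (.inr y) := by
      rw [h.cell_nestLeaves hkd hy]
      exact hl.1
    exact (hn.eq_root_of_loop h0 hS h1 h2).2.2.1 w hw
  intro v v' hv hv'
  change .inr v ∈ C.zoom.extend.dotsAt (h.thetaCell z).1.1 (C.thetaElem y) at hv
  change .inr v' ∈ C.zoom.extend.dotsAt (h.thetaCell z).1.1 (C.thetaElem y') at hv'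
  rw [ez, h.mem_dotsAt_thetaElem hy] at hv
  rw [ez, h.mem_dotsAt_thetaElem hy'] at hv'
  obtain ⟨w, hw, rfl⟩ := hv
  obtain ⟨w', hw', rfl⟩ := hv'
  have m := hwz hl hy hw
  have m' := hwz hl' hy' hw'
  rw [ez]
  change _ ∈ C.zoom.extend.white (k + 2) (C.thetaElem z) ∧ _ ∈ C.zoom.extend.white (k + 2)
    (C.thetaElem z) ∧ C.zoom.extend.whiteLT (k + 2) (C.thetaElem z) _ _
  rw [h.extend_zoom_white hkd hk, h.extend_zoom_whiteLT hkd m m']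
  refine ⟨⟨w, m, rfl⟩, ⟨w', m', rfl⟩, ?_⟩
  exact (H.whiteLT_iff h m.2 (h.dim_cellWhite m) m'.2 (h.dim_cellWhite m') hne ⟨hx, hxd, hn⟩
    ⟨hx, hxd, hn'⟩ (TreeHyp.inr_mem_cellDots.1 hw).2 (TreeHyp.inr_mem_cellDots.1 hw').2).2
    (Or.inr (Or.inr ⟨hl, hl', hlt⟩))

/-- The isomorphism from a dendritic face complex to the face complex of its zoom complex. -/
noncomputable def thetaIso (h : C.IsDFC) : DFCIso C C.zoom.faces :=
  DFCIso.ofEquiv h (PreZoom.faces_isDFC h.zoom_isOpetope.extend_isOpetope)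
    (Equiv.ofBijective h.thetaCell h.thetaCell_bijective)
    (fun x => by
      change ((h.thetaCell x).1.1 : ℤ) - 2 = C.dim x
      have := h.thetaCell_fst x
      omega)
    h.mem_δ_thetaCell h.mem_γ_thetaCell
    (fun _ hx _ _ _ hl hn hl' hn' hlt => h.localLT_thetaCell hx hl hn hl' hn' hlt)

end IsDFC

end PreMOP

/-! ### Cell trees and white dots of the face complex of an opetope -/

namespace PreZoom

variable {Y : PreZoom.{u}} {p q w w' z : Y.faces.Cell} {k : ℕ}

theorem faces_topDim (hX : Y.extend.IsOpetope) : Y.faces.topDim = Y.dim := by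
  have e : Y.faces.dim Y.topFace = Y.dim := by
    change ((Y.dim + 2 : ℕ) : ℤ) - 2 = Y.dim
    omega
  have := (faces_isMOP hX).topDim_eq (topFace_isTop hX) (by omega)
  omega

theorem face_dim {j : ℤ} : Y.faces.dim p = j ↔ (p.1.1 : ℤ) = j + 2 := by
  change (p.1.1 : ℤ) - 2 = j ↔ _
  omega

/-- The cell given by an edge. -/
def edgeFace (Y : PreZoom.{u}) (k : ℕ) (b : Y.extend.Elem) (hk : k + 2 ≤ Y.dim + 2)
    (hb : b ∈ (Y.extend.tree (k + 2)).edges) : Y.faces.Cell :=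
  ⟨(k + 2, b), by dsimp only; omega, hk, hb, by dsimp only; omega⟩

theorem face_node (hX : Y.extend.IsOpetope) (hp : p.1.1 = k + 3) : p ∈ Y.faces.Lam ↔
    p.1.2 ∈ (Y.extend.tree (k + 2)).nodes := by
  have hk : k + 2 < Y.extend.dim := by
    have : p.1.1 ≤ Y.dim + 2 := p.2.2.1
    change k + 2 < Y.dim + 2
    omega
  rw [face_leaf_of_lam hX (by omega), (hX.constellation _ hk).black, hp]

/-- A cell in `Λ` is a leaf, so its nest is a single black dot, and its signs are incidences in the
tree below. -/
theorem face_cellTree_out (hX : Y.extend.IsOpetope) : (Y.faces.cellTree k).out p q ↔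
    p.1.1 = k + 3 ∧ q.1.1 = k + 2 ∧ (Y.extend.tree (k + 2)).out p.1.2 q.1.2 := by
  constructor
  · rintro ⟨hl, hd, hp⟩
    obtain ⟨e, hs⟩ := (face_pos hX).1 hp
    have e1 := face_dim.1 hd
    have e2 : q.1.1 = k + 2 := by omega
    have hle := (face_leaf_of_lam hX (by omega)).1 hl
    rw [e] at hle
    exact ⟨by omega, e2, e2 ▸ (hX.sgn_leaf_eq_one (face_lt e) hle).1 hs⟩
  · rintro ⟨e1, e2, ho⟩
    have e : p.1.1 = q.1.1 + 1 := by omega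
    have hp : p ∈ Y.faces.Lam := (face_node hX e1).2
      ((hX.tree (k + 2) (by have := face_lt e; omega)).out_mem _ _ ho).1
    have hle := (face_leaf_of_lam hX (by omega)).1 hp
    rw [e] at hle
    refine ⟨hp, face_dim.2 (by omega), (face_pos hX).2 ⟨e, ?_⟩⟩
    exact (hX.sgn_leaf_eq_one (face_lt e) hle).2 (e2.symm ▸ ho)

theorem face_cellTree_inp (hX : Y.extend.IsOpetope) : (Y.faces.cellTree k).inp p q ↔
    p.1.1 = k + 3 ∧ q.1.1 = k + 2 ∧ (Y.extend.tree (k + 2)).inp p.1.2 q.1.2 := by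
  constructor
  · rintro ⟨hl, hd, hp⟩
    obtain ⟨e, hs⟩ := (face_neg hX).1 hp
    have e1 := face_dim.1 hd
    have e2 : q.1.1 = k + 2 := by omega
    have hle := (face_leaf_of_lam hX (by omega)).1 hl
    rw [e] at hle
    exact ⟨by omega, e2, e2 ▸ (hX.sgn_leaf_eq_neg_one (face_lt e) hle).1 hs⟩
  · rintro ⟨e1, e2, ho⟩
    have e : p.1.1 = q.1.1 + 1 := by omega
    have hp : p ∈ Y.faces.Lam := (face_node hX e1).2
      ((hX.tree (k + 2) (by have := face_lt e; omega)).inp_mem _ _ ho).1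
    have hle := (face_leaf_of_lam hX (by omega)).1 hp
    rw [e] at hle
    refine ⟨hp, face_dim.2 (by omega), (face_neg hX).2 ⟨e, ?_⟩⟩
    exact (hX.sgn_leaf_eq_neg_one (face_lt e) hle).2 (e2.symm ▸ ho)

theorem face_desc (hX : Y.extend.IsOpetope) (hk : k ≤ Y.dim)
    {s t : Y.faces.Cell ⊕ Y.faces.Cell} (h : (Y.faces.cellTree k).Desc s t) :
    (Y.extend.tree (k + 2)).Desc (Sum.map (fun p => p.1.2) (fun p => p.1.2) s)
      (Sum.map (fun p => p.1.2) (fun p => p.1.2) t) := by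
  have hT := hX.tree (k + 2) (Nat.add_le_add_right hk 2)
  refine ReflTransGen.lift _ (fun s t hst => ?_) _ _ h
  cases hst with
  | edge a b _ _ h => exact hT.step_inp ((face_cellTree_inp hX).1 h).2.2
  | node a b _ _ h => exact hT.step_out ((face_cellTree_out hX).1 h).2.2

/-- A sourceless node `w` leaves no black dot above its target `t`. So the edge carrying `w` is a
root edge of the nest of `t`, that is `γ(γ(w))`. -/
theorem face_white_of_mem (hX : Y.extend.IsOpetope) (hw : w.1.1 = k + 4) (hz : z.1.1 = k + 2)
    (h : w.1.2 ∈ Y.extend.white (k + 2) z.1.2) : w ∈ Y.faces.cellWhite k z := by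
  have hd : w.1.1 ≤ Y.dim + 2 := w.2.2.1
  have hk3 : k + 3 < Y.extend.dim := by
    change k + 3 < Y.dim + 2
    omega
  have hk2 : k + 2 < Y.extend.dim := by omega
  have hD := faces_isDFC hX
  have hT := hX.tree _ hk3.le
  have hnull := (hX.constellation _ hk2).mem_nulldots h
  have hl : w ∈ Y.faces.Lam := (face_node hX hw).2 hnull.1
  have hn : ∀ q, ¬ Y.faces.Neg q w := by
    intro q hq
    exact hnull.2 _ ((face_cellTree_inp (k := k + 1) hX).1
      ⟨hl, face_dim.2 (by push_cast; omega), hq⟩).2.2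
  obtain ⟨t, ht⟩ := hD.exists_pos (x := w) (by have := (face_dim (p := w)).1 rfl; omega)
    fun z => hD.lam_not_loop hl
  obtain ⟨-, et, ho⟩ := (face_cellTree_out (k := k + 1) hX).1
    ⟨hl, face_dim.2 (by push_cast; omega), ht⟩
  refine ⟨face_dim.2 (by omega), hl, ?_, t, ht.1, ?_⟩
  · refine Set.eq_empty_iff_forall_notMem.2 fun q hq => ?_
    rcases PreMOP.facet_cases (Or.inl hq : Y.faces.Facet q w) with h1 | h1 | h1
    · exact h1.2 hq
    · exact hn q h1
    · exact hD.lam_not_loop hl h1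
  · have hb : ∀ a, a ∉ (Y.extend.tree (k + 2 + 1)).leavesAbove t.1.2 := by
      rintro a ⟨ha, hda⟩
      rcases hT.desc_out_cases ho hda with e | hda
      · obtain rfl := Sum.inr.inj e
        exact ha.2 _ ho
      · rcases PreTree.IsRootedTree.desc_inl_cases hda with e | ⟨b, hb, -⟩
        · cases e
        · exact hnull.2 _ hb
    refine ⟨by omega, ?_⟩
    change z.1.2 ∈ Y.extend.rootsAt z.1.1 t.1.2
    rw [hz]
    refine (hX.mem_rootsAt hk2).2 ⟨(hX.mem_edgesAt hk2).2 (Or.inr (Or.inr ?_)), ?_⟩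
    · exact ⟨w.1.2, h, hT.desc_out ho⟩
    · rintro ⟨a, ha, -⟩
      exact hb a ha

theorem face_white (hX : Y.extend.IsOpetope) (hw : w.1.1 = k + 4) (hz : z.1.1 = k + 2) :
    w ∈ Y.faces.cellWhite k z ↔ w.1.2 ∈ Y.extend.white (k + 2) z.1.2 := by
  refine ⟨fun h => ?_, face_white_of_mem hX hw hz⟩
  have hd : w.1.1 ≤ Y.dim + 2 := w.2.2.1
  have hk2 : k + 2 < Y.extend.dim := by
    change k + 2 < Y.dim + 2
    omega
  have hD := faces_isDFC hX
  have hnull := hD.cellWhite_nulldot h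
  have hnull' : w.1.2 ∈ (Y.extend.tree (k + 3)).nulldots := by
    refine ⟨(face_node hX hw).1 hnull.1.1, fun b hb => ?_⟩
    have hbe := ((hX.tree _ hk2).inp_mem _ _ hb).2
    exact hnull.2 (Y.edgeFace (k + 1) b (by omega) hbe) ((face_cellTree_inp hX).2 ⟨hw, rfl, hb⟩)
  -- The dot `w` is on some edge `b` of the opetope. By the converse it is then on the cell `b` as
  -- well, and a white dot of a complex is on only one cell.
  have hc := hX.constellation _ hk2
  obtain ⟨b, hb⟩ := hc.exists_white hnull'
  have h1 := face_white_of_mem (z := Y.edgeFace k b (by omega) (hc.white_edge _ _ hb)) hX hw rfl hb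
  rw [hD.cellWhite_unique h h1]
  exact hb

/-- The order of the white dots is recovered from the face complex. -/
theorem whiteLT_of_face (hX : Y.extend.IsOpetope) (hw : w.1.1 = k + 4) (hw' : w'.1.1 = k + 4)
    (hz : z.1.1 = k + 2) (h : w.1.2 ∈ Y.extend.white (k + 2) z.1.2)
    (h' : w'.1.2 ∈ Y.extend.white (k + 2) z.1.2) (hne : w ≠ w')
    (hlt : Y.faces.WhiteLT z w w') : Y.extend.whiteLT (k + 2) z.1.2 w.1.2 w'.1.2 := by
  have hd : w.1.1 ≤ Y.dim + 2 := w.2.2.1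
  have hk2 : k + 2 < Y.extend.dim := by
    change k + 2 < Y.dim + 2
    omega
  have hD := faces_isDFC hX
  have H := hD.treeHyp (k := k + 1) (by rw [faces_topDim hX]; omega)
  have m := (face_white hX hw hz).2 h
  have m' := (face_white hX hw' hz).2 h'
  have d := hD.dim_cellWhite m
  have d' := hD.dim_cellWhite m'
  obtain ⟨x, y, y', hny, hi, hi', hwy, hwy'⟩ := H.exists_meet_white hD m.2 d m'.2 d' hne
  have hS := hX.isSubdivision hk2
  have hT := hX.tree _ hk2
  obtain ⟨-, ey, gi⟩ := (face_cellTree_inp hX).1 hi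
  obtain ⟨-, ey', gi'⟩ := (face_cellTree_inp hX).1 hi'
  have hny' : y.1.2 ≠ y'.1.2 := fun e => hny (face_ext (by omega) e)
  have gw := face_desc hX (by omega) hwy
  have gw' := face_desc hX (by omega) hwy'
  have hin := hX.inr_mem_dotsAt_of_white hk2 h gw
  have hin' := hX.inr_mem_dotsAt_of_white hk2 h' gw'
  have hnin : .inr w'.1.2 ∉ Y.extend.dotsAt (k + 2) y.1.2 := fun hc =>
    hny' (hT.eq_of_desc_siblings gi gi' ((hX.inr_mem_dotsAt hk2).1 hc).2 gw')
  have hnin' : .inr w.1.2 ∉ Y.extend.dotsAt (k + 2) y'.1.2 := fun hc =>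
    hny' (hT.eq_of_desc_siblings gi gi' gw ((hX.inr_mem_dotsAt hk2).1 hc).2)
  have hwne : w.1.2 ≠ w'.1.2 := fun e => hne (face_ext (by omega) e)
  have hye : y.1.2 ∈ (Y.extend.tree (k + 2 + 1)).edges := (hT.inp_mem _ _ gi).2
  have hye' : y'.1.2 ∈ (Y.extend.tree (k + 2 + 1)).edges := (hT.inp_mem _ _ gi').2
  rcases hS.trichotomous h h' with hc | hc | hc
  · exact hc
  · exact (hwne hc).elim
  exfalso
  -- Suppose `w'` is under `w`. If `z ≺⁻ y`, closure under lower dots puts `w'` into the nest of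
  -- `y`. If `z ≺⁺ y'`, a black dot of the nest of `y'` has target edge `z`, and convexity puts `w`
  -- into that nest. For two loops the local order is the order of their white dots.
  rcases (H.whiteLT_iff hD m.2 d m'.2 d' hny hi hi' hwy hwy').1 hlt with hs | hs | ⟨-, hl', hs⟩
  · obtain ⟨z₀, hn⟩ := hX.exists_nest hk2 hye
    refine hnin (hn.under _ hin _ h ?_ _ ⟨h', hc⟩)
    rintro rfl
    refine hs.2 ⟨by omega, ?_⟩
    change z.1.2 ∈ Y.extend.rootsAt z.1.1 y.1.2
    rw [hz, hX.rootsAt_eq hk2 hn]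
    rfl
  · have hr : z.1.2 ∈ Y.extend.rootsAt (k + 2) y'.1.2 := hz ▸ hs.1.2
    have hn := hX.nest_of_root hk2 hye' hr
    have h1 := ((face_pos hX).1 hs).2
    rw [hz] at h1
    obtain ⟨⟨a, ha, ho⟩, -⟩ := (hX.sgn_eq_one hk2).1 h1
    exact hnin' (hn.convex _ ((hX.inl_mem_dotsAt hk2).2 ha) ho _ h _ hin' ⟨h', hc⟩)
  · have h1 := (hs w.1.2 w'.1.2 (by rw [hz]; exact hin) (by rw [hz]; exact hin')).2.2
    rw [hz] at h1
    exact hS.asymm h h' h1 hc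

/-- Both orders are strict and total on the white dots of an edge, so the implication
`whiteLT_of_face` is an equivalence. -/
theorem face_whiteLT (hX : Y.extend.IsOpetope) (hw : w.1.1 = k + 4) (hw' : w'.1.1 = k + 4)
    (hz : z.1.1 = k + 2) (h : w.1.2 ∈ Y.extend.white (k + 2) z.1.2)
    (h' : w'.1.2 ∈ Y.extend.white (k + 2) z.1.2) :
    Y.faces.WhiteLT z w w' ↔ Y.extend.whiteLT (k + 2) z.1.2 w.1.2 w'.1.2 := by
  have hd : w.1.1 ≤ Y.dim + 2 := w.2.2.1
  have hk2 : k + 2 < Y.extend.dim := by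
    change k + 2 < Y.dim + 2
    omega
  have hD := faces_isDFC hX
  have hS := hX.isSubdivision hk2
  have hS' := (hD.treeHyp (k := k + 1) (by rw [faces_topDim hX]; omega)).cell_isSubdivision hD
  have m := (face_white hX hw hz).2 h
  have m' := (face_white hX hw' hz).2 h'
  by_cases hne : w = w'
  · subst hne
    exact iff_of_false (hS'.irrefl m) (hS.irrefl h)
  refine ⟨whiteLT_of_face hX hw hw' hz h h' hne, fun hlt => ?_⟩
  rcases hS'.trichotomous m m' with h1 | h1 | h1
  · exact h1
  · exact (hne h1).elim
  · exact (hS.asymm h h' hlt (whiteLT_of_face hX hw' hw hz h' h (Ne.symm hne) h1)).elim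

end PreZoom

/-! ### Isomorphisms of trees; trees with one node and one leaf -/

namespace PreTree

variable {N E N' E' : Type u}

/-- Maps on nodes and edges that form an isomorphism onto the tree `T'`. -/
structure IsIso (T : PreTree N E) (T' : PreTree N' E') (f : T.nodes → N') (g : T.edges → E') :
    Prop where
  node_mem : ∀ a, f a ∈ T'.nodes
  edge_mem : ∀ b, g b ∈ T'.edges
  node_inj : f.Injective
  edge_inj : g.Injective
  node_surj : ∀ a' ∈ T'.nodes, ∃ a, f a = a'
  edge_surj : ∀ b' ∈ T'.edges, ∃ b, g b = b'
  out : ∀ a b, T.out a.1 b.1 ↔ T'.out (f a) (g b)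
  inp : ∀ a b, T.inp a.1 b.1 ↔ T'.inp (f a) (g b)

namespace IsIso

variable {T : PreTree N E} {T' : PreTree N' E'} {f : T.nodes → N'} {g : T.edges → E'}

/-- The bijection of the nodes. -/
noncomputable def nodeEquiv (h : T.IsIso T' f g) : T.nodes ≃ T'.nodes :=
  Equiv.ofBijective (fun a => ⟨f a, h.node_mem a⟩)
    ⟨fun _ _ e => h.node_inj (congrArg Subtype.val e), fun a' =>
      (h.node_surj a'.1 a'.2).imp fun _ e => Subtype.ext e⟩

/-- The bijection of the edges. -/
noncomputable def edgeEquiv (h : T.IsIso T' f g) : T.edges ≃ T'.edges :=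
  Equiv.ofBijective (fun b => ⟨g b, h.edge_mem b⟩)
    ⟨fun _ _ e => h.edge_inj (congrArg Subtype.val e), fun b' =>
      (h.edge_surj b'.1 b'.2).imp fun _ e => Subtype.ext e⟩

theorem root_iff (h : T.IsIso T' f g) (hT : T.IsRootedTree) (hT' : T'.IsRootedTree)
    (b : T.edges) : b.1 ∈ T.root ↔ g b ∈ T'.root := by
  rw [hT.mem_root_iff b.2, hT'.mem_root_iff (h.edge_mem b)]
  constructor
  · intro hn a' ha'
    obtain ⟨a, rfl⟩ := h.node_surj a' (hT'.inp_mem _ _ ha').1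
    exact hn a ((h.inp a b).2 ha')
  · exact fun hn a ha => hn _ ((h.inp ⟨a, (hT.inp_mem _ _ ha).1⟩ b).1 ha)

theorem of_isEmpty (hN : T.nodes = ∅) (hE : T.edges = ∅) (hN' : T'.nodes = ∅)
    (hE' : T'.edges = ∅) : T.IsIso T' f g := by
  have h1 : ∀ a : T.nodes, False := fun a => (hN ▸ a.2 : a.1 ∈ (∅ : Set N))
  have h2 : ∀ b : T.edges, False := fun b => (hE ▸ b.2 : b.1 ∈ (∅ : Set E))
  exact ⟨fun a => (h1 a).elim, fun b => (h2 b).elim, fun a => (h1 a).elim, fun b => (h2 b).elim,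
    fun a ha => (hN' ▸ ha : a ∈ (∅ : Set N')).elim, fun b hb => (hE' ▸ hb : b ∈ (∅ : Set E')).elim,
    fun a => (h1 a).elim, fun a => (h1 a).elim⟩

end IsIso

theorem IsElementary.eq_stick {A : Type u} {T : PreTree A A} (hT : T.IsRootedTree)
    (h : T.IsElementary) : ∃ a r l, r ≠ l ∧ T = stick a r l := by
  obtain ⟨⟨a, ha⟩, l, hl⟩ := h
  have ham : a ∈ T.nodes := ha ▸ rfl
  obtain ⟨r, hr⟩ := hT.exists_mem_root
  obtain ⟨a', ho⟩ := hT.exists_out_root hr ham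
  have hnode : ∀ a' ∈ T.nodes, a' = a := fun a' h => (ha ▸ h : a' ∈ ({a} : Set A))
  obtain rfl := hnode a' (hT.out_mem _ _ ho).1
  have hlm : l ∈ T.leaves := hl ▸ rfl
  have hne : r ≠ l := by
    rintro rfl
    exact hlm.2 _ ho
  obtain ⟨a, hi⟩ := hT.exists_inp_of_ne_root hr hlm.1 hne.symm
  obtain rfl := hnode a (hT.inp_mem _ _ hi).1
  have hedge : ∀ b ∈ T.edges, b = r ∨ b = l := by
    intro b hb
    by_cases hbl : b ∈ T.leaves
    · exact Or.inr (hl ▸ hbl : b ∈ ({l} : Set A))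
    · obtain ⟨a', ha'⟩ : ∃ a', T.out a' b := by
        by_contra hc
        exact hbl ⟨hb, fun a ha => hc ⟨a, ha⟩⟩
      obtain rfl := hnode a' (hT.out_mem _ _ ha').1
      exact Or.inl (hT.out_unique ha' ho)
  refine ⟨a, r, l, hne, ext_iff'.2 ⟨ha, ?_, fun x b => ⟨fun h => ?_, ?_⟩,
    fun x b => ⟨fun h => ?_, ?_⟩, ?_⟩⟩
  · ext b
    refine ⟨hedge b, ?_⟩
    rintro (rfl | rfl)
    · exact hT.root_mem hr
    · exact hlm.1
  · obtain rfl := hnode x (hT.out_mem _ _ h).1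
    exact ⟨rfl, hT.out_unique h ho⟩
  · rintro ⟨rfl, rfl⟩
    exact ho
  · obtain rfl := hnode x (hT.inp_mem _ _ h).1
    refine ⟨rfl, (hedge b (hT.inp_mem _ _ h).2).resolve_left ?_⟩
    rintro rfl
    exact hT.not_inp_root hr h
  · rintro ⟨rfl, rfl⟩
    exact hi
  · ext b
    exact ⟨fun hb => hT.root_unique hb hr, fun hb => (show b = r from hb) ▸ hr⟩

theorem stick_isIso {A B : Type u} {T : PreTree A A} {T' : PreTree B B} {a r l : A} {a' r' l' : B}
    (hne : r ≠ l) (hne' : r' ≠ l') (e : T = stick a r l) (e' : T' = stick a' r' l')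
    {f : T.nodes → B} {g : T.edges → B} (hf : ∀ x, f x = a')
    (hr : ∀ b, b.1 ∈ T.root → g b = r') (hl : ∀ b, b.1 ∉ T.root → g b = l') :
    T.IsIso T' f g := by
  subst e e'
  have hg : ∀ b, (b.1 = r ∧ g b = r') ∨ (b.1 = l ∧ g b = l') := by
    rintro ⟨b, rfl | rfl⟩
    · exact Or.inl ⟨rfl, hr _ rfl⟩
    · exact Or.inr ⟨rfl, hl _ hne.symm⟩
  refine ⟨fun x => hf x, fun b => ?_, fun x y _ => Subtype.ext (x.2.trans y.2.symm),
    fun b c h => Subtype.ext ?_, fun x hx => ⟨⟨a, rfl⟩, (hf _).trans hx.symm⟩, ?_,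
    fun x b => ?_, fun x b => ?_⟩
  · rcases hg b with h | h
    · exact Or.inl h.2
    · exact Or.inr h.2
  · rcases hg b with ⟨h1, h2⟩ | ⟨h1, h2⟩ <;> rcases hg c with ⟨h3, h4⟩ | ⟨h3, h4⟩
    · exact h1.trans h3.symm
    · exact (hne' (h2.symm.trans (h.trans h4))).elim
    · exact (hne' (h4.symm.trans (h.symm.trans h2))).elim
    · exact h1.trans h3.symm
  · rintro _ (rfl | rfl)
    · exact ⟨⟨r, Or.inl rfl⟩, hr _ rfl⟩
    · exact ⟨⟨l, Or.inr rfl⟩, hl _ hne.symm⟩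
  · have hx : x.1 = a := x.2
    rcases hg b with ⟨h1, h2⟩ | ⟨h1, h2⟩
    · exact iff_of_true ⟨hx, h1⟩ ⟨hf x, h2⟩
    · exact iff_of_false (fun h => hne (h.2.symm.trans h1)) fun h => hne' (h.2.symm.trans h2)
  · have hx : x.1 = a := x.2
    rcases hg b with ⟨h1, h2⟩ | ⟨h1, h2⟩
    · exact iff_of_false (fun h => hne (h1.symm.trans h.2)) fun h => hne' (h2.symm.trans h.2)
    · exact iff_of_true ⟨hx, h1⟩ ⟨hf x, h2⟩

end PreTree

/-! ### The isomorphism `τ` -/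

namespace PreZoom

variable {Y : PreZoom.{u}} {k : ℕ}

namespace IsOpetope

theorem le_of_node (h : Y.IsOpetope) {a : Y.Elem} (ha : a ∈ (Y.tree k).nodes) : k ≤ Y.dim := by
  by_contra hc
  rw [(h.void k (by omega)).1] at ha
  exact ha

theorem le_of_edge (h : Y.IsOpetope) {b : Y.Elem} (hb : b ∈ (Y.tree k).edges) : k ≤ Y.dim := by
  by_contra hc
  rw [(h.void k (by omega)).2] at hb
  exact hb

theorem extend_edge_of_node (h : Y.IsOpetope) {a : Y.Elem} (ha : a ∈ (Y.tree k).nodes) :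
    Y.oldElem a ∈ (Y.extend.tree (k + 1)).edges := by
  have hk := h.le_of_node ha
  have h1 : Y.oldElem a ∈ (Y.extend.tree (k + 1)).leaves := by
    rw [← (h.extend_isOpetope.constellation k (by change k < Y.dim + 2; omega)).black,
      Y.extend_tree_old hk]
    exact ⟨a, ha, rfl⟩
  exact h1.1

theorem extend_edge (h : Y.IsOpetope) {b : Y.Elem} (hb : b ∈ (Y.tree k).edges) :
    Y.oldElem b ∈ (Y.extend.tree k).edges := by
  rw [Y.extend_tree_old (h.le_of_edge hb)]
  exact ⟨b, hb, rfl⟩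

/-- The cell given by a node. -/
def nodeCell (h : Y.IsOpetope) (k : ℕ) (a : (Y.tree (k + 1)).nodes) : Y.faces.Cell :=
  Y.edgeFace k (Y.oldElem a.1) (by have := h.le_of_node a.2; omega) (h.extend_edge_of_node a.2)

/-- The cell given by an edge. -/
def edgeCell (h : Y.IsOpetope) (k : ℕ) (b : (Y.tree (k + 2)).edges) : Y.faces.Cell :=
  Y.edgeFace k (Y.oldElem b.1) (by have := h.le_of_edge b.2; omega) (h.extend_edge b.2)

/-- The cell of dimension `-1`. -/
def rootCell (h : Y.IsOpetope) (b : (Y.tree 1).edges) (hb : b.1 ∈ (Y.tree 1).root) :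
    Y.faces.Cell :=
  ⟨(1, Y.oldElem b.1), le_rfl, Nat.le_add_left 1 _, h.extend_edge b.2, fun _ => by
    rw [Y.extend_tree_old (h.le_of_edge b.2)]
    exact ⟨b.1, hb, rfl⟩⟩

/-- The map from the nodes of an opetope to those of the zoom complex of its face complex. -/
def tauNode (h : Y.IsOpetope) : ∀ k, (Y.tree k).nodes → Y.faces.zoom.Elem
  | 0, _ => Y.faces.augElem .node
  | k + 1, a => Y.faces.cellElem (h.nodeCell k a)

open Classical in
/-- The map from the edges of an opetope to those of the zoom complex of its face complex. -/
noncomputable def tauEdge (h : Y.IsOpetope) : ∀ k, (Y.tree k).edges → Y.faces.zoom.Elem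
  | 0, b => if b.1 ∈ (Y.tree 0).root then Y.faces.augElem .root else Y.faces.augElem .leaf
  | 1, b => if hb : b.1 ∈ (Y.tree 1).root then Y.faces.cellElem (h.rootCell b hb)
      else Y.faces.augElem .node
  | k + 2, b => Y.faces.cellElem (h.edgeCell k b)

theorem nodeCell_injective (h : Y.IsOpetope) : (h.nodeCell k).Injective := fun _ _ e =>
  Subtype.ext (Y.oldElem_injective (congrArg (fun p => p.1.2) e))

theorem edgeCell_injective (h : Y.IsOpetope) : (h.edgeCell k).Injective := fun _ _ e =>
  Subtype.ext (Y.oldElem_injective (congrArg (fun p => p.1.2) e))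

theorem nodeCell_lam (h : Y.IsOpetope) (a : (Y.tree (k + 1)).nodes) :
    h.nodeCell k a ∈ Y.faces.Lam := by
  have hk := h.le_of_node a.2
  refine (face_leaf_of_lam h.extend_isOpetope (Nat.le_add_left 2 k)).2 ?_
  change Y.oldElem a.1 ∈ (Y.extend.tree (k + 1 + 1)).leaves
  rw [← (h.extend_isOpetope.constellation (k + 1) (by change k + 1 < Y.dim + 2; omega)).black,
    Y.extend_tree_old hk]
  exact ⟨a.1, a.2, rfl⟩

theorem exists_nodeCell (h : Y.IsOpetope) (hk : k + 1 ≤ Y.dim) {p : Y.faces.Cell}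
    (hp : p ∈ Y.faces.Lam) (hd : p.1.1 = k + 2) : ∃ a, h.nodeCell k a = p := by
  have hl := (face_leaf_of_lam h.extend_isOpetope (by omega)).1 hp
  rw [hd, show k + 2 = k + 1 + 1 from rfl,
    ← (h.extend_isOpetope.constellation (k + 1) (by change k + 1 < Y.dim + 2; omega)).black,
    Y.extend_tree_old hk] at hl
  obtain ⟨a, ha, e⟩ := hl
  exact ⟨⟨a, ha⟩, face_ext hd.symm e⟩

theorem exists_edgeCell (h : Y.IsOpetope) (hk : k + 2 ≤ Y.dim) {p : Y.faces.Cell}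
    (hd : p.1.1 = k + 2) : ∃ b, h.edgeCell k b = p := by
  have hl := face_edge p
  rw [hd, Y.extend_tree_old hk] at hl
  obtain ⟨b, hb, e⟩ := hl
  exact ⟨⟨b, hb⟩, face_ext hd.symm e⟩

theorem tau_isIso (h : Y.IsOpetope) (k : ℕ) :
    (Y.tree k).IsIso (Y.faces.zoom.tree k) (h.tauNode k) (h.tauEdge k) := by
  have hX := h.extend_isOpetope
  have hD := faces_isDFC hX
  have htop : Y.faces.topDim = Y.dim := faces_topDim hX
  have hZ := hD.zoom_isOpetope
  rcases Nat.lt_or_ge Y.dim k with hk | hk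
  · have h1 := h.void k hk
    have h2 := hZ.void k (by change Y.faces.topDim < k; omega)
    exact .of_isEmpty h1.1 h1.2 h2.1 h2.2
  match k with
  | 0 =>
    obtain ⟨a, r, l, hne, e⟩ := h.zero.eq_stick (h.tree 0 hk)
    exact PreTree.stick_isIso hne Y.faces.augElem_root_ne_leaf e
      (PreMOP.IsDFC.zoom_tree_zero Y.faces) (fun _ => rfl) (fun b hb => if_pos hb)
      fun b hb => if_neg hb
  | 1 =>
    obtain ⟨a, r, l, hne, e⟩ := (h.one hk).eq_stick (h.tree 1 hk)
    have ha : a ∈ (Y.tree 1).nodes := e ▸ rfl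
    have hr : r ∈ (Y.tree 1).edges := e ▸ Or.inl rfl
    have hr' : r ∈ (Y.tree 1).root := e ▸ rfl
    have e' := hD.zoom_tree_one (by omega) (h.nodeCell_lam ⟨a, ha⟩) (face_dim.2 rfl)
      (s := h.rootCell ⟨r, hr⟩ hr') (face_dim.2 rfl)
    refine PreTree.stick_isIso hne (PreMOP.cellElem_ne_augElem _ _) e e' ?_ ?_ ?_
    · rintro ⟨x, hx⟩
      obtain rfl : x = a := (e ▸ hx : x ∈ (PreTree.stick a r l).nodes)
      rfl
    · rintro ⟨b, hb⟩ hb'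
      obtain rfl : b = r := (e ▸ hb' : b ∈ (PreTree.stick a r l).root)
      exact dif_pos hb'
    · exact fun b hb => dif_neg hb
  | k + 2 =>
    rw [hD.zoom_tree_succ (by omega)]
    refine ⟨fun a => ?_, fun b => ?_, fun a a' e => ?_, fun b b' e => ?_, ?_, ?_,
      fun a b => ?_, fun a b => ?_⟩
    · exact ⟨_, ⟨h.nodeCell_lam a, face_dim.2 (by change ((k + 1 + 2 : ℕ) : ℤ) = _; omega)⟩, rfl⟩
    · exact ⟨_, face_dim.2 rfl, rfl⟩
    · exact h.nodeCell_injective (Y.faces.cellElem_injective e)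
    · exact h.edgeCell_injective (Y.faces.cellElem_injective e)
    · rintro _ ⟨p, ⟨hp, hd⟩, rfl⟩
      obtain ⟨a, rfl⟩ := h.exists_nodeCell (k := k + 1) hk hp (by have := face_dim.1 hd; omega)
      exact ⟨a, rfl⟩
    · rintro _ ⟨p, hd, rfl⟩
      obtain ⟨b, rfl⟩ := h.exists_edgeCell hk (p := p) (by
        have := (face_dim (j := k)).1 hd
        omega)
      exact ⟨b, rfl⟩
    · refine Iff.trans ?_ (PreTree.map_out Y.faces.cellElem_injective (a := h.nodeCell (k + 1) a)
        (b := h.edgeCell k b)).symm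
      rw [face_cellTree_out hX, Y.extend_tree_old hk]
      exact (PreTree.map_out Y.oldElem_injective).symm.trans
        ⟨fun h => ⟨rfl, rfl, h⟩, fun h => h.2.2⟩
    · refine Iff.trans ?_ (PreTree.map_inp Y.faces.cellElem_injective (a := h.nodeCell (k + 1) a)
        (b := h.edgeCell k b)).symm
      rw [face_cellTree_inp hX, Y.extend_tree_old hk]
      exact (PreTree.map_inp Y.oldElem_injective).symm.trans
        ⟨fun h => ⟨rfl, rfl, h⟩, fun h => h.2.2⟩

/-- The next tree has degree one or two. It is elementary or linear, so each of its nodes has a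
source and there is no white dot. -/
theorem white_low (h : Y.IsOpetope) (hk : k < 2) (hkd : k < Y.dim) (b : Y.Elem) :
    Y.white k b = ∅ := by
  refine Set.eq_empty_iff_forall_notMem.2 fun w hw => ?_
  have hn := (h.constellation k hkd).mem_nulldots hw
  obtain ⟨c, hc⟩ : ∃ c, (Y.tree (k + 1)).inp w c := by
    match k with
    | 0 =>
      obtain ⟨a, r, l, hne, e⟩ := (h.one hkd).eq_stick (h.tree 1 hkd)
      obtain rfl : w = a := (e ▸ hn.1 : w ∈ (PreTree.stick a r l).nodes)
      exact ⟨l, e ▸ ⟨rfl, rfl⟩⟩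
    | 1 => exact (h.two hkd w hn.1).exists
  exact hn.2 c hc

theorem tau_black (h : Y.IsOpetope) (k : ℕ) (a : (Y.tree k).nodes)
    (b : (Y.tree (k + 1)).edges) : a.1 = b.1 ↔ h.tauNode k a = h.tauEdge (k + 1) b := by
  match k with
  | 0 =>
    -- The node of `T_0` is the leaf of `T_1`, and in `T_1` being the leaf means not being the root;
    -- this is how `tauEdge` distinguishes the two edges.
    have hk := h.le_of_edge b.2
    have hT := h.tree 1 hk
    have hl : ∀ c, c ∈ (Y.tree 1).leaves ↔ a.1 = c := by
      obtain ⟨a, ha⟩ := a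
      obtain ⟨a₀, h0⟩ := h.zero.1
      intro c
      change _ ↔ a = c
      rw [h0] at ha
      rw [← (h.constellation 0 hk).black, h0, show a = a₀ from ha]
      exact eq_comm
    obtain ⟨a₁, r, l, hne, e⟩ := (h.one hk).eq_stick hT
    have hb : ∀ c ∈ (Y.tree 1).edges, c ∈ (Y.tree 1).leaves ↔ c ∉ (Y.tree 1).root := by
      intro c hc
      rw [e] at hc
      rw [e, PreTree.stick_leaves hne]
      rcases hc with h2 | h2
      · exact iff_of_false (fun h3 => hne (h2.symm.trans h3)) fun h3 => h3 h2
      · exact iff_of_true h2 fun h3 => hne (Eq.trans (Eq.symm h3) h2)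
    rw [← hl, hb _ b.2]
    by_cases hr : b.1 ∈ (Y.tree 1).root
    · have e1 : h.tauEdge 1 b = Y.faces.cellElem (h.rootCell b hr) := dif_pos hr
      refine iff_of_false (fun h => h hr) fun h2 => ?_
      exact PreMOP.cellElem_ne_augElem _ _ (e1.symm.trans h2.symm)
    · have e1 : h.tauEdge 1 b = Y.faces.augElem .node := dif_neg hr
      exact iff_of_true hr e1.symm
  | k + 1 =>
    constructor
    · intro e
      exact congrArg Y.faces.cellElem (face_ext rfl (congrArg Y.oldElem e))
    · intro e
      have := Y.faces.cellElem_injective e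
      exact Y.oldElem_injective (congrArg (fun p => p.1.2) this)

theorem tau_white (h : Y.IsOpetope) (k : ℕ) (b : (Y.tree k).edges)
    (w : (Y.tree (k + 1)).nodes) :
    w.1 ∈ Y.white k b.1 ↔ h.tauNode (k + 1) w ∈ Y.faces.zoom.white k (h.tauEdge k b) := by
  have hX := h.extend_isOpetope
  have hk := h.le_of_node w.2
  have low : ∀ k < 2, ∀ (b : (Y.tree k).edges) (w : (Y.tree (k + 1)).nodes),
      w.1 ∈ Y.white k b.1 ↔ h.tauNode (k + 1) w ∈ Y.faces.zoom.white k (h.tauEdge k b) := by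
    intro k hk2 b w
    rw [h.white_low hk2 (h.le_of_node w.2), PreMOP.IsDFC.zoom_white_low hk2]
    exact Iff.rfl
  match k with
  | 0 => exact low 0 (by omega) b w
  | 1 => exact low 1 (by omega) b w
  | k + 2 =>
    have e := PreMOP.IsDFC.zoom_white (C := Y.faces) (k := k) (by rw [faces_topDim hX]; omega)
      (b := h.edgeCell k b)
    refine Iff.trans ?_ (Set.ext_iff.1 e _).symm
    refine Iff.trans ?_ (Y.faces.cellElem_injective.mem_set_image (a := h.nodeCell (k + 2) w)).symm
    rw [face_white hX (w := h.nodeCell (k + 2) w) (z := h.edgeCell k b) rfl rfl]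
    refine Iff.trans ?_ (Set.ext_iff.1 (Y.extend_white_old hk b.1) _).symm
    exact (Y.oldElem_injective.mem_set_image).symm

theorem tau_whiteLT (h : Y.IsOpetope) (k : ℕ) (b : (Y.tree k).edges)
    (w w' : (Y.tree (k + 1)).nodes) (hw : w.1 ∈ Y.white k b.1) (hw' : w'.1 ∈ Y.white k b.1) :
    Y.whiteLT k b.1 w.1 w'.1 ↔
      Y.faces.zoom.whiteLT k (h.tauEdge k b) (h.tauNode (k + 1) w) (h.tauNode (k + 1) w') := by
  have hX := h.extend_isOpetope
  have hk := h.le_of_node w.2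
  rcases Nat.lt_or_ge k 2 with h2 | h2
  · rw [h.white_low h2 hk] at hw
    exact hw.elim
  obtain ⟨k, rfl⟩ := Nat.exists_eq_add_of_le' h2
  have m : ∀ {w : (Y.tree (k + 2 + 1)).nodes}, w.1 ∈ Y.white (k + 2) b.1 →
      Y.oldElem w.1 ∈ Y.extend.white (k + 2) (Y.oldElem b.1) := by
    intro w hw
    rw [Y.extend_white_old hk]
    exact ⟨_, hw, rfl⟩
  refine Iff.trans ?_ (PreMOP.IsDFC.zoom_whiteLT (C := Y.faces) (b := h.edgeCell k b)
    (w := h.nodeCell (k + 2) w) (w' := h.nodeCell (k + 2) w')).symm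
  rw [face_whiteLT hX (k := k) rfl rfl rfl (m hw) (m hw')]
  exact (Y.extend_whiteLT_old hk).symm

/-- The isomorphism from an opetope to the zoom complex of its face complex. -/
noncomputable def tauIso (h : Y.IsOpetope) : ZoomIso Y Y.faces.zoom where
  dim_eq := (faces_topDim h.extend_isOpetope).symm
  node k := (h.tau_isIso k).nodeEquiv
  edge k := (h.tau_isIso k).edgeEquiv
  out k := (h.tau_isIso k).out
  inp k := (h.tau_isIso k).inp
  -- The root is the edge that is a source of no node, so it is preserved as soon as incidence is.
  root k b := by
    have hk := h.le_of_edge b.2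
    have e : Y.faces.zoom.dim = Y.dim := faces_topDim h.extend_isOpetope
    exact (h.tau_isIso k).root_iff (h.tree k hk)
      ((faces_isDFC h.extend_isOpetope).zoom_isOpetope.tree k (by omega)) b
  black := h.tau_black
  white := h.tau_white
  whiteLT := h.tau_whiteLT

end IsOpetope

end PreZoom

/-! ### Naturality and the equivalence of the two groupoids -/

namespace PreMOP

variable {C D : PreMOP.{u}}

theorem isTop_iff (f : DFCIso C D) (hC : C.IsMOP) (hD : D.IsMOP) (x : C.Cell) :
    C.IsTop x ↔ D.IsTop (f.toEquiv x) :=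
  ⟨f.isTop_imp hC hD, fun h => by simpa [DFCIso.symm] using f.symm.isTop_imp hD hC h⟩

theorem topTarget_iff (f : DFCIso C D) (hC : C.IsMOP) (hD : D.IsMOP) (x : C.Cell) :
    (∃ ω, C.IsTop ω ∧ x ∈ C.γ ω) ↔ ∃ ω, D.IsTop ω ∧ f.toEquiv x ∈ D.γ ω := by
  rw [f.toEquiv.surjective.exists]
  exact exists_congr fun ω => and_congr (isTop_iff f hC hD ω) (f.mem_γ hC hD ω x)

/-- Isomorphisms preserve the greatest cell and its target, so both sides fall into the same case of
the definition of `θ`. For the other cells, the edge may be an old edge or a leaf of the corolla,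
that is an old node; the action on both is `f`. -/
theorem thetaElem_naturality (f : DFCIso C D) (hC : C.IsMOP) (hD : D.IsMOP) (x : C.Cell) (k : ℕ)
    (hx : C.thetaElem x ∈ (C.zoom.extend.tree k).edges) :
    D.thetaElem (f.toEquiv x) =
      ((f.zoom hC hD).extend.edge k ⟨C.thetaElem x, hx⟩).1 := by
  -- The edge is a variable here, since the proof of membership depends on it and the value of
  -- `thetaElem` could not be rewritten in place.
  have key : ∀ v (hv : v ∈ (C.zoom.extend.tree k).edges),
      (v = .inr .top → ((f.zoom hC hD).extend.edge k ⟨v, hv⟩).1 = .inr .top) ∧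
      (v = .inr .root → ((f.zoom hC hD).extend.edge k ⟨v, hv⟩).1 = .inr .root) ∧
      (v = .inl (.inl x) →
        ((f.zoom hC hD).extend.edge k ⟨v, hv⟩).1 = .inl (.inl (f.toEquiv x))) := by
    intro v hv
    refine ⟨?_, ?_, ?_⟩
    · rintro rfl
      rfl
    · rintro rfl
      rfl
    · rintro rfl
      change ((f.zoom hC hD).extEdge k ⟨.inl (.inl x), hv⟩).1 = _
      simp only [ZoomIso.extEdge]
      split_ifs <;> rfl
  have h1 := isTop_iff f hC hD x
  have h2 := topTarget_iff f hC hD x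
  by_cases ht : C.IsTop x
  · have e : C.thetaElem x = .inr .top := if_pos ht
    have e' : D.thetaElem (f.toEquiv x) = .inr .top := if_pos (h1.1 ht)
    exact e'.trans ((key _ hx).1 e).symm
  · by_cases hr : ∃ ω, C.IsTop ω ∧ x ∈ C.γ ω
    · have e : C.thetaElem x = .inr .root := (if_neg ht).trans (if_pos hr)
      have e' : D.thetaElem (f.toEquiv x) = .inr .root :=
        (if_neg fun h => ht (h1.2 h)).trans (if_pos (h2.1 hr))
      exact e'.trans ((key _ hx).2.1 e).symm
    · have e : C.thetaElem x = .inl (.inl x) := (if_neg ht).trans (if_neg hr)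
      have e' : D.thetaElem (f.toEquiv x) = .inl (.inl (f.toEquiv x)) :=
        (if_neg fun h => ht (h1.2 h)).trans (if_neg fun h => hr (h2.2 h))
      exact e'.trans ((key _ hx).2.2 e).symm

end PreMOP

namespace DFCIso

variable {C D : PreMOP.{u}}

theorem trans_symm (f : DFCIso C D) (hC : C.IsMOP) (hD : D.IsMOP) :
    f.trans f.symm hC hD hC = refl C :=
  DFCIso.ext (Equiv.self_trans_symm f.toEquiv)

theorem symm_trans (f : DFCIso C D) (hC : C.IsMOP) (hD : D.IsMOP) :
    f.symm.trans f hD hC hD = refl D :=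
  DFCIso.ext (Equiv.symm_trans_self f.toEquiv)

end DFCIso

namespace ZoomIso

variable {Y Y' : PreZoom.{u}}

theorem trans_symm (f : ZoomIso Y Y') : f.trans f.symm = refl Y :=
  ZoomIso.ext (funext fun k => Equiv.self_trans_symm (f.node k))
    (funext fun k => Equiv.self_trans_symm (f.edge k))

theorem symm_trans (f : ZoomIso Y Y') : f.symm.trans f = refl Y' :=
  ZoomIso.ext (funext fun k => Equiv.symm_trans_self (f.node k))
    (funext fun k => Equiv.symm_trans_self (f.edge k))

/-- The map on nodes is natural. -/
theorem tauNode_naturality (f : ZoomIso Y Y') (h : Y.IsOpetope) (h' : Y'.IsOpetope) (k : ℕ)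
    (a : (Y.tree k).nodes) :
    h'.tauNode k (f.node k a) = f.faces.elem (h.tauNode k a) := by
  match k with
  | 0 => rfl
  | k + 1 =>
    have ha := h.le_of_node a.2
    have hn : (Sum.inl a.1 : Y.Elem ⊕ NewElem) ∈ (Y.extTree (k + 1)).nodes :=
      (Y.mem_extend_nodes _ _).2 (Or.inl ⟨ha, a.1, a.2, rfl⟩)
    -- A node becomes a cell through the edge with the same name one degree higher; compatibility
    -- with black dots says that both have the same image.
    have e := f.extend_black_imp (k + 1) ⟨.inl a.1, hn⟩ ⟨.inl a.1, h.extend_edge_of_node a.2⟩ rfl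
    refine congrArg Y'.faces.cellElem (PreZoom.face_ext rfl ?_)
    exact e

/-- The map on edges is natural. -/
theorem tauEdge_naturality (f : ZoomIso Y Y') (h : Y.IsOpetope) (h' : Y'.IsOpetope) (k : ℕ)
    (b : (Y.tree k).edges) :
    h'.tauEdge k (f.edge k b) = f.faces.elem (h.tauEdge k b) := by
  have hk := h.le_of_edge b.2
  have key : ∀ hb : (Sum.inl b.1 : Y.Elem ⊕ NewElem) ∈ (Y.extTree k).edges,
      (f.extEdge k ⟨.inl b.1, hb⟩).1 = .inl (f.edge k b).1 := by
    intro hb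
    simp only [extEdge, dif_pos hk]
  match k with
  | 0 =>
    by_cases hr : b.1 ∈ (Y.tree 0).root
    · have e : h.tauEdge 0 b = Y.faces.augElem .root := if_pos hr
      have e' : h'.tauEdge 0 (f.edge 0 b) = Y'.faces.augElem .root :=
        if_pos ((f.root 0 b).1 hr)
      rw [e, e']
      rfl
    · have e : h.tauEdge 0 b = Y.faces.augElem .leaf := if_neg hr
      have e' : h'.tauEdge 0 (f.edge 0 b) = Y'.faces.augElem .leaf :=
        if_neg fun h2 => hr ((f.root 0 b).2 h2)
      rw [e, e']
      rfl
  | 1 =>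
    by_cases hr : b.1 ∈ (Y.tree 1).root
    · have hr' := (f.root 1 b).1 hr
      have e : h.tauEdge 1 b = Y.faces.cellElem (h.rootCell b hr) := dif_pos hr
      have e' : h'.tauEdge 1 (f.edge 1 b) = Y'.faces.cellElem (h'.rootCell (f.edge 1 b) hr') :=
        dif_pos hr'
      rw [e, e']
      refine congrArg Y'.faces.cellElem (PreZoom.face_ext rfl ?_)
      exact (key _).symm
    · have e : h.tauEdge 1 b = Y.faces.augElem .node := dif_neg hr
      have e' : h'.tauEdge 1 (f.edge 1 b) = Y'.faces.augElem .node :=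
        dif_neg fun h2 => hr ((f.root 1 b).2 h2)
      rw [e, e']
      rfl
  | k + 2 =>
    refine congrArg Y'.faces.cellElem (PreZoom.face_ext rfl ?_)
    exact (key _).symm

end ZoomIso

/-- An isomorphism of dendritic face complexes is an isomorphism in their groupoid. -/
def DFCIso.toIso {C D : DFCcore.{u}} (f : DFCIso C.toPreMOP D.toPreMOP) :
    C ≅ D where
  hom := f
  inv := f.symm
  hom_inv_id := f.trans_symm C.isDFC.toIsMOP D.isDFC.toIsMOP
  inv_hom_id := f.symm_trans C.isDFC.toIsMOP D.isDFC.toIsMOP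

/-- An isomorphism of opetopes is an isomorphism in their groupoid. -/
def ZoomIso.toIso {Y Y' : KJBM.{u}} (f : ZoomIso Y.toPreZoom Y'.toPreZoom) : Y ≅ Y' where
  hom := f
  inv := f.symm
  hom_inv_id := f.trans_symm
  inv_hom_id := f.symm_trans

/-- The natural isomorphism between the identity and `P ∘ Z`. -/
noncomputable def thetaNatIso (hZ : ∀ C : DFCcore.{u}, C.toPreMOP.zoom.IsOpetope)
    (hP : ∀ Y : KJBM.{u}, Y.toPreZoom.faces.IsDFC) :
    𝟭 DFCcore.{u} ≅ Zfunctor hZ ⋙ Pfunctor hP :=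
  NatIso.ofComponents (fun C => DFCIso.toIso (D := (Zfunctor hZ ⋙ Pfunctor hP).obj C)
    C.isDFC.thetaIso) fun {C D} f => by
      refine DFCIso.ext (Equiv.ext fun x => PreZoom.face_ext ?_ ?_)
      · have h1 := D.isDFC.thetaCell_fst (DFCIso.toEquiv f x)
        have h2 := C.isDFC.thetaCell_fst x
        have h3 := (DFCIso.hom f).dim x
        change (D.isDFC.thetaCell (DFCIso.toEquiv f x)).1.1 = (C.isDFC.thetaCell x).1.1
        omega
      · exact PreMOP.thetaElem_naturality f C.isDFC.toIsMOP D.isDFC.toIsMOP x _ _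

/-- The natural isomorphism between the identity and `Z ∘ P`. -/
noncomputable def tauNatIso (hZ : ∀ C : DFCcore.{u}, C.toPreMOP.zoom.IsOpetope)
    (hP : ∀ Y : KJBM.{u}, Y.toPreZoom.faces.IsDFC) :
    𝟭 KJBM.{u} ≅ Pfunctor hP ⋙ Zfunctor hZ :=
  NatIso.ofComponents (fun Y => ZoomIso.toIso (Y' := (Pfunctor hP ⋙ Zfunctor hZ).obj Y)
    Y.isOpetope.tauIso) fun {Y Y'} f => by
      refine ZoomIso.ext (funext fun k => Equiv.ext fun a => Subtype.ext ?_)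
        (funext fun k => Equiv.ext fun b => Subtype.ext ?_)
      · exact ZoomIso.tauNode_naturality f Y.isOpetope Y'.isOpetope k a
      · exact ZoomIso.tauEdge_naturality f Y.isOpetope Y'.isOpetope k b

theorem mainTheorem1 :
    ∃ (hZ : ∀ C : DFCcore.{u}, C.toPreMOP.zoom.IsOpetope)
      (hP : ∀ Y : KJBM.{u}, Y.toPreZoom.faces.IsDFC)
      (θ : 𝟭 DFCcore.{u} ≅ Zfunctor hZ ⋙ Pfunctor hP)
      (τ : 𝟭 KJBM.{u} ≅ Pfunctor hP ⋙ Zfunctor hZ),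
      (Zfunctor hZ).IsEquivalence ∧ (Pfunctor hP).IsEquivalence ∧
      (∀ (C : DFCcore.{u}) (x : C.toPreMOP.Cell),
        (DFCIso.toEquiv (θ.hom.app C) x).1 = thetaFun C.toPreMOP x) ∧
      ∀ (Y : KJBM.{u}) (k : ℕ), 2 ≤ k →
        (∀ a : (Y.toPreZoom.tree k).nodes, ∃ c : Y.toPreZoom.faces.Cell,
          c.1 = (k + 1, .inl a.1) ∧ (ZoomIso.node (τ.hom.app Y) k a).1 = .inl c) ∧
        ∀ b : (Y.toPreZoom.tree k).edges, ∃ c : Y.toPreZoom.faces.Cell,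
          c.1 = (k, .inl b.1) ∧ (ZoomIso.edge (τ.hom.app Y) k b).1 = .inl c := by
  have hZ : ∀ C : DFCcore.{u}, C.toPreMOP.zoom.IsOpetope := fun C => C.isDFC.zoom_isOpetope
  have hP : ∀ Y : KJBM.{u}, Y.toPreZoom.faces.IsDFC := fun Y =>
    PreZoom.faces_isDFC Y.isOpetope.extend_isOpetope
  -- The construction of an adjoint equivalence may change the unit. Only the fact that both
  -- functors are equivalences is taken from it; `θ` and `τ` are the natural isomorphisms
  -- themselves.
  let e : DFCcore.{u} ≌ KJBM.{u} :=
    CategoryTheory.Equivalence.mk (Zfunctor hZ) (Pfunctor hP) (thetaNatIso hZ hP)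
      (tauNatIso hZ hP).symm
  refine ⟨hZ, hP, thetaNatIso hZ hP, tauNatIso hZ hP, e.isEquivalence_functor,
    e.isEquivalence_inverse, fun C x => rfl, fun Y k hk => ?_⟩
  obtain ⟨k, rfl⟩ := Nat.exists_eq_add_of_le' hk
  exact ⟨fun a => ⟨Y.isOpetope.nodeCell (k + 1) a, rfl, rfl⟩,
    fun b => ⟨Y.isOpetope.edgeCell k b, rfl, rfl⟩⟩
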